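/- Let $\mathcal S_0\subset\mathbb R^2$ be closed, bounded, connected and simply connected with smooth boundary, let $\mathcal F_0=\mathbb R^2\setminus\mathcal S_0$, let $m,\mathcal J>0$ and $\alpha\ge 0$, and write $x^\perp=(-x_2,x_1)$. Let $\mathcal H$ be the space of $\phi\in L^2(\mathbb R^2;\mathbb R^2)$ with $\operatorname{div}\phi=0$ in $\mathbb R^2$ and $D(\phi)=0$ in $\mathcal S_0$, where $D(\phi)=\frac12(\nabla\phi+\nabla\phi^T)$; then $\phi=\phi_{\mathcal S}:=\ell_\phi+r_\phi x^\perp$ on $\mathcal S_0$. Put $$\|\phi\|_{\mathcal H}^2=\int_{\mathcal F_0}|\phi|^2\,dx+m|\ell_\phi|^2+\mathcal J r_\phi^2 ,$$ $$\underline{\mathcal V}=\Big\{\phi\in\mathcal H:\int_{\mathcal F_0}|\nabla\phi|^2<\infty\Big\},\qquad \|\phi\|_{\underline{\mathcal V}}=\|\phi\|_{\mathcal H}+\|\nabla\phi\|_{L^2(\mathcal F_0)},$$ $$\mathcal V=\Big\{\phi\in\mathcal H:\int_{\mathcal F_0}|\nabla\phi(y)|^2(1+|y|^2)\,dy<\infty\Big\},\qquad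 \|\phi\|_{\mathcal V}=\|\phi\|_{\mathcal H}+\Big(\int_{\mathcal F_0}|\nabla\phi(y)|^2(1+|y|^2)\,dy\Big)^{1/2},$$ $$\widehat{\mathcal V}=\{\phi\in\mathcal V:\phi|_{\mathcal F_0}\in\mathrm{Lip}(\overline{\mathcal F_0})\},\qquad \|\phi\|_{\widehat{\mathcal V}}=\|\phi\|_{\mathcal V}+\|\phi\|_{\mathrm{Lip}(\overline{\mathcal F_0})}.$$ Let $H$ be the classical solution ($C^1$ up to the boundary), vanishing at infinity, of $\operatorname{div}H=0$ and $\operatorname{curl}H=0$ in $\mathcal F_0$, $H\cdot n=0$ on $\partial\mathcal S_0$, $\int_{\partial\mathcal S_0}H\cdot\tau\,ds=1$ ($\tau$ the counterclockwise unit tangent), extended by $0$ inside $\mathcal S_0$. For $X$ one of the spaces above, $X\oplus\mathbb RH$ carries the norm $\|\tilde u+\beta H\|=\|\tilde u\|_X+|\beta|$, and for $u=\tilde u+\beta H$ we set $u_{\mathcal S}=\tilde u_{\mathcal S}$, $\ell_u=\ell_{\tilde u}$, $r_u=r_{\tilde u}$. Let $$a(u,v)=-\alpha\int_{\partial\mathcal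 S_0}(u-u_{\mathcal S})\cdot(v-v_{\mathcal S})\,ds-\int_{\mathcal F_0}D(u):D(v)\,dx,$$ $$b(u,v,w)=\int_{\mathcal F_0}\Big([(u-u_{\mathcal S})\cdot\nabla w]\cdot v-r_u\,v^\perp\cdot w\Big)dx-m\,r_u\,\ell_v^\perp\cdot\ell_w ,$$ where on $\partial\mathcal S_0$ the fields $u,v$ are understood as traces from $\mathcal F_0$. Then: (i) On $(\underline{\mathcal V}\oplus\mathbb RH)\times\underline{\mathcal V}\times(\mathcal V\oplus\mathbb RH)$ the integral defining $b$ converges absolutely, $b$ is trilinear, and there is $C>0$ such that for all $u=\tilde u+\beta_1H$, $\tilde v$, $w=\tilde w+\beta_3H$ $$|b(u,\tilde v,w)|\le C(\|\tilde u\|_{\underline{\mathcal V}}+|\beta_1|)\,\|\tilde v\|_{\underline{\mathcal V}}\,(\|\tilde w\|_{\mathcal V}+|\beta_3|).$$ (ii) The maps $b(H,\cdot,\cdot)$ and $b(\cdot,\cdot,H)$ are well defined (absolutely convergent integrals), bilinear and continuous on $\underline{\mathcal V}\times\underline{\mathcal V}$, i.e. bounded by $C$ times the product of the $\underline{\mathcal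 V}$-norms of the two arguments, and $b(H,\tilde v,H)=0$ for all $\tilde v\in\underline{\mathcal V}$. (iii) For all $u\in\underline{\mathcal V}\oplus\mathbb RH$ and $\tilde v\in\underline{\mathcal V}$ one has $b(u,\tilde v,\tilde v)=0$. Here the integral is a Lebesgue integral whenever it converges absolutely (in particular for $\tilde v\in\mathcal V$). For every $\tilde v\in\underline{\mathcal V}$ the integral over $\mathcal F_0\cap\{|x|<R\}$ converges absolutely for each $R$, and the identity holds with $\int_{\mathcal F_0}$ replaced by $\lim_{R\to\infty}\int_{\mathcal F_0\cap\{|x|<R\}}$. Moreover $b(u,\tilde v,\tilde w)=-b(u,\tilde w,\tilde v)$ for all $u\in\underline{\mathcal V}\oplus\mathbb RH$ and $\tilde v,\tilde w\in\mathcal V$. (iv) There is exactly one trilinear map on $(\mathcal H\oplus\mathbb RH)\times\mathcal H\times(\widehat{\mathcal V}\oplus\mathbb RH)$ that coincides with $b$ on $(\underline{\mathcal V}\oplus\mathbb RH)\times\underline{\mathcal V}\times(\widehat{\mathcal V}\oplus\mathbb RH)$ and is continuous, i.e. that satisfies, still denoted by $b$ and for some $C>0$, $$|b(u,\tilde v,w)|\le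 C(\|\tilde u\|_{\mathcal H}+|\beta_1|)\,\|\tilde v\|_{\mathcal H}\,(\|\tilde w\|_{\widehat{\mathcal V}}+|\beta_3|)$$ for all $u=\tilde u+\beta_1H$, $\tilde v$, $w=\tilde w+\beta_3H$. (v) On $(\underline{\mathcal V}\oplus\mathbb RH)\times\underline{\mathcal V}$ the traces exist, the integrals defining $a$ converge absolutely, $a$ is bilinear, and there is $C>0$ with $|a(\tilde u+\beta H,\tilde v)|\le C(\|\tilde u\|_{\underline{\mathcal V}}+|\beta|)\,\|\tilde v\|_{\underline{\mathcal V}}$ for all $\tilde u,\tilde v\in\underline{\mathcal V}$ and $\beta\in\mathbb R$. -/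

import Mathlib

open MeasureTheory Set Filter Topology
open scoped ContDiff ENNReal NNReal RealInnerProductSpace

noncomputable section

/-- The Euclidean plane. -/
abbrev Plane : Type := EuclideanSpace ℝ (Fin 2)

/-- `2 × 2` matrices with the Frobenius norm; the gradient of a vector field `w` is stored as
`(i, j) ↦ ∂ⱼ wᵢ`. -/
abbrev Mat2 : Type := EuclideanSpace ℝ (Fin 2 × Fin 2)

/-- The space `L²(ℝ²; ℝ²)`. -/
abbrev L2Plane : Type := Lp Plane 2 (volume : Measure Plane)

/-- `x^⊥ = (-x₂, x₁)`. -/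
def perp (x : Plane) : Plane := !₂[-x 1, x 0]

/-- The partial derivative `∂ⱼ ψ` of a scalar function. -/
def pd (j : Fin 2) (ψ : Plane → ℝ) (x : Plane) : ℝ :=
  fderiv ℝ ψ x (EuclideanSpace.single j 1)

/-- The classical gradient `(i, j) ↦ ∂ⱼ wᵢ` of a vector field. -/
def classicalGrad (w : Plane → Plane) (x : Plane) : Mat2 :=
  WithLp.toLp 2 fun p => (fderiv ℝ w x (EuclideanSpace.single p.2 1)) p.1

/-! ### The body and its boundary -/

/-- `ρ` is a smooth local defining function of `S` near the point `p`. -/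
def IsDefiningFunctionAt (S : Set Plane) (p : Plane) (ρ : Plane → ℝ) : Prop :=
  ContDiff ℝ ∞ ρ ∧ gradient ρ p ≠ 0 ∧ ∀ᶠ x in 𝓝 p, (x ∈ S ↔ ρ x ≤ 0)

/-- A closed, bounded, connected and simply connected subset of the plane with smooth boundary. -/
structure IsSmoothBody (S : Set Plane) : Prop where
  isClosed : IsClosed S
  isBounded : Bornology.IsBounded S
  isConnected : IsConnected S
  isSimplyConnected : IsSimplyConnected S
  smooth_boundary : ∀ p ∈ frontier S, ∃ ρ, IsDefiningFunctionAt S p ρ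

/-- `ν` is the unit normal to the boundary of `S` at `p` that points out of `S`. -/
def IsUnitNormal (S : Set Plane) (p ν : Plane) : Prop :=
  ∃ ρ, IsDefiningFunctionAt S p ρ ∧ ν = ‖gradient ρ p‖⁻¹ • gradient ρ p

open Classical in
/-- The unit normal at `p ∈ ∂S`, pointing from the body `S` into the fluid. (The normal that is
outward to the fluid domain is its opposite.) -/
def bodyNormal (S : Set Plane) (p : Plane) : Plane :=
  if h : ∃ ν, IsUnitNormal S p ν then h.choose else 0

/-- The counterclockwise unit tangent to `∂S`. -/
def bodyTangent (S : Set Plane) (p : Plane) : Plane := perp (bodyNormal S p)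

/-- Arc length on the boundary of the body. -/
def arcLength (S : Set Plane) : Measure Plane :=
  (Measure.hausdorffMeasure 1 : Measure Plane).restrict (frontier S)

/-- The field `H`: divergence free, curl free and tangent to the boundary, with circulation one
around the body, vanishing at infinity. It is a classical solution (`C¹` up to the boundary, i.e.
the restriction to the closed fluid domain of a `C¹` map), extended by `0` inside the body. -/
structure IsCirculationField (S : Set Plane) (H : Plane → Plane) : Prop where
  regular : ∃ G : Plane → Plane, ContDiff ℝ 1 G ∧ EqOn H G (closure Sᶜ)
  div_eq_zero : ∀ x ∈ Sᶜ, classicalGrad H x (0, 0) + classicalGrad H x (1, 1) = 0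
  curl_eq_zero : ∀ x ∈ Sᶜ, classicalGrad H x (1, 0) - classicalGrad H x (0, 1) = 0
  normal_eq_zero : ∀ x ∈ frontier S, ⟪H x, bodyNormal S x⟫ = 0
  circulation : ∫ x, ⟪H x, bodyTangent S x⟫ ∂(arcLength S) = 1
  vanish_at_infinity : Tendsto H (cocompact Plane) (𝓝 0)
  eq_zero_inside : ∀ x ∈ interior S, H x = 0

/-! ### Weak derivatives -/

/-- `ψ` is a test function in the open set `O`. -/
def IsTest (O : Set Plane) (ψ : Plane → ℝ) : Prop :=
  ContDiff ℝ ∞ ψ ∧ HasCompactSupport ψ ∧ tsupport ψ ⊆ O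

/-- `G` is the weak gradient of `w` in the open set `O`. -/
def IsWeakGrad (O : Set Plane) (w : Plane → Plane) (G : Plane → Mat2) : Prop :=
  LocallyIntegrableOn w O ∧ LocallyIntegrableOn G O ∧
    ∀ ψ, IsTest O ψ → ∀ i j : Fin 2,
      ∫ x in O, w x i * pd j ψ x = - ∫ x in O, G x (i, j) * ψ x

open Classical in
/-- The weak gradient in `O` (unique up to null sets where it exists). -/
def weakGrad (O : Set Plane) (w : Plane → Plane) : Plane → Mat2 :=
  if h : ∃ G, IsWeakGrad O w G then h.choose else 0

/-- `div φ = 0` in the plane, in the sense of distributions. -/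
def WeakDivFree (φ : Plane → Plane) : Prop :=
  ∀ ψ, IsTest univ ψ → ∫ x, (φ x 0 * pd 0 ψ x + φ x 1 * pd 1 ψ x) = 0

/-- `D(φ) = 0` in `S`, in the sense of distributions. -/
def WeakDeformationFree (S : Set Plane) (φ : Plane → Plane) : Prop :=
  ∀ ψ, IsTest (interior S) ψ → ∀ i j : Fin 2, ∫ x, (φ x i * pd j ψ x + φ x j * pd i ψ x) = 0

/-! ### Rigid part -/

open Classical in
/-- The pair `(ℓ_u, r_u)` with `u(x) = ℓ_u + r_u x^⊥` for (almost every) `x` in the body. -/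
def rigidData (S : Set Plane) (u : Plane → Plane) : Plane × ℝ :=
  if h : ∃ q : Plane × ℝ, ∀ᵐ x ∂(volume.restrict S), u x = q.1 + q.2 • perp x
    then h.choose else 0

/-- `ℓ_u`. -/
def linVel (S : Set Plane) (u : Plane → Plane) : Plane := (rigidData S u).1

/-- `r_u`. -/
def angVel (S : Set Plane) (u : Plane → Plane) : ℝ := (rigidData S u).2

/-- `u_S(x) = ℓ_u + r_u x^⊥`, for all `x` in the plane. -/
def rigidPart (S : Set Plane) (u : Plane → Plane) (x : Plane) : Plane :=
  linVel S u + angVel S u • perp x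

/-! ### The function spaces -/

/-- `φ` coincides almost everywhere in the fluid domain with a function on the closed fluid domain
that is bounded by `A` and Lipschitz with constant `K`. -/
def LipBound (S : Set Plane) (φ : Plane → Plane) (A K : ℝ) : Prop :=
  0 ≤ A ∧ 0 ≤ K ∧ ∃ f : Plane → Plane, f =ᵐ[volume.restrict Sᶜ] φ ∧
    (∀ x ∈ closure Sᶜ, ‖f x‖ ≤ A) ∧
    ∀ x ∈ closure Sᶜ, ∀ y ∈ closure Sᶜ, ‖f x - f y‖ ≤ K * ‖x - y‖

lemma IsTest.integrable_pd {O : Set Plane} {ψ : Plane → ℝ} (h : IsTest O ψ) (j : Fin 2) :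
    Continuous (pd j ψ) ∧ HasCompactSupport (pd j ψ) ∧ tsupport (pd j ψ) ⊆ O := by
  have h1 : Continuous (pd j ψ) := by
    have := h.1.continuous_fderiv (by simp)
    exact this.clm_apply continuous_const
  have h2 : tsupport (pd j ψ) ⊆ tsupport ψ := by
    refine closure_minimal (fun x hx => ?_) (isClosed_tsupport ψ)
    apply support_fderiv_subset ℝ
    intro h0
    exact hx (by simp [pd, h0])
  exact ⟨h1, h.2.1.of_isClosed_subset (isClosed_tsupport _) h2, h2.trans h.2.2⟩

lemma integrableOn_mul_test {O : Set Plane} {f g : Plane → ℝ} (hf : LocallyIntegrableOn f O)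
    (hg : Continuous g) (hc : HasCompactSupport g) (hs : tsupport g ⊆ O) :
    IntegrableOn (fun x => f x * g x) O := by
  have h1 : IntegrableOn (fun x => f x * g x) (tsupport g) :=
    (hf.integrableOn_compact_subset hs hc).mul_continuousOn hg.continuousOn hc
  refine (IntegrableOn.integrable_of_forall_notMem_eq_zero h1 fun x hx => ?_).integrableOn
  rw [image_eq_zero_of_notMem_tsupport hx, mul_zero]

lemma locallyIntegrableOn_coord {ι : Type*} [Fintype ι] {O : Set Plane}
    {w : Plane → EuclideanSpace ℝ ι} (h : LocallyIntegrableOn w O) (i : ι) :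
    LocallyIntegrableOn (fun x => w x i) O := by
  intro x hx
  obtain ⟨s, hs, hi⟩ := h x hx
  exact ⟨s, hs, (EuclideanSpace.proj (𝕜 := ℝ) i).integrable_comp hi⟩

lemma L2Plane.locallyIntegrableOn (φ : L2Plane) (O : Set Plane) :
    LocallyIntegrableOn (φ : Plane → Plane) O :=
  ((Lp.memLp φ).locallyIntegrable (by norm_num)).locallyIntegrableOn O

lemma IsWeakGrad.comb {O : Set Plane} {w w' w'' : Plane → Plane} {G G' : Plane → Mat2}
    (h : IsWeakGrad O w G) (h' : IsWeakGrad O w' G') (c : ℝ)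
    (hw : w'' =ᵐ[volume] fun x => c • w x + w' x) :
    IsWeakGrad O w'' (fun x => c • G x + G' x) := by
  refine ⟨?_, (h.2.1.smul c).add h'.2.1, fun ψ hψ i j => ?_⟩
  · intro x hx
    obtain ⟨s, hs, hi⟩ := ((h.1.smul c).add h'.1) x hx
    exact ⟨s, hs, hi.congr (ae_restrict_of_ae hw.symm)⟩
  · obtain ⟨a1, a2, a3⟩ := hψ.integrable_pd j
    have e1 := integrableOn_mul_test (locallyIntegrableOn_coord h.1 i) a1 a2 a3
    have e2 := integrableOn_mul_test (locallyIntegrableOn_coord h'.1 i) a1 a2 a3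
    have e3 := integrableOn_mul_test (locallyIntegrableOn_coord h.2.1 (i, j)) hψ.1.continuous hψ.2.1 hψ.2.2
    have e4 := integrableOn_mul_test (locallyIntegrableOn_coord h'.2.1 (i, j)) hψ.1.continuous hψ.2.1 hψ.2.2
    have l1 : ∫ x in O, w'' x i * pd j ψ x =
        ∫ x in O, (c * (w x i * pd j ψ x) + w' x i * pd j ψ x) := by
      refine integral_congr_ae (ae_restrict_of_ae ?_)
      filter_upwards [hw] with x hx
      simp only [hx, PiLp.add_apply, PiLp.smul_apply, smul_eq_mul]
      ring
    have l2 : ∫ x in O, (c • G x + G' x) (i, j) * ψ x =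
        ∫ x in O, (c * (G x (i, j) * ψ x) + G' x (i, j) * ψ x) := by
      congr 1
      ext x
      simp only [PiLp.add_apply, PiLp.smul_apply, smul_eq_mul]
      ring
    rw [l1, l2, integral_add (e1.const_mul c) e2, integral_add (e3.const_mul c) e4,
      integral_const_mul, integral_const_mul, h.2.2 ψ hψ i j, h'.2.2 ψ hψ i j]
    ring

lemma isWeakGrad_zero (O : Set Plane) : IsWeakGrad O ((0 : L2Plane) : Plane → Plane) 0 := by
  refine ⟨L2Plane.locallyIntegrableOn 0 O, locallyIntegrableOn_zero, fun ψ _ i j => ?_⟩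
  simp

/-- Submodules from closure under `c • x + y`. -/
def submoduleOfComb (P : L2Plane → Prop) (h0 : P 0)
    (h : ∀ (c : ℝ) (x y : L2Plane), P x → P y → P (c • x + y)) : Submodule ℝ L2Plane where
  carrier := {φ | P φ}
  zero_mem' := h0
  add_mem' {x y} hx hy := by simpa using h 1 x y hx hy
  smul_mem' c x hx := by simpa using h c x 0 hx h0

lemma L2Plane.coeFn_comb (c : ℝ) (x y : L2Plane) :
    ((c • x + y : L2Plane) : Plane → Plane) =ᵐ[volume]
      fun p => c • (x : Plane → Plane) p + (y : Plane → Plane) p := by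
  filter_upwards [Lp.coeFn_add (c • x) y, Lp.coeFn_smul c x] with p h1 h2
  rw [h1, Pi.add_apply, h2, Pi.smul_apply]

lemma pairing_comb (c : ℝ) (x y : L2Plane) {O : Set Plane} {ψ : Plane → ℝ} (hψ : IsTest O ψ)
    (i j k l : Fin 2) :
    ∫ p, ((c • x + y : L2Plane) p i * pd j ψ p + (c • x + y : L2Plane) p k * pd l ψ p) =
      c * (∫ p, (x p i * pd j ψ p + x p k * pd l ψ p)) +
        ∫ p, (y p i * pd j ψ p + y p k * pd l ψ p) := by
  have key : ∀ (z : L2Plane) (i j : Fin 2), Integrable (fun p => z p i * pd j ψ p) := by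
    intro z i j
    obtain ⟨a1, a2, -⟩ := hψ.integrable_pd j
    simpa [IntegrableOn] using integrableOn_mul_test
      (locallyIntegrableOn_coord (L2Plane.locallyIntegrableOn z univ) i) a1 a2 (subset_univ _)
  have e1 : Integrable (fun p => c * (x p i * pd j ψ p + x p k * pd l ψ p)) :=
    ((key x i j).add (key x k l)).const_mul c
  have e2 : Integrable (fun p => y p i * pd j ψ p + y p k * pd l ψ p) :=
    (key y i j).add (key y k l)
  rw [← integral_const_mul, ← integral_add e1 e2]
  refine integral_congr_ae ?_
  filter_upwards [L2Plane.coeFn_comb c x y] with p hp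
  simp only [hp, PiLp.add_apply, PiLp.smul_apply, smul_eq_mul]
  ring

lemma coe_zero_ae : ∀ᵐ p ∂(volume : Measure Plane), ((0 : L2Plane) : Plane → Plane) p = 0 := by
  exact Lp.coeFn_zero Plane 2 (volume : Measure Plane)

/-- The space `𝓗` of divergence-free `L²` vector fields on the plane with `D(φ) = 0` in `S`. -/
def spaceH (S : Set Plane) : Submodule ℝ L2Plane :=
  submoduleOfComb (fun φ => WeakDivFree φ ∧ WeakDeformationFree S φ)
    (by
      constructor
      · intro ψ _
        simp
      · intro ψ _ i j
        simp)
    (by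
      intro c x y hx hy
      constructor
      · intro ψ hψ
        rw [pairing_comb c x y hψ, hx.1 ψ hψ, hy.1 ψ hψ]
        simp
      · intro ψ hψ i j
        rw [pairing_comb c x y hψ, hx.2 ψ hψ i j, hy.2 ψ hψ i j]
        simp)

/-- The space `𝓥_` of all `φ ∈ 𝓗` with `∫_F |∇φ|² < ∞`, where `F = Sᶜ`. -/
def spaceVu (S : Set Plane) : Submodule ℝ L2Plane :=
  spaceH S ⊓ submoduleOfComb
    (fun φ => ∃ G, IsWeakGrad Sᶜ φ G ∧ MemLp G 2 (volume.restrict Sᶜ))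
    ⟨0, isWeakGrad_zero _, MemLp.zero⟩
    (by
      rintro c x y ⟨G, h1, h2⟩ ⟨G', h1', h2'⟩
      exact ⟨_, h1.comb h1' c (L2Plane.coeFn_comb c x y), (h2.const_smul c).add h2'⟩)

/-- The space `𝓥` of all `φ ∈ 𝓗` with `∫_F |∇φ(y)|² (1 + |y|²) dy < ∞`. -/
def spaceV (S : Set Plane) : Submodule ℝ L2Plane :=
  spaceH S ⊓ submoduleOfComb
    (fun φ => ∃ G, IsWeakGrad Sᶜ φ G ∧
      MemLp (fun y => Real.sqrt (1 + ‖y‖ ^ 2) • G y) 2 (volume.restrict Sᶜ))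
    ⟨0, isWeakGrad_zero _, by simp⟩
    (by
      rintro c x y ⟨G, h1, h2⟩ ⟨G', h1', h2'⟩
      refine ⟨_, h1.comb h1' c (L2Plane.coeFn_comb c x y), ?_⟩
      have e : (fun y => Real.sqrt (1 + ‖y‖ ^ 2) • (c • G y + G' y)) =
          fun y => c • (Real.sqrt (1 + ‖y‖ ^ 2) • G y) + Real.sqrt (1 + ‖y‖ ^ 2) • G' y := by
        ext1 y
        rw [smul_add, smul_comm]
      rw [e]
      exact (h2.const_smul c).add h2')

/-- The space `𝓥^` of all `φ ∈ 𝓥` whose restriction to the fluid domain is Lipschitz up to the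
boundary. -/
def spaceVhat (S : Set Plane) : Submodule ℝ L2Plane :=
  spaceV S ⊓ submoduleOfComb (fun φ => ∃ A K, LipBound S φ A K)
    (by
      refine ⟨0, 0, le_rfl, le_rfl, 0, ?_, by simp, by simp⟩
      exact (ae_restrict_of_ae coe_zero_ae).mono fun x hx => hx.symm)
    (by
      rintro c x y ⟨A, K, hA, hK, f, h1, h2, h3⟩ ⟨A', K', hA', hK', f', h1', h2', h3'⟩
      refine ⟨|c| * A + A', |c| * K + K', by positivity, by positivity,
        fun p => c • f p + f' p, ?_, ?_, ?_⟩
      · filter_upwards [ae_restrict_of_ae (L2Plane.coeFn_comb c x y), h1, h1'] with p e1 e2 e3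
        rw [e1, e2, e3]
      · intro p hp
        refine (norm_add_le _ _).trans (add_le_add ?_ (h2' p hp))
        rw [norm_smul, Real.norm_eq_abs]
        exact mul_le_mul_of_nonneg_left (h2 p hp) (abs_nonneg c)
      · intro p hp q hq
        have : c • f p + f' p - (c • f q + f' q) = c • (f p - f q) + (f' p - f' q) := by
          rw [smul_sub]; abel
        rw [this]
        refine (norm_add_le _ _).trans ?_
        rw [norm_smul, Real.norm_eq_abs, add_mul, mul_assoc]
        exact add_le_add (mul_le_mul_of_nonneg_left (h3 p hp q hq) (abs_nonneg c))
          (h3' p hp q hq))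

/-! ### The norms -/

/-- `‖φ‖_𝓗`, from the inner product `∫_F φ · ψ + m ℓ_φ · ℓ_ψ + J r_φ r_ψ`. -/
def normH (S : Set Plane) (m J : ℝ) (φ : Plane → Plane) : ℝ :=
  Real.sqrt ((∫ x in Sᶜ, ‖φ x‖ ^ 2) + m * ‖linVel S φ‖ ^ 2 + J * angVel S φ ^ 2)

/-- `‖φ‖_𝓥_ = ‖φ‖_𝓗 + ‖∇φ‖_{L²(F)}`. -/
def normVu (S : Set Plane) (m J : ℝ) (φ : Plane → Plane) : ℝ :=
  normH S m J φ + Real.sqrt (∫ x in Sᶜ, ‖weakGrad Sᶜ φ x‖ ^ 2)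

/-- `‖φ‖_𝓥 = ‖φ‖_𝓗 + (∫_F |∇φ(y)|² (1 + |y|²) dy)^{1/2}`. -/
def normV (S : Set Plane) (m J : ℝ) (φ : Plane → Plane) : ℝ :=
  normH S m J φ + Real.sqrt (∫ y in Sᶜ, ‖weakGrad Sᶜ φ y‖ ^ 2 * (1 + ‖y‖ ^ 2))

/-- The norm of `Lip(F̄)`: supremum plus best Lipschitz constant. -/
def normLip (S : Set Plane) (φ : Plane → Plane) : ℝ :=
  sInf {M : ℝ | ∃ A K, LipBound S φ A K ∧ M = A + K}

/-- `‖φ‖_𝓥^ = ‖φ‖_𝓥 + ‖φ‖_{Lip(F̄)}`. -/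
def normVhat (S : Set Plane) (m J : ℝ) (φ : Plane → Plane) : ℝ :=
  normV S m J φ + normLip S φ

/-- The vector field `φ + β H`, for `φ` in a subspace `X` of `L²`: the pair `(φ, β)` represents an
element of `X ⊕ ℝH`. -/
def withH {X : Submodule ℝ L2Plane} (H : Plane → Plane) (φ : X) (β : ℝ) (x : Plane) : Plane :=
  ((φ : L2Plane) : Plane → Plane) x + β • H x

/-- The vector field of an element of a subspace of `L²`. -/
abbrev field {X : Submodule ℝ L2Plane} (φ : X) : Plane → Plane := ((φ : L2Plane) : Plane → Plane)

/-! ### The form `b` -/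

/-- The integrand `[(u - u_S) · ∇ w] · v - r_u v^⊥ · w`. -/
def bIntegrand (S : Set Plane) (u v w : Plane → Plane) (x : Plane) : ℝ :=
  (∑ i : Fin 2, ∑ j : Fin 2, (u x - rigidPart S u x) j * weakGrad Sᶜ w x (i, j) * v x i)
    - angVel S u * ⟪perp (v x), w x⟫

/-- The contribution `m r_u ℓ_v^⊥ · ℓ_w` of the body. -/
def bBody (S : Set Plane) (m : ℝ) (u v w : Plane → Plane) : ℝ :=
  m * angVel S u * ⟪perp (linVel S v), linVel S w⟫

/-- `b(u,v,w) = ∫_F ([(u - u_S) · ∇ w] · v - r_u v^⊥ · w) - m r_u ℓ_v^⊥ · ℓ_w`. -/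
def bForm (S : Set Plane) (m : ℝ) (u v w : Plane → Plane) : ℝ :=
  (∫ x in Sᶜ, bIntegrand S u v w x) - bBody S m u v w

/-! ### Boundary traces and the form `a` -/

/-- `g` is the trace on `∂S`, from the fluid side, of the field `u`: for suitable `C¹` fields `φₙ`,
`φₙ → u` in `H¹` of every bounded part of the fluid domain and `φₙ → g` in `L²(∂S)`. -/
def IsTrace (S : Set Plane) (u g : Plane → Plane) : Prop :=
  MemLp g 2 (arcLength S) ∧ (∃ G, IsWeakGrad Sᶜ u G) ∧
  ∃ φ : ℕ → Plane → Plane, (∀ n, ContDiff ℝ 1 (φ n)) ∧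
    (∀ R : ℝ, Tendsto (fun n => eLpNorm (fun x => φ n x - u x) 2
      (volume.restrict (Sᶜ ∩ Metric.ball 0 R))) atTop (𝓝 0)) ∧
    (∀ R : ℝ, Tendsto (fun n => eLpNorm (fun x => classicalGrad (φ n) x - weakGrad Sᶜ u x) 2
      (volume.restrict (Sᶜ ∩ Metric.ball 0 R))) atTop (𝓝 0)) ∧
    Tendsto (fun n => eLpNorm (fun x => φ n x - g x) 2 (arcLength S)) atTop (𝓝 0)

open Classical in
/-- The trace of `u` on `∂S` from the fluid side (unique up to null sets where it exists). -/
def bdryTrace (S : Set Plane) (u : Plane → Plane) : Plane → Plane :=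
  if h : ∃ g, IsTrace S u g then h.choose else 0

/-- `D(u) : D(v)`, with the deformation tensor `D(u) = (½ (∂ⱼ uᵢ + ∂ᵢ uⱼ))`. -/
def deformationProduct (S : Set Plane) (u v : Plane → Plane) (x : Plane) : ℝ :=
  ∑ i : Fin 2, ∑ j : Fin 2,
    ((weakGrad Sᶜ u x (i, j) + weakGrad Sᶜ u x (j, i)) / 2) *
      ((weakGrad Sᶜ v x (i, j) + weakGrad Sᶜ v x (j, i)) / 2)

/-- The boundary integrand `(u - u_S) · (v - v_S)`. -/
def slipProduct (S : Set Plane) (u v : Plane → Plane) (x : Plane) : ℝ :=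
  ⟪bdryTrace S u x - rigidPart S u x, bdryTrace S v x - rigidPart S v x⟫

/-- `a(u,v) = -α ∫_{∂S} (u - u_S) · (v - v_S) - ∫_F D(u) : D(v)`. -/
def aForm (S : Set Plane) (α : ℝ) (u v : Plane → Plane) : ℝ :=
  - α * (∫ x, slipProduct S u v x ∂(arcLength S)) - ∫ x in Sᶜ, deformationProduct S u v x

end

open Metric

/-- Convolution of a scalar function with a kernel. -/
noncomputable def mol (K f : Plane → ℝ) (x : Plane) : ℝ := ∫ y, f y * K (x - y)

/-- A sequence of smooth, compactly supported, nonnegative kernels of mass one that concentrate at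
the origin. -/
structure IsMollifier (K : ℕ → Plane → ℝ) : Prop where
  smooth : ∀ n, ContDiff ℝ ∞ (K n)
  compact : ∀ n, HasCompactSupport (K n)
  nonneg : ∀ n x, 0 ≤ K n x
  mass : ∀ n, ∫ x, K n x = 1
  small : ∀ ε > 0, ∀ᶠ n in atTop, ∀ x, K n x ≠ 0 → ‖x‖ < ε

theorem exists_isMollifier (v : Plane) {δ : ℝ} (hδ : 0 < δ) :
    ∃ K, IsMollifier K ∧ ∀ n x, x ∈ tsupport (K n) →
      ∃ t : ℝ, 0 < t ∧ t ≤ 1 / ((n : ℝ) + 1) ∧ x ∈ ball (t • v) (t * δ) := by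
  have ht : ∀ n : ℕ, (0 : ℝ) < 1 / ((n : ℝ) + 1) := fun n => by positivity
  let φ : ∀ n : ℕ, ContDiffBump ((1 / ((n : ℝ) + 1)) • v) := fun n =>
    ⟨1 / ((n : ℝ) + 1) * δ / 4, 1 / ((n : ℝ) + 1) * δ / 2, by have := ht n; positivity, by
      have := mul_pos (ht n) hδ; linarith⟩
  refine ⟨fun n => (φ n).normed volume, ⟨fun n => (φ n).contDiff_normed,
    fun n => (φ n).hasCompactSupport_normed, fun n x => (φ n).nonneg_normed x,
    fun n => (φ n).integral_normed, fun ε hε => ?_⟩, fun n x hx => ?_⟩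
  · have h1 : Tendsto (fun n : ℕ => 1 / ((n : ℝ) + 1) * (‖v‖ + δ)) atTop (𝓝 (0 * (‖v‖ + δ))) :=
      tendsto_one_div_add_atTop_nhds_zero_nat.mul_const _
    rw [zero_mul] at h1
    filter_upwards [h1.eventually (gt_mem_nhds hε)] with n hn x hx
    have hx' : x ∈ ball ((1 / ((n : ℝ) + 1)) • v) (1 / ((n : ℝ) + 1) * δ / 2) := by
      have := (φ n).support_normed_eq (μ := volume)
      rw [← this]; exact hx
    rw [mem_ball_iff_norm] at hx'
    have h2 : ‖x‖ ≤ ‖x - (1 / ((n : ℝ) + 1)) • v‖ + ‖(1 / ((n : ℝ) + 1)) • v‖ := by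
      simpa using norm_add_le (x - (1 / ((n : ℝ) + 1)) • v) ((1 / ((n : ℝ) + 1)) • v)
    rw [norm_smul, Real.norm_of_nonneg (ht n).le] at h2
    have := mul_pos (ht n) hδ
    nlinarith
  · rw [(φ n).tsupport_normed_eq] at hx
    refine ⟨1 / ((n : ℝ) + 1), ht n, le_rfl, closedBall_subset_ball ?_ hx⟩
    have := mul_pos (ht n) hδ
    change 1 / ((n : ℝ) + 1) * δ / 2 < _
    linarith

theorem exists_isMollifier_small : ∃ K, IsMollifier K ∧ ∀ n x, x ∈ tsupport (K n) →
    ‖x‖ < 1 / ((n : ℝ) + 1) := by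
  obtain ⟨K, hK, h⟩ := exists_isMollifier 0 one_pos
  refine ⟨K, hK, fun n x hx => ?_⟩
  obtain ⟨t, h1, h2, h3⟩ := h n x hx
  simp at h3
  exact h3.trans_le (by simpa using h2)

section kernel

variable {K f g : Plane → ℝ}

theorem mol_eq_convolution (K f : Plane → ℝ) :
    mol K f = convolution f K (ContinuousLinearMap.mul ℝ ℝ) volume := by
  ext x; simp [mol, convolution]

theorem integrable_mul_kernel (hf : LocallyIntegrable f) (hK : Continuous K)
    (hc : HasCompactSupport K) (x : Plane) : Integrable fun y => f y * K (x - y) := by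
  have h1 : HasCompactSupport fun y => K (x - y) := by
    exact hc.comp_homeomorph (Homeomorph.subLeft x)
  have h := integrableOn_mul_test (locallyIntegrableOn_univ.2 hf)
    (hK.comp (continuous_const.sub continuous_id : Continuous fun y => x - y)) h1 (subset_univ _)
  simpa [IntegrableOn] using h

theorem mol_contDiff (hf : LocallyIntegrable f) (hK : ContDiff ℝ ∞ K) (hc : HasCompactSupport K) :
    ContDiff ℝ ∞ (mol K f) := by
  rw [mol_eq_convolution]
  exact hc.contDiff_convolution_right _ hf hK

theorem pd_mol (hf : LocallyIntegrable f) (hK : ContDiff ℝ ∞ K) (hc : HasCompactSupport K)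
    (j : Fin 2) : pd j (mol K f) = mol (pd j K) f := by
  ext x
  have h := hc.hasFDerivAt_convolution_right (ContinuousLinearMap.mul ℝ ℝ) hf (hK.of_le (by simp)) x
  rw [pd, mol_eq_convolution, h.fderiv, convolution, mol]
  have hc' : HasCompactSupport (fderiv ℝ K) := hc.fderiv ℝ
  have hi : ConvolutionExistsAt f (fderiv ℝ K) x
      ((ContinuousLinearMap.mul ℝ ℝ).precompR Plane) volume :=
    hc'.convolutionExists_right _ hf (hK.continuous_fderiv (by simp)) x
  rw [ContinuousLinearMap.integral_apply hi]
  simp [pd]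

theorem contDiff_pd (hK : ContDiff ℝ ∞ K) (j : Fin 2) : ContDiff ℝ ∞ (pd j K) :=
  (hK.fderiv_right (m := ∞) (by simp)).clm_apply contDiff_const

theorem hasCompactSupport_pd (hc : HasCompactSupport K) (j : Fin 2) : HasCompactSupport (pd j K) :=
  hc.fderiv_apply ℝ _

theorem mol_sub (hf : LocallyIntegrable f) (hg : LocallyIntegrable g) (hK : Continuous K)
    (hc : HasCompactSupport K) : mol K (f - g) = mol K f - mol K g := by
  ext x
  simp only [mol, Pi.sub_apply, sub_mul]
  exact integral_sub (integrable_mul_kernel hf hK hc x) (integrable_mul_kernel hg hK hc x)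

theorem integrable_kernel_sub (hK : Continuous K) (hc : HasCompactSupport K) (x : Plane) :
    Integrable fun y => K (x - y) :=
  (hK.integrable_of_hasCompactSupport hc).comp_sub_left x

/-- Young's inequality. -/
theorem eLpNorm_mol_le_lintegral (hf : LocallyIntegrable f) (hK : Continuous K) :
    eLpNorm (mol K f) 2 ≤ (∫⁻ x, ‖K x‖ₑ) * eLpNorm f 2 := by
  have hfm : AEMeasurable f := hf.aestronglyMeasurable.aemeasurable
  set k := ∫⁻ x, ‖K x‖ₑ with hk
  have key : ∀ x, ‖mol K f x‖ₑ ^ (2 : ℝ) ≤ (∫⁻ y, ‖f y‖ₑ ^ (2 : ℝ) * ‖K (x - y)‖ₑ) * k := by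
    intro x
    have hKm : Measurable fun y => ‖K (x - y)‖ₑ :=
      (hK.comp (continuous_const.sub continuous_id)).measurable.enorm
    have e1 : ‖mol K f x‖ₑ ≤ ∫⁻ y, ‖f y‖ₑ * ‖K (x - y)‖ₑ :=
      (enorm_integral_le_lintegral_enorm _).trans (le_of_eq (lintegral_congr fun y => enorm_mul _ _))
    have e2 := ENNReal.lintegral_mul_le_Lp_mul_Lq volume Real.HolderConjugate.two_two
      (f := fun y => ‖f y‖ₑ * ‖K (x - y)‖ₑ ^ (1 / 2 : ℝ))
      (g := fun y => ‖K (x - y)‖ₑ ^ (1 / 2 : ℝ))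
      (hfm.enorm.mul (hKm.pow_const _).aemeasurable) (hKm.pow_const _).aemeasurable
    have e3 : ∀ y, ‖K (x - y)‖ₑ ^ (1 / 2 : ℝ) * ‖K (x - y)‖ₑ ^ (1 / 2 : ℝ) = ‖K (x - y)‖ₑ :=
      fun y => by rw [← ENNReal.rpow_add_of_nonneg _ _ (by norm_num) (by norm_num)]; norm_num
    have e4 : ∀ y, (‖K (x - y)‖ₑ ^ (1 / 2 : ℝ)) ^ (2 : ℝ) = ‖K (x - y)‖ₑ := fun y => by
      rw [← ENNReal.rpow_mul]; norm_num
    simp only [Pi.mul_apply, mul_assoc, e3, ENNReal.mul_rpow_of_nonneg _ _ (zero_le_two : (0:ℝ) ≤ 2),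
      e4] at e2
    rw [lintegral_sub_left_eq_self (fun y => ‖K y‖ₑ) x,
      ← ENNReal.mul_rpow_of_nonneg _ _ (by norm_num)] at e2
    calc ‖mol K f x‖ₑ ^ (2 : ℝ)
        ≤ (((∫⁻ y, ‖f y‖ₑ ^ (2 : ℝ) * ‖K (x - y)‖ₑ) * k) ^ (1 / 2 : ℝ)) ^ (2 : ℝ) :=
          ENNReal.rpow_le_rpow (e1.trans e2) (by norm_num)
      _ = _ := by rw [← ENNReal.rpow_mul]; norm_num
  rw [eLpNorm_eq_lintegral_rpow_enorm_toReal (by norm_num) (by norm_num),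
    eLpNorm_eq_lintegral_rpow_enorm_toReal (by norm_num) (by norm_num)]
  simp only [ENNReal.toReal_ofNat]
  have hkk : k = (k ^ (2 : ℝ)) ^ (1 / 2 : ℝ) := by rw [← ENNReal.rpow_mul]; norm_num
  rw [hkk, ← ENNReal.mul_rpow_of_nonneg _ _ (by norm_num)]
  refine ENNReal.rpow_le_rpow ?_ (by norm_num)
  calc ∫⁻ x, ‖mol K f x‖ₑ ^ (2 : ℝ)
      ≤ ∫⁻ x, (∫⁻ y, ‖f y‖ₑ ^ (2 : ℝ) * ‖K (x - y)‖ₑ) * k := lintegral_mono key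
    _ = (∫⁻ x, ∫⁻ y, ‖f y‖ₑ ^ (2 : ℝ) * ‖K (x - y)‖ₑ) * k := by
        refine lintegral_mul_const'' _ (AEMeasurable.lintegral_prod_right' (f := fun p : Plane × Plane =>
          ‖f p.2‖ₑ ^ (2 : ℝ) * ‖K (p.1 - p.2)‖ₑ) ?_)
        exact ((hfm.enorm.pow_const _).comp_snd).mul
          ((hK.comp (continuous_fst.sub continuous_snd)).measurable.enorm).aemeasurable
    _ = (∫⁻ y, ∫⁻ x, ‖f y‖ₑ ^ (2 : ℝ) * ‖K (x - y)‖ₑ) * k := by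
        congr 1
        refine lintegral_lintegral_swap ?_
        exact ((hfm.enorm.pow_const _).comp_snd).mul
          ((hK.comp (continuous_fst.sub continuous_snd)).measurable.enorm).aemeasurable
    _ = ((∫⁻ y, ‖f y‖ₑ ^ (2 : ℝ)) * k) * k := by
        congr 1
        rw [← lintegral_mul_const'' _ (hfm.enorm.pow_const _)]
        refine lintegral_congr fun y => ?_
        have hm : Measurable fun x => ‖K (x - y)‖ₑ :=
          (hK.comp (continuous_id.sub continuous_const)).measurable.enorm
        rw [lintegral_const_mul _ hm, lintegral_sub_right_eq_self (fun x => ‖K x‖ₑ) y]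
    _ = _ := by rw [ENNReal.rpow_two, pow_two]; ring

theorem eLpNorm_mol_le (hf : LocallyIntegrable f) (hK : Continuous K) (hc : HasCompactSupport K)
    (h0 : ∀ x, 0 ≤ K x) (h1 : ∫ x, K x = 1) : eLpNorm (mol K f) 2 ≤ eLpNorm f 2 := by
  have e : ∫⁻ x, ‖K x‖ₑ = 1 := by
    rw [← ofReal_integral_norm_eq_lintegral_enorm (hK.integrable_of_hasCompactSupport hc)]
    simp only [Real.norm_of_nonneg (h0 _), h1, ENNReal.ofReal_one]
  simpa [e] using eLpNorm_mol_le_lintegral hf hK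

theorem memLp_mol (hf : MemLp f 2) (hK : ContDiff ℝ ∞ K) (hc : HasCompactSupport K) :
    MemLp (mol K f) 2 :=
  ⟨(mol_contDiff (hf.locallyIntegrable (by norm_num)) hK hc).continuous.aestronglyMeasurable,
    (eLpNorm_mol_le_lintegral (hf.locallyIntegrable (by norm_num)) hK.continuous).trans_lt
      (ENNReal.mul_lt_top (hK.continuous.integrable_of_hasCompactSupport hc).2 hf.2)⟩

theorem abs_mol_sub_le (hg : Continuous g) (hK : Continuous K)
    (hc : HasCompactSupport K) (h0 : ∀ x, 0 ≤ K x) (h1 : ∫ x, K x = 1) {x : Plane} {ε : ℝ}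
    (h : ∀ y, K (x - y) ≠ 0 → |g y - g x| ≤ ε) : |mol K g x - g x| ≤ ε := by
  have i1 := integrable_mul_kernel (hg.locallyIntegrable (μ := volume)) hK hc x
  have i2 := integrable_kernel_sub hK hc x
  have e1 : ∫ y, K (x - y) = 1 := by rw [integral_sub_left_eq_self K volume x, h1]
  have e2 : mol K g x - g x = ∫ y, (g y - g x) * K (x - y) := by
    simp only [sub_mul]
    rw [integral_sub i1 (i2.const_mul (g x)), integral_const_mul, e1, mul_one, mol]
  rw [e2]
  calc |∫ y, (g y - g x) * K (x - y)| ≤ ∫ y, ε * K (x - y) := by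
        rw [← Real.norm_eq_abs]
        refine norm_integral_le_of_norm_le (i2.const_mul ε) (ae_of_all _ fun y => ?_)
        rw [norm_mul, Real.norm_of_nonneg (h0 _), Real.norm_eq_abs]
        by_cases hy : K (x - y) = 0
        · simp [hy]
        · exact mul_le_mul_of_nonneg_right (h y hy) (h0 _)
    _ = ε := by rw [integral_const_mul, e1, mul_one]

end kernel

variable {K : ℕ → Plane → ℝ}

theorem IsMollifier.tendstoUniformly (hK : IsMollifier K) {g : Plane → ℝ}
    (hg : UniformContinuous g) :
    ∀ ε > 0, ∀ᶠ n in atTop, ∀ x, |mol (K n) g x - g x| ≤ ε := by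
  intro ε hε
  obtain ⟨d, hd, h⟩ := Metric.uniformContinuous_iff.1 hg ε hε
  filter_upwards [hK.small d hd] with n hn x
  refine abs_mol_sub_le hg.continuous (hK.smooth n).continuous (hK.compact n) (hK.nonneg n)
    (hK.mass n) fun y hy => ?_
  have := h (a := y) (b := x) (by rw [dist_comm, dist_eq_norm]; exact hn _ hy)
  rw [Real.dist_eq] at this
  exact this.le

theorem IsMollifier.tendsto_eLpNorm_of_continuous (hK : IsMollifier K) {g : Plane → ℝ}
    (hg : Continuous g) (hc : HasCompactSupport g) :
    Tendsto (fun n => eLpNorm (mol (K n) g - g) 2) atTop (𝓝 0) := by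
  set A : Set Plane := cthickening 1 (tsupport g)
  have hA : IsCompact A := hc.isCompact.cthickening
  have hAm : volume A ≠ ⊤ := hA.measure_lt_top.ne
  rw [ENNReal.tendsto_nhds_zero]
  intro ε hε
  obtain ⟨η, hη, hle⟩ : ∃ η : ℝ, 0 < η ∧ volume A ^ (1 / (2 : ℝ)) * ENNReal.ofReal η ≤ ε := by
    have ht : Tendsto (fun n : ℝ => volume A ^ (1 / (2 : ℝ)) * ENNReal.ofReal n) (𝓝[>] 0)
        (𝓝 (volume A ^ (1 / (2 : ℝ)) * ENNReal.ofReal 0)) :=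
      (ENNReal.Tendsto.const_mul (ENNReal.tendsto_ofReal tendsto_id)
        (Or.inr (ENNReal.rpow_ne_top_of_nonneg (by norm_num) hAm))).mono_left nhdsWithin_le_nhds
    rw [ENNReal.ofReal_zero, mul_zero] at ht
    obtain ⟨η, h1, h2⟩ := ((ht.eventually (gt_mem_nhds hε)).and self_mem_nhdsWithin).exists
    exact ⟨η, h2, h1.le⟩
  have huc : UniformContinuous g := hc.uniformContinuous_of_continuous hg
  filter_upwards [hK.tendstoUniformly huc η hη, hK.small 1 one_pos] with n h1 h2
  have hz : ∀ x, x ∉ A → mol (K n) g x - g x = 0 := by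
    intro x hx
    have hx0 : g x = 0 := by
      by_contra h
      exact hx (Metric.self_subset_cthickening _ (subset_tsupport _ h))
    rw [hx0, sub_zero, mol]
    refine integral_eq_zero_of_ae (ae_of_all _ fun y => ?_)
    by_contra hne
    have hy : g y ≠ 0 := fun h => hne (by simp [h])
    have hk : K n (x - y) ≠ 0 := fun h => hne (by simp [h])
    exact hx (mem_cthickening_of_dist_le x y 1 _ (subset_tsupport _ hy)
      (by rw [dist_eq_norm]; exact (h2 _ hk).le))
  have e : mol (K n) g - g = A.indicator (mol (K n) g - g) := by
    ext x
    by_cases hx : x ∈ A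
    · simp [hx]
    · simpa [hx] using hz x hx
  rw [e, eLpNorm_indicator_eq_eLpNorm_restrict hA.measurableSet]
  refine (eLpNorm_le_of_ae_bound (C := η) (ae_of_all _ fun x => h1 x)).trans ?_
  simpa using hle

/-- Mollification converges in `L²`. -/
theorem IsMollifier.tendsto_eLpNorm (hK : IsMollifier K) {f : Plane → ℝ} (hf : MemLp f 2) :
    Tendsto (fun n => eLpNorm (mol (K n) f - f) 2) atTop (𝓝 0) := by
  rw [ENNReal.tendsto_nhds_zero]
  intro ε hε
  by_cases hε' : ε = ⊤
  · simp [hε']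
  have h3 : ε / 3 ≠ 0 := (ENNReal.div_pos hε.ne' (by norm_num)).ne'
  obtain ⟨g, hgc, hfg, hg, hg2⟩ := hf.exists_hasCompactSupport_eLpNorm_sub_le (by norm_num) h3
  filter_upwards [ENNReal.tendsto_nhds_zero.1 (hK.tendsto_eLpNorm_of_continuous hg hgc) (ε / 3)
    (pos_iff_ne_zero.2 h3)] with n hn
  have lf := hf.locallyIntegrable (by norm_num)
  have lg := hg2.locallyIntegrable (by norm_num)
  have hk := (hK.smooth n).continuous
  have e : mol (K n) f - f = mol (K n) (f - g) + ((mol (K n) g - g) + (g - f)) := by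
    rw [mol_sub lf lg hk (hK.compact n)]; abel
  have m1 : ∀ {u : Plane → ℝ}, LocallyIntegrable u → AEStronglyMeasurable (mol (K n) u) := fun hu =>
    (mol_contDiff hu (hK.smooth n) (hK.compact n)).continuous.aestronglyMeasurable
  rw [e]
  calc _ ≤ eLpNorm (mol (K n) (f - g)) 2 + (eLpNorm (mol (K n) g - g) 2 + eLpNorm (g - f) 2) := by
        refine (eLpNorm_add_le (m1 (lf.sub lg)) (((m1 lg).sub hg2.1).add (hg2.1.sub hf.1))
          (by norm_num)).trans ?_
        gcongr
        exact eLpNorm_add_le ((m1 lg).sub hg2.1) (hg2.1.sub hf.1) (by norm_num)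
    _ ≤ ε / 3 + (ε / 3 + ε / 3) := by
        gcongr
        · exact (eLpNorm_mol_le (lf.sub lg) hk (hK.compact n) (hK.nonneg n) (hK.mass n)).trans hfg
        · rw [← neg_sub, eLpNorm_neg]; exact hfg
    _ = ε := by rw [← add_assoc, ENNReal.add_thirds]

/-! ### Weak partial derivatives of scalar functions -/

/-- `G` is the weak partial derivative `∂ⱼ g` in `O`. -/
def HasWeakPd (O : Set Plane) (j : Fin 2) (g G : Plane → ℝ) : Prop :=
  LocallyIntegrableOn g O ∧ LocallyIntegrableOn G O ∧
    ∀ ψ, IsTest O ψ → ∫ x in O, g x * pd j ψ x = - ∫ x in O, G x * ψ x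

theorem locallyIntegrableOn_of_coord {ι : Type*} [Fintype ι] {O : Set Plane} (hO : IsOpen O)
    {w : Plane → EuclideanSpace ℝ ι} (h : ∀ i, LocallyIntegrableOn (fun x => w x i) O) :
    LocallyIntegrableOn w O := by
  rw [locallyIntegrableOn_iff hO.isLocallyClosed]
  intro k hk hc
  have h1 : ∀ i, IntegrableOn (fun x => w x i) k := fun i => (h i).integrableOn_compact_subset hk hc
  have h2 : Integrable (fun x => WithLp.ofLp (w x)) (volume.restrict k) := Integrable.of_eval h1
  exact (PiLp.continuousLinearEquiv 2 ℝ (fun _ : ι => ℝ)).symm.toContinuousLinearMap.integrable_comp h2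

theorem isWeakGrad_iff {O : Set Plane} (hO : IsOpen O) {w : Plane → Plane} {G : Plane → Mat2} :
    IsWeakGrad O w G ↔ ∀ i j, HasWeakPd O j (fun x => w x i) (fun x => G x (i, j)) := by
  constructor
  · intro h i j
    exact ⟨locallyIntegrableOn_coord h.1 i, locallyIntegrableOn_coord h.2.1 (i, j),
      fun ψ hψ => h.2.2 ψ hψ i j⟩
  · intro h
    exact ⟨locallyIntegrableOn_of_coord hO fun i => (h i 0).1,
      locallyIntegrableOn_of_coord hO fun p => (h p.1 p.2).2.1, fun ψ hψ i j => (h i j).2.2 ψ hψ⟩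

theorem HasWeakPd.unique {O : Set Plane} (hO : IsOpen O) {j : Fin 2} {g G G' : Plane → ℝ}
    (h : HasWeakPd O j g G) (h' : HasWeakPd O j g G') : G =ᵐ[volume.restrict O] G' := by
  have h0 : ∀ᵐ x ∂(volume : Measure Plane), x ∈ O → (G - G') x = 0 := by
    refine hO.ae_eq_zero_of_integral_contDiff_smul_eq_zero (h.2.1.sub h'.2.1) fun ψ s1 s2 s3 => ?_
    have i1 := integrableOn_mul_test h.2.1 s1.continuous s2 s3
    have i2 := integrableOn_mul_test h'.2.1 s1.continuous s2 s3
    have e1 := h.2.2 ψ ⟨s1, s2, s3⟩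
    rw [h'.2.2 ψ ⟨s1, s2, s3⟩, neg_inj] at e1
    have e2 : ∫ x, ψ x • (G - G') x = ∫ x in O, (G x * ψ x - G' x * ψ x) := by
      rw [setIntegral_eq_integral_of_forall_compl_eq_zero]
      · refine integral_congr_ae (ae_of_all _ fun x => ?_)
        simp only [Pi.sub_apply, smul_eq_mul]; ring
      · intro x hx
        rw [image_eq_zero_of_notMem_tsupport fun hh => hx (s3 hh)]; ring
    rw [e2, integral_sub i1 i2, e1, sub_self]
  rw [EventuallyEq, ae_restrict_iff' hO.measurableSet]
  filter_upwards [h0] with x hx hxO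
  exact sub_eq_zero.1 (hx hxO)

theorem LocallyIntegrableOn.congr_ae {O : Set Plane} (hO : IsOpen O) {f g : Plane → ℝ}
    (h : LocallyIntegrableOn f O) (hfg : f =ᵐ[volume.restrict O] g) : LocallyIntegrableOn g O := by
  rw [locallyIntegrableOn_iff hO.isLocallyClosed] at h ⊢
  exact fun k hk hc => (h k hk hc).congr (ae_restrict_of_ae_restrict_of_subset hk hfg)

theorem HasWeakPd.congr {O : Set Plane} (hO : IsOpen O) {j : Fin 2} {g g' G G' : Plane → ℝ}
    (h : HasWeakPd O j g G) (hg : g =ᵐ[volume.restrict O] g') (hG : G =ᵐ[volume.restrict O] G') :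
    HasWeakPd O j g' G' := by
  refine ⟨LocallyIntegrableOn.congr_ae hO h.1 hg, LocallyIntegrableOn.congr_ae hO h.2.1 hG,
    fun ψ hψ => ?_⟩
  have e1 : ∫ x in O, g' x * pd j ψ x = ∫ x in O, g x * pd j ψ x :=
    integral_congr_ae (by filter_upwards [hg] with x hx; rw [hx])
  have e2 : ∫ x in O, G' x * ψ x = ∫ x in O, G x * ψ x :=
    integral_congr_ae (by filter_upwards [hG] with x hx; rw [hx])
  rw [e1, e2, h.2.2 ψ hψ]

theorem HasWeakPd.mono {O O' : Set Plane} {j : Fin 2} {g G : Plane → ℝ}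
    (h : HasWeakPd O j g G) (hO' : O' ⊆ O) : HasWeakPd O' j g G := by
  refine ⟨h.1.mono_set hO', h.2.1.mono_set hO', fun ψ hψ => ?_⟩
  have e := h.2.2 ψ ⟨hψ.1, hψ.2.1, hψ.2.2.trans hO'⟩
  obtain ⟨-, -, a3⟩ := hψ.integrable_pd j
  have key : ∀ (a b : Plane → ℝ), tsupport b ⊆ O' →
      ∫ x in O, a x * b x = ∫ x in O', a x * b x := fun a b hb => by
    rw [setIntegral_eq_integral_of_forall_compl_eq_zero,
      setIntegral_eq_integral_of_forall_compl_eq_zero]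
    · intro x hx; rw [image_eq_zero_of_notMem_tsupport fun hh => hx (hb hh), mul_zero]
    · intro x hx; rw [image_eq_zero_of_notMem_tsupport fun hh => hx (hO' (hb hh)), mul_zero]
  rw [← key _ _ a3, ← key _ _ hψ.2.2, e]

theorem HasWeakPd.comb {O : Set Plane} {j : Fin 2} {g g' G G' : Plane → ℝ}
    (h : HasWeakPd O j g G) (h' : HasWeakPd O j g' G') (c : ℝ) :
    HasWeakPd O j (fun x => c * g x + g' x) (fun x => c * G x + G' x) := by
  refine ⟨(h.1.smul c).add h'.1, (h.2.1.smul c).add h'.2.1, fun ψ hψ => ?_⟩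
  obtain ⟨a1, a2, a3⟩ := hψ.integrable_pd j
  have e1 := integrableOn_mul_test h.1 a1 a2 a3
  have e2 := integrableOn_mul_test h'.1 a1 a2 a3
  have e3 := integrableOn_mul_test h.2.1 hψ.1.continuous hψ.2.1 hψ.2.2
  have e4 := integrableOn_mul_test h'.2.1 hψ.1.continuous hψ.2.1 hψ.2.2
  simp only [add_mul, mul_assoc]
  rw [integral_add (e1.const_mul c) e2, integral_add (e3.const_mul c) e4,
    integral_const_mul, integral_const_mul, h.2.2 ψ hψ, h'.2.2 ψ hψ]
  ring

section pd

variable {f g : Plane → ℝ}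

theorem continuous_pd (hf : ContDiff ℝ 1 f) (j : Fin 2) : Continuous (pd j f) :=
  (hf.continuous_fderiv (by simp)).clm_apply continuous_const

theorem tsupport_pd_subset (f : Plane → ℝ) (j : Fin 2) : tsupport (pd j f) ⊆ tsupport f := by
  refine closure_minimal (fun x hx => ?_) (isClosed_tsupport f)
  apply support_fderiv_subset ℝ
  intro h0
  exact hx (by simp [pd, h0])

theorem pd_mul {x : Plane} (hf : DifferentiableAt ℝ f x) (hg : DifferentiableAt ℝ g x)
    (j : Fin 2) : pd j (fun y => f y * g y) x = pd j f x * g x + f x * pd j g x := by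
  simp only [pd, fderiv_fun_mul hf hg]
  simp; ring

theorem pd_add {x : Plane} (hf : DifferentiableAt ℝ f x) (hg : DifferentiableAt ℝ g x)
    (j : Fin 2) : pd j (fun y => f y + g y) x = pd j f x + pd j g x := by
  simp only [pd, fderiv_fun_add hf hg]
  simp

theorem pd_sum {ι : Type*} {s : Finset ι} {f : ι → Plane → ℝ} {x : Plane}
    (hf : ∀ i ∈ s, DifferentiableAt ℝ (f i) x) (j : Fin 2) :
    pd j (fun y => ∑ i ∈ s, f i y) x = ∑ i ∈ s, pd j (f i) x := by
  simp only [pd, fderiv_fun_sum hf]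
  simp

theorem pd_congr {x : Plane} (h : f =ᶠ[𝓝 x] g) (j : Fin 2) : pd j f x = pd j g x := by
  simp only [pd, h.fderiv_eq]

theorem pd_eq_of_eqOn {O : Set Plane} (hO : IsOpen O) (h : EqOn f g O) (j : Fin 2) :
    EqOn (pd j f) (pd j g) O := fun _ hx =>
  pd_congr (h.eventuallyEq_of_mem (hO.mem_nhds hx)) j

@[simp] theorem pd_const (c : ℝ) (j : Fin 2) (x : Plane) : pd j (fun _ => c) x = 0 := by simp [pd]

theorem pd_coord (i j : Fin 2) (x : Plane) :
    pd j (fun y : Plane => y i) x = if i = j then 1 else 0 := by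
  have : (fun y : Plane => y i) = (EuclideanSpace.proj i : Plane →L[ℝ] ℝ) := rfl
  rw [pd, this, ContinuousLinearMap.fderiv]
  simp

/-- Integration by parts. -/
theorem integral_mul_pd (hf : ContDiff ℝ 1 f) (hg : ContDiff ℝ 1 g) (hc : HasCompactSupport g)
    (j : Fin 2) : ∫ x, f x * pd j g x = - ∫ x, pd j f x * g x := by
  have hc' : HasCompactSupport (pd j g) := hc.fderiv_apply ℝ _
  refine integral_mul_fderiv_eq_neg_fderiv_mul_of_integrable ?_ ?_ ?_
    (fun x _ => hf.differentiable (by simp) x) (fun x _ => hg.differentiable (by simp) x)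
  · exact ((continuous_pd hf j).mul hg.continuous).integrable_of_hasCompactSupport hc.mul_left
  · exact (hf.continuous.mul (continuous_pd hg j)).integrable_of_hasCompactSupport hc'.mul_left
  · exact (hf.continuous.mul hg.continuous).integrable_of_hasCompactSupport hc.mul_left

theorem setIntegral_mul_of_tsupport_subset {O : Set Plane} {a b : Plane → ℝ} (h : tsupport b ⊆ O) :
    ∫ x in O, a x * b x = ∫ x, a x * b x :=
  setIntegral_eq_integral_of_forall_compl_eq_zero fun x hx => by
    rw [image_eq_zero_of_notMem_tsupport fun hh => hx (h hh), mul_zero]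

theorem HasWeakPd.of_contDiff (O : Set Plane) (hf : ContDiff ℝ 1 f) (j : Fin 2) :
    HasWeakPd O j f (pd j f) := by
  refine ⟨hf.continuous.locallyIntegrable.locallyIntegrableOn O,
    (continuous_pd hf j).locallyIntegrable.locallyIntegrableOn O, fun ψ hψ => ?_⟩
  obtain ⟨-, -, a3⟩ := hψ.integrable_pd j
  rw [setIntegral_mul_of_tsupport_subset a3, setIntegral_mul_of_tsupport_subset hψ.2.2,
    integral_mul_pd hf (hψ.1.of_le (by simp)) hψ.2.1]

theorem LocallyIntegrableOn.mul_continuous {O : Set Plane} (hO : IsOpen O)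
    (hf : LocallyIntegrableOn f O) (hg : Continuous g) :
    LocallyIntegrableOn (fun x => g x * f x) O :=
  (locallyIntegrableOn_iff hO.isLocallyClosed).2 fun _ hk hc =>
    (hf.integrableOn_compact_subset hk hc).continuousOn_mul hg.continuousOn hc

theorem HasWeakPd.smooth_mul {O : Set Plane} (hO : IsOpen O) {j : Fin 2} {G η : Plane → ℝ}
    (h : HasWeakPd O j f G) (hη : ContDiff ℝ ∞ η) :
    HasWeakPd O j (fun x => η x * f x) (fun x => η x * G x + pd j η x * f x) := by
  have hη1 : ContDiff ℝ 1 η := hη.of_le (by simp)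
  have l1 := LocallyIntegrableOn.mul_continuous hO h.1 (continuous_pd hη1 j)
  have l2 := LocallyIntegrableOn.mul_continuous hO h.2.1 hη.continuous
  refine ⟨LocallyIntegrableOn.mul_continuous hO h.1 hη.continuous, l2.add l1, fun ψ hψ => ?_⟩
  obtain ⟨a1, a2, a3⟩ := hψ.integrable_pd j
  have ht : IsTest O fun x => η x * ψ x :=
    ⟨hη.mul hψ.1, hψ.2.1.mul_left, (tsupport_mul_subset_right).trans hψ.2.2⟩
  obtain ⟨b1, b2, b3⟩ := ht.integrable_pd j
  have e := h.2.2 _ ht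
  have i1 := integrableOn_mul_test h.1 b1 b2 b3
  have i2 := integrableOn_mul_test l1 hψ.1.continuous hψ.2.1 hψ.2.2
  have i3 := integrableOn_mul_test l2 hψ.1.continuous hψ.2.1 hψ.2.2
  have e1 : ∫ x in O, η x * f x * pd j ψ x =
      ∫ x in O, (f x * pd j (fun x => η x * ψ x) x - pd j η x * f x * ψ x) := by
    refine integral_congr_ae (ae_of_all _ fun x => ?_)
    have := pd_mul (hη1.differentiable (by simp) x) (hψ.1.differentiable (by simp) x) j
    simp only [this]
    ring
  rw [e1, integral_sub i1 i2, e]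
  simp only [add_mul]
  rw [integral_add i3 i2]
  have : ∀ x, G x * (η x * ψ x) = η x * G x * ψ x := fun x => by ring
  simp only [this]
  ring

end pd

theorem IsTest.of_kernel {O : Set Plane} {K : Plane → ℝ} (hK : ContDiff ℝ ∞ K)
    (hc : HasCompactSupport K) {x : Plane} (hs : ∀ z ∈ tsupport K, x - z ∈ O) :
    IsTest O fun y => K (x - y) := by
  refine ⟨hK.comp (contDiff_const.sub contDiff_id), hc.comp_homeomorph (Homeomorph.subLeft x), ?_⟩
  intro y hy
  have h1 : tsupport (K ∘ (Homeomorph.subLeft x)) = (Homeomorph.subLeft x) ⁻¹' tsupport K :=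
    tsupport_comp_eq_preimage K (Homeomorph.subLeft x)
  have h2 : y ∈ (Homeomorph.subLeft x) ⁻¹' tsupport K := by rw [← h1]; exact hy
  simpa using hs _ h2

theorem pd_kernel {K : Plane → ℝ} (hK : ContDiff ℝ ∞ K) (x y : Plane) (j : Fin 2) :
    pd j (fun y => K (x - y)) y = - pd j K (x - y) := by
  have h1 : HasFDerivAt (fun y => K (x - y))
      ((fderiv ℝ K (x - y)).comp (-ContinuousLinearMap.id ℝ Plane)) y :=
    ((hK.differentiable (by simp) (x - y)).hasFDerivAt).comp y ((hasFDerivAt_id y).const_sub x)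
  simp [pd, h1.fderiv]

/-- Differentiating a mollification: where the kernel only sees the domain of weak
differentiability, the derivative is the mollification of the weak derivative. -/
theorem HasWeakPd.pd_mol {O : Set Plane} (hO : IsOpen O) {j : Fin 2} {g G K : Plane → ℝ}
    (h : HasWeakPd O j g G) (hg : LocallyIntegrable (O.indicator g)) (hK : ContDiff ℝ ∞ K)
    (hc : HasCompactSupport K) {x : Plane} (hs : ∀ z ∈ tsupport K, x - z ∈ O) :
    pd j (mol K (O.indicator g)) x = mol K (O.indicator G) x := by
  have ht := IsTest.of_kernel hK hc hs
  have e := h.2.2 _ ht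
  simp only [pd_kernel hK, mul_neg, integral_neg, neg_inj] at e
  rw [_root_.pd_mol hg hK hc]
  have key : ∀ a b : Plane → ℝ, ∫ y, O.indicator a y * b (x - y) = ∫ y in O, a y * b (x - y) := by
    intro a b
    rw [← integral_indicator hO.measurableSet]
    refine integral_congr_ae (ae_of_all _ fun y => ?_)
    by_cases hy : y ∈ O <;> simp [hy]
  rw [mol, mol, key, key, e]

theorem mol_eq_zero_of_disjoint {K f : Plane → ℝ} {x : Plane}
    (h : ∀ z ∈ tsupport K, f (x - z) = 0) : mol K f x = 0 := by
  refine integral_eq_zero_of_ae (ae_of_all _ fun y => ?_)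
  by_cases hy : x - y ∈ tsupport K
  · have := h _ hy
    rw [sub_sub_cancel] at this
    simp [this]
  · simp [image_eq_zero_of_notMem_tsupport hy]

/-! ### Oblique coordinates -/

theorem exists_lintegral_coord {v w : Plane} (h : v 0 * w 1 - v 1 * w 0 ≠ 0) :
    ∃ c : ℝ≥0, c ≠ 0 ∧ ∀ g : Plane → ℝ≥0∞, Measurable g →
      ∫⁻ x, g x = c * ∫⁻ a : ℝ, ∫⁻ b : ℝ, g (a • v + b • w) := by
  let f : ℝ × ℝ →ₗ[ℝ] Plane :=
    (LinearMap.toSpanSingleton ℝ Plane v).coprod (LinearMap.toSpanSingleton ℝ Plane w)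
  have hf : ∀ q : ℝ × ℝ, f q = q.1 • v + q.2 • w := fun q => by simp [f]
  have hinj : Function.Injective f := by
    rw [← LinearMap.ker_eq_bot, LinearMap.ker_eq_bot']
    intro q hq
    rw [hf] at hq
    have h0 := congrArg (fun x : Plane => x 0) hq
    have h1 := congrArg (fun x : Plane => x 1) hq
    simp at h0 h1
    have e1 : q.1 * (v 0 * w 1 - v 1 * w 0) = 0 := by linear_combination w 1 * h0 - w 0 * h1
    have e2 : q.2 * (v 0 * w 1 - v 1 * w 0) = 0 := by linear_combination v 0 * h1 - v 1 * h0
    exact Prod.ext ((mul_eq_zero.1 e1).resolve_right h) ((mul_eq_zero.1 e2).resolve_right h)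
  let L : (ℝ × ℝ) ≃L[ℝ] Plane :=
    (LinearEquiv.ofInjectiveOfFinrankEq f hinj (by simp)).toContinuousLinearEquiv
  have hL : ∀ q : ℝ × ℝ, L q = q.1 • v + q.2 • w := fun q => hf q
  have : ((volume : Measure (ℝ × ℝ)).map L).IsAddHaarMeasure := L.isAddHaarMeasure_map _
  refine ⟨Measure.addHaarScalarFactor (volume : Measure Plane) ((volume : Measure (ℝ × ℝ)).map L),
    (Measure.addHaarScalarFactor_pos_of_isAddHaarMeasure _ _).ne', fun g hg => ?_⟩
  conv_lhs => rw [Measure.isAddLeftInvariant_eq_smul (volume : Measure Plane)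
    ((volume : Measure (ℝ × ℝ)).map L)]
  have e : ∫⁻ q : ℝ × ℝ, g (L q) = ∫⁻ a : ℝ, ∫⁻ b : ℝ, g (a • v + b • w) := by
    rw [Measure.volume_eq_prod, lintegral_prod (fun q => g (L q))
      (hg.comp L.continuous.measurable).aemeasurable]
    simp only [hL]
  rw [lintegral_smul_measure, lintegral_map hg L.continuous.measurable, e]
  rfl

theorem ContDiff.pd_sum_smul {f : Plane → ℝ} (x v : Plane) :
    fderiv ℝ f x v = v 0 * pd 0 f x + v 1 * pd 1 f x := by
  have : v = v 0 • EuclideanSpace.single 0 1 + v 1 • EuclideanSpace.single 1 1 := by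
    ext i; fin_cases i <;> simp
  conv_lhs => rw [this]
  simp [pd]

/-! ### Local charts at the boundary -/

/-- A ball in which `S` is the sublevel set of a smooth function that increases, at a definite
rate, in all directions close to `e`. -/
structure BChart (S : Set Plane) where
  p : Plane
  e : Plane
  r : ℝ
  δ : ℝ
  c : ℝ
  ρ : Plane → ℝ
  δ_pos : 0 < δ
  c_pos : 0 < c
  e_ne : e ≠ 0
  smooth : ContDiff ℝ ∞ ρ
  mem_iff : ∀ x ∈ ball p r, (x ∈ S ↔ ρ x ≤ 0)
  slope : ∀ x ∈ ball p r, ∀ v ∈ ball e δ, c ≤ fderiv ℝ ρ x v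

theorem fderiv_eq_inner_gradient (ρ : Plane → ℝ) (x v : Plane) :
    fderiv ℝ ρ x v = ⟪gradient ρ x, v⟫ := by
  rw [gradient, InnerProductSpace.toDual_symm_apply]

theorem IsSmoothBody.exists_bchart {S : Set Plane} (hS : IsSmoothBody S) {p : Plane}
    (hp : p ∈ frontier S) : ∃ C : BChart S, C.p = p ∧ 0 < C.r := by
  obtain ⟨ρ, hρ, h0, hm⟩ := hS.smooth_boundary p hp
  set e := gradient ρ p
  have hpos : 0 < fderiv ℝ ρ p e := by rw [fderiv_eq_inner_gradient]; exact real_inner_self_pos.2 h0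
  have hcont : Continuous fun q : Plane × Plane => fderiv ℝ ρ q.1 q.2 :=
    ((hρ.continuous_fderiv (by simp)).comp continuous_fst).clm_apply continuous_snd
  have hev : ∀ᶠ q : Plane × Plane in 𝓝 (p, e), fderiv ℝ ρ p e / 2 < fderiv ℝ ρ q.1 q.2 :=
    hcont.continuousAt.eventually (lt_mem_nhds (half_lt_self hpos))
  rw [nhds_prod_eq] at hev
  obtain ⟨P, hP, Q, hQ, hPQ⟩ := Filter.eventually_prod_iff.1 hev
  obtain ⟨r, hr, hr'⟩ := Metric.eventually_nhds_iff_ball.1 (hP.and hm)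
  obtain ⟨δ, hδ, hδ'⟩ := Metric.eventually_nhds_iff_ball.1 hQ
  exact ⟨⟨p, e, r, δ, fderiv ℝ ρ p e / 2, ρ, hδ, half_pos hpos, h0, hρ, fun x hx => (hr' x hx).2,
    fun x hx v hv => (hPQ (hr' x hx).1 (hδ' v hv)).le⟩, rfl, hr⟩

namespace BChart

variable {S : Set Plane} (C : BChart S)

/-- The ball in which the chart is valid. -/
def nhd : Set Plane := ball C.p C.r

theorem isOpen_nhd : IsOpen C.nhd := isOpen_ball

theorem growth {x y : Plane} (hx : x ∈ C.nhd) (hy : y ∈ C.nhd) {t : ℝ} (ht : 0 < t)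
    (h : y - x ∈ ball (t • C.e) (t * C.δ)) : C.ρ x + C.c * t ≤ C.ρ y := by
  obtain ⟨z, hz, e⟩ := domain_mvt (f := C.ρ) (f' := fun x => fderiv ℝ C.ρ x) (s := C.nhd)
    (fun x _ => (C.smooth.differentiable (by simp) x).hasFDerivAt.hasFDerivWithinAt)
    (convex_ball C.p C.r) hx hy
  have hz' : z ∈ C.nhd := (convex_ball C.p C.r).segment_subset hx hy hz
  have hv : t⁻¹ • (y - x) ∈ ball C.e C.δ := by
    rw [mem_ball_iff_norm] at h ⊢
    have : t⁻¹ • (y - x) - C.e = t⁻¹ • (y - x - t • C.e) := by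
      rw [smul_sub t⁻¹ (y - x), smul_smul, inv_mul_cancel₀ ht.ne', one_smul]
    rw [this, norm_smul, norm_inv, Real.norm_of_nonneg ht.le, inv_mul_lt_iff₀ ht]
    exact h
  have h1 := C.slope z hz' _ hv
  rw [map_smul, smul_eq_mul, le_inv_mul_iff₀ ht] at h1
  linarith

theorem mem_interior {x : Plane} (hx : x ∈ C.nhd) (h : C.ρ x < 0) : x ∈ interior S := by
  rw [mem_interior_iff_mem_nhds]
  filter_upwards [C.isOpen_nhd.mem_nhds hx,
    C.smooth.continuous.continuousAt.eventually (gt_mem_nhds h)] with y h1 h2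
  exact (C.mem_iff y h1).2 h2.le

theorem nonneg_of_mem_closure {x : Plane} (hx : x ∈ C.nhd) (h : x ∈ closure Sᶜ) : 0 ≤ C.ρ x := by
  by_contra h'
  rw [closure_compl] at h
  exact h (C.mem_interior hx (not_le.1 h'))

theorem eq_zero_of_mem_frontier (hS : IsClosed S) {x : Plane} (hx : x ∈ C.nhd)
    (h : x ∈ frontier S) : C.ρ x = 0 := by
  refine le_antisymm ((C.mem_iff x hx).1 (hS.frontier_subset h)) (C.nonneg_of_mem_closure hx ?_)
  rw [closure_compl]; exact h.2

/-- Moving outwards from the closed fluid domain one stays in the fluid domain. -/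
theorem cone_out {x y : Plane} (hx : x ∈ C.nhd) (hy : y ∈ C.nhd) {t : ℝ} (ht : 0 < t)
    (h : y - x ∈ ball (t • C.e) (t * C.δ)) (hxS : x ∈ closure Sᶜ) : y ∈ Sᶜ := by
  intro hyS
  have h1 := C.growth hx hy ht h
  have h2 := C.nonneg_of_mem_closure hx hxS
  have h3 := (C.mem_iff y hy).1 hyS
  have := mul_pos C.c_pos ht
  linarith

/-- Moving inwards from the body one stays in the interior of the body. -/
theorem cone_in {x y : Plane} (hx : x ∈ C.nhd) (hy : y ∈ C.nhd) {t : ℝ} (ht : 0 < t)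
    (h : y - x ∈ ball (t • C.e) (t * C.δ)) (hyS : y ∈ S) : x ∈ interior S := by
  refine C.mem_interior hx ?_
  have h1 := C.growth hx hy ht h
  have h3 := (C.mem_iff y hy).1 hyS
  have := mul_pos C.c_pos ht
  linarith

theorem smul_e_mem {t : ℝ} (ht : 0 < t) : t • C.e ∈ ball (t • C.e) (t * C.δ) :=
  mem_ball_self (mul_pos ht C.δ_pos)

theorem smul_mem {t : ℝ} (ht : 0 < t) {v : Plane} (hv : v ∈ ball C.e C.δ) :
    t • v ∈ ball (t • C.e) (t * C.δ) := by
  rw [mem_ball_iff_norm] at hv ⊢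
  rw [← smul_sub, norm_smul, Real.norm_of_nonneg ht.le]
  exact mul_lt_mul_of_pos_left hv ht

theorem not_frontier_of_frontier (hS : IsClosed S) {x y : Plane} (hx : x ∈ C.nhd)
    (hy : y ∈ C.nhd) {t : ℝ} (ht : 0 < t) (h : y - x ∈ ball (t • C.e) (t * C.δ))
    (hxS : x ∈ frontier S) : y ∉ frontier S := fun hyS =>
  C.cone_out hx hy ht h (by rw [closure_compl]; exact hxS.2) (hS.frontier_subset hyS)

theorem volume_frontier_inter (hS : IsClosed S) : volume (frontier S ∩ C.nhd) = 0 := by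
  have hdet : C.e 0 * (perp C.e) 1 - C.e 1 * (perp C.e) 0 ≠ 0 := by
    have h : C.e 0 ^ 2 + C.e 1 ^ 2 = ‖C.e‖ ^ 2 := by rw [EuclideanSpace.norm_sq_eq]; simp
    have h2 : 0 < ‖C.e‖ ^ 2 := by have := norm_pos_iff.2 C.e_ne; positivity
    simp [perp]
    nlinarith
  have hdet' : (perp C.e) 0 * C.e 1 - (perp C.e) 1 * C.e 0 ≠ 0 := fun h => hdet (by linarith)
  obtain ⟨k, -, hk⟩ := exists_lintegral_coord hdet'
  have hm : MeasurableSet (frontier S ∩ C.nhd) :=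
    isClosed_frontier.measurableSet.inter C.isOpen_nhd.measurableSet
  rw [← lintegral_indicator_one hm, hk _ (measurable_one.indicator hm)]
  have : ∀ a : ℝ, ∫⁻ b : ℝ, (frontier S ∩ C.nhd).indicator (1 : Plane → ℝ≥0∞)
      (a • perp C.e + b • C.e) = 0 := by
    intro a
    have e1 : ∀ b : ℝ, (frontier S ∩ C.nhd).indicator (1 : Plane → ℝ≥0∞) (a • perp C.e + b • C.e) =
        ((fun b : ℝ => a • perp C.e + b • C.e) ⁻¹' (frontier S ∩ C.nhd)).indicator 1 b :=
      fun b => rfl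
    have hm' : MeasurableSet ((fun b : ℝ => a • perp C.e + b • C.e) ⁻¹' (frontier S ∩ C.nhd)) :=
      (by fun_prop : Continuous fun b : ℝ => a • perp C.e + b • C.e).measurable hm
    simp only [e1]
    rw [lintegral_indicator_one hm']
    refine Set.Subsingleton.measure_zero ?_ _
    have key : ∀ b b' : ℝ, b < b' → a • perp C.e + b • C.e ∈ frontier S ∩ C.nhd →
        a • perp C.e + b' • C.e ∈ frontier S ∩ C.nhd → False := fun b b' hlt h1 h2 => by
      refine C.not_frontier_of_frontier hS h1.2 h2.2 (sub_pos.2 hlt) ?_ h1.1 h2.1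
      have : a • perp C.e + b' • C.e - (a • perp C.e + b • C.e) = (b' - b) • C.e := by
        rw [sub_smul]; abel
      rw [this]
      exact C.smul_e_mem (sub_pos.2 hlt)
    intro b hb b' hb'
    rcases lt_trichotomy b b' with hlt | heq | hgt
    · exact (key b b' hlt hb hb').elim
    · exact heq
    · exact (key b' b hgt hb' hb).elim
  simp [this]

end BChart

namespace IsSmoothBody

variable {S : Set Plane} (hS : IsSmoothBody S)
include hS

theorem isCompact : IsCompact S := Metric.isCompact_of_isClosed_isBounded hS.isClosed hS.isBounded

theorem isCompact_frontier : IsCompact (frontier S) :=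
  hS.isCompact.of_isClosed_subset isClosed_frontier hS.isClosed.frontier_subset

theorem isOpen_compl : IsOpen Sᶜ := hS.isClosed.isOpen_compl

theorem volume_frontier : volume (frontier S) = 0 := by
  refine hS.isCompact_frontier.induction_on (p := fun T => volume (T ∩ frontier S) = 0) (by simp)
    (fun s t hst ht => measure_mono_null (by gcongr) ht)
    (fun s t h1 h2 => by rw [union_inter_distrib_right]; exact measure_union_null h1 h2)
    (fun p hp => ?_) |> fun h => by simpa using h
  obtain ⟨C, hC, hr⟩ := hS.exists_bchart hp
  refine ⟨C.nhd, mem_nhdsWithin_of_mem_nhds (C.isOpen_nhd.mem_nhds ?_), ?_⟩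
  · rw [← hC]; exact mem_ball_self hr
  · rw [inter_comm]; exact C.volume_frontier_inter hS.isClosed

/-- Near a boundary point all interior points can be joined within the interior. -/
theorem exists_join {q : Plane} (hq : q ∈ frontier S) :
    ∃ y ∈ interior S, ∃ ε > 0, ∀ x ∈ ball q ε, x ∈ S → x ∉ frontier S →
      segment ℝ x y ⊆ interior S := by
  obtain ⟨C, rfl, hr⟩ := hS.exists_bchart hq
  obtain ⟨t, ht, htb⟩ : ∃ t : ℝ, 0 < t ∧ C.p - t • C.e ∈ C.nhd := by
    have hc : Continuous fun t : ℝ => C.p - t • C.e := by fun_prop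
    have h0 : (fun t : ℝ => C.p - t • C.e) 0 ∈ C.nhd := by
      have : C.p ∈ C.nhd := mem_ball_self hr
      simpa only [zero_smul, sub_zero] using this
    have := (hc.continuousAt.mono_left nhdsWithin_le_nhds : Tendsto _ (𝓝[>] (0:ℝ)) _).eventually
      (C.isOpen_nhd.mem_nhds h0)
    obtain ⟨t, h1, h2⟩ := (this.and self_mem_nhdsWithin).exists
    exact ⟨t, h2, h1⟩
  have hp : C.p ∈ C.nhd := mem_ball_self hr
  refine ⟨C.p - t • C.e, C.cone_in htb hp ht (by simpa using mul_pos ht C.δ_pos)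
    (hS.isClosed.frontier_subset hq), min C.r (t * C.δ), lt_min hr (mul_pos ht C.δ_pos), ?_⟩
  intro x hx hxS hxf
  have hxb : x ∈ C.nhd := ball_subset_ball (min_le_left _ _) hx
  have hxi : x ∈ interior S := by by_contra h; exact hxf ⟨subset_closure hxS, h⟩
  rw [segment_eq_image']
  rintro _ ⟨s, hs, rfl⟩
  rcases hs.1.eq_or_lt with h0 | h0
  · simpa [← h0] using hxi
  refine C.cone_in ?_ hxb (mul_pos h0 ht) ?_ hxS
  · exact (convex_ball C.p C.r).segment_subset hxb htb (by
      rw [segment_eq_image']; exact ⟨s, hs, rfl⟩)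
  · have hx2 : ‖x - C.p‖ < t * C.δ := by
      rw [← mem_ball_iff_norm]; exact ball_subset_ball (min_le_right _ _) hx
    rw [mem_ball_iff_norm]
    have : x - (x + s • (C.p - t • C.e - x)) - (s * t) • C.e = s • (x - C.p) := by
      rw [mul_smul]; module
    rw [this, norm_smul, Real.norm_of_nonneg h0.le, mul_assoc]
    exact mul_lt_mul_of_pos_left hx2 h0

theorem closure_interior : S ⊆ closure (interior S) := by
  intro x hx
  by_cases hxi : x ∈ interior S
  · exact subset_closure hxi
  have hxf : x ∈ frontier S := ⟨subset_closure hx, hxi⟩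
  obtain ⟨C, rfl, hr⟩ := hS.exists_bchart hxf
  have hp : C.p ∈ C.nhd := mem_ball_self hr
  have hc : Continuous fun t : ℝ => C.p - t • C.e := by fun_prop
  have h0 : Tendsto (fun t : ℝ => C.p - t • C.e) (𝓝[>] 0) (𝓝 C.p) := by
    have := (hc.tendsto 0).mono_left (nhdsWithin_le_nhds : 𝓝[>] (0:ℝ) ≤ 𝓝 0)
    simpa using this
  refine mem_closure_of_tendsto h0 ?_
  filter_upwards [h0.eventually (C.isOpen_nhd.mem_nhds hp), self_mem_nhdsWithin] with t h1 h2
  exact C.cone_in h1 hp h2 (by simpa using mul_pos h2 C.δ_pos) hx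

theorem isPreconnected_interior : IsPreconnected (interior S) := by
  intro u v hu hv huv hne1 hne2
  have hpc := isPreconnected_closed_iff.1 hS.isConnected.isPreconnected
    (closure (interior S ∩ u)) (closure (interior S ∩ v)) isClosed_closure isClosed_closure
    (by
      rw [← closure_union, ← inter_union_distrib_left, inter_eq_left.2 huv]
      exact hS.closure_interior)
    (hne1.mono fun x hx => ⟨interior_subset hx.1, subset_closure hx⟩)
    (hne2.mono fun x hx => ⟨interior_subset hx.1, subset_closure hx⟩)
  obtain ⟨q, hqS, hq1, hq2⟩ := hpc
  by_cases hqi : q ∈ interior S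
  · rcases huv hqi with h | h
    · obtain ⟨z, hz1, hz2⟩ := mem_closure_iff.1 hq2 _ (isOpen_interior.inter hu) ⟨hqi, h⟩
      exact ⟨z, hz1.1, hz1.2, hz2.2⟩
    · obtain ⟨z, hz1, hz2⟩ := mem_closure_iff.1 hq1 _ (isOpen_interior.inter hv) ⟨hqi, h⟩
      exact ⟨z, hz1.1, hz2.2, hz1.2⟩
  · obtain ⟨y, hy, ε, hε, h⟩ := hS.exists_join ⟨subset_closure hqS, hqi⟩
    obtain ⟨x1, hx1, hx1'⟩ := mem_closure_iff.1 hq1 _ isOpen_ball (mem_ball_self hε)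
    obtain ⟨x2, hx2, hx2'⟩ := mem_closure_iff.1 hq2 _ isOpen_ball (mem_ball_self hε)
    have s1 := h x1 hx1 (interior_subset hx1'.1) (fun hh => hh.2 hx1'.1)
    have s2 := h x2 hx2 (interior_subset hx2'.1) (fun hh => hh.2 hx2'.1)
    have hc : IsPreconnected (segment ℝ x1 y ∪ segment ℝ x2 y) :=
      (convex_segment x1 y).isPreconnected.union y (right_mem_segment ℝ x1 y)
        (right_mem_segment ℝ x2 y) (convex_segment x2 y).isPreconnected
    obtain ⟨z, hz, hz'⟩ := hc u v hu hv ((union_subset s1 s2).trans huv)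
      ⟨x1, Or.inl (left_mem_segment ℝ x1 y), hx1'.2⟩ ⟨x2, Or.inr (left_mem_segment ℝ x2 y), hx2'.2⟩
    exact ⟨z, union_subset s1 s2 hz, hz'⟩

theorem interior_nonempty : (interior S).Nonempty := by
  obtain ⟨x, hx⟩ := hS.isConnected.nonempty
  by_contra h
  rw [not_nonempty_iff_eq_empty] at h
  have := hS.closure_interior hx
  simp [h] at this

/-- A finite smooth partition of unity near the boundary, subordinate to charts. -/
theorem exists_partition : ∃ (ι : Type) (_ : Fintype ι) (C : ι → BChart S) (η : ι → Plane → ℝ),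
    (∀ k, IsTest (C k).nhd (η k)) ∧ ∀ x ∈ frontier S, ∀ᶠ y in 𝓝 x, ∑ k, η k y = 1 := by
  choose C hC hr using fun p : frontier S => hS.exists_bchart p.2
  have hball : ∀ p : frontier S, (C p).nhd ∈ 𝓝 (p : Plane) := fun p => by
    have h := (C p).isOpen_nhd.mem_nhds (mem_ball_self (hr p))
    rwa [hC p] at h
  obtain ⟨t, htc⟩ := hS.isCompact_frontier.elim_nhds_subcover' (fun p hp => (C ⟨p, hp⟩).nhd)
    (fun p hp => hball ⟨p, hp⟩)
  let U : Option t → Set Plane := fun o => o.elim (frontier S)ᶜ fun k => (C k).nhd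
  have hU : ∀ o, IsOpen (U o) := by
    rintro (_ | k)
    · exact isClosed_frontier.isOpen_compl
    · exact (C k).isOpen_nhd
  have hcov : (univ : Set Plane) ⊆ ⋃ o, U o := by
    intro x _
    by_cases hx : x ∈ frontier S
    · obtain ⟨k, hk, hxk⟩ := mem_iUnion₂.1 (htc hx)
      exact mem_iUnion.2 ⟨some ⟨k, hk⟩, hxk⟩
    · exact mem_iUnion.2 ⟨none, hx⟩
  obtain ⟨f, hf⟩ := SmoothPartitionOfUnity.exists_isSubordinate (modelWithCornersSelf ℝ Plane)
    isClosed_univ U hU hcov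
  refine ⟨t, inferInstance, fun k => C k, fun k => f (some k), fun k => ⟨?_, ?_, hf (some k)⟩, ?_⟩
  · exact (f (some k)).contMDiff.contDiff
  · exact ((isBounded_ball (x := (C k).p) (r := (C k).r)).subset (show tsupport (f (some k)) ⊆ (C k).nhd from hf (some k))).isCompact_closure.of_isClosed_subset
      (isClosed_tsupport _) subset_closure
  · intro x hx
    have h0 : x ∉ tsupport (f none) := fun h => hf none h hx
    filter_upwards [(isClosed_tsupport (f none)).isOpen_compl.mem_nhds h0] with y hy
    have h1 := f.sum_eq_one (mem_univ y)
    rw [finsum_eq_sum_of_fintype, Fintype.sum_option, image_eq_zero_of_notMem_tsupport hy,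
      zero_add] at h1
    exact h1

end IsSmoothBody

/-! ### Perpendicular vectors -/

@[simp] theorem perp_apply_zero (x : Plane) : perp x 0 = -x 1 := rfl
@[simp] theorem perp_apply_one (x : Plane) : perp x 1 = x 0 := rfl

theorem plane_norm_sq (x : Plane) : ‖x‖ ^ 2 = x 0 ^ 2 + x 1 ^ 2 := by
  rw [EuclideanSpace.norm_sq_eq]; simp

theorem plane_inner (x y : Plane) : ⟪x, y⟫ = x 0 * y 0 + x 1 * y 1 := by
  rw [PiLp.inner_apply]; simp [mul_comm]

theorem perp_norm (x : Plane) : ‖perp x‖ = ‖x‖ := by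
  have h : ‖perp x‖ ^ 2 = ‖x‖ ^ 2 := by rw [plane_norm_sq, plane_norm_sq]; simp; ring
  exact (pow_left_inj₀ (norm_nonneg _) (norm_nonneg _) (by norm_num)).1 h

theorem inner_perp_self (x : Plane) : ⟪perp x, x⟫ = 0 := by simp [plane_inner]; ring

theorem perp_decomp {e : Plane} (he : e ≠ 0) (x : Plane) :
    x = (⟪perp e, x⟫ / ‖e‖ ^ 2) • perp e + (⟪e, x⟫ / ‖e‖ ^ 2) • e := by
  have h : e 0 ^ 2 + e 1 ^ 2 ≠ 0 := by rw [← plane_norm_sq]; have := norm_pos_iff.2 he; positivity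
  rw [plane_norm_sq, plane_inner, plane_inner]
  ext i
  fin_cases i <;> simp <;> field_simp <;> ring

theorem perp_det {e : Plane} (he : e ≠ 0) : perp e 0 * e 1 - perp e 1 * e 0 ≠ 0 := by
  have h : e 0 ^ 2 + e 1 ^ 2 ≠ 0 := by rw [← plane_norm_sq]; have := norm_pos_iff.2 he; positivity
  simp only [perp_apply_zero, perp_apply_one]
  intro h'
  exact h (by linarith)

theorem abs_coord_le (x : Plane) (i : Fin 2) : |x i| ≤ ‖x‖ := by simpa using PiLp.norm_apply_le x i

/-! ### Bounds along lines -/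

/-- The sum of the absolute values of the partial derivatives. -/
noncomputable def pdSum (h : Plane → ℝ) (x : Plane) : ℝ := |pd 0 h x| + |pd 1 h x|

theorem continuous_pdSum {h : Plane → ℝ} (hh : ContDiff ℝ 1 h) : Continuous (pdSum h) :=
  (continuous_pd hh 0).abs.add (continuous_pd hh 1).abs

theorem abs_fderiv_le (h : Plane → ℝ) (x v : Plane) : |fderiv ℝ h x v| ≤ ‖v‖ * pdSum h x := by
  rw [ContDiff.pd_sum_smul, pdSum, mul_add]
  refine (abs_add_le _ _).trans ?_
  rw [abs_mul, abs_mul]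
  gcongr <;> exact abs_coord_le _ _

theorem sq_le_lintegral_line {h : Plane → ℝ} (hh : ContDiff ℝ 1 h) (hc : HasCompactSupport h)
    {D : Set Plane} {x v : Plane} (hv : v ≠ 0)
    (hD : ∀ s : ℝ, 0 < s → x + s • v ∈ D ∨ h (x + s • v) = 0) :
    ENNReal.ofReal (h x ^ 2) ≤ ∫⁻ s : ℝ,
      D.indicator (fun y => ENNReal.ofReal (2 * ‖v‖ * (|h y| * pdSum h y))) (x + s • v) := by
  set q : ℝ → ℝ := fun s => h (x + s • v) ^ 2
  have hemb : IsClosedEmbedding fun s : ℝ => x + s • v :=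
    (Homeomorph.addLeft x).isClosedEmbedding.comp (isClosedEmbedding_smul_left hv)
  have hl : ContDiff ℝ 1 fun s : ℝ => x + s • v := by fun_prop
  have hq : ContDiff ℝ 1 q := (hh.comp hl).pow 2
  have hqc : HasCompactSupport q :=
    (hc.comp_isClosedEmbedding hemb).comp_left (g := fun y : ℝ => y ^ 2) (by simp)
  have hd : ∀ s, deriv q s = 2 * h (x + s • v) * fderiv ℝ h (x + s • v) v := by
    intro s
    have h1 : HasDerivAt (fun s : ℝ => x + s • v) v s := by
      simpa using ((hasDerivAt_id s).smul_const v).const_add x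
    have h2 := ((hh.differentiable (by simp) (x + s • v)).hasFDerivAt.comp_hasDerivAt s h1).pow 2
    refine h2.deriv.trans ?_
    simp
  have e := hqc.integral_Ioi_deriv_eq hq 0
  have e0 : q 0 = h x ^ 2 := by simp [q]
  calc ENNReal.ofReal (h x ^ 2) = ‖∫ s in Ioi 0, deriv q s‖ₑ := by
        rw [e, enorm_neg, e0, Real.enorm_of_nonneg (sq_nonneg _)]
    _ ≤ ∫⁻ s in Ioi 0, ‖deriv q s‖ₑ := enorm_integral_le_lintegral_enorm _
    _ ≤ ∫⁻ s in Ioi (0 : ℝ),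
        D.indicator (fun y => ENNReal.ofReal (2 * ‖v‖ * (|h y| * pdSum h y))) (x + s • v) := by
        refine setLIntegral_mono' measurableSet_Ioi fun s hs => ?_
        rw [hd]
        rcases hD s hs with h1 | h1
        · rw [indicator_of_mem h1, Real.enorm_eq_ofReal_abs, abs_mul, abs_mul, abs_two]
          refine ENNReal.ofReal_le_ofReal ?_
          calc _ ≤ 2 * |h (x + s • v)| * (‖v‖ * pdSum h (x + s • v)) := by
                gcongr; exact abs_fderiv_le _ _ _
            _ = _ := by ring
        · simp [h1]
    _ ≤ _ := setLIntegral_le_lintegral _ _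

theorem measurable_energy {h : Plane → ℝ} (hh : ContDiff ℝ 1 h) (k : ℝ) :
    Measurable fun y => ENNReal.ofReal (k * (|h y| * pdSum h y)) :=
  ((continuous_const.mul (hh.continuous.abs.mul (continuous_pdSum hh))).measurable).ennreal_ofReal

theorem lintegral_energy {h : Plane → ℝ} {k : ℝ} (hk : 0 ≤ k) (D : Set Plane)
    (hh : ContDiff ℝ 1 h) :
    ∫⁻ y in D, ENNReal.ofReal (k * (|h y| * pdSum h y)) =
      ENNReal.ofReal k * ∫⁻ y in D, ENNReal.ofReal (|h y| * pdSum h y) := by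
  simp only [ENNReal.ofReal_mul hk]
  exact lintegral_const_mul _ (by simpa using measurable_energy hh 1)

theorem exists_line_energy {v w : Plane} (hdet : v 0 * w 1 - v 1 * w 0 ≠ 0) :
    ∃ k : ℝ≥0, ∀ {D : Set Plane} {h : Plane → ℝ}, MeasurableSet D → ContDiff ℝ 1 h →
      HasCompactSupport h → ∃ A : ℝ → ℝ≥0∞, Measurable A ∧
        ∫⁻ a, A a = k * ∫⁻ x in D, ENNReal.ofReal (|h x| * pdSum h x) ∧
        ∀ a b : ℝ, (∀ s : ℝ, 0 < s → a • v + b • w + s • w ∈ D ∨ h (a • v + b • w + s • w) = 0) →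
          ENNReal.ofReal (h (a • v + b • w) ^ 2) ≤ A a := by
  obtain ⟨c, hc0, hc⟩ := exists_lintegral_coord hdet
  have hw : w ≠ 0 := by rintro rfl; simp at hdet
  refine ⟨c⁻¹ * Real.toNNReal (2 * ‖w‖), fun {D h} hD hh hcs => ?_⟩
  set g : Plane → ℝ≥0∞ := D.indicator fun y => ENNReal.ofReal (2 * ‖w‖ * (|h y| * pdSum h y))
  have mg : Measurable g := (measurable_energy hh _).indicator hD
  have mL : Measurable fun q : ℝ × ℝ => q.1 • v + q.2 • w :=
    (by fun_prop : Continuous fun q : ℝ × ℝ => q.1 • v + q.2 • w).measurable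
  refine ⟨fun a => ∫⁻ b : ℝ, g (a • v + b • w), (mg.comp mL).lintegral_prod_right', ?_, ?_⟩
  · have e := hc g mg
    rw [lintegral_indicator hD, lintegral_energy (by positivity) D hh] at e
    push_cast
    rw [mul_assoc, ENNReal.coe_inv hc0, ← ENNReal.ofReal, e, ← mul_assoc,
      ENNReal.inv_mul_cancel (by simpa) (by simp), one_mul]
  · intro a b hab
    refine (sq_le_lintegral_line hh hcs hw hab).trans (le_of_eq ?_)
    show _ = ∫⁻ b : ℝ, g (a • v + b • w)
    rw [← lintegral_add_left_eq_self (fun b : ℝ => g (a • v + b • w)) b]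
    refine lintegral_congr fun s => ?_
    simp only [g]; congr 1; rw [add_smul]; abel

/-- A one-sided form of Ladyzhenskaya's inequality. -/
theorem exists_ladyzhenskaya {v w : Plane} (hdet : v 0 * w 1 - v 1 * w 0 ≠ 0) :
    ∃ A : ℝ≥0, ∀ (D : Set Plane) (h : Plane → ℝ), MeasurableSet D → ContDiff ℝ 1 h →
      HasCompactSupport h →
      (∀ x ∈ D, ∀ s : ℝ, 0 < s → (x + s • v ∈ D ∨ h (x + s • v) = 0) ∧
        (x + s • w ∈ D ∨ h (x + s • w) = 0)) →
      ∫⁻ x in D, ENNReal.ofReal (h x ^ 2) ^ 2 ≤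
        A * (∫⁻ x in D, ENNReal.ofReal (|h x| * pdSum h x)) ^ 2 := by
  obtain ⟨c, hc0, hc⟩ := exists_lintegral_coord hdet
  obtain ⟨k, hk⟩ := exists_line_energy hdet
  obtain ⟨l, hl⟩ := exists_line_energy (v := w) (w := v) (fun h => hdet (by linarith))
  refine ⟨c * (k * l), fun D h hD hh hcs hcone => ?_⟩
  obtain ⟨A, mA, iA, bA⟩ := hk hD hh hcs
  obtain ⟨B, mB, iB, bB⟩ := hl hD hh hcs
  have m4 : Measurable fun x => ENNReal.ofReal (h x ^ 2) ^ 2 :=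
    ((hh.continuous.pow 2).measurable.ennreal_ofReal).pow_const 2
  calc ∫⁻ x in D, ENNReal.ofReal (h x ^ 2) ^ 2
      = c * ∫⁻ a : ℝ, ∫⁻ b : ℝ, D.indicator (fun x => ENNReal.ofReal (h x ^ 2) ^ 2) (a • v + b • w) := by
        rw [← lintegral_indicator hD, hc _ (m4.indicator hD)]
    _ ≤ c * ∫⁻ a : ℝ, ∫⁻ b : ℝ, A a * B b := by
        gcongr with a b
        by_cases hab : a • v + b • w ∈ D
        · rw [indicator_of_mem hab, pow_two]
          refine mul_le_mul' (bA a b fun s hs => (hcone _ hab s hs).2) ?_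
          rw [add_comm] at hab ⊢
          exact bB b a fun s hs => (hcone _ hab s hs).1
        · simp [hab]
    _ = c * ((∫⁻ a, A a) * ∫⁻ b, B b) := by
        simp only [lintegral_const_mul _ mB]
        rw [lintegral_mul_const _ mA]
    _ = _ := by
        rw [iA, iB]
        push_cast
        ring

/-- The `H¹` norm on `O` of a function and its partial derivatives. -/
noncomputable def h1n (O : Set Plane) (f : Plane → ℝ) (G : Fin 2 → Plane → ℝ) : ℝ≥0∞ :=
  eLpNorm f 2 (volume.restrict O) + ∑ j, eLpNorm (G j) 2 (volume.restrict O)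

theorem lintegral_energy_le {h : Plane → ℝ} (hh : ContDiff ℝ 1 h) (D : Set Plane) :
    ∫⁻ x in D, ENNReal.ofReal (|h x| * pdSum h x) ≤ h1n D h (fun j => pd j h) ^ 2 := by
  have m := hh.continuous.measurable.aemeasurable (μ := volume.restrict D)
  have mp := fun j => (continuous_pd hh j).measurable.aemeasurable (μ := volume.restrict D)
  have e2 : ∀ f : Plane → ℝ, (∫⁻ x in D, ‖f x‖ₑ ^ (2 : ℝ)) ^ (1 / (2 : ℝ)) =
      eLpNorm f 2 (volume.restrict D) := fun f => by
    rw [eLpNorm_eq_lintegral_rpow_enorm_toReal (by norm_num) (by norm_num)]; simp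
  have hold : ∀ j, ∫⁻ x in D, ‖h x‖ₑ * ‖pd j h x‖ₑ ≤
      eLpNorm h 2 (volume.restrict D) * eLpNorm (pd j h) 2 (volume.restrict D) := fun j => by
    rw [← e2, ← e2]
    exact ENNReal.lintegral_mul_le_Lp_mul_Lq _ Real.HolderConjugate.two_two m.enorm (mp j).enorm
  have e : ∀ x, ENNReal.ofReal (|h x| * pdSum h x) =
      ‖h x‖ₑ * ‖pd 0 h x‖ₑ + ‖h x‖ₑ * ‖pd 1 h x‖ₑ := fun x => by
    rw [pdSum, mul_add, ENNReal.ofReal_add (by positivity) (by positivity),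
      ENNReal.ofReal_mul (abs_nonneg _), ENNReal.ofReal_mul (abs_nonneg _)]
    simp only [Real.enorm_eq_ofReal_abs]
  simp only [e]
  have ma : AEMeasurable (fun x => ‖h x‖ₑ * ‖pd 0 h x‖ₑ) (volume.restrict D) :=
    m.enorm.mul (mp 0).enorm
  rw [lintegral_add_left' ma, h1n, Fin.sum_univ_two]
  calc _ ≤ eLpNorm h 2 (volume.restrict D) * eLpNorm (pd 0 h) 2 (volume.restrict D) +
        eLpNorm h 2 (volume.restrict D) * eLpNorm (pd 1 h) 2 (volume.restrict D) :=
        add_le_add (hold 0) (hold 1)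
    _ = eLpNorm h 2 (volume.restrict D) *
        (eLpNorm (pd 0 h) 2 (volume.restrict D) + eLpNorm (pd 1 h) 2 (volume.restrict D)) := by ring
    _ ≤ _ := by
        rw [pow_two]
        exact mul_le_mul' le_self_add le_add_self

/-- The `L⁴` norm is bounded by the `H¹` norm. -/
theorem exists_L4_local {v w : Plane} (hdet : v 0 * w 1 - v 1 * w 0 ≠ 0) :
    ∃ A : ℝ≥0, ∀ (D : Set Plane) (h : Plane → ℝ), MeasurableSet D → ContDiff ℝ 1 h →
      HasCompactSupport h →
      (∀ x ∈ D, ∀ s : ℝ, 0 < s → (x + s • v ∈ D ∨ h (x + s • v) = 0) ∧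
        (x + s • w ∈ D ∨ h (x + s • w) = 0)) →
      eLpNorm h 4 (volume.restrict D) ≤ A * h1n D h (fun j => pd j h) := by
  obtain ⟨A, hA⟩ := exists_ladyzhenskaya hdet
  refine ⟨A ^ (1 / (4 : ℝ)), fun D h hD hh hcs hcone => ?_⟩
  have h1 := hA D h hD hh hcs hcone
  have h2 := lintegral_energy_le hh D
  rw [eLpNorm_eq_lintegral_rpow_enorm_toReal (by norm_num) (by norm_num)]
  have e : ∀ x, ‖h x‖ₑ ^ (4 : ℝ≥0∞).toReal = ENNReal.ofReal (h x ^ 2) ^ 2 := fun x => by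
    rw [← sq_abs (h x), ENNReal.ofReal_pow (abs_nonneg _), Real.enorm_eq_ofReal_abs, ← pow_mul]
    rw [ENNReal.toReal_ofNat, ← ENNReal.rpow_natCast]; norm_num
  simp only [e]
  calc _ ≤ ((A : ℝ≥0∞) * h1n D h (fun j => pd j h) ^ (4 : ℝ)) ^ (1 / (4 : ℝ≥0∞).toReal) := by
        gcongr
        refine h1.trans ?_
        have : h1n D h (fun j => pd j h) ^ (4 : ℝ) = (h1n D h (fun j => pd j h) ^ 2) ^ 2 := by
          rw [← pow_mul, ← ENNReal.rpow_natCast]; norm_num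
        rw [this]
        gcongr
    _ = _ := by
        rw [ENNReal.mul_rpow_of_nonneg _ _ (by positivity), ← ENNReal.rpow_mul]
        norm_num
        rw [ENNReal.coe_rpow_of_nonneg _ (by norm_num)]

/-! ### The trace inequality -/

namespace BChart

variable {S : Set Plane} (C : BChart S)

/-- The coordinate along the boundary. -/
noncomputable def tang (x : Plane) : ℝ := ⟪perp C.e, x⟫ / ‖C.e‖ ^ 2

theorem continuous_tang : Continuous C.tang := by unfold tang; fun_prop

theorem dist_le_tang (hS : IsClosed S) {x y : Plane} (hx : x ∈ frontier S ∩ C.nhd)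
    (hy : y ∈ frontier S ∩ C.nhd) :
    ‖x - y‖ ≤ (‖C.e‖ * (1 + ‖C.e‖ / C.δ)) * |C.tang x - C.tang y| := by
  have he : 0 < ‖C.e‖ := norm_pos_iff.2 C.e_ne
  have key : ∀ x ∈ frontier S ∩ C.nhd, ∀ y ∈ frontier S ∩ C.nhd, 0 < ⟪C.e, x - y⟫ / ‖C.e‖ ^ 2 →
      (⟪C.e, x - y⟫ / ‖C.e‖ ^ 2) * C.δ ≤ |C.tang (x - y)| * ‖C.e‖ := by
    intro x hx y hy hpos
    by_contra hlt
    push Not at hlt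
    refine C.not_frontier_of_frontier hS hy.2 hx.2 hpos ?_ hy.1 hx.1
    rw [mem_ball_iff_norm]
    have h1 : x - y - (⟪C.e, x - y⟫ / ‖C.e‖ ^ 2) • C.e = C.tang (x - y) • perp C.e := by
      nth_rw 1 [perp_decomp C.e_ne (x - y)]
      rw [add_sub_cancel_right]; rfl
    rw [h1, norm_smul, perp_norm]
    exact hlt
  have hsub : C.tang x - C.tang y = C.tang (x - y) := by simp only [tang, inner_sub_right]; ring
  have hb : |⟪C.e, x - y⟫ / ‖C.e‖ ^ 2| * C.δ ≤ |C.tang (x - y)| * ‖C.e‖ := by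
    rcases lt_trichotomy (⟪C.e, x - y⟫ / ‖C.e‖ ^ 2) 0 with h | h | h
    · have e1 : ⟪C.e, y - x⟫ = -⟪C.e, x - y⟫ := by rw [← inner_neg_right, neg_sub]
      have e2 : C.tang (y - x) = -C.tang (x - y) := by
        rw [← hsub]; simp only [tang, inner_sub_right]; ring
      have h' := key y hy x hx (by rw [e1, neg_div]; linarith)
      rw [e1, e2, abs_neg, neg_div] at h'
      rwa [abs_of_neg h]
    · rw [h]; simp; positivity
    · rw [abs_of_pos h]; exact key x hx y hy h
  rw [hsub]
  calc ‖x - y‖ ≤ |C.tang (x - y)| * ‖C.e‖ + |⟪C.e, x - y⟫ / ‖C.e‖ ^ 2| * ‖C.e‖ := by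
        nth_rw 1 [perp_decomp C.e_ne (x - y)]
        refine (norm_add_le _ _).trans ?_
        rw [norm_smul, norm_smul, perp_norm]; rfl
    _ ≤ |C.tang (x - y)| * ‖C.e‖ + (|C.tang (x - y)| * ‖C.e‖ / C.δ) * ‖C.e‖ := by
        gcongr
        rwa [le_div_iff₀ C.δ_pos]
    _ = _ := by ring

theorem exists_arcLength_le (hS : IsClosed S) : ∃ K : ℝ≥0, ∀ B : Set ℝ, MeasurableSet B →
    arcLength S (C.nhd ∩ C.tang ⁻¹' B) ≤ K * volume B := by
  set k : ℝ≥0 := Real.toNNReal (‖C.e‖ * (1 + ‖C.e‖ / C.δ))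
  refine ⟨k, fun B hB => ?_⟩
  have hm : MeasurableSet (C.nhd ∩ C.tang ⁻¹' B) :=
    C.isOpen_nhd.measurableSet.inter (C.continuous_tang.measurable hB)
  rw [arcLength, Measure.restrict_apply hm]
  set T := C.nhd ∩ C.tang ⁻¹' B ∩ frontier S
  have hT : ∀ x ∈ T, ∀ y ∈ T, dist x y ≤ k * dist (C.tang x) (C.tang y) := fun x hx y hy => by
    rw [dist_eq_norm, Real.dist_eq, Real.coe_toNNReal _ (by have := C.δ_pos; positivity)]
    exact C.dist_le_tang hS ⟨hx.2, hx.1.1⟩ ⟨hy.2, hy.1.1⟩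
  have hinj : InjOn C.tang T := fun x hx y hy h => by
    have := hT x hx y hy
    rw [h, dist_self, mul_zero] at this
    exact dist_le_zero.1 this
  have himg : Function.invFunOn C.tang T '' (C.tang '' T) = T := by
    rw [hinj.invFunOn_image subset_rfl]
  have hlip : LipschitzOnWith k (Function.invFunOn C.tang T) (C.tang '' T) := by
    refine LipschitzOnWith.of_dist_le_mul ?_
    rintro _ ⟨x, hx, rfl⟩ _ ⟨y, hy, rfl⟩
    rw [hinj.leftInvOn_invFunOn hx, hinj.leftInvOn_invFunOn hy]
    exact hT x hx y hy
  have h := hlip.hausdorffMeasure_image_le (d := 1) zero_le_one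
  rw [himg, ENNReal.rpow_one, hausdorffMeasure_real] at h
  refine h.trans ?_
  gcongr
  rintro _ ⟨x, hx, rfl⟩
  exact hx.1.2

theorem exists_trace_local (hS : IsClosed S) : ∃ A : ℝ≥0, ∀ h : Plane → ℝ, ContDiff ℝ 1 h →
    HasCompactSupport h → (∀ x, x ∉ C.nhd → h x = 0) →
    eLpNorm h 2 (arcLength S) ≤ A * h1n Sᶜ h (fun j => pd j h) := by
  obtain ⟨K, hK⟩ := C.exists_arcLength_le hS
  obtain ⟨k, hk⟩ := exists_line_energy (perp_det C.e_ne)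
  refine ⟨(K * k) ^ (1 / (2 : ℝ)), fun h hh hcs h0 => ?_⟩
  obtain ⟨A, mA, iA, hA⟩ := hk hS.isOpen_compl.measurableSet hh hcs
  have bA : ∀ x ∈ frontier S ∩ C.nhd, ENNReal.ofReal (h x ^ 2) ≤ A (C.tang x) := by
    intro x hx
    have h1 := hA (C.tang x) (⟪C.e, x⟫ / ‖C.e‖ ^ 2)
    rw [tang, ← perp_decomp C.e_ne] at h1
    refine h1 fun s hs => ?_
    by_cases hb : x + s • C.e ∈ C.nhd
    · refine Or.inl (C.cone_out hx.2 hb hs ?_ ?_)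
      · rw [add_sub_cancel_left]; exact C.smul_e_mem hs
      · rw [closure_compl]; exact hx.1.2
    · exact Or.inr (h0 _ hb)
  set μ := (arcLength S).restrict C.nhd
  have hmap : μ.map C.tang ≤ (K : ℝ≥0∞) • volume := by
    refine Measure.le_iff.2 fun B hB => ?_
    rw [Measure.map_apply C.continuous_tang.measurable hB, Measure.restrict_apply
      (C.continuous_tang.measurable hB), inter_comm]
    exact hK B hB
  have main : ∫⁻ x, ENNReal.ofReal (h x ^ 2) ∂(arcLength S) ≤
      (K * k : ℝ≥0) * h1n Sᶜ h (fun j => pd j h) ^ 2 := by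
    calc ∫⁻ x, ENNReal.ofReal (h x ^ 2) ∂(arcLength S) = ∫⁻ x, ENNReal.ofReal (h x ^ 2) ∂μ := by
          rw [← lintegral_indicator C.isOpen_nhd.measurableSet]
          refine lintegral_congr fun x => ?_
          by_cases hx : x ∈ C.nhd
          · simp [hx]
          · simp [hx, h0 x hx]
      _ ≤ ∫⁻ x, A (C.tang x) ∂μ := by
          refine lintegral_mono_ae ?_
          simp only [μ, arcLength]
          rw [Measure.restrict_restrict C.isOpen_nhd.measurableSet]
          refine (ae_restrict_iff' (C.isOpen_nhd.measurableSet.inter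
            isClosed_frontier.measurableSet)).2 (ae_of_all _ fun x hx => ?_)
          exact bA x ⟨hx.2, hx.1⟩
      _ = ∫⁻ a, A a ∂(μ.map C.tang) := (lintegral_map mA C.continuous_tang.measurable).symm
      _ ≤ ∫⁻ a, A a ∂((K : ℝ≥0∞) • volume) := lintegral_mono' hmap le_rfl
      _ = K * (k * ∫⁻ y in Sᶜ, ENNReal.ofReal (|h y| * pdSum h y)) := by
          rw [lintegral_smul_measure, iA, smul_eq_mul]
      _ ≤ K * (k * h1n Sᶜ h (fun j => pd j h) ^ 2) := by gcongr; exact lintegral_energy_le hh _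
      _ = _ := by rw [ENNReal.coe_mul, mul_assoc]
  rw [eLpNorm_eq_lintegral_rpow_enorm_toReal (by norm_num) (by norm_num)]
  have e : ∀ x, ‖h x‖ₑ ^ (2 : ℝ≥0∞).toReal = ENNReal.ofReal (h x ^ 2) := fun x => by
    rw [← sq_abs (h x), ENNReal.ofReal_pow (abs_nonneg _), Real.enorm_eq_ofReal_abs]
    rw [ENNReal.toReal_ofNat, ← ENNReal.rpow_natCast]; norm_num
  simp only [e]
  rw [ENNReal.toReal_ofNat]
  calc _ ≤ ((K * k : ℝ≥0) * h1n Sᶜ h (fun j => pd j h) ^ 2) ^ (1 / (2 : ℝ)) := by gcongr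
    _ = _ := by
        rw [ENNReal.mul_rpow_of_nonneg _ _ (by positivity), ENNReal.coe_rpow_of_nonneg _ (by norm_num),
          ← ENNReal.rpow_natCast, ← ENNReal.rpow_mul]
        norm_num

end BChart

/-! ### Radial cut-off functions -/

/-- A smooth function on the line equal to `1` on `(-∞, 1]` and to `0` on `[2, ∞)`. -/
noncomputable def cutProfile (s : ℝ) : ℝ := Real.smoothTransition (2 - s)

theorem contDiff_cutProfile {n : ℕ∞} : ContDiff ℝ n cutProfile :=
  Real.smoothTransition.contDiff.comp (contDiff_const.sub contDiff_id)

theorem cutProfile_one {s : ℝ} (h : s ≤ 1) : cutProfile s = 1 :=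
  Real.smoothTransition.one_of_one_le (by linarith)

theorem cutProfile_zero {s : ℝ} (h : 2 ≤ s) : cutProfile s = 0 :=
  Real.smoothTransition.zero_of_nonpos (by linarith)

theorem abs_cutProfile_le (s : ℝ) : |cutProfile s| ≤ 1 :=
  abs_le.2 ⟨by have := Real.smoothTransition.nonneg (2 - s); unfold cutProfile; linarith,
    Real.smoothTransition.le_one _⟩

theorem deriv_cutProfile_low {s : ℝ} (h : s < 1) : deriv cutProfile s = 0 := by
  have : cutProfile =ᶠ[𝓝 s] fun _ => 1 := by
    filter_upwards [Iio_mem_nhds h] with y hy using cutProfile_one (le_of_lt hy)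
  rw [this.deriv_eq, deriv_const]

theorem deriv_cutProfile_high {s : ℝ} (h : 2 < s) : deriv cutProfile s = 0 := by
  have : cutProfile =ᶠ[𝓝 s] fun _ => 0 := by
    filter_upwards [Ioi_mem_nhds h] with y hy using cutProfile_zero (le_of_lt hy)
  rw [this.deriv_eq, deriv_const]

theorem contDiff_deriv_cutProfile {n : ℕ∞} : ContDiff ℝ n (deriv cutProfile) := by
  have h : ContDiff ℝ (n + 1) cutProfile := contDiff_cutProfile (n := n + 1)
  exact (contDiff_succ_iff_deriv.1 h).2.2

theorem exists_bound_of_support {f : ℝ → ℝ} (hf : Continuous f) {a b : ℝ}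
    (h1 : ∀ s < a, f s = 0) (h2 : ∀ s, b < s → f s = 0) : ∃ M, 0 < M ∧ ∀ s, |f s| ≤ M := by
  obtain ⟨M, hM⟩ := isCompact_Icc.exists_bound_of_continuousOn (s := Icc a b) hf.continuousOn
  refine ⟨max M 1, by positivity, fun s => ?_⟩
  by_cases hs : s ∈ Icc a b
  · exact (hM s hs).trans (le_max_left _ _)
  · have : f s = 0 := by
      rw [mem_Icc, not_and_or, not_le, not_le] at hs
      exact hs.elim (h1 s) (h2 s)
    rw [this, abs_zero]; positivity

theorem exists_deriv_cutProfile_bound : ∃ M, 0 < M ∧ ∀ s, |deriv cutProfile s| ≤ M :=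
  exists_bound_of_support (contDiff_deriv_cutProfile (n := 0)).continuous
    (fun _ => deriv_cutProfile_low) (fun _ => deriv_cutProfile_high)

theorem pd_radial {g : ℝ → ℝ} (hg : Differentiable ℝ g) (N : ℝ) (j : Fin 2) (x : Plane) :
    pd j (fun y => g (‖y‖ ^ 2 / N ^ 2)) x = deriv g (‖x‖ ^ 2 / N ^ 2) * (2 * x j / N ^ 2) := by
  have h1 : HasFDerivAt (fun y : Plane => ‖y‖ ^ 2 / N ^ 2)
      ((N ^ 2)⁻¹ • ((2 : ℝ) • innerSL ℝ x)) x := by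
    have := ((hasStrictFDerivAt_norm_sq x).hasFDerivAt).const_mul ((N ^ 2)⁻¹)
    refine (this.congr_of_eventuallyEq (Eventually.of_forall fun y => ?_)).congr_fderiv ?_
    · simp only []; ring
    · ext v; simp
  have h2 := (hg (‖x‖ ^ 2 / N ^ 2)).hasDerivAt.comp_hasFDerivAt x h1
  have h3 : (g ∘ fun y : Plane => ‖y‖ ^ 2 / N ^ 2) = fun y => g (‖y‖ ^ 2 / N ^ 2) := rfl
  rw [h3] at h2
  rw [pd, h2.fderiv]
  simp only [smul_apply, innerSL_apply_apply, plane_inner, smul_eq_mul]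
  fin_cases j <;> simp <;> left <;> ring

/-- Radial cut-off at scale `N`. -/
noncomputable def cut (N : ℝ) (x : Plane) : ℝ := cutProfile (‖x‖ ^ 2 / N ^ 2)

theorem contDiff_normSq_div (N : ℝ) : ContDiff ℝ ∞ fun x : Plane => ‖x‖ ^ 2 / N ^ 2 :=
  (contDiff_norm_sq ℝ).div_const _

theorem contDiff_cut (N : ℝ) : ContDiff ℝ ∞ (cut N) :=
  (contDiff_cutProfile (n := ⊤)).comp (contDiff_normSq_div N)

theorem cut_one {N : ℝ} (hN : 0 < N) {x : Plane} (h : ‖x‖ ≤ N) : cut N x = 1 := by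
  refine cutProfile_one ?_
  rw [div_le_one (by positivity)]
  gcongr

theorem cut_zero {N : ℝ} (hN : 0 < N) {x : Plane} (h : 2 * N ≤ ‖x‖) : cut N x = 0 := by
  refine cutProfile_zero ?_
  rw [le_div_iff₀ (by positivity)]
  nlinarith

theorem abs_cut_le (N : ℝ) (x : Plane) : |cut N x| ≤ 1 := abs_cutProfile_le _

theorem tsupport_cut_subset {N : ℝ} (hN : 0 < N) : tsupport (cut N) ⊆ closedBall 0 (2 * N) := by
  refine closure_minimal (fun x hx => ?_) isClosed_closedBall
  rw [mem_closedBall_zero_iff]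
  by_contra h
  exact hx (cut_zero hN (not_le.1 h).le)

theorem hasCompactSupport_cut {N : ℝ} (hN : 0 < N) : HasCompactSupport (cut N) :=
  (isCompact_closedBall 0 (2 * N)).of_isClosed_subset (isClosed_tsupport _) (tsupport_cut_subset hN)

theorem pd_cut (N : ℝ) (j : Fin 2) (x : Plane) :
    pd j (cut N) x = deriv cutProfile (‖x‖ ^ 2 / N ^ 2) * (2 * x j / N ^ 2) :=
  pd_radial ((contDiff_cutProfile (n := 1)).differentiable (by simp)) N j x

theorem exists_pd_cut_bound : ∃ M, 0 < M ∧ ∀ N, 0 < N → ∀ j x, |pd j (cut N) x| ≤ M / N := by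
  obtain ⟨M, hM, h⟩ := exists_deriv_cutProfile_bound
  refine ⟨4 * M, by positivity, fun N hN j x => ?_⟩
  rw [pd_cut]
  by_cases hx : ‖x‖ ≤ 2 * N
  · rw [abs_mul, abs_div, abs_mul, abs_two, abs_of_pos (by positivity : 0 < N ^ 2)]
    calc _ ≤ M * (2 * (2 * N) / N ^ 2) := by
          gcongr
          · exact h _
          · exact (abs_coord_le x j).trans hx
      _ = _ := by field_simp; ring
  · rw [deriv_cutProfile_high, zero_mul, abs_zero]
    · positivity
    · rw [lt_div_iff₀ (by positivity)]
      nlinarith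

theorem pd_cut_eq_zero {N : ℝ} (hN : 0 < N) (j : Fin 2) {x : Plane} (hx : ‖x‖ < N) :
    pd j (cut N) x = 0 := by
  rw [pd_cut, deriv_cutProfile_low, zero_mul]
  rw [div_lt_one (by positivity)]
  gcongr

theorem tendsto_cut (x : Plane) : Tendsto (fun N => cut N x) atTop (𝓝 1) := by
  refine tendsto_const_nhds.congr' ?_
  filter_upwards [eventually_gt_atTop 0, eventually_ge_atTop ‖x‖] with N h1 h2
  rw [cut_one h1 h2]

/-! ### Dominated convergence in `L²` -/

theorem tendsto_eLpNorm_mul_zero {α ι : Type*} [MeasurableSpace α] {μ : Measure α} {l : Filter ι}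
    [l.IsCountablyGenerated] {f : α → ℝ} (hf : MemLp f 2 μ) {a : ι → α → ℝ}
    (ha : ∀ᶠ n in l, AEStronglyMeasurable (a n) μ) {M : ℝ} (hM : ∀ᶠ n in l, ∀ x, |a n x| ≤ M)
    (h0 : ∀ᵐ x ∂μ, Tendsto (fun n => a n x) l (𝓝 0)) :
    Tendsto (fun n => eLpNorm (fun x => a n x * f x) 2 μ) l (𝓝 0) := by
  have e : ∀ n, eLpNorm (fun x => a n x * f x) 2 μ =
      (∫⁻ x, ‖a n x * f x‖ₑ ^ (2 : ℝ) ∂μ) ^ (1 / (2 : ℝ)) := fun n => by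
    rw [eLpNorm_eq_lintegral_rpow_enorm_toReal (by norm_num) (by norm_num)]; simp
  simp only [e]
  have hfin : ∫⁻ x, (ENNReal.ofReal M * ‖f x‖ₑ) ^ (2 : ℝ) ∂μ ≠ ⊤ := by
    simp only [ENNReal.mul_rpow_of_nonneg _ _ (zero_le_two : (0 : ℝ) ≤ 2)]
    rw [lintegral_const_mul' _ _ (ENNReal.rpow_ne_top_of_nonneg (by norm_num) ENNReal.ofReal_ne_top)]
    refine ENNReal.mul_ne_top (ENNReal.rpow_ne_top_of_nonneg (by norm_num) ENNReal.ofReal_ne_top) ?_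
    have := lintegral_rpow_enorm_lt_top_of_eLpNorm_lt_top (p := 2) (by norm_num) (by norm_num) hf.2
    simpa using this.ne
  have h : Tendsto (fun n => ∫⁻ x, ‖a n x * f x‖ₑ ^ (2 : ℝ) ∂μ) l (𝓝 (∫⁻ _, 0 ∂μ)) := by
    refine tendsto_lintegral_filter_of_dominated_convergence' _ ?_ ?_ hfin ?_
    · filter_upwards [ha] with n hn
      exact ((hn.mul hf.1).enorm.pow_const _)
    · filter_upwards [hM] with n hn
      refine ae_of_all _ fun x => ?_
      rw [enorm_mul]
      gcongr
      rw [Real.enorm_eq_ofReal_abs]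
      exact ENNReal.ofReal_le_ofReal (hn x)
    · filter_upwards [h0] with x hx
      have h1 : Tendsto (fun n => a n x * f x) l (𝓝 0) := by simpa using hx.mul_const (f x)
      have h2 := ((ENNReal.continuous_rpow_const (y := 2)).tendsto _).comp h1.enorm
      simpa [Function.comp_def] using h2
  rw [lintegral_zero] at h
  have h2 := ((ENNReal.continuous_rpow_const (y := 1 / 2)).tendsto _).comp h
  simpa [Function.comp_def] using h2

/-! ### Multiplication by bounded functions -/

theorem eLpNorm_mul_le_of_bound {α : Type*} [MeasurableSpace α] {μ : Measure α} {a f : α → ℝ}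
    {M : ℝ≥0} (h : ∀ x, |a x| ≤ M) (p : ℝ≥0∞) :
    eLpNorm (fun x => a x * f x) p μ ≤ M * eLpNorm f p μ := by
  have := eLpNorm_le_nnreal_smul_eLpNorm_of_ae_le_mul (μ := μ) (f := fun x => a x * f x) (g := f)
    (c := M) (ae_of_all _ fun x => by
      rw [← NNReal.coe_le_coe]
      push_cast
      simp only [Real.norm_eq_abs, abs_mul]
      exact mul_le_mul_of_nonneg_right (h x) (abs_nonneg _)) p
  simpa [ENNReal.smul_def] using this

theorem eLpNorm_le_h1n (D : Set Plane) (f : Plane → ℝ) (G : Fin 2 → Plane → ℝ) :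
    eLpNorm f 2 (volume.restrict D) ≤ h1n D f G := le_self_add

theorem eLpNorm_le_h1n' (D : Set Plane) (f : Plane → ℝ) (G : Fin 2 → Plane → ℝ) (j : Fin 2) :
    eLpNorm (G j) 2 (volume.restrict D) ≤ h1n D f G :=
  (Finset.single_le_sum (f := fun j => eLpNorm (G j) 2 (volume.restrict D))
    (fun _ _ => zero_le) (Finset.mem_univ j)).trans le_add_self

theorem h1n_mono {D D' : Set Plane} (h : D ⊆ D') (f : Plane → ℝ) (G : Fin 2 → Plane → ℝ) :
    h1n D f G ≤ h1n D' f G := by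
  unfold h1n
  gcongr

theorem h1n_add_le {D : Set Plane} {f f' : Plane → ℝ} {G G' : Fin 2 → Plane → ℝ}
    (hf : AEStronglyMeasurable f (volume.restrict D))
    (hf' : AEStronglyMeasurable f' (volume.restrict D))
    (hG : ∀ j, AEStronglyMeasurable (G j) (volume.restrict D))
    (hG' : ∀ j, AEStronglyMeasurable (G' j) (volume.restrict D)) :
    h1n D (f + f') (fun j => G j + G' j) ≤ h1n D f G + h1n D f' G' := by
  unfold h1n
  calc _ ≤ (eLpNorm f 2 (volume.restrict D) + eLpNorm f' 2 (volume.restrict D)) +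
        ∑ j, (eLpNorm (G j) 2 (volume.restrict D) + eLpNorm (G' j) 2 (volume.restrict D)) := by
        gcongr with j
        · exact eLpNorm_add_le hf hf' (by norm_num)
        · exact eLpNorm_add_le (hG j) (hG' j) (by norm_num)
    _ = _ := by rw [Finset.sum_add_distrib]; abel

/-- Multiplication by a function with bounded value and gradient is bounded in `H¹`; only the part
of the domain where the multiplier does not vanish matters. -/
theorem h1n_mul_le {D B : Set Plane} (hB : MeasurableSet B) {η f : Plane → ℝ}
    {G : Fin 2 → Plane → ℝ} {M : ℝ≥0} (h0 : ∀ x, |η x| ≤ M) (h1 : ∀ j x, |pd j η x| ≤ M)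
    (hη0 : ∀ x, x ∉ B → η x = 0) (hη1 : ∀ j x, x ∉ B → pd j η x = 0) (hηc : Continuous η)
    (hηd : ∀ j, Continuous (pd j η))
    (hf : AEStronglyMeasurable f (volume.restrict D))
    (hG : ∀ j, AEStronglyMeasurable (G j) (volume.restrict D)) :
    h1n D (fun x => η x * f x) (fun j x => η x * G j x + pd j η x * f x) ≤
      (4 * M) * h1n (D ∩ B) f G := by
  have key : ∀ a g : Plane → ℝ, (∀ x, |a x| ≤ M) → (∀ x, x ∉ B → a x = 0) →
      eLpNorm (fun x => a x * g x) 2 (volume.restrict D) ≤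
        M * eLpNorm g 2 (volume.restrict (D ∩ B)) := by
    intro a g ha hB0
    have e : (fun x => a x * g x) = B.indicator fun x => a x * g x := by
      ext x
      by_cases hx : x ∈ B
      · simp [hx]
      · simp [hx, hB0 x hx]
    rw [e, eLpNorm_indicator_eq_eLpNorm_restrict hB, Measure.restrict_restrict hB, inter_comm]
    exact eLpNorm_mul_le_of_bound ha 2
  have k1 := key η f h0 hη0
  have k2 : ∀ j, eLpNorm (fun x => η x * G j x + pd j η x * f x) 2 (volume.restrict D) ≤
      M * eLpNorm (G j) 2 (volume.restrict (D ∩ B)) + M * eLpNorm f 2 (volume.restrict (D ∩ B)) :=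
    fun j => (eLpNorm_add_le (hηc.aestronglyMeasurable.mul (hG j))
      ((hηd j).aestronglyMeasurable.mul hf) (by norm_num)).trans
      (add_le_add (key η (G j) h0 hη0) (key (pd j η) f (h1 j) (hη1 j)))
  unfold h1n
  calc _ ≤ M * eLpNorm f 2 (volume.restrict (D ∩ B)) +
        ∑ j, (M * eLpNorm (G j) 2 (volume.restrict (D ∩ B)) +
          M * eLpNorm f 2 (volume.restrict (D ∩ B))) := by
        gcongr with j; exact k2 j
    _ = 3 * M * eLpNorm f 2 (volume.restrict (D ∩ B)) +
        M * ∑ j, eLpNorm (G j) 2 (volume.restrict (D ∩ B)) := by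
        rw [Finset.sum_add_distrib, Finset.mul_sum]; simp; ring
    _ ≤ 4 * M * eLpNorm f 2 (volume.restrict (D ∩ B)) +
        4 * M * ∑ j, eLpNorm (G j) 2 (volume.restrict (D ∩ B)) := by
        gcongr
        · norm_num
        · calc (M : ℝ≥0∞) = 1 * M := (one_mul _).symm
            _ ≤ 4 * M := by gcongr; norm_num
    _ = _ := by ring

theorem exists_bound_test {η : Plane → ℝ} (h : ContDiff ℝ 1 η) (hc : HasCompactSupport η) :
    ∃ M : ℝ≥0, (∀ x, |η x| ≤ M) ∧ ∀ j x, |pd j η x| ≤ M := by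
  obtain ⟨M0, h0⟩ := h.continuous.bounded_above_of_compact_support hc
  have hd : ∀ j, ∃ M, ∀ x, ‖pd j η x‖ ≤ M := fun j =>
    (continuous_pd h j).bounded_above_of_compact_support (hc.fderiv_apply ℝ _)
  choose M1 h1 using hd
  refine ⟨Real.toNNReal (max M0 (max (M1 0) (M1 1))), fun x => ?_, fun j x => ?_⟩
  · exact ((h0 x).trans (le_max_left _ _)).trans (Real.le_coe_toNNReal _)
  · refine le_trans ((h1 j x).trans ?_) (Real.le_coe_toNNReal _)
    fin_cases j
    · exact (le_max_left _ _).trans (le_max_right _ _)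
    · exact (le_max_right _ _).trans (le_max_right _ _)

/-! ### Functions in `H¹` of the fluid domain -/

/-- `f ∈ H¹(O)` with gradient `G`. -/
structure IsH1 (O : Set Plane) (f : Plane → ℝ) (G : Fin 2 → Plane → ℝ) : Prop where
  weak : ∀ j, HasWeakPd O j f (G j)
  memLp : MemLp f 2 (volume.restrict O)
  memLp_grad : ∀ j, MemLp (G j) 2 (volume.restrict O)

theorem IsH1.h1n_lt_top {O : Set Plane} {f : Plane → ℝ} {G : Fin 2 → Plane → ℝ}
    (h : IsH1 O f G) : h1n O f G < ⊤ :=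
  ENNReal.add_lt_top.2 ⟨h.memLp.2, ENNReal.sum_lt_top.2 fun j _ => (h.memLp_grad j).2⟩

theorem memLp_mul_bounded {μ : Measure Plane} {a f : Plane → ℝ} (hf : MemLp f 2 μ)
    (ha : Continuous a) {M : ℝ≥0} (h : ∀ x, |a x| ≤ M) : MemLp (fun x => a x * f x) 2 μ :=
  ⟨ha.aestronglyMeasurable.mul hf.1, (eLpNorm_mul_le_of_bound h 2).trans_lt
    (ENNReal.mul_lt_top (by simp) hf.2)⟩

theorem IsH1.mul {O : Set Plane} (hO : IsOpen O) {f : Plane → ℝ} {G : Fin 2 → Plane → ℝ}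
    (h : IsH1 O f G) {η : Plane → ℝ} (hη : ContDiff ℝ ∞ η) {M : ℝ≥0} (h0 : ∀ x, |η x| ≤ M)
    (h1 : ∀ j x, |pd j η x| ≤ M) :
    IsH1 O (fun x => η x * f x) (fun j x => η x * G j x + pd j η x * f x) :=
  ⟨fun j => (h.weak j).smooth_mul hO hη, memLp_mul_bounded h.memLp hη.continuous h0,
    fun j => (memLp_mul_bounded (h.memLp_grad j) hη.continuous h0).add
      (memLp_mul_bounded h.memLp (continuous_pd (hη.of_le (by simp)) j) (h1 j))⟩

/-- `f` can be approximated in `H¹(O)` by test functions of the plane. -/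
structure SmoothApprox (O : Set Plane) (f : Plane → ℝ) (G : Fin 2 → Plane → ℝ) : Prop where
  memLp : MemLp f 2 (volume.restrict O)
  memLp_grad : ∀ j, MemLp (G j) 2 (volume.restrict O)
  approx : ∀ ε : ℝ≥0∞, ε ≠ 0 → ∃ φ, IsTest univ φ ∧ h1n O (φ - f) (fun j => pd j φ - G j) ≤ ε

theorem IsTest.contDiff_one {O : Set Plane} {φ : Plane → ℝ} (h : IsTest O φ) : ContDiff ℝ 1 φ :=
  h.1.of_le (by simp)

theorem IsTest.differentiableAt {O : Set Plane} {φ : Plane → ℝ} (h : IsTest O φ) (x : Plane) :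
    DifferentiableAt ℝ φ x := h.1.differentiable (by simp) x

theorem SmoothApprox.zero (O : Set Plane) : SmoothApprox O 0 0 := by
  refine ⟨MemLp.zero, fun j => MemLp.zero, fun ε _ => ⟨0, ⟨contDiff_const, HasCompactSupport.zero,
    subset_univ _⟩, ?_⟩⟩
  have : ∀ j, pd j 0 = 0 := fun j => funext fun x => by
    rw [show (0 : Plane → ℝ) = fun _ => 0 from rfl]; exact pd_const _ _ _
  have e : h1n O ((0 : Plane → ℝ) - 0) (fun j => pd j 0 - (0 : Fin 2 → Plane → ℝ) j) = 0 := by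
    simp [h1n, this]
  rw [e]; exact zero_le

theorem SmoothApprox.add {O : Set Plane} {f f' : Plane → ℝ} {G G' : Fin 2 → Plane → ℝ}
    (h : SmoothApprox O f G) (h' : SmoothApprox O f' G') : SmoothApprox O (f + f') (G + G') := by
  refine ⟨h.memLp.add h'.memLp, fun j => (h.memLp_grad j).add (h'.memLp_grad j), fun ε hε => ?_⟩
  have h2 : ε / 2 ≠ 0 := (ENNReal.half_pos hε).ne'
  obtain ⟨φ, hφ, e⟩ := h.approx _ h2
  obtain ⟨φ', hφ', e'⟩ := h'.approx _ h2
  refine ⟨φ + φ', ⟨hφ.1.add hφ'.1, hφ.2.1.add hφ'.2.1, subset_univ _⟩, ?_⟩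
  have hpd : ∀ j, pd j (φ + φ') = pd j φ + pd j φ' := fun j => funext fun x =>
    pd_add (hφ.differentiableAt x) (hφ'.differentiableAt x) j
  have e1 : h1n O (φ + φ' - (f + f')) (fun j => pd j (φ + φ') - (G + G') j) =
      h1n O ((φ - f) + (φ' - f')) (fun j => (pd j φ - G j) + (pd j φ' - G' j)) := by
    congr 1
    · abel
    · ext j x; simp [hpd]; ring
  rw [e1]
  refine (h1n_add_le (hφ.1.continuous.aestronglyMeasurable.sub h.memLp.1)
    (hφ'.1.continuous.aestronglyMeasurable.sub h'.memLp.1)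
    (fun j => (continuous_pd hφ.contDiff_one j).aestronglyMeasurable.sub (h.memLp_grad j).1)
    (fun j => (continuous_pd hφ'.contDiff_one j).aestronglyMeasurable.sub
      (h'.memLp_grad j).1)).trans ?_
  calc _ ≤ ε / 2 + ε / 2 := add_le_add e e'
    _ = ε := ENNReal.add_halves ε

theorem SmoothApprox.sum {ι : Type*} (s : Finset ι) {O : Set Plane} {f : ι → Plane → ℝ}
    {G : ι → Fin 2 → Plane → ℝ} (h : ∀ i ∈ s, SmoothApprox O (f i) (G i)) :
    SmoothApprox O (∑ i ∈ s, f i) (∑ i ∈ s, G i) := by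
  classical
  induction s using Finset.induction_on with
  | empty => simpa using SmoothApprox.zero O
  | insert i s hi ih =>
    rw [Finset.sum_insert hi, Finset.sum_insert hi]
    exact (h i (Finset.mem_insert_self i s)).add (ih fun k hk => h k (Finset.mem_insert_of_mem hk))

/-- The mollification of a localized function, with kernels that only see the domain. -/
theorem IsH1.smoothApprox_mul {O : Set Plane} (hO : IsOpen O) {f : Plane → ℝ}
    {G : Fin 2 → Plane → ℝ} (h : IsH1 O f G) {η : Plane → ℝ} (hη : IsTest univ η)
    {K : ℕ → Plane → ℝ} (hK : IsMollifier K)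
    (hsee : ∀ᶠ n in atTop, ∀ x ∈ O, (∀ z ∈ tsupport (K n), x - z ∈ O) ∨
      ∀ z ∈ tsupport (K n), x - z ∉ tsupport η) :
    SmoothApprox O (fun x => η x * f x) (fun j x => η x * G j x + pd j η x * f x) := by
  obtain ⟨M, h0, h1⟩ := exists_bound_test hη.contDiff_one hη.2.1
  have hH := h.mul hO hη.1 h0 h1
  set f' : Plane → ℝ := fun x => η x * f x
  set G' : Fin 2 → Plane → ℝ := fun j x => η x * G j x + pd j η x * f x
  have hm := hO.measurableSet
  have mf : MemLp (O.indicator f') 2 := (memLp_indicator_iff_restrict hm).2 hH.memLp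
  have mG : ∀ j, MemLp (O.indicator (G' j)) 2 := fun j =>
    (memLp_indicator_iff_restrict hm).2 (hH.memLp_grad j)
  have lf := mf.locallyIntegrable (by norm_num)
  refine ⟨hH.memLp, hH.memLp_grad, fun ε hε => ?_⟩
  have t1 := hK.tendsto_eLpNorm mf
  have t2 := fun j => hK.tendsto_eLpNorm (mG j)
  have t3 : Tendsto (fun n => eLpNorm (mol (K n) (O.indicator f') - O.indicator f') 2 +
      ∑ j, eLpNorm (mol (K n) (O.indicator (G' j)) - O.indicator (G' j)) 2) atTop
      (𝓝 (0 + ∑ _j : Fin 2, 0)) := t1.add (tendsto_finsetSum _ fun j _ => t2 j)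
  simp only [Finset.sum_const_zero, add_zero] at t3
  obtain ⟨n, hn, hs⟩ := ((ENNReal.tendsto_nhds_zero.1 t3 ε (pos_iff_ne_zero.2 hε)).and hsee).exists
  refine ⟨mol (K n) (O.indicator f'), ⟨mol_contDiff lf (hK.smooth n) (hK.compact n), ?_,
    subset_univ _⟩, le_trans ?_ hn⟩
  · rw [mol_eq_convolution]
    refine HasCompactSupport.convolution _ ?_ (hK.compact n)
    refine hη.2.1.mono fun x hx => ?_
    have hx' : x ∈ O ∧ f' x ≠ 0 := by simpa using hx
    exact left_ne_zero_of_mul hx'.2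
  · have hpd : ∀ j, ∀ x ∈ O, pd j (mol (K n) (O.indicator f')) x =
        mol (K n) (O.indicator (G' j)) x := by
      intro j x hx
      rcases hs x hx with h2 | h2
      · exact (hH.weak j).pd_mol hO lf (hK.smooth n) (hK.compact n) h2
      · have z1 : ∀ y ∉ tsupport η, O.indicator f' y = 0 := fun y hy => by
          by_cases hyO : y ∈ O <;> simp [hyO, f', image_eq_zero_of_notMem_tsupport hy]
        have z2 : ∀ y ∉ tsupport η, O.indicator (G' j) y = 0 := fun y hy => by
          have : y ∉ tsupport (pd j η) := fun hh => hy (tsupport_pd_subset η j hh)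
          by_cases hyO : y ∈ O <;> simp [hyO, G', image_eq_zero_of_notMem_tsupport hy,
            image_eq_zero_of_notMem_tsupport this]
        rw [_root_.pd_mol lf (hK.smooth n) (hK.compact n),
          mol_eq_zero_of_disjoint fun z hz => z1 _ (h2 z (tsupport_pd_subset _ j hz)),
          mol_eq_zero_of_disjoint fun z hz => z2 _ (h2 z hz)]
    have r : ∀ (a b c d : Plane → ℝ), (∀ x ∈ O, a x = c x) → (∀ x ∈ O, b x = d x) →
        eLpNorm (a - b) 2 (volume.restrict O) ≤ eLpNorm (c - d) 2 volume := by
      intro a b c d hac hbd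
      refine le_trans (le_of_eq ?_) (eLpNorm_mono_measure (c - d)
        (Measure.restrict_le_self (s := O)))
      refine eLpNorm_congr_ae ((ae_restrict_iff' hm).2 (ae_of_all _ fun x hx => ?_))
      simp [hac x hx, hbd x hx]
    unfold h1n
    gcongr with j
    · exact r _ _ _ _ (fun x _ => rfl) (fun x hx => by simp [hx])
    · exact r _ _ _ _ (hpd j) (fun x hx => by simp [hx])

/-! ### Kernels that only see one side of the boundary -/

/-- Near points of `A` the kernels only see `A`, or do not see `T`. -/
def Sees (A T : Set Plane) (K : ℕ → Plane → ℝ) : Prop :=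
  ∀ᶠ n in atTop, ∀ x ∈ A, (∀ z ∈ tsupport (K n), x - z ∈ A) ∨ ∀ z ∈ tsupport (K n), x - z ∉ T

theorem exists_kernel_toward (v : Plane) {δ : ℝ} (hδ : 0 < δ) {A B T : Set Plane} (hB : IsOpen B)
    (hT : IsCompact T) (hTB : T ⊆ B)
    (hA : ∀ x ∈ A, ∀ y ∈ B, x ∈ B → ∀ t : ℝ, 0 < t → x - y ∈ ball (t • v) (t * δ) → y ∈ A) :
    ∃ K, IsMollifier K ∧ Sees A T K := by
  obtain ⟨K, hK, hs⟩ := exists_isMollifier v hδ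
  refine ⟨K, hK, ?_⟩
  obtain ⟨ε, hε, hsub⟩ := hT.exists_thickening_subset_open hB hTB
  have h1 : Tendsto (fun n : ℕ => 1 / ((n : ℝ) + 1) * (‖v‖ + δ)) atTop (𝓝 (0 * (‖v‖ + δ))) :=
    tendsto_one_div_add_atTop_nhds_zero_nat.mul_const _
  rw [zero_mul] at h1
  filter_upwards [h1.eventually (gt_mem_nhds (half_pos hε))] with n hn x hx
  by_contra hcon
  push Not at hcon
  obtain ⟨⟨z, hz, hzA⟩, z0, hz0, hz0T⟩ := hcon
  have hnorm : ∀ z ∈ tsupport (K n), ‖z‖ < ε / 2 := by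
    intro z hz
    obtain ⟨t, t0, t1, hzt⟩ := hs n z hz
    rw [mem_ball_iff_norm] at hzt
    have h2 : ‖z‖ ≤ ‖z - t • v‖ + ‖t • v‖ := by simpa using norm_add_le (z - t • v) (t • v)
    rw [norm_smul, Real.norm_of_nonneg t0.le] at h2
    have : t * (‖v‖ + δ) ≤ 1 / ((n : ℝ) + 1) * (‖v‖ + δ) := by gcongr
    nlinarith
  have hx0 : ‖x - (x - z0)‖ < ε := by
    rw [sub_sub_cancel]; exact (hnorm z0 hz0).trans (half_lt_self hε)
  have hx1 : ‖x - z - (x - z0)‖ < ε := by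
    rw [sub_sub_sub_cancel_left]
    calc ‖z0 - z‖ ≤ ‖z0‖ + ‖z‖ := norm_sub_le _ _
      _ < ε := by linarith [hnorm z hz, hnorm z0 hz0]
  have hxB : x ∈ B := hsub (mem_thickening_iff.2 ⟨_, hz0T, by rwa [dist_eq_norm]⟩)
  have hyB : x - z ∈ B := hsub (mem_thickening_iff.2 ⟨_, hz0T, by rwa [dist_eq_norm]⟩)
  obtain ⟨t, t0, -, hzt⟩ := hs n z hz
  exact hzA (hA x hx _ hyB hxB t t0 (by rwa [sub_sub_cancel]))

theorem BChart.exists_kernel_out {S : Set Plane} (C : BChart S) {T : Set Plane} (hT : IsCompact T)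
    (hTB : T ⊆ C.nhd) : ∃ K, IsMollifier K ∧ Sees Sᶜ T K := by
  refine exists_kernel_toward (-C.e) C.δ_pos C.isOpen_nhd hT hTB fun x hx y hy hxB t ht h => ?_
  refine C.cone_out hxB hy ht ?_ (subset_closure hx)
  rw [mem_ball_iff_norm] at h ⊢
  rw [← norm_neg]
  have e : -(y - x - t • C.e) = x - y - t • -C.e := by module
  rwa [e]

theorem BChart.exists_kernel_in {S : Set Plane} (C : BChart S) {T : Set Plane} (hT : IsCompact T)
    (hTB : T ⊆ C.nhd) : ∃ K, IsMollifier K ∧ Sees S T K :=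
  exists_kernel_toward C.e C.δ_pos C.isOpen_nhd hT hTB fun _ hx _ hy hxB _ ht h =>
    interior_subset (C.cone_in hy hxB ht h hx)

theorem IsPreconnected.exists_mem_frontier {t A : Set Plane} (ht : IsPreconnected t)
    (h1 : (t ∩ A).Nonempty) (h2 : (t ∩ Aᶜ).Nonempty) : (t ∩ frontier A).Nonempty := by
  by_contra h
  have hno : ∀ x ∈ t, x ∉ frontier A := fun x hx hf => h ⟨x, hx, hf⟩
  have c1 : ∀ x ∈ t, x ∈ A → x ∈ interior A := fun x hx hA => by
    by_contra hi; exact hno x hx ⟨subset_closure hA, hi⟩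
  have c2 : ∀ x ∈ t, x ∉ A → x ∉ closure A := fun x hx hA hc =>
    hno x hx ⟨hc, fun hi => hA (interior_subset hi)⟩
  obtain ⟨a, hat, haA⟩ := h1
  obtain ⟨b, hbt, hbA⟩ := h2
  obtain ⟨z, -, hz1, hz2⟩ := ht (interior A) (closure A)ᶜ isOpen_interior
    isClosed_closure.isOpen_compl (fun x hx => by
      by_cases hA : x ∈ A
      · exact Or.inl (c1 x hx hA)
      · exact Or.inr (c2 x hx hA)) ⟨a, hat, c1 a hat haA⟩ ⟨b, hbt, c2 b hbt hbA⟩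
  exact hz2 (subset_closure (interior_subset hz1))

theorem exists_kernel_away {A T : Set Plane} (hT : IsCompact T) (hTA : T ∩ frontier A = ∅) :
    ∃ K, IsMollifier K ∧ Sees A T K := by
  obtain ⟨K, hK, hs⟩ := exists_isMollifier_small
  refine ⟨K, hK, ?_⟩
  obtain ⟨ε, hε, hsub⟩ := hT.exists_thickening_subset_open
    (isClosed_frontier (s := A)).isOpen_compl (fun x hx h => by
      have : x ∈ T ∩ frontier A := ⟨hx, h⟩
      rw [hTA] at this; exact this)
  filter_upwards [tendsto_one_div_add_atTop_nhds_zero_nat.eventually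
    (gt_mem_nhds (half_pos hε))] with n hn x hx
  by_contra hcon
  push Not at hcon
  obtain ⟨⟨z, hz, hzA⟩, z0, hz0, hz0T⟩ := hcon
  have h1 := (hs n z hz).trans hn
  have h2 := (hs n z0 hz0).trans hn
  have hx0 : x ∈ ball (x - z0) ε := by rw [mem_ball_iff_norm, sub_sub_cancel]; linarith
  have hx1 : x - z ∈ ball (x - z0) ε := by
    rw [mem_ball_iff_norm, sub_sub_sub_cancel_left]
    calc ‖z0 - z‖ ≤ ‖z0‖ + ‖z‖ := norm_sub_le _ _
      _ < ε := by linarith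
  obtain ⟨y, hy1, hy2⟩ := (convex_ball (x - z0) ε).isPreconnected.exists_mem_frontier
    ⟨x, hx0, hx⟩ ⟨x - z, hx1, hzA⟩
  exact hsub (mem_thickening_iff.2 ⟨_, hz0T, hy1⟩) hy2

/-! ### Density of smooth functions -/

theorem SmoothApprox.of_tendsto {O : Set Plane} {f : Plane → ℝ} {G : Fin 2 → Plane → ℝ}
    (hf : MemLp f 2 (volume.restrict O)) (hG : ∀ j, MemLp (G j) 2 (volume.restrict O))
    (h : ∀ ε : ℝ≥0∞, ε ≠ 0 → ∃ f' G', SmoothApprox O f' G' ∧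
      h1n O (f' - f) (fun j => G' j - G j) ≤ ε) : SmoothApprox O f G := by
  refine ⟨hf, hG, fun ε hε => ?_⟩
  have h2 : ε / 2 ≠ 0 := (ENNReal.half_pos hε).ne'
  obtain ⟨f', G', h', e'⟩ := h _ h2
  obtain ⟨φ, hφ, e⟩ := h'.approx _ h2
  refine ⟨φ, hφ, ?_⟩
  have e1 : h1n O (φ - f) (fun j => pd j φ - G j) =
      h1n O ((φ - f') + (f' - f)) (fun j => (pd j φ - G' j) + (G' j - G j)) := by simp
  rw [e1]
  refine (h1n_add_le (hφ.1.continuous.aestronglyMeasurable.sub h'.memLp.1) (h'.memLp.1.sub hf.1)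
    (fun j => (continuous_pd hφ.contDiff_one j).aestronglyMeasurable.sub (h'.memLp_grad j).1)
    (fun j => (h'.memLp_grad j).1.sub (hG j).1)).trans ?_
  calc _ ≤ ε / 2 + ε / 2 := add_le_add e e'
    _ = ε := ENNReal.add_halves ε

theorem IsTest.cut {N : ℝ} (hN : 0 < N) : IsTest univ (_root_.cut N) :=
  ⟨contDiff_cut N, hasCompactSupport_cut hN, subset_univ _⟩

theorem IsTest.mul {O : Set Plane} {η φ : Plane → ℝ} (h : IsTest O η) (hφ : ContDiff ℝ ∞ φ) :
    IsTest O fun x => φ x * η x :=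
  ⟨hφ.mul h.1, h.2.1.mul_left, tsupport_mul_subset_right.trans h.2.2⟩

theorem tendsto_h1n_cut {O : Set Plane} {f : Plane → ℝ} {G : Fin 2 → Plane → ℝ} (h : IsH1 O f G) :
    Tendsto (fun N : ℝ => h1n O (fun x => cut N x * f x - f x)
      (fun j x => cut N x * G j x + pd j (cut N) x * f x - G j x)) atTop (𝓝 0) := by
  have c1 : ∀ g : Plane → ℝ, MemLp g 2 (volume.restrict O) →
      Tendsto (fun N : ℝ => eLpNorm (fun x => (cut N x - 1) * g x) 2 (volume.restrict O)) atTop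
        (𝓝 0) := fun g hg => by
    refine tendsto_eLpNorm_mul_zero hg (M := 2) (Eventually.of_forall fun N =>
      ((contDiff_cut N).continuous.sub continuous_const).aestronglyMeasurable)
      (Eventually.of_forall fun N x => ?_) (ae_of_all _ fun x => ?_)
    · calc |cut N x - 1| ≤ |cut N x| + |1| := abs_sub _ _
        _ ≤ 2 := by have := abs_cut_le N x; rw [abs_one]; linarith
    · simpa using (tendsto_cut x).sub_const 1
  obtain ⟨M, hM, hb⟩ := exists_pd_cut_bound
  have c2 : ∀ j, Tendsto (fun N : ℝ => eLpNorm (fun x => pd j (cut N) x * f x) 2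
      (volume.restrict O)) atTop (𝓝 0) := fun j => by
    refine tendsto_eLpNorm_mul_zero h.memLp (M := M) (Eventually.of_forall fun N =>
      (continuous_pd ((contDiff_cut N).of_le (by simp)) j).aestronglyMeasurable) ?_
      (ae_of_all _ fun x => ?_)
    · filter_upwards [eventually_ge_atTop 1] with N hN x
      exact (hb N (by linarith) j x).trans (div_le_self hM.le hN)
    · refine tendsto_const_nhds.congr' ?_
      filter_upwards [eventually_gt_atTop 0, eventually_gt_atTop ‖x‖] with N h1 h2
      rw [pd_cut_eq_zero h1 j h2]
  have t : Tendsto (fun N : ℝ => eLpNorm (fun x => (cut N x - 1) * f x) 2 (volume.restrict O) +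
      ∑ j, (eLpNorm (fun x => (cut N x - 1) * G j x) 2 (volume.restrict O) +
        eLpNorm (fun x => pd j (cut N) x * f x) 2 (volume.restrict O))) atTop
      (𝓝 (0 + ∑ _j : Fin 2, (0 + 0))) :=
    (c1 f h.memLp).add (tendsto_finsetSum _ fun j _ => (c1 _ (h.memLp_grad j)).add (c2 j))
  simp only [add_zero, Finset.sum_const_zero] at t
  refine tendsto_of_tendsto_of_tendsto_of_le_of_le tendsto_const_nhds t (fun _ => zero_le)
    fun N => ?_
  unfold h1n
  have m := (contDiff_cut N).continuous.aestronglyMeasurable (μ := volume.restrict O)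
  have mp := fun j => (continuous_pd ((contDiff_cut N).of_le (by simp) : ContDiff ℝ 1 (cut N))
    j).aestronglyMeasurable (μ := volume.restrict O)
  gcongr with j
  · exact le_of_eq (by congr 1; ext x; ring)
  · have e : (fun x => cut N x * G j x + pd j (cut N) x * f x - G j x) =
        (fun x => (cut N x - 1) * G j x) + fun x => pd j (cut N) x * f x := by
      ext x; simp; ring
    beta_reduce
    rw [e]
    exact eLpNorm_add_le ((m.sub aestronglyMeasurable_const).mul (h.memLp_grad j).1)
      ((mp j).mul h.memLp.1) (by norm_num)

theorem IsSmoothBody.smoothApprox {S : Set Plane} (hS : IsSmoothBody S) {f : Plane → ℝ}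
    {G : Fin 2 → Plane → ℝ} (h : IsH1 Sᶜ f G) : SmoothApprox Sᶜ f G := by
  obtain ⟨ι, _, C, η, hη, hsum⟩ := hS.exists_partition
  have key : ∀ N : ℝ, 0 < N → SmoothApprox Sᶜ (fun x => cut N x * f x)
      (fun j x => cut N x * G j x + pd j (cut N) x * f x) := by
    intro N hN
    set η0 : Plane → ℝ := fun x => 1 - ∑ k, η k x
    have hη0 : ContDiff ℝ ∞ η0 := contDiff_const.sub (ContDiff.sum fun k _ => (hη k).1)
    let ζ : Option ι → Plane → ℝ := fun o => o.elim (fun x => η0 x * cut N x)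
      fun k x => cut N x * η k x
    have hζ : ∀ o, IsTest univ (ζ o) := by
      rintro (_ | k)
      · exact (IsTest.cut hN).mul hη0
      · exact ⟨((hη k).mul (contDiff_cut N)).1, ((hη k).mul (contDiff_cut N)).2.1, subset_univ _⟩
    have hpiece : ∀ o, SmoothApprox Sᶜ (fun x => ζ o x * f x)
        (fun j x => ζ o x * G j x + pd j (ζ o) x * f x) := by
      rintro (_ | k)
      · obtain ⟨K, hK, hs⟩ := exists_kernel_away (A := Sᶜ) (hζ none).2.1 (by
          rw [frontier_compl, eq_empty_iff_forall_notMem]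
          rintro x ⟨hx1, hx2⟩
          rw [tsupport, mem_closure_iff_nhds] at hx1
          obtain ⟨y, hy1, hy2⟩ := hx1 _ (hsum x hx2)
          refine hy2 ?_
          have : ∑ k, η k y = 1 := hy1
          simp [ζ, η0, this])
        exact h.smoothApprox_mul hS.isOpen_compl (hζ none) hK hs
      · obtain ⟨K, hK, hs⟩ := (C k).exists_kernel_out (hζ (some k)).2.1
          ((hη k).mul (contDiff_cut N)).2.2
        exact h.smoothApprox_mul hS.isOpen_compl (hζ (some k)) hK hs
    have hs := SmoothApprox.sum Finset.univ fun o _ => hpiece o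
    have hζs : ∀ x, ∑ o, ζ o x = cut N x := fun x => by
      rw [Fintype.sum_option]
      simp only [ζ, Option.elim, η0, ← Finset.mul_sum]
      ring
    have hζp : ∀ j x, ∑ o, pd j (ζ o) x = pd j (cut N) x := fun j x => by
      rw [← pd_sum fun o _ => (hζ o).differentiableAt x]
      simp only [hζs]
    convert hs using 1
    · ext x
      rw [Finset.sum_apply, ← Finset.sum_mul, hζs]
    · ext j x
      rw [Finset.sum_apply, Finset.sum_apply, Finset.sum_add_distrib, ← Finset.sum_mul,
        ← Finset.sum_mul, hζs, hζp]
  refine SmoothApprox.of_tendsto h.memLp h.memLp_grad fun ε hε => ?_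
  obtain ⟨N, hN1, hN2⟩ := ((ENNReal.tendsto_nhds_zero.1 (tendsto_h1n_cut h) ε
    (pos_iff_ne_zero.2 hε)).and (eventually_gt_atTop 0)).exists
  exact ⟨_, _, key N hN2, hN1⟩

/-! ### The embedding into `L⁴` and the trace inequality -/

theorem contDiff_indicator {S : Set Plane} (hS : IsClosed S) {h : Plane → ℝ} {n : WithTop ℕ∞}
    (hh : ContDiff ℝ n h) (h0 : ∀ x ∈ frontier S, h =ᶠ[𝓝 x] 0) :
    ContDiff ℝ n (Sᶜ.indicator h) ∧ ∀ j, pd j (Sᶜ.indicator h) = Sᶜ.indicator (pd j h) := by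
  have key : ∀ x, (x ∈ Sᶜ ∧ Sᶜ.indicator h =ᶠ[𝓝 x] h) ∨ (Sᶜ.indicator h =ᶠ[𝓝 x] 0 ∧
      (x ∈ Sᶜ → h =ᶠ[𝓝 x] 0)) := by
    intro x
    by_cases hx : x ∈ S
    · right
      refine ⟨?_, fun h => absurd hx h⟩
      by_cases hi : x ∈ interior S
      · filter_upwards [isOpen_interior.mem_nhds hi] with y hy
        simp [interior_subset hy]
      · filter_upwards [h0 x ⟨subset_closure hx, hi⟩] with y hy
        by_cases hyS : y ∈ S
        · simp [hyS]
        · rw [indicator_of_mem (by exact hyS), hy]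
    · left
      refine ⟨hx, ?_⟩
      filter_upwards [hS.isOpen_compl.mem_nhds hx] with y hy
      simp [indicator_of_mem hy]
  constructor
  · rw [contDiff_iff_contDiffAt]
    intro x
    rcases key x with ⟨-, h1⟩ | ⟨h1, -⟩
    · exact hh.contDiffAt.congr_of_eventuallyEq h1
    · exact (contDiffAt_const (c := (0 : ℝ))).congr_of_eventuallyEq h1
  · intro j
    ext x
    rcases key x with ⟨hx, h1⟩ | ⟨h1, h2⟩
    · rw [indicator_of_mem hx, pd_congr h1]
    · have z : ∀ g : Plane → ℝ, g =ᶠ[𝓝 x] 0 → pd j g x = 0 := fun g hg => by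
        rw [pd_congr hg]; exact pd_const 0 j x
      rw [z _ h1]
      by_cases hx : x ∈ Sᶜ
      · rw [indicator_of_mem hx, z _ (h2 hx)]
      · simp [hx]

theorem BChart.exists_second_direction {S : Set Plane} (C : BChart S) :
    ∃ w ∈ ball C.e C.δ, C.e 0 * w 1 - C.e 1 * w 0 ≠ 0 := by
  have he : 0 < ‖C.e‖ := norm_pos_iff.2 C.e_ne
  have hs : 0 < C.δ / (2 * ‖C.e‖) := div_pos C.δ_pos (by positivity)
  refine ⟨C.e + (C.δ / (2 * ‖C.e‖)) • perp C.e, ?_, ?_⟩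
  · rw [mem_ball_iff_norm, add_sub_cancel_left, norm_smul, perp_norm, Real.norm_of_nonneg hs.le]
    have : C.δ / (2 * ‖C.e‖) * ‖C.e‖ = C.δ / 2 := by field_simp
    rw [this]; exact half_lt_self C.δ_pos
  · have : C.e 0 * (C.e + (C.δ / (2 * ‖C.e‖)) • perp C.e) 1 -
        C.e 1 * (C.e + (C.δ / (2 * ‖C.e‖)) • perp C.e) 0 = (C.δ / (2 * ‖C.e‖)) * ‖C.e‖ ^ 2 := by
      rw [plane_norm_sq]
      simp; ring
    rw [this]; positivity

theorem pd_mul_test {η φ : Plane → ℝ} (hη : ContDiff ℝ 1 η) (hφ : ContDiff ℝ 1 φ) (j : Fin 2) :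
    pd j (fun x => η x * φ x) = fun x => η x * pd j φ x + pd j η x * φ x := by
  ext x
  rw [pd_mul (hη.differentiable (by simp) x) (hφ.differentiable (by simp) x)]
  ring

theorem h1n_mul_smooth_le {D B : Set Plane} (hB : MeasurableSet B) {η φ : Plane → ℝ} {M : ℝ≥0}
    (hη : ContDiff ℝ 1 η) (h0 : ∀ x, |η x| ≤ M) (h1 : ∀ j x, |pd j η x| ≤ M)
    (hs : tsupport η ⊆ B) (hφ : ContDiff ℝ 1 φ) :
    h1n D (fun x => η x * φ x) (fun j => pd j fun x => η x * φ x) ≤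
      (4 * M) * h1n (D ∩ B) φ (fun j => pd j φ) := by
  simp only [pd_mul_test hη hφ]
  exact h1n_mul_le hB h0 h1 (fun x hx => image_eq_zero_of_notMem_tsupport fun hh => hx (hs hh))
    (fun j x hx => image_eq_zero_of_notMem_tsupport fun hh => hx (hs (tsupport_pd_subset η j hh)))
    hη.continuous (continuous_pd hη) hφ.continuous.aestronglyMeasurable
    fun j => (continuous_pd hφ j).aestronglyMeasurable

namespace IsSmoothBody

variable {S : Set Plane} (hS : IsSmoothBody S)
include hS

theorem exists_L4_test : ∃ A : ℝ≥0, ∀ φ, IsTest univ φ →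
    eLpNorm φ 4 (volume.restrict Sᶜ) ≤ A * h1n Sᶜ φ (fun j => pd j φ) := by
  obtain ⟨ι, _, C, η, hη, hsum⟩ := hS.exists_partition
  have hm : MeasurableSet Sᶜ := hS.isOpen_compl.measurableSet
  choose w hw hdet using fun k => (C k).exists_second_direction
  choose A hA using fun k => exists_L4_local (hdet k)
  choose M hM0 hM1 using fun k => exists_bound_test (hη k).contDiff_one (hη k).2.1
  obtain ⟨A0, hA0⟩ := exists_L4_local (v := !₂[1, 0]) (w := !₂[0, 1]) (by simp)
  set η0 : Plane → ℝ := fun x => 1 - ∑ k, η k x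
  have hη0 : ContDiff ℝ 1 η0 := contDiff_const.sub (ContDiff.sum fun k _ => (hη k).contDiff_one)
  set M0 : ℝ≥0 := 1 + ∑ k, M k
  have hM00 : ∀ x, |η0 x| ≤ M0 := fun x => by
    calc |η0 x| ≤ |1| + |∑ k, η k x| := abs_sub _ _
      _ ≤ 1 + ∑ k, |η k x| := by rw [abs_one]; gcongr; exact Finset.abs_sum_le_sum_abs _ _
      _ ≤ 1 + ∑ k, (M k : ℝ) := by gcongr with k; exact hM0 k x
      _ = M0 := by simp [M0]
  have hM01 : ∀ j x, |pd j η0 x| ≤ M0 := fun j x => by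
    have e : pd j η0 x = - ∑ k, pd j (η k) x := by
      rw [← pd_sum fun k _ => (hη k).differentiableAt x]
      simp [pd, η0, fderiv_const_sub]
    rw [e, abs_neg]
    calc |∑ k, pd j (η k) x| ≤ ∑ k, |pd j (η k) x| := Finset.abs_sum_le_sum_abs _ _
      _ ≤ ∑ k, (M k : ℝ) := by gcongr with k; exact hM1 k j x
      _ ≤ M0 := by simp [M0]
  refine ⟨A0 * (4 * M0) + ∑ k, A k * (4 * M k), fun φ hφ => ?_⟩
  have b0 : eLpNorm (fun x => η0 x * φ x) 4 (volume.restrict Sᶜ) ≤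
      A0 * ((4 * M0) * h1n Sᶜ φ (fun j => pd j φ)) := by
    have hz : ∀ x ∈ frontier S, (fun x => η0 x * φ x) =ᶠ[𝓝 x] 0 := fun x hx => by
      filter_upwards [hsum x hx] with y hy
      simp [η0, hy]
    obtain ⟨c1, c2⟩ := contDiff_indicator hS.isClosed (hη0.mul hφ.contDiff_one) hz
    have hcs : HasCompactSupport (Sᶜ.indicator fun x => η0 x * φ x) := hφ.2.1.mono fun x hx => by
        have : x ∈ Sᶜ ∧ η0 x * φ x ≠ 0 := by simpa using hx
        exact right_ne_zero_of_mul this.2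
    have h := hA0 univ _ MeasurableSet.univ c1 hcs fun x _ s _ => ⟨Or.inl trivial, Or.inl trivial⟩
    rw [Measure.restrict_univ, eLpNorm_indicator_eq_eLpNorm_restrict hm] at h
    refine h.trans ?_
    gcongr
    refine le_trans (le_of_eq ?_) ((h1n_mul_smooth_le (D := Sᶜ) MeasurableSet.univ hη0 hM00 hM01
      (subset_univ _) hφ.contDiff_one).trans (by rw [inter_univ]))
    unfold h1n
    simp only [c2]
    simp only [Measure.restrict_univ, eLpNorm_indicator_eq_eLpNorm_restrict hm]
  have bk : ∀ k, eLpNorm (fun x => η k x * φ x) 4 (volume.restrict Sᶜ) ≤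
      A k * ((4 * M k) * h1n Sᶜ φ (fun j => pd j φ)) := by
    intro k
    have hDm : MeasurableSet (Sᶜ ∩ (C k).nhd) := hm.inter (C k).isOpen_nhd.measurableSet
    have hz : ∀ x, x ∉ (C k).nhd → η k x * φ x = 0 := fun x hx => by
      rw [image_eq_zero_of_notMem_tsupport fun hh => hx ((hη k).2.2 hh), zero_mul]
    have h := hA k (Sᶜ ∩ (C k).nhd) (fun x => η k x * φ x) hDm
      ((hη k).contDiff_one.mul hφ.contDiff_one) hφ.2.1.mul_left (fun x hx s hs => by
        have hd : ∀ v ∈ ball (C k).e (C k).δ,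
            x + s • v ∈ Sᶜ ∩ (C k).nhd ∨ η k (x + s • v) * φ (x + s • v) = 0 := fun v hv => by
          by_cases hb : x + s • v ∈ (C k).nhd
          · refine Or.inl ⟨(C k).cone_out hx.2 hb hs ?_ (subset_closure hx.1), hb⟩
            rw [add_sub_cancel_left]
            exact (C k).smul_mem hs hv
          · exact Or.inr (hz _ hb)
        exact ⟨hd _ (mem_ball_self (C k).δ_pos), hd _ (hw k)⟩)
    have e : eLpNorm (fun x => η k x * φ x) 4 (volume.restrict Sᶜ) =
        eLpNorm (fun x => η k x * φ x) 4 (volume.restrict (Sᶜ ∩ (C k).nhd)) := by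
      have : (fun x => η k x * φ x) = (C k).nhd.indicator fun x => η k x * φ x := by
        ext x
        by_cases hx : x ∈ (C k).nhd
        · simp [hx]
        · simp only [hx, not_false_eq_true, indicator_of_notMem]; exact hz x hx
      conv_lhs => rw [this]
      rw [eLpNorm_indicator_eq_eLpNorm_restrict (C k).isOpen_nhd.measurableSet,
        Measure.restrict_restrict (C k).isOpen_nhd.measurableSet, inter_comm]
    rw [e]
    refine h.trans ?_
    gcongr
    refine (h1n_mono inter_subset_left _ _).trans ?_
    refine (h1n_mul_smooth_le (D := Sᶜ) MeasurableSet.univ (hη k).contDiff_one (hM0 k) (hM1 k)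
      (subset_univ _) hφ.contDiff_one).trans (by rw [inter_univ])
  have hdec : φ = (fun x => η0 x * φ x) + ∑ k, fun x => η k x * φ x := by
    ext x
    simp only [Pi.add_apply, Finset.sum_apply, ← Finset.sum_mul, η0]
    ring
  have mφ : ∀ a : Plane → ℝ, Continuous a → AEStronglyMeasurable (fun x => a x * φ x)
      (volume.restrict Sᶜ) := fun a ha => (ha.mul hφ.1.continuous).aestronglyMeasurable
  calc eLpNorm φ 4 (volume.restrict Sᶜ) ≤ eLpNorm (fun x => η0 x * φ x) 4 (volume.restrict Sᶜ) +
        ∑ k, eLpNorm (fun x => η k x * φ x) 4 (volume.restrict Sᶜ) := by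
        conv_lhs => rw [hdec]
        refine (eLpNorm_add_le (mφ _ hη0.continuous) ?_ (by norm_num)).trans ?_
        · exact Finset.aestronglyMeasurable_sum _ fun k _ => mφ _ (hη k).1.continuous
        · gcongr
          exact eLpNorm_sum_le (fun k _ => mφ _ (hη k).1.continuous) (by norm_num)
    _ ≤ A0 * ((4 * M0) * h1n Sᶜ φ (fun j => pd j φ)) +
        ∑ k, A k * ((4 * M k) * h1n Sᶜ φ (fun j => pd j φ)) := by
        gcongr with k
        exact bk k
    _ = _ := by
        push_cast
        rw [add_mul, Finset.sum_mul]
        simp only [mul_assoc]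

theorem exists_seq_approx {f : Plane → ℝ} {G : Fin 2 → Plane → ℝ} (h : IsH1 Sᶜ f G) :
    ∃ φ : ℕ → Plane → ℝ, (∀ n, IsTest univ (φ n)) ∧
      Tendsto (fun n => h1n Sᶜ (φ n - f) (fun j => pd j (φ n) - G j)) atTop (𝓝 0) := by
  have hn : ∀ n : ℕ, ((n : ℝ≥0∞) + 1)⁻¹ ≠ 0 := fun n => by simp
  choose φ hφ e using fun n : ℕ => (hS.smoothApprox h).approx _ (hn n)
  refine ⟨φ, hφ, tendsto_of_tendsto_of_tendsto_of_le_of_le tendsto_const_nhds ?_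
    (fun _ => zero_le) e⟩
  have := ENNReal.tendsto_inv_nat_nhds_zero.comp (tendsto_add_atTop_nat 1)
  simpa [Function.comp_def] using this

/-- `H¹(F) ⊂ L⁴(F)`. -/
theorem exists_L4 : ∃ A : ℝ≥0, ∀ f G, IsH1 Sᶜ f G →
    eLpNorm f 4 (volume.restrict Sᶜ) ≤ A * h1n Sᶜ f G := by
  obtain ⟨A, hA⟩ := hS.exists_L4_test
  refine ⟨A, fun f G h => ?_⟩
  obtain ⟨φ, hφ, ht⟩ := hS.exists_seq_approx h
  have t1 : Tendsto (fun n => eLpNorm (φ n - f) 2 (volume.restrict Sᶜ)) atTop (𝓝 0) :=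
    tendsto_of_tendsto_of_tendsto_of_le_of_le tendsto_const_nhds ht (fun _ => zero_le)
      fun n => eLpNorm_le_h1n _ _ _
  have hm := tendstoInMeasure_of_tendsto_eLpNorm (by norm_num)
    (fun n => (hφ n).1.continuous.aestronglyMeasurable) h.memLp.1 t1
  obtain ⟨ns, hns, hae⟩ := hm.exists_seq_tendsto_ae
  refine (Lp.eLpNorm_lim_le_liminf_eLpNorm
    (fun n => (hφ (ns n)).1.continuous.aestronglyMeasurable) f hae).trans ?_
  have t2 : Tendsto (fun n => A * (h1n Sᶜ f G +
      h1n Sᶜ (φ (ns n) - f) (fun j => pd j (φ (ns n)) - G j))) atTop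
      (𝓝 (A * (h1n Sᶜ f G + 0))) :=
    ENNReal.Tendsto.const_mul (tendsto_const_nhds.add (ht.comp hns.tendsto_atTop))
      (Or.inr ENNReal.coe_ne_top)
  rw [add_zero] at t2
  rw [← t2.liminf_eq]
  refine liminf_le_liminf (Eventually.of_forall fun n => (hA _ (hφ (ns n))).trans ?_)
  gcongr
  have e : h1n Sᶜ (φ (ns n)) (fun j => pd j (φ (ns n))) =
      h1n Sᶜ (f + (φ (ns n) - f)) (fun j => G j + (pd j (φ (ns n)) - G j)) := by simp
  rw [e]
  exact h1n_add_le h.memLp.1 ((hφ _).1.continuous.aestronglyMeasurable.sub h.memLp.1)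
    (fun j => (h.memLp_grad j).1)
    (fun j => (continuous_pd (hφ _).contDiff_one j).aestronglyMeasurable.sub (h.memLp_grad j).1)

theorem exists_trace_inequality : ∃ (A : ℝ≥0) (R : ℝ), ∀ φ, ContDiff ℝ 1 φ →
    eLpNorm φ 2 (arcLength S) ≤ A * h1n (Sᶜ ∩ ball 0 R) φ (fun j => pd j φ) := by
  obtain ⟨ι, _, C, η, hη, hsum⟩ := hS.exists_partition
  choose A hA using fun k => (C k).exists_trace_local hS.isClosed
  choose M hM0 hM1 using fun k => exists_bound_test (hη k).contDiff_one (hη k).2.1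
  have hbd : Bornology.IsBounded (⋃ k, tsupport (η k)) :=
    (Bornology.isBounded_iUnion).2 fun k => (hη k).2.1.isCompact.isBounded
  obtain ⟨R, hR⟩ := hbd.subset_ball 0
  refine ⟨∑ k, A k * (4 * M k), R, fun φ hφ => ?_⟩
  have bk : ∀ k, eLpNorm (fun x => η k x * φ x) 2 (arcLength S) ≤
      A k * ((4 * M k) * h1n (Sᶜ ∩ ball 0 R) φ (fun j => pd j φ)) := by
    intro k
    refine (hA k _ ((hη k).contDiff_one.mul hφ) (hη k).2.1.mul_right fun x hx => ?_).trans ?_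
    · rw [image_eq_zero_of_notMem_tsupport fun hh => hx ((hη k).2.2 hh), zero_mul]
    · gcongr
      exact h1n_mul_smooth_le isOpen_ball.measurableSet (hη k).contDiff_one (hM0 k) (hM1 k)
        ((subset_iUnion _ k).trans hR) hφ
  have hdec : φ =ᵐ[arcLength S] ∑ k, fun x => η k x * φ x := by
    refine (ae_restrict_iff' isClosed_frontier.measurableSet).2 (ae_of_all _ fun x hx => ?_)
    rw [Finset.sum_apply, ← Finset.sum_mul, (hsum x hx).self_of_nhds, one_mul]
  rw [eLpNorm_congr_ae hdec]
  refine (eLpNorm_sum_le (fun k _ => ((hη k).1.continuous.mul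
    hφ.continuous).aestronglyMeasurable) (by norm_num)).trans ?_
  push_cast
  rw [Finset.sum_mul]
  gcongr with k
  rw [mul_assoc]
  exact bk k

end IsSmoothBody

/-! ### Rigid motions -/

/-- The rigid velocity field `ℓ + r x^⊥`. -/
noncomputable def rigid (q : Plane × ℝ) (x : Plane) : Plane := q.1 + q.2 • perp x

theorem rigid_apply_zero (q : Plane × ℝ) (x : Plane) : rigid q x 0 = q.1 0 - q.2 * x 1 := by
  simp [rigid]; ring

theorem rigid_apply_one (q : Plane × ℝ) (x : Plane) : rigid q x 1 = q.1 1 + q.2 * x 0 := by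
  simp [rigid]

theorem continuous_perp : Continuous perp := by
  unfold perp
  refine (PiLp.continuous_toLp 2 _).comp (continuous_pi fun i => ?_)
  fin_cases i <;> simp <;> fun_prop

theorem continuous_rigid (q : Plane × ℝ) : Continuous (rigid q) :=
  continuous_const.add (continuous_perp.const_smul q.2)

theorem rigid_unique {U : Set Plane} (hU : IsOpen U) (hne : U.Nonempty) {q q' : Plane × ℝ}
    (h : rigid q =ᵐ[volume.restrict U] rigid q') : q = q' := by
  have heq : EqOn (rigid q) (rigid q') U :=
    Measure.eqOn_open_of_ae_eq h hU (continuous_rigid q).continuousOn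
      (continuous_rigid q').continuousOn
  obtain ⟨x, hx⟩ := hne
  obtain ⟨ε, hε, hb⟩ := Metric.isOpen_iff.1 hU x hx
  have hx' : x + (ε / 2) • EuclideanSpace.single 0 1 ∈ U := hb (by
    rw [mem_ball_iff_norm, add_sub_cancel_left, norm_smul]
    simp [abs_of_pos hε]; linarith)
  have e1 := congrArg (fun y : Plane => y 1) (heq hx)
  have e2 := congrArg (fun y : Plane => y 1) (heq hx')
  have e3 := congrArg (fun y : Plane => y 0) (heq hx)
  simp only [rigid_apply_one, rigid_apply_zero] at e1 e2 e3
  simp at e2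
  have h2 : q.2 = q'.2 := by
    have : (q.2 - q'.2) * (ε / 2) = 0 := by linear_combination e2 - e1
    have := (mul_eq_zero.1 this).resolve_right (half_pos hε).ne'
    linarith
  refine Prod.ext ?_ h2
  rw [h2] at e1 e3
  ext i
  fin_cases i
  · simpa using e3
  · simpa using e1

theorem pd_comm {u : Plane → ℝ} (hu : ContDiff ℝ ∞ u) (i j : Fin 2) (x : Plane) :
    pd i (pd j u) x = pd j (pd i u) x := by
  have hd : Differentiable ℝ (fderiv ℝ u) := (hu.fderiv_right (m := ∞) (by simp)).differentiable
    (by simp)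
  have e : ∀ i j, pd i (pd j u) x =
      fderiv ℝ (fderiv ℝ u) x (EuclideanSpace.single i 1) (EuclideanSpace.single j 1) := by
    intro i j
    have h1 : HasFDerivAt (pd j u) ((ContinuousLinearMap.apply ℝ ℝ
        (EuclideanSpace.single j 1 : Plane)).comp (fderiv ℝ (fderiv ℝ u) x)) x :=
      (ContinuousLinearMap.apply ℝ ℝ (EuclideanSpace.single j 1 : Plane)).hasFDerivAt.comp x
        (hd x).hasFDerivAt
    rw [pd, h1.fderiv]; simp
  rw [e, e]
  exact (hu.contDiffAt.isSymmSndFDerivAt (by simpa using WithTop.coe_le_coe.2 (le_top : (2 : ℕ∞) ≤ ⊤))) _ _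

theorem eqOn_const_of_pd_eq_zero {f : Plane → ℝ} {U : Set Plane} (hU : IsOpen U)
    (hc : IsPreconnected U) (hf : Differentiable ℝ f) (h : ∀ j, ∀ x ∈ U, pd j f x = 0)
    {x y : Plane} (hx : x ∈ U) (hy : y ∈ U) : f x = f y := by
  refine hU.is_const_of_fderiv_eq_zero hc hf.differentiableOn (fun z hz => ?_) hx hy
  ext v
  rw [ContDiff.pd_sum_smul, h 0 z hz, h 1 z hz]; simp

theorem exists_rigid_of_smooth {u : Fin 2 → Plane → ℝ} (hu : ∀ i, ContDiff ℝ ∞ (u i))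
    {U : Set Plane} (hU : IsOpen U) (hc : IsPreconnected U) (hne : U.Nonempty)
    (h : ∀ i j, ∀ x ∈ U, pd j (u i) x + pd i (u j) x = 0) :
    ∃ q : Plane × ℝ, ∀ x ∈ U, ∀ i, u i x = rigid q x i := by
  obtain ⟨p, hp⟩ := hne
  have hd : ∀ i, Differentiable ℝ (u i) := fun i => (hu i).differentiable (by simp)
  have h00 : ∀ x ∈ U, pd 0 (u 0) x = 0 := fun x hx => by have := h 0 0 x hx; linarith
  have h11 : ∀ x ∈ U, pd 1 (u 1) x = 0 := fun x hx => by have := h 1 1 x hx; linarith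
  have h01 : ∀ x ∈ U, pd 0 (u 1) x = - pd 1 (u 0) x := fun x hx => by
    have := h 0 1 x hx; linarith
  set c := pd 0 (u 1) p
  have hω : ∀ x ∈ U, pd 0 (u 1) x = c := by
    intro x hx
    refine eqOn_const_of_pd_eq_zero hU hc ((contDiff_pd (hu 1) 0).differentiable (by simp)) ?_ hx hp
    intro j x hx
    fin_cases j
    · have e : pd 0 (pd 0 (u 1)) x = pd 0 (fun y => - pd 1 (u 0) y) x :=
        pd_eq_of_eqOn hU (fun y hy => h01 y hy) 0 hx
      have e2 : pd 0 (fun y => - pd 1 (u 0) y) x = - pd 0 (pd 1 (u 0)) x := by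
        show fderiv ℝ (fun y => -pd 1 (u 0) y) x _ = _
        rw [fderiv_fun_neg]; rfl
      have e3 : pd 1 (pd 0 (u 0)) x = pd 1 (fun _ => 0) x :=
        pd_eq_of_eqOn hU (fun y hy => h00 y hy) 1 hx
      show pd 0 (pd 0 (u 1)) x = 0
      rw [e, e2, pd_comm (hu 0), e3, pd_const, neg_zero]
    · have e3 : pd 0 (pd 1 (u 1)) x = pd 0 (fun _ => 0) x :=
        pd_eq_of_eqOn hU (fun y hy => h11 y hy) 0 hx
      show pd 1 (pd 0 (u 1)) x = 0
      rw [pd_comm (hu 1), e3, pd_const]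
  have lin : ∀ i : Fin 2, Differentiable ℝ fun x : Plane => c * x i := fun i => by fun_prop
  have plin : ∀ i j : Fin 2, ∀ x, pd j (fun x : Plane => c * x i) x = if i = j then c else 0 := by
    intro i j x
    have : pd j (fun x : Plane => c * x i) x = c * pd j (fun x : Plane => x i) x := by
      rw [pd_mul (by fun_prop) (by fun_prop), pd_const]; ring
    rw [this, pd_coord]; simp
  have k0 : ∀ x ∈ U, u 0 x + c * x 1 = u 0 p + c * p 1 := fun x hx => by
    refine eqOn_const_of_pd_eq_zero (f := fun x => u 0 x + c * x 1) hU hc ((hd 0).add (lin 1))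
      (fun j x hx => ?_) hx hp
    rw [pd_add (hd 0 x) (lin 1 x), plin]
    fin_cases j
    · simpa using h00 x hx
    · have := h01 x hx
      rw [hω x hx] at this
      simp; linarith
  have k1 : ∀ x ∈ U, u 1 x + -c * x 0 = u 1 p + -c * p 0 := fun x hx => by
    have hl : Differentiable ℝ fun x : Plane => -c * x 0 := by fun_prop
    refine eqOn_const_of_pd_eq_zero (f := fun x => u 1 x + -c * x 0) hU hc ((hd 1).add hl)
      (fun j x hx => ?_) hx hp
    rw [pd_add (hd 1 x) (hl x), pd_mul (by fun_prop) (by fun_prop), pd_const, pd_coord]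
    fin_cases j
    · have := hω x hx
      simp; linarith
    · simpa using h11 x hx
  refine ⟨(!₂[u 0 p + c * p 1, u 1 p - c * p 0], c), fun x hx i => ?_⟩
  fin_cases i
  · have := k0 x hx
    simp only [Fin.zero_eta, rigid_apply_zero]
    simp; linarith
  · have := k1 x hx
    simp only [Fin.mk_one, rigid_apply_one]
    simp; linarith

theorem plane_ext {x y : Plane} (h : ∀ i, x i = y i) : x = y := by ext i; exact h i

/-- Pointwise limits of rigid motions, at almost every point of a ball, are rigid motions. -/
theorem exists_rigid_of_tendsto {U : Set Plane} (hU : IsOpen U) (hne : U.Nonempty)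
    {q : ℕ → Plane × ℝ} {φ : Plane → Plane}
    (h : ∀ᵐ x ∂(volume.restrict U), Tendsto (fun n => rigid (q n) x) atTop (𝓝 (φ x))) :
    ∃ q0, φ =ᵐ[volume.restrict U] rigid q0 := by
  have hnb : (ae ((volume : Measure Plane).restrict U)).NeBot := by
    rw [ae_neBot]
    intro h0
    rw [Measure.restrict_eq_zero] at h0
    exact (hU.measure_pos volume hne).ne' h0
  obtain ⟨a, ha⟩ := h.exists
  have hne' : ∀ᵐ x ∂((volume : Measure Plane).restrict U), x ≠ a :=
    ae_restrict_of_ae (Measure.ae_ne volume a)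
  obtain ⟨b, hb, hba⟩ := (h.and hne').exists
  have hsub : ∀ n, rigid (q n) b - rigid (q n) a = (q n).2 • perp (b - a) := fun n => by
    refine plane_ext fun i => ?_
    fin_cases i <;> simp [rigid] <;> ring
  have h2 : Tendsto (fun n => (q n).2) atTop
      (𝓝 (⟪perp (b - a), φ b - φ a⟫ / ‖perp (b - a)‖ ^ 2)) := by
    have hp : ‖perp (b - a)‖ ≠ 0 := by rw [perp_norm, norm_ne_zero_iff]; exact sub_ne_zero.2 hba
    have t : Tendsto (fun n => ⟪perp (b - a), rigid (q n) b - rigid (q n) a⟫ /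
        ‖perp (b - a)‖ ^ 2) atTop (𝓝 (⟪perp (b - a), φ b - φ a⟫ / ‖perp (b - a)‖ ^ 2)) :=
      ((tendsto_const_nhds.inner (hb.sub ha)).div_const _)
    refine t.congr fun n => ?_
    rw [hsub, real_inner_smul_right, real_inner_self_eq_norm_sq]
    field_simp
  have h1 : Tendsto (fun n => (q n).1) atTop (𝓝 (φ a -
      (⟪perp (b - a), φ b - φ a⟫ / ‖perp (b - a)‖ ^ 2) • perp a)) := by
    refine (ha.sub (h2.smul_const (perp a))).congr fun n => ?_
    simp [rigid]
  refine ⟨(φ a - (⟪perp (b - a), φ b - φ a⟫ / ‖perp (b - a)‖ ^ 2) • perp a,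
    ⟪perp (b - a), φ b - φ a⟫ / ‖perp (b - a)‖ ^ 2), ?_⟩
  filter_upwards [h] with x hx
  exact tendsto_nhds_unique hx (h1.add (h2.smul_const (perp x)))

theorem exists_rigid_local {S : Set Plane} {φ : Plane → Plane} (hφ : ∀ i, MemLp (fun x => φ x i) 2)
    (hd : WeakDeformationFree S φ) {p : Plane} (hp : p ∈ interior S) :
    ∃ r > 0, ∃ q, φ =ᵐ[volume.restrict (ball p r)] rigid q := by
  obtain ⟨ε, hε, hb⟩ := Metric.isOpen_iff.1 isOpen_interior p hp
  refine ⟨ε / 2, half_pos hε, ?_⟩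
  obtain ⟨K, hK, hs⟩ := exists_isMollifier_small
  have lf : ∀ i, LocallyIntegrable fun x => φ x i := fun i => (hφ i).locallyIntegrable (by norm_num)
  set u : ℕ → Fin 2 → Plane → ℝ := fun n i => mol (K n) fun x => φ x i
  have hu : ∀ n i, ContDiff ℝ ∞ (u n i) := fun n i => mol_contDiff (lf i) (hK.smooth n) (hK.compact n)
  have hne : (ball p (ε / 2)).Nonempty := ⟨p, mem_ball_self (half_pos hε)⟩
  obtain ⟨n0, hn0⟩ := (tendsto_one_div_add_atTop_nhds_zero_nat.eventually
    (gt_mem_nhds (half_pos hε))).exists_forall_of_atTop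
  have hrig : ∀ n, n0 ≤ n → ∃ q : Plane × ℝ, ∀ x ∈ ball p (ε / 2), ∀ i, u n i x = rigid q x i := by
    intro n hn
    refine exists_rigid_of_smooth (hu n) isOpen_ball (convex_ball _ _).isPreconnected hne ?_
    intro i j x hx
    have ht : IsTest (interior S) fun y => K n (x - y) :=
      IsTest.of_kernel (hK.smooth n) (hK.compact n) fun z hz => hb (by
        rw [mem_ball_iff_norm] at hx ⊢
        have h1 := (hs n z hz).trans (hn0 n hn)
        calc ‖x - z - p‖ = ‖(x - p) - z‖ := by congr 1; abel
          _ ≤ ‖x - p‖ + ‖z‖ := norm_sub_le _ _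
          _ < ε := by linarith)
    have e := hd _ ht i j
    simp only [pd_kernel (hK.smooth n)] at e
    have c := fun j => (contDiff_pd (hK.smooth n) j).continuous
    have s := fun j => hasCompactSupport_pd (hK.compact n) j
    have i1 := integrable_mul_kernel (lf i) (c j) (s j) x
    have i2 := integrable_mul_kernel (lf j) (c i) (s i) x
    simp only [u]
    rw [pd_mol (lf i) (hK.smooth n) (hK.compact n), pd_mol (lf j) (hK.smooth n) (hK.compact n),
      mol, mol, ← integral_add i1 i2]
    simp only [mul_neg, ← neg_add, integral_neg, neg_eq_zero] at e
    exact e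
  have tm := fun i => tendstoInMeasure_of_tendsto_eLpNorm (by norm_num)
    (fun n => (hu n i).continuous.aestronglyMeasurable) (hφ i).1 (hK.tendsto_eLpNorm (hφ i))
  obtain ⟨ns, hns, h0⟩ := (tm 0).exists_seq_tendsto_ae
  have tm1 : TendstoInMeasure volume (fun n => u (ns n) 1) atTop fun x => φ x 1 := fun δ hδ =>
    (tm 1 δ hδ).comp hns.tendsto_atTop
  obtain ⟨ms, hms, h1⟩ := tm1.exists_seq_tendsto_ae
  choose! q hq using hrig
  have hnm : Tendsto (fun n => ns (ms n)) atTop atTop := hns.tendsto_atTop.comp hms.tendsto_atTop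
  refine exists_rigid_of_tendsto isOpen_ball hne (q := fun n => q (ns (ms n))) ?_
  refine (ae_restrict_iff' isOpen_ball.measurableSet).2 ?_
  filter_upwards [h0, h1] with x hx0 hx1 hxb
  have key : ∀ i, Tendsto (fun n => rigid (q (ns (ms n))) x i) atTop (𝓝 (φ x i)) := by
    intro i
    have hi : Tendsto (fun n => u (ns (ms n)) i x) atTop (𝓝 (φ x i)) := by
      fin_cases i
      · exact hx0.comp hms.tendsto_atTop
      · exact hx1
    refine hi.congr' ?_
    filter_upwards [hnm.eventually_ge_atTop n0] with n hn
    exact hq _ hn x hxb i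
  have := (PiLp.continuous_toLp 2 (fun _ : Fin 2 => ℝ)).continuousAt.tendsto.comp
    (tendsto_pi_nhds.2 key)
  exact this

namespace IsSmoothBody

variable {S : Set Plane} (hS : IsSmoothBody S)
include hS

/-- A field without deformation in the body is rigid there. -/
theorem exists_rigid {φ : Plane → Plane} (hφ : ∀ i, MemLp (fun x => φ x i) 2)
    (hd : WeakDeformationFree S φ) : ∃ q, φ =ᵐ[volume.restrict S] rigid q := by
  obtain ⟨p0, hp0⟩ := hS.interior_nonempty
  choose! r hr q hq using fun p (hp : p ∈ interior S) => exists_rigid_local hφ hd hp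
  have huniq : ∀ p ∈ interior S, ∀ p' ∈ interior S, ∀ z,
      z ∈ ball p (r p) → z ∈ ball p' (r p') → q p = q p' := by
    intro p hp p' hp' z hz hz'
    refine rigid_unique (isOpen_ball.inter isOpen_ball) ⟨z, hz, hz'⟩ ?_
    have h1 := ae_restrict_of_ae_restrict_of_subset
      (inter_subset_left (s := ball p (r p)) (t := ball p' (r p'))) (hq p hp)
    have h2 := ae_restrict_of_ae_restrict_of_subset
      (inter_subset_right (s := ball p (r p)) (t := ball p' (r p'))) (hq p' hp')
    filter_upwards [h1, h2] with x e1 e2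
    rw [← e1, e2]
  set U : Set Plane := ⋃ p ∈ {p | p ∈ interior S ∧ q p = q p0}, ball p (r p)
  set V : Set Plane := ⋃ p ∈ {p | p ∈ interior S ∧ q p ≠ q p0}, ball p (r p)
  have hUV : Disjoint U V := by
    rw [Set.disjoint_left]
    intro z hz hz'
    obtain ⟨p, ⟨hp, hpq⟩, hzp⟩ := mem_iUnion₂.1 hz
    obtain ⟨p', ⟨hp', hpq'⟩, hzp'⟩ := mem_iUnion₂.1 hz'
    exact hpq' ((huniq p hp p' hp' z hzp hzp').symm.trans hpq)
  have hcov : interior S ⊆ U ∪ V := by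
    intro p hp
    by_cases h : q p = q p0
    · exact Or.inl (mem_iUnion₂.2 ⟨p, ⟨hp, h⟩, mem_ball_self (hr p hp)⟩)
    · exact Or.inr (mem_iUnion₂.2 ⟨p, ⟨hp, h⟩, mem_ball_self (hr p hp)⟩)
  have hsub : interior S ⊆ U := hS.isPreconnected_interior.subset_left_of_subset_union
    (isOpen_biUnion fun _ _ => isOpen_ball) (isOpen_biUnion fun _ _ => isOpen_ball)
    hUV hcov ⟨p0, hp0, mem_iUnion₂.2 ⟨p0, ⟨hp0, rfl⟩, mem_ball_self (hr p0 hp0)⟩⟩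
  refine ⟨q p0, ?_⟩
  have hnull : volume ({x | φ x ≠ rigid (q p0) x} ∩ interior S) = 0 := by
    refine measure_null_of_locally_null _ fun x hx => ?_
    obtain ⟨p, ⟨hp, hpq⟩, hxp⟩ := mem_iUnion₂.1 (hsub hx.2)
    refine ⟨{x | φ x ≠ rigid (q p0) x} ∩ interior S ∩ ball p (r p),
      inter_mem_nhdsWithin _ (isOpen_ball.mem_nhds hxp), ?_⟩
    have h := (ae_restrict_iff' isOpen_ball.measurableSet).1 (hq p hp)
    rw [hpq] at h
    refine measure_mono_null (fun y hy => ?_) h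
    intro hcon
    exact hy.1.1 (hcon hy.2)
  rw [EventuallyEq, ae_restrict_iff' hS.isClosed.measurableSet]
  have hall : volume ({x | φ x ≠ rigid (q p0) x} ∩ interior S ∪ frontier S) = 0 :=
    measure_union_null hnull hS.volume_frontier
  refine measure_mono_null (fun x hx => ?_) hall
  have hx' : x ∈ S ∧ φ x ≠ rigid (q p0) x := by
    by_contra hcon
    exact hx fun hxS => by by_contra hne; exact hcon ⟨hxS, hne⟩
  by_cases hi : x ∈ interior S
  · exact Or.inl ⟨hx'.2, hi⟩
  · exact Or.inr ⟨subset_closure hx'.1, hi⟩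

theorem rigidData_eq {u : Plane → Plane} {q : Plane × ℝ}
    (h : u =ᵐ[volume.restrict S] rigid q) : rigidData S u = q := by
  have hex : ∃ q : Plane × ℝ, ∀ᵐ x ∂(volume.restrict S), u x = q.1 + q.2 • perp x := ⟨q, h⟩
  rw [rigidData, dif_pos hex]
  refine rigid_unique isOpen_interior hS.interior_nonempty
    (ae_restrict_of_ae_restrict_of_subset interior_subset ?_)
  filter_upwards [h, hex.choose_spec] with x h1 h2
  rw [← h1, h2]; rfl

theorem field_ae_rigid {X : Submodule ℝ L2Plane} (hX : X ≤ spaceH S) (φ : X) :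
    field φ =ᵐ[volume.restrict S] rigid (rigidData S (field φ)) := by
  have hm : ∀ i, MemLp (fun x => field φ x i) 2 := fun i =>
    (EuclideanSpace.proj (𝕜 := ℝ) i).comp_memLp' (Lp.memLp (φ : L2Plane))
  obtain ⟨q, hq⟩ := hS.exists_rigid hm (hX φ.2).2
  rw [hS.rigidData_eq hq]
  exact hq

end IsSmoothBody

/-! ### Decay of the circulation field -/

/-- A function that is holomorphic near infinity and vanishes there is `O(1/|z|)`, with
corresponding bounds for its derivatives. -/
theorem exists_decay_of_differentiable {f : ℂ → ℂ}
    (hd : ∀ᶠ z in Bornology.cobounded ℂ, DifferentiableAt ℂ f z)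
    (h0 : Tendsto f (Bornology.cobounded ℂ) (𝓝 0)) :
    ∃ (M : ℝ) (c : ℂ), (∀ᶠ z in Bornology.cobounded ℂ, ‖f z‖ * ‖z‖ ≤ M ∧
      ‖deriv f z‖ * ‖z‖ ^ 2 ≤ M ∧ ‖f z + z * deriv f z‖ * ‖z‖ ^ 2 ≤ M) ∧
      Tendsto (fun z => z * f z) (Bornology.cobounded ℂ) (𝓝 c) := by
  have hinv : Tendsto (fun z : ℂ => z⁻¹) (Bornology.cobounded ℂ) (𝓝[≠] 0) := tendsto_inv₀_cobounded'
  set g : ℂ → ℂ := Function.update (fun w => f w⁻¹) 0 0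
  have hg : ∀ w, w ≠ 0 → g w = f w⁻¹ := fun w hw => Function.update_of_ne hw _ _
  have hgc : ContinuousAt g 0 := continuousAt_update_same.2 (h0.comp tendsto_inv₀_nhdsNE_zero)
  have hgd : ∀ᶠ w in 𝓝[≠] (0 : ℂ), DifferentiableAt ℂ g w := by
    filter_upwards [tendsto_inv₀_nhdsNE_zero.eventually hd, self_mem_nhdsWithin] with w hw hw0
    have hw0 : w ≠ 0 := hw0
    refine (DifferentiableAt.comp w hw (differentiableAt_inv hw0)).congr_of_eventuallyEq ?_
    filter_upwards [isOpen_ne.mem_nhds hw0] with y hy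
    exact hg y hy
  have hga : AnalyticAt ℂ g 0 :=
    Complex.analyticAt_of_differentiable_on_punctured_nhds_of_continuousAt hgd hgc
  obtain ⟨p, hp⟩ := hga
  set k := dslope g 0
  have hk : AnalyticAt ℂ k 0 := hp.has_fpower_series_dslope_fslope.analyticAt
  have hfk : ∀ z : ℂ, z ≠ 0 → z * f z = k z⁻¹ := by
    intro z hz
    have h1 := sub_smul_dslope g 0 z⁻¹
    rw [hg _ (inv_ne_zero hz), inv_inv, sub_zero, smul_eq_mul] at h1
    have : g 0 = 0 := Function.update_self _ _ _
    rw [this, sub_zero] at h1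
    rw [← h1, ← mul_assoc, mul_inv_cancel₀ hz, one_mul]
  have big : ∀ᶠ z in Bornology.cobounded ℂ, 1 ≤ ‖z‖ :=
    tendsto_norm_cobounded_atTop.eventually_ge_atTop 1
  have ne : ∀ᶠ z in Bornology.cobounded ℂ, z ≠ 0 := big.mono fun z hz h => by norm_num [h] at hz
  have hinv0 : Tendsto (fun z : ℂ => z⁻¹) (Bornology.cobounded ℂ) (𝓝 0) :=
    hinv.mono_right nhdsWithin_le_nhds
  have b1 : ∀ᶠ z in Bornology.cobounded ℂ, ‖k z⁻¹‖ < ‖k 0‖ + 1 :=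
    hinv0.eventually (hk.continuousAt.norm.eventually (gt_mem_nhds (by linarith)))
  have b2 : ∀ᶠ z in Bornology.cobounded ℂ, ‖deriv k z⁻¹‖ < ‖deriv k 0‖ + 1 :=
    hinv0.eventually (hk.deriv.continuousAt.norm.eventually (gt_mem_nhds (by linarith)))
  have b3 : ∀ᶠ z in Bornology.cobounded ℂ, DifferentiableAt ℂ k z⁻¹ :=
    hinv0.eventually (hk.eventually_analyticAt.mono fun w hw => hw.differentiableAt)
  refine ⟨(‖k 0‖ + 1) + (‖deriv k 0‖ + 1), k 0, ?_, ?_⟩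
  · filter_upwards [ne, big, b1, b2, b3, hd] with z hz hz1 c1 c2 c3 c4
    have hzn : 0 < ‖z‖ := by linarith
    have e1 : ‖f z‖ * ‖z‖ = ‖k z⁻¹‖ := by rw [← hfk z hz, norm_mul, mul_comm]
    have e2 : f z + z * deriv f z = deriv k z⁻¹ * (-(z ^ 2)⁻¹) := by
      have d1 : HasDerivAt (fun z => z * f z) (1 * f z + z * deriv f z) z :=
        (hasDerivAt_id z).mul c4.hasDerivAt
      have d2 : HasDerivAt (fun z => k z⁻¹) (deriv k z⁻¹ * (-(z ^ 2)⁻¹)) z :=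
        c3.hasDerivAt.comp z (hasDerivAt_inv hz)
      have d3 := d2.congr_of_eventuallyEq (f₁ := fun z => z * f z) (by
        filter_upwards [isOpen_ne.mem_nhds hz] with y hy using hfk y hy)
      rw [← d1.unique d3, one_mul]
    have e3 : ‖f z + z * deriv f z‖ * ‖z‖ ^ 2 = ‖deriv k z⁻¹‖ := by
      rw [e2, norm_mul, norm_neg, norm_inv, norm_pow, mul_assoc, inv_mul_cancel₀ (by positivity),
        mul_one]
    have n1 := norm_nonneg (k z⁻¹)
    have n2 := norm_nonneg (deriv k z⁻¹)
    refine ⟨by rw [e1]; linarith, ?_, by rw [e3]; linarith⟩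
    have h5 : ‖deriv f z‖ * ‖z‖ ≤ ‖f z + z * deriv f z‖ + ‖f z‖ := by
      rw [mul_comm, ← norm_mul]
      calc ‖z * deriv f z‖ = ‖(f z + z * deriv f z) - f z‖ := by congr 1; ring
        _ ≤ _ := norm_sub_le _ _
    calc ‖deriv f z‖ * ‖z‖ ^ 2 = (‖deriv f z‖ * ‖z‖) * ‖z‖ := by ring
      _ ≤ (‖f z + z * deriv f z‖ + ‖f z‖) * ‖z‖ := by gcongr
      _ = ‖f z + z * deriv f z‖ * ‖z‖ + ‖f z‖ * ‖z‖ := by ring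
      _ ≤ ‖f z + z * deriv f z‖ * ‖z‖ ^ 2 + ‖f z‖ * ‖z‖ := by
        gcongr
        nlinarith
      _ ≤ _ := by rw [e1, e3]; linarith
  · refine (hk.continuousAt.tendsto.comp hinv0).congr' ?_
    filter_upwards [ne] with z hz
    exact (hfk z hz).symm

/-- Decay of a curl free and divergence free field that vanishes at infinity. -/
theorem exists_decay_of_div_curl {G : Plane → Plane} {R : ℝ}
    (hG : ∀ x, R < ‖x‖ → DifferentiableAt ℝ G x)
    (hdiv : ∀ x, R < ‖x‖ → pd 0 (fun y => G y 0) x + pd 1 (fun y => G y 1) x = 0)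
    (hcurl : ∀ x, R < ‖x‖ → pd 0 (fun y => G y 1) x - pd 1 (fun y => G y 0) x = 0)
    (h0 : Tendsto G (Bornology.cobounded Plane) (𝓝 0)) :
    ∃ M c : ℝ, (∀ᶠ x in Bornology.cobounded Plane, (∀ i, |G x i| * ‖x‖ ≤ M) ∧
      (∀ i j, |pd j (fun y => G y i) x| * ‖x‖ ^ 2 ≤ M) ∧
      (∀ i, |(∑ j, perp x j * pd j (fun y => G y i) x) - perp (G x) i| * ‖x‖ ^ 2 ≤ M)) ∧
      Tendsto (fun x => ⟪perp x, G x⟫) (Bornology.cobounded Plane) (𝓝 c) := by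
  set P : ℂ ≃ₗᵢ[ℝ] Plane := Complex.orthonormalBasisOneI.repr
  have P0 : ∀ z, P z 0 = z.re := fun z => by simp [P]
  have P1 : ∀ z, P z 1 = z.im := fun z => by simp [P]
  have Pone : P 1 = EuclideanSpace.single 0 1 := by
    refine plane_ext fun i => ?_
    fin_cases i
    · simp [P0]
    · simp [P1]
  have PI : P Complex.I = EuclideanSpace.single 1 1 := by
    refine plane_ext fun i => ?_
    fin_cases i
    · simp [P0]
    · simp [P1]
  set f : ℂ → ℂ := fun z => ⟨G (P z) 0, -G (P z) 1⟩
  set T : Plane →L[ℝ] ℂ := (Complex.ofRealCLM.comp (EuclideanSpace.proj 0)) -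
    (Complex.I • (Complex.ofRealCLM.comp (EuclideanSpace.proj 1)))
  have hT : ∀ y, T y = ⟨y 0, -y 1⟩ := fun y => by apply Complex.ext <;> simp [T]
  have hpd : ∀ x, R < ‖x‖ → ∀ i j, pd j (fun y => G y i) x =
      fderiv ℝ G x (EuclideanSpace.single j 1) i := fun x hx i j => by
    have := (EuclideanSpace.proj (𝕜 := ℝ) i).hasFDerivAt.comp x (hG x hx).hasFDerivAt
    rw [pd]
    exact congrArg (fun L => L (EuclideanSpace.single j 1)) this.fderiv
  have hf : ∀ z, R < ‖z‖ → HasFDerivAt f (T.comp ((fderiv ℝ G (P z)).comp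
      (P.toContinuousLinearEquiv : ℂ →L[ℝ] Plane))) z := by
    intro z hz
    have h1 : HasFDerivAt G (fderiv ℝ G (P z)) (P z) := (hG _ (by rwa [P.norm_map])).hasFDerivAt
    have h2 := T.hasFDerivAt.comp z (h1.comp z
      (P.toContinuousLinearEquiv : ℂ →L[ℝ] Plane).hasFDerivAt)
    refine h2.congr_of_eventuallyEq (Eventually.of_forall fun y => ?_)
    exact (hT _).symm
  have hfd : ∀ z, R < ‖z‖ → DifferentiableAt ℂ f z ∧
      deriv f z = ⟨pd 0 (fun y => G y 0) (P z), -pd 0 (fun y => G y 1) (P z)⟩ := by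
    intro z hz
    have hz' : R < ‖P z‖ := by rwa [P.norm_map]
    have e1 : fderiv ℝ f z 1 = ⟨pd 0 (fun y => G y 0) (P z), -pd 0 (fun y => G y 1) (P z)⟩ := by
      rw [(hf z hz).fderiv, hpd _ hz', hpd _ hz', ← hT, ← Pone]; rfl
    have e2 : fderiv ℝ f z Complex.I =
        ⟨pd 1 (fun y => G y 0) (P z), -pd 1 (fun y => G y 1) (P z)⟩ := by
      rw [(hf z hz).fderiv, hpd _ hz', hpd _ hz', ← hT, ← PI]; rfl
    have hdiff : DifferentiableAt ℂ f z := by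
      refine differentiableAt_complex_iff_differentiableAt_real.2 ⟨(hf z hz).differentiableAt, ?_⟩
      rw [e1, e2]
      have a1 := hdiv _ hz'
      have a2 := hcurl _ hz'
      apply Complex.ext
      · simp; linarith
      · simp; linarith
    refine ⟨hdiff, ?_⟩
    rw [← e1]
    have := (hdiff.hasDerivAt.hasFDerivAt.restrictScalars ℝ).fderiv
    rw [this]
    simp
  have Pc : Tendsto P (Bornology.cobounded ℂ) (Bornology.cobounded Plane) := by
    rw [← tendsto_norm_atTop_iff_cobounded]
    simpa using tendsto_norm_cobounded_atTop (E := ℂ)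
  have Pc' : Tendsto P.symm (Bornology.cobounded Plane) (Bornology.cobounded ℂ) := by
    rw [← tendsto_norm_atTop_iff_cobounded]
    simpa using tendsto_norm_cobounded_atTop (E := Plane)
  have hlarge : ∀ᶠ z in Bornology.cobounded ℂ, R < ‖z‖ :=
    tendsto_norm_cobounded_atTop.eventually_gt_atTop R
  have hf0 : Tendsto f (Bornology.cobounded ℂ) (𝓝 0) := by
    have := (T.continuous.tendsto 0).comp (h0.comp Pc)
    rw [map_zero] at this
    exact this.congr fun z => hT _
  obtain ⟨M, c, hM, hc⟩ := exists_decay_of_differentiable (hlarge.mono fun z hz => (hfd z hz).1) hf0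
  have q0 : ∀ x, (P.symm x).re = x 0 := fun x => by rw [← P0, P.apply_symm_apply]
  have q1 : ∀ x, (P.symm x).im = x 1 := fun x => by rw [← P1, P.apply_symm_apply]
  refine ⟨M, -c.im, ?_, ?_⟩
  · filter_upwards [Pc'.eventually hM, Pc'.eventually hlarge] with x ⟨m1, m2, m3⟩ hx
    have hxR : R < ‖x‖ := by rwa [P.symm.norm_map] at hx
    rw [(hfd _ hx).2] at m2 m3
    rw [P.symm.norm_map] at m1 m2 m3
    simp only [f, P.apply_symm_apply] at m1 m2 m3
    have re := fun z : ℂ => Complex.abs_re_le_norm z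
    have im := fun z : ℂ => Complex.abs_im_le_norm z
    have a1 := hdiv x hxR
    have a2 := hcurl x hxR
    have d1 : pd 1 (fun y => G y 1) x = - pd 0 (fun y => G y 0) x := by linarith
    have d2 : pd 1 (fun y => G y 0) x = pd 0 (fun y => G y 1) x := by linarith
    refine ⟨fun i => ?_, fun i j => ?_, fun i => ?_⟩
    · refine le_trans ?_ m1
      gcongr
      fin_cases i
      · exact re ⟨G x 0, -G x 1⟩
      · simpa using im ⟨G x 0, -G x 1⟩
    · refine le_trans ?_ m2
      gcongr
      have r1 := re ⟨pd 0 (fun y => G y 0) x, -pd 0 (fun y => G y 1) x⟩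
      have r2 := im ⟨pd 0 (fun y => G y 0) x, -pd 0 (fun y => G y 1) x⟩
      simp only [abs_neg] at r1 r2
      fin_cases i <;> fin_cases j
      · exact r1
      · simpa [d2] using r2
      · exact r2
      · simpa [d1] using r1
    · refine le_trans ?_ m3
      gcongr
      rw [Fin.sum_univ_two, perp_apply_zero, perp_apply_one]
      fin_cases i
      · refine le_trans (le_of_eq ?_) (im _)
        rw [← abs_neg]
        congr 1
        simp only [Complex.add_im, Complex.mul_im, q0, q1]
        simp [d2]
      · refine le_trans (le_of_eq ?_) (re _)
        rw [← abs_neg]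
        congr 1
        simp only [Complex.add_re, Complex.mul_re, q0, q1]
        simp [d1]; ring
  · refine ((Complex.continuous_im.tendsto c).comp (hc.comp Pc')).neg.congr fun x => ?_
    simp only [Function.comp, Complex.mul_im, q0, q1, f, P.apply_symm_apply, plane_inner,
      perp_apply_zero, perp_apply_one]
    ring

/-! ### Tangential divergence free fields have no flux through the boundary -/

theorem tendsto_slope_line {ρ : Plane → ℝ} (hρ : ContDiff ℝ ∞ ρ) (y v : Plane) :
    Tendsto (fun t : ℝ => t⁻¹ * (ρ (y + t • v) - ρ y)) (𝓝[>] 0) (𝓝 ⟪gradient ρ y, v⟫) := by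
  have h1 : HasDerivAt (fun t : ℝ => y + t • v) v 0 := by
    simpa using ((hasDerivAt_id (0 : ℝ)).smul_const v).const_add y
  have h2 : HasFDerivAt ρ (fderiv ℝ ρ y) (y + (0 : ℝ) • v) := by
    rw [zero_smul, add_zero]
    exact (hρ.differentiable (by simp) y).hasFDerivAt
  have h3 := hasDerivAt_iff_tendsto_slope_zero.1 (h2.comp_hasDerivAt (0 : ℝ) h1)
  rw [fderiv_eq_inner_gradient] at h3
  refine (h3.mono_left (nhdsWithin_mono _ fun t ht => ne_of_gt ht)).congr fun t => ?_
  simp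

theorem IsDefiningFunctionAt.eq_zero {S : Set Plane} (hS : IsClosed S) {y : Plane}
    (hy : y ∈ frontier S) {ρ : Plane → ℝ} (h : IsDefiningFunctionAt S y ρ) : ρ y = 0 := by
  refine le_antisymm (h.2.2.self_of_nhds.1 (hS.frontier_subset hy)) ?_
  by_contra h0
  refine hy.2 (mem_interior_iff_mem_nhds.2 ?_)
  filter_upwards [h.2.2, h.1.continuous.continuousAt.eventually (gt_mem_nhds (not_le.1 h0))]
    with x h1 h2 using h1.2 h2.le

theorem IsDefiningFunctionAt.inner_eq_zero {S : Set Plane} (hS : IsClosed S) {y : Plane}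
    (hy : y ∈ frontier S) {ρ ρ' : Plane → ℝ} (h : IsDefiningFunctionAt S y ρ)
    (h' : IsDefiningFunctionAt S y ρ') {v : Plane} (hv : ⟪v, gradient ρ' y⟫ = 0) :
    ⟪v, gradient ρ y⟫ = 0 := by
  have key : ∀ w : Plane, ⟪gradient ρ y, w⟫ < 0 → ⟪gradient ρ' y, w⟫ ≤ 0 := by
    intro w hw
    have t1 := tendsto_slope_line h.1 y w
    have t2 := tendsto_slope_line h'.1 y w
    rw [h.eq_zero hS hy] at t1
    rw [h'.eq_zero hS hy] at t2
    have hc : Tendsto (fun t : ℝ => y + t • w) (𝓝[>] 0) (𝓝 y) := by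
      have : Continuous fun t : ℝ => y + t • w := by fun_prop
      simpa using (this.tendsto 0).mono_left nhdsWithin_le_nhds
    refine le_of_tendsto t2 ?_
    filter_upwards [t1.eventually (gt_mem_nhds hw), hc.eventually h.2.2, hc.eventually h'.2.2,
      self_mem_nhdsWithin] with t a1 a2 a3 (a4 : 0 < t)
    have hi : 0 < t⁻¹ := inv_pos.2 a4
    have b1 : ρ (y + t • w) < 0 := by
      by_contra hcon
      have := mul_nonneg hi.le (not_lt.1 hcon)
      rw [sub_zero] at a1
      linarith
    have b2 := a3.1 (a2.2 b1.le)
    rw [sub_zero]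
    exact mul_nonpos_of_nonneg_of_nonpos hi.le b2
  set a := gradient ρ y
  set b := gradient ρ' y
  have ha : 0 < ⟪a, a⟫ := real_inner_self_pos.2 h.2.1
  have hb : 0 < ⟪b, b⟫ := real_inner_self_pos.2 h'.2.1
  have orth : ∀ w : Plane, ⟪a, w⟫ = 0 → ⟪b, w⟫ ≤ 0 := by
    intro w hw
    have hs : ∀ s : ℝ, 0 < s → ⟪b, w⟫ - s * ⟪b, a⟫ ≤ 0 := fun s hs => by
      have := key (w - s • a) (by
        rw [inner_sub_right, hw, inner_smul_right]; linarith [mul_pos hs ha])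
      rwa [inner_sub_right, inner_smul_right] at this
    have t : Tendsto (fun s : ℝ => ⟪b, w⟫ - s * ⟪b, a⟫) (𝓝[>] 0) (𝓝 ⟪b, w⟫) := by
      have : Continuous fun s : ℝ => ⟪b, w⟫ - s * ⟪b, a⟫ := by fun_prop
      simpa using (this.tendsto 0).mono_left nhdsWithin_le_nhds
    refine le_of_tendsto t ?_
    filter_upwards [self_mem_nhdsWithin] with s hs' using hs s hs'
  have hdet : ⟪b, perp a⟫ = 0 := by
    have h0 : ⟪a, perp a⟫ = 0 := by simp [plane_inner]; ring
    have h1 := orth (perp a) h0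
    have h2 := orth (-perp a) (by rw [inner_neg_right, h0, neg_zero])
    rw [inner_neg_right] at h2
    linarith
  simp only [plane_inner, perp_apply_zero, perp_apply_one] at *
  have : (b 0 * b 0 + b 1 * b 1) * (v 0 * a 0 + v 1 * a 1) = 0 := by
    linear_combination (a 0 * b 0 + a 1 * b 1) * hv - (b 0 * v 1 - b 1 * v 0) * hdet
  exact (mul_eq_zero.1 this).resolve_left hb.ne'

/-- The derivative of `ψ` along `G`. -/
noncomputable def along (G : Plane → Plane) (ψ : Plane → ℝ) (x : Plane) : ℝ :=
  G x 0 * pd 0 ψ x + G x 1 * pd 1 ψ x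

theorem along_eq_fderiv (G : Plane → Plane) (ψ : Plane → ℝ) (x : Plane) :
    along G ψ x = fderiv ℝ ψ x (G x) := by rw [ContDiff.pd_sum_smul]; rfl

theorem ContDiff.coord {n : WithTop ℕ∞} {G : Plane → Plane} (hG : ContDiff ℝ n G) (i : Fin 2) :
    ContDiff ℝ n fun x => G x i :=
  (EuclideanSpace.proj (𝕜 := ℝ) i).contDiff.comp hG

theorem continuous_along {G : Plane → Plane} (hG : Continuous G) {ψ : Plane → ℝ}
    (hψ : ContDiff ℝ 1 ψ) : Continuous (along G ψ) := by
  have h : ∀ i, Continuous fun x => G x i := fun i => by fun_prop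
  exact ((h 0).mul (continuous_pd hψ 0)).add ((h 1).mul (continuous_pd hψ 1))

theorem hasCompactSupport_along (G : Plane → Plane) {ψ : Plane → ℝ} (hc : HasCompactSupport ψ) :
    HasCompactSupport (along G ψ) :=
  (hc.fderiv_apply ℝ _).mul_left.add (hc.fderiv_apply ℝ _).mul_left

theorem along_eq_zero_of_notMem (G : Plane → Plane) {ψ : Plane → ℝ} {x : Plane}
    (hx : x ∉ tsupport ψ) : along G ψ x = 0 := by
  rw [along_eq_fderiv]
  have : fderiv ℝ ψ x = 0 := by
    by_contra h
    exact hx (support_fderiv_subset ℝ h)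
  rw [this]; rfl

theorem along_mul (G : Plane → Plane) {a b : Plane → ℝ} (ha : ContDiff ℝ 1 a)
    (hb : ContDiff ℝ 1 b) (x : Plane) :
    along G (fun y => a y * b y) x = a x * along G b x + along G a x * b x := by
  simp only [along, pd_mul_test ha hb]; ring

namespace IsSmoothBody

variable {S : Set Plane} (hS : IsSmoothBody S)
include hS

theorem integral_along_of_eventually_eq_zero {G : Plane → Plane} (hG : ContDiff ℝ 1 G)
    (hdiv : ∀ x ∈ Sᶜ, pd 0 (fun y => G y 0) x + pd 1 (fun y => G y 1) x = 0) {ψ : Plane → ℝ}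
    (hψ : ContDiff ℝ 1 ψ) (hc : HasCompactSupport ψ) (h0 : ∀ x ∈ frontier S, ψ =ᶠ[𝓝 x] 0) :
    ∫ x in Sᶜ, along G ψ x = 0 := by
  obtain ⟨h1, h2⟩ := contDiff_indicator hS.isClosed hψ h0
  have hm : MeasurableSet Sᶜ := hS.isOpen_compl.measurableSet
  have hc' : HasCompactSupport (Sᶜ.indicator ψ) := hc.mono (fun x hx => by
      rw [Function.mem_support] at hx ⊢
      intro h; exact hx (by by_cases hxs : x ∈ Sᶜ <;> simp [hxs, h]))
  have e : Sᶜ.indicator (along G ψ) = fun x => G x 0 * pd 0 (Sᶜ.indicator ψ) x +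
      G x 1 * pd 1 (Sᶜ.indicator ψ) x := by
    ext x
    rw [h2, h2]
    by_cases hx : x ∈ Sᶜ
    · simp only [indicator_of_mem hx, along]
    · simp only [indicator_of_notMem hx, mul_zero, add_zero]
  have ii : ∀ j : Fin 2, Integrable fun x => G x j * pd j (Sᶜ.indicator ψ) x := fun j =>
    ((hG.coord j).continuous.mul (continuous_pd h1 j)).integrable_of_hasCompactSupport
      (hc'.fderiv_apply ℝ _).mul_left
  have ii' : ∀ j : Fin 2, Integrable fun x => pd j (fun y => G y j) x * Sᶜ.indicator ψ x := fun j =>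
    ((continuous_pd (hG.coord j) j).mul h1.continuous).integrable_of_hasCompactSupport hc'.mul_left
  rw [← integral_indicator hm, e, integral_add (ii 0) (ii 1), integral_mul_pd (hG.coord 0) h1 hc',
    integral_mul_pd (hG.coord 1) h1 hc', ← neg_add, ← integral_add (ii' 0) (ii' 1), neg_eq_zero]
  refine integral_eq_zero_of_ae (Eventually.of_forall fun x => ?_)
  by_cases hx : x ∈ Sᶜ
  · simp only [indicator_of_mem hx, ← add_mul, hdiv x hx, zero_mul, Pi.zero_apply]
  · simp only [indicator_of_notMem hx, mul_zero, add_zero, Pi.zero_apply]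

theorem inner_gradient_eq_zero {G : Plane → Plane} (hn : ∀ x ∈ frontier S, ⟪G x, bodyNormal S x⟫ = 0)
    (C : BChart S) {y : Plane} (hy : y ∈ frontier S) (hyC : y ∈ C.nhd) :
    fderiv ℝ C.ρ y (G y) = 0 := by
  have hdef : IsDefiningFunctionAt S y C.ρ := by
    refine ⟨C.smooth, fun h => ?_, ?_⟩
    · have := C.slope y hyC C.e (mem_ball_self C.δ_pos)
      rw [fderiv_eq_inner_gradient, h, inner_zero_left] at this
      exact absurd this (not_le.2 C.c_pos)
    · filter_upwards [C.isOpen_nhd.mem_nhds hyC] with x hx using C.mem_iff x hx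
  have hex : ∃ ν, IsUnitNormal S y ν := ⟨_, C.ρ, hdef, rfl⟩
  have h := hn y hy
  rw [bodyNormal, dif_pos hex] at h
  obtain ⟨ρ', hρ', e⟩ := hex.choose_spec
  rw [e, inner_smul_right] at h
  have h' := (mul_eq_zero.1 h).resolve_left (inv_ne_zero (norm_ne_zero_iff.2 hρ'.2.1))
  rw [fderiv_eq_inner_gradient, real_inner_comm]
  exact hdef.inner_eq_zero hS.isClosed hy hρ' h'

/-- Near the boundary the normal component of a tangential field is controlled by the distance to
the boundary. -/
theorem exists_normal_bound {G : Plane → Plane} (hG : ContDiff ℝ 1 G)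
    (hn : ∀ x ∈ frontier S, ⟪G x, bodyNormal S x⟫ = 0) (C : BChart S) {T : Set Plane}
    (hT : IsCompact T) (hTC : T ⊆ C.nhd) :
    ∃ ε L : ℝ, 0 < ε ∧ 0 ≤ L ∧ ∀ x ∈ Sᶜ ∩ T, C.ρ x ≤ ε → |along G C.ρ x| ≤ L * C.ρ x := by
  have hh : ContDiff ℝ 1 (along G C.ρ) := by
    have : ∀ j, ContDiff ℝ 1 (pd j C.ρ) := fun j =>
      (contDiff_pd C.smooth j).of_le (by exact_mod_cast le_top)
    exact ((hG.coord 0).mul (this 0)).add ((hG.coord 1).mul (this 1))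
  obtain ⟨L, hL⟩ := (isCompact_closedBall C.p C.r).exists_bound_of_continuousOn
    (hh.continuous_fderiv (by simp)).continuousOn
  obtain ⟨δ, hδ, hsub⟩ := hT.exists_thickening_subset_open C.isOpen_nhd hTC
  have he : 0 < ‖C.e‖ := norm_pos_iff.2 C.e_ne
  refine ⟨C.c * δ / (2 * ‖C.e‖), |L| * (‖C.e‖ / C.c), by have := C.c_pos; positivity,
    by have := C.c_pos; positivity, fun x hx hρ => ?_⟩
  have hxC := hTC hx.2
  have hρ0 : 0 < C.ρ x := by
    by_contra h
    exact hx.1 ((C.mem_iff x hxC).2 (not_lt.1 h))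
  set s1 := C.ρ x / C.c
  have hs1 : 0 < s1 := div_pos hρ0 C.c_pos
  have hmem : ∀ s ∈ Icc 0 s1, x - s • C.e ∈ C.nhd := fun s hs => by
    refine hsub (mem_thickening_iff.2 ⟨x, hx.2, ?_⟩)
    rw [dist_eq_norm, sub_sub_cancel_left, norm_neg, norm_smul, Real.norm_of_nonneg hs.1]
    have h1 : s1 ≤ δ / (2 * ‖C.e‖) := by
      rw [div_le_iff₀ C.c_pos]
      calc C.ρ x ≤ _ := hρ
        _ = _ := by ring
    calc s * ‖C.e‖ ≤ δ / (2 * ‖C.e‖) * ‖C.e‖ := by gcongr; exact hs.2.trans h1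
      _ = δ / 2 := by field_simp
      _ < δ := half_lt_self hδ
  have hend : C.ρ (x - s1 • C.e) ≤ 0 := by
    have := C.growth (hmem s1 ⟨hs1.le, le_rfl⟩) hxC hs1 (by
      rw [sub_sub_cancel]; exact mem_ball_self (mul_pos hs1 C.δ_pos))
    have e : C.c * s1 = C.ρ x := mul_div_cancel₀ _ C.c_pos.ne'
    linarith
  have hcont : Continuous fun s : ℝ => C.ρ (x - s • C.e) := by
    have := C.smooth.continuous
    fun_prop
  obtain ⟨s, hs, hs0⟩ : ∃ s ∈ Icc 0 s1, C.ρ (x - s • C.e) = 0 :=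
    intermediate_value_Icc' hs1.le hcont.continuousOn ⟨hend, by simpa using hρ0.le⟩
  set y := x - s • C.e
  have hyC : y ∈ C.nhd := hmem s hs
  have hyf : y ∈ frontier S := by
    refine ⟨subset_closure ((C.mem_iff y hyC).2 hs0.le), fun hi => ?_⟩
    have hlim : Tendsto (fun t : ℝ => y + t • C.e) (𝓝[>] 0) (𝓝 y) := by
      have : Continuous fun t : ℝ => y + t • C.e := by fun_prop
      simpa using (this.tendsto 0).mono_left nhdsWithin_le_nhds
    obtain ⟨t, ⟨h1, h2⟩, h3⟩ := ((hlim.eventually (isOpen_interior.mem_nhds hi)).and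
      (hlim.eventually (C.isOpen_nhd.mem_nhds hyC))|>.and self_mem_nhdsWithin).exists
    have h3 : 0 < t := h3
    have := C.growth hyC h2 h3 (by
      rw [add_sub_cancel_left]; exact mem_ball_self (mul_pos h3 C.δ_pos))
    have h4 := (C.mem_iff _ h2).1 (interior_subset h1)
    nlinarith [mul_pos C.c_pos h3]
  have hy0 : along G C.ρ y = 0 := by
    rw [along_eq_fderiv]; exact hS.inner_gradient_eq_zero hn C hyf hyC
  have hlip := (convex_ball C.p C.r).norm_image_sub_le_of_norm_fderiv_le (𝕜 := ℝ)
    (f := along G C.ρ) (C := |L|) (fun z _ => hh.differentiable (by simp) z)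
    (fun z hz => (hL z (ball_subset_closedBall hz)).trans (le_abs_self L)) hyC hxC
  rw [hy0, sub_zero, Real.norm_eq_abs] at hlip
  refine hlip.trans ?_
  rw [mul_assoc]
  gcongr
  rw [show x - y = s • C.e by simp [y], norm_smul, Real.norm_of_nonneg hs.1]
  calc s * ‖C.e‖ ≤ s1 * ‖C.e‖ := by gcongr; exact hs.2
    _ = _ := by simp only [s1]; ring

theorem integral_along_of_tsupport_subset {G : Plane → Plane} (hG : ContDiff ℝ 1 G)
    (hdiv : ∀ x ∈ Sᶜ, pd 0 (fun y => G y 0) x + pd 1 (fun y => G y 1) x = 0)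
    (hn : ∀ x ∈ frontier S, ⟪G x, bodyNormal S x⟫ = 0) (C : BChart S) {ψ : Plane → ℝ}
    (hψ : ContDiff ℝ 1 ψ) (hc : HasCompactSupport ψ) (hs : tsupport ψ ⊆ C.nhd) :
    ∫ x in Sᶜ, along G ψ x = 0 := by
  obtain ⟨ε, L, hε, hL, hb⟩ := hS.exists_normal_bound hG hn C hc hs
  obtain ⟨M, hM, hcut⟩ := exists_deriv_cutProfile_bound
  have hcp : ContDiff ℝ 1 cutProfile := contDiff_cutProfile (n := 1)
  have hρ1 : ContDiff ℝ 1 C.ρ := C.smooth.of_le (by exact_mod_cast le_top)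
  set θ : ℕ → Plane → ℝ := fun n x => 1 - cutProfile (n * C.ρ x)
  have hθ : ∀ n, ContDiff ℝ 1 (θ n) := fun n =>
    contDiff_const.sub (hcp.comp (contDiff_const.mul hρ1))
  have hθd : ∀ n x, along G (θ n) x = -(deriv cutProfile (n * C.ρ x) * (n * along G C.ρ x)) := by
    intro n x
    have h1 : HasFDerivAt (fun x => (n : ℝ) * C.ρ x) ((n : ℝ) • fderiv ℝ C.ρ x) x :=
      (hρ1.differentiable (by simp) x).hasFDerivAt.const_mul _
    have h2 := (hcp.differentiable (by simp) (n * C.ρ x)).hasDerivAt.comp_hasFDerivAt x h1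
    have h3 := (h2.const_sub 1).fderiv
    rw [along_eq_fderiv, along_eq_fderiv]
    refine (congrArg (fun A => A (G x)) h3).trans ?_
    simp
  have hzero : ∀ n, ∫ x in Sᶜ, along G (fun y => θ n y * ψ y) x = 0 := by
    intro n
    refine hS.integral_along_of_eventually_eq_zero hG hdiv ((hθ n).mul hψ) hc.mul_left ?_
    intro x hx
    by_cases hxC : x ∈ C.nhd
    · have h0 : (n : ℝ) * C.ρ x < 1 := by rw [C.eq_zero_of_mem_frontier hS.isClosed hxC hx]; simp
      have hcon : Continuous fun y => (n : ℝ) * C.ρ y := continuous_const.mul hρ1.continuous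
      filter_upwards [hcon.continuousAt.eventually (gt_mem_nhds h0)] with y hy
      simp [θ, cutProfile_one hy.le]
    · have : (tsupport ψ)ᶜ ∈ 𝓝 x := (isClosed_tsupport ψ).isOpen_compl.mem_nhds fun h => hxC (hs h)
      filter_upwards [this] with y hy
      simp [image_eq_zero_of_notMem_tsupport hy]
  simp only [along_mul G (hθ _) hψ] at hzero
  have hpos : ∀ x ∈ Sᶜ, x ∈ tsupport ψ → 0 < C.ρ x := fun x hx hxs => by
    by_contra h
    exact hx ((C.mem_iff x (hs hxs)).2 (not_lt.1 h))
  have hm : MeasurableSet Sᶜ := hS.isOpen_compl.measurableSet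
  have iA : Integrable (along G ψ) := (continuous_along hG.continuous hψ).integrable_of_hasCompactSupport
    (hasCompactSupport_along G hc)
  have iψ : Integrable ψ := hψ.continuous.integrable_of_hasCompactSupport hc
  have hlim : Tendsto (fun n => ∫ x in Sᶜ, (θ n x * along G ψ x + along G (θ n) x * ψ x)) atTop
      (𝓝 (∫ x in Sᶜ, along G ψ x)) := by
    refine tendsto_integral_filter_of_dominated_convergence
      (fun x => 2 * |along G ψ x| + M * (2 * L) * |ψ x|) ?_ ?_ ?_ ?_
    · exact Eventually.of_forall fun n => (((hθ n).continuous.mul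
        (continuous_along hG.continuous hψ)).add ((continuous_along hG.continuous (hθ n)).mul
        hψ.continuous)).aestronglyMeasurable
    · have hbig : ∀ᶠ n : ℕ in atTop, 2 / ε ≤ (n : ℝ) ∧ 1 ≤ (n : ℝ) :=
        (tendsto_natCast_atTop_atTop.eventually_ge_atTop _).and
          (tendsto_natCast_atTop_atTop.eventually_ge_atTop _)
      filter_upwards [hbig] with n ⟨hn1, hn2⟩
      filter_upwards [ae_restrict_mem hm] with x hx
      have hθb : |θ n x| ≤ 2 := by
        have := abs_le.1 (abs_cutProfile_le (n * C.ρ x))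
        rw [abs_le]; constructor <;> simp only [θ] <;> linarith [this.1, this.2]
      rw [Real.norm_eq_abs]
      refine (abs_add_le _ _).trans (add_le_add ?_ ?_)
      · rw [abs_mul]; gcongr
      · rw [abs_mul]
        by_cases hxs : x ∈ tsupport ψ
        · gcongr
          have hp := hpos x hx hxs
          rw [hθd, abs_neg, abs_mul]
          have hn0 : (0 : ℝ) < n := by linarith
          by_cases hle : (n : ℝ) * C.ρ x ≤ 2
          · have hρε : C.ρ x ≤ ε := by
              have : C.ρ x ≤ 2 / n := by rwa [le_div_iff₀ hn0, mul_comm]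
              refine this.trans ?_
              rw [div_le_iff₀ hε] at hn1
              rw [div_le_iff₀ hn0]; linarith
            have := hb x ⟨hx, hxs⟩ hρε
            gcongr
            · exact hcut _
            · rw [abs_mul, Nat.abs_cast]
              calc (n : ℝ) * |along G C.ρ x| ≤ n * (L * C.ρ x) := by gcongr
                _ = L * (n * C.ρ x) := by ring
                _ ≤ L * 2 := by gcongr
                _ = 2 * L := by ring
          · rw [deriv_cutProfile_high (not_le.1 hle), abs_zero, zero_mul]
            positivity
        · rw [image_eq_zero_of_notMem_tsupport hxs, abs_zero, mul_zero, mul_zero]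
    · exact ((iA.abs.const_mul 2).add (iψ.abs.const_mul _)).integrableOn
    · filter_upwards [ae_restrict_mem hm] with x hx
      refine tendsto_const_nhds.congr' ?_
      by_cases hxs : x ∈ tsupport ψ
      · have hp := hpos x hx hxs
        have : ∀ᶠ n : ℕ in atTop, 2 < (n : ℝ) * C.ρ x :=
          (tendsto_natCast_atTop_atTop.atTop_mul_const hp).eventually_gt_atTop 2
        filter_upwards [this] with n hn
        rw [hθd, deriv_cutProfile_high hn]
        simp [θ, cutProfile_zero hn.le]
      · refine Eventually.of_forall fun n => ?_
        simp only [along_eq_zero_of_notMem G hxs, image_eq_zero_of_notMem_tsupport hxs]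
        simp
  exact tendsto_nhds_unique hlim (by simpa only [hzero] using tendsto_const_nhds)

/-- A divergence free field that is tangential at the boundary has no flux. -/
theorem integral_along_eq_zero {G : Plane → Plane} (hG : ContDiff ℝ 1 G)
    (hdiv : ∀ x ∈ Sᶜ, pd 0 (fun y => G y 0) x + pd 1 (fun y => G y 1) x = 0)
    (hn : ∀ x ∈ frontier S, ⟪G x, bodyNormal S x⟫ = 0) {ψ : Plane → ℝ}
    (hψ : ContDiff ℝ 1 ψ) (hc : HasCompactSupport ψ) : ∫ x in Sᶜ, along G ψ x = 0 := by
  obtain ⟨ι, _, C, η, hη, hsum⟩ := hS.exists_partition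
  have hη1 : ∀ k, ContDiff ℝ 1 (η k) := fun k => (hη k).contDiff_one
  have h1 : ∀ k, ∫ x in Sᶜ, along G (fun y => η k y * ψ y) x = 0 := fun k =>
    hS.integral_along_of_tsupport_subset hG hdiv hn (C k) ((hη1 k).mul hψ) hc.mul_left
      (tsupport_mul_subset_left.trans (hη k).2.2)
  set η0 : Plane → ℝ := fun y => 1 - ∑ k, η k y
  have hη0 : ContDiff ℝ 1 η0 := contDiff_const.sub (ContDiff.sum fun k _ => hη1 k)
  have h0 : ∫ x in Sᶜ, along G (fun y => η0 y * ψ y) x = 0 := by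
    refine hS.integral_along_of_eventually_eq_zero hG hdiv (hη0.mul hψ) hc.mul_left fun x hx => ?_
    filter_upwards [hsum x hx] with y hy
    simp [η0, hy]
  have hi : ∀ {a : Plane → ℝ}, ContDiff ℝ 1 a →
      IntegrableOn (along G (fun y => a y * ψ y)) Sᶜ := fun ha =>
    ((continuous_along hG.continuous (ha.mul hψ)).integrable_of_hasCompactSupport
      (hasCompactSupport_along G hc.mul_left)).integrableOn
  have e : ∀ x, along G ψ x = along G (fun y => η0 y * ψ y) x +
      ∑ k, along G (fun y => η k y * ψ y) x := by
    intro x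
    have hd : ∀ k, DifferentiableAt ℝ (fun y => η k y * ψ y) x := fun k =>
      ((hη1 k).mul hψ).differentiable (by simp) x
    have e1 : ψ = fun y => η0 y * ψ y + ∑ k, η k y * ψ y := by
      ext y
      rw [← Finset.sum_mul]; simp only [η0]; ring
    have hs : HasFDerivAt (fun y => ∑ k, η k y * ψ y) (∑ k, fderiv ℝ (fun y => η k y * ψ y) x) x :=
      HasFDerivAt.fun_sum fun k _ => (hd k).hasFDerivAt
    have hs0 := ((hη0.mul hψ).differentiable (by simp) x).hasFDerivAt.add hs
    simp only [along_eq_fderiv]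
    conv_lhs => rw [e1]
    refine (congrArg (fun A => A (G x)) hs0.fderiv).trans ?_
    simp
  simp only [e]
  rw [integral_add (hi hη0) (integrable_finsetSum _ fun k _ => hi (hη1 k)),
    integral_finsetSum _ fun k _ => hi (hη1 k), h0]
  simp [h1]

end IsSmoothBody

/-! ### The circulation field -/

/-- The derivative in the direction of `x^⊥`, corrected by the rotation of the field itself. -/
noncomputable def angular (G : Plane → Plane) (x : Plane) (i : Fin 2) : ℝ :=
  along perp (fun y => G y i) x - perp (G x) i

/-- The properties of the circulation field that matter for the forms. -/
structure CircData (S : Set Plane) (H : Plane → Plane) where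
  G : Plane → Plane
  M : ℝ
  c : ℝ
  M_nonneg : 0 ≤ M
  contDiff : ContDiff ℝ 1 G
  eqOn : EqOn H G (closure Sᶜ)
  div : ∀ x ∈ Sᶜ, pd 0 (fun y => G y 0) x + pd 1 (fun y => G y 1) x = 0
  curl : ∀ x ∈ Sᶜ, pd 0 (fun y => G y 1) x = pd 1 (fun y => G y 0) x
  bound : ∀ x ∈ Sᶜ, ∀ i, |G x i| ≤ M / (1 + ‖x‖)
  bound_pd : ∀ x ∈ Sᶜ, ∀ i j, |pd j (fun y => G y i) x| ≤ M / (1 + ‖x‖) ^ 2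
  bound_angular : ∀ x ∈ Sᶜ, ∀ i, |angular G x i| ≤ M / (1 + ‖x‖) ^ 2
  tendsto : Tendsto (fun x => ⟪perp x, G x⟫) (Bornology.cobounded Plane) (𝓝 c)
  flux : ∀ ψ, ContDiff ℝ 1 ψ → HasCompactSupport ψ → ∫ x in Sᶜ, along G ψ x = 0
  ae_zero : H =ᵐ[volume.restrict S] 0

theorem continuous_angular {G : Plane → Plane} (hG : ContDiff ℝ 1 G) (i : Fin 2) :
    Continuous fun x => angular G x i :=
  (continuous_along continuous_perp (hG.coord i)).sub
    ((EuclideanSpace.proj (𝕜 := ℝ) i).continuous.comp (continuous_perp.comp hG.continuous))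

theorem IsCirculationField.exists_data {S : Set Plane} (hS : IsSmoothBody S) {H : Plane → Plane}
    (hH : IsCirculationField S H) : Nonempty (CircData S H) := by
  obtain ⟨G, hG, he⟩ := hH.regular
  have hloc : ∀ x ∈ Sᶜ, ∀ i j, classicalGrad H x (i, j) = pd j (fun y => G y i) x := by
    intro x hx i j
    have e1 : H =ᶠ[𝓝 x] G := by
      filter_upwards [hS.isOpen_compl.mem_nhds hx] with y hy using he (subset_closure hy)
    have e2 := (EuclideanSpace.proj (𝕜 := ℝ) i).hasFDerivAt.comp x
      (hG.differentiable (by simp) x).hasFDerivAt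
    have e3 : pd j (fun y => G y i) x = fderiv ℝ G x (EuclideanSpace.single j 1) i :=
      congrArg (fun L => L (EuclideanSpace.single j 1)) e2.fderiv
    rw [e3, classicalGrad, e1.fderiv_eq]
  have hdiv : ∀ x ∈ Sᶜ, pd 0 (fun y => G y 0) x + pd 1 (fun y => G y 1) x = 0 := fun x hx => by
    have := hH.div_eq_zero x hx
    rwa [hloc x hx, hloc x hx] at this
  have hcurl : ∀ x ∈ Sᶜ, pd 0 (fun y => G y 1) x - pd 1 (fun y => G y 0) x = 0 := fun x hx => by
    have := hH.curl_eq_zero x hx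
    rwa [hloc x hx, hloc x hx] at this
  obtain ⟨R, hR⟩ := hS.isBounded.subset_closedBall 0
  have hout : ∀ x, R < ‖x‖ → x ∈ Sᶜ := fun x hx hxS => by
    have := hR hxS
    rw [mem_closedBall_zero_iff] at this
    linarith
  have hlarge : ∀ᶠ x in Bornology.cobounded Plane, R < ‖x‖ :=
    tendsto_norm_cobounded_atTop.eventually_gt_atTop R
  have hG0 : Tendsto G (Bornology.cobounded Plane) (𝓝 0) := by
    have := hH.vanish_at_infinity
    rw [← Metric.cobounded_eq_cocompact] at this
    refine this.congr' ?_
    filter_upwards [hlarge] with x hx using he (subset_closure (hout x hx))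
  obtain ⟨M, c, hM, hc⟩ := exists_decay_of_div_curl
    (fun x _ => hG.differentiable (by simp) x) (fun x hx => hdiv x (hout x hx))
    (fun x hx => hcurl x (hout x hx)) hG0
  obtain ⟨R', -, hR'⟩ := (hasBasis_cobounded_norm (E := Plane)).eventually_iff.1
    (hM.and (tendsto_norm_cobounded_atTop.eventually_ge_atTop 1))
  have hbd : ∀ f : Plane → ℝ, Continuous f → ∃ B, ∀ x ∈ closedBall (0 : Plane) R', ‖f x‖ ≤ B :=
    fun f hf => (isCompact_closedBall 0 R').exists_bound_of_continuousOn hf.continuousOn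
  choose B0 hB0 using fun i => hbd _ (hG.coord i).continuous
  choose B1 hB1 using fun (i : Fin 2) (j : Fin 2) => hbd _ (continuous_pd (hG.coord i) j)
  choose B2 hB2 using fun i => hbd _ (continuous_angular hG i)
  set B := ∑ i, |B0 i| + ∑ i, ∑ j, |B1 i j| + ∑ i, |B2 i|
  have s0 : 0 ≤ ∑ i, |B0 i| := Finset.sum_nonneg fun _ _ => abs_nonneg _
  have s1 : 0 ≤ ∑ i, ∑ j, |B1 i j| :=
    Finset.sum_nonneg fun _ _ => Finset.sum_nonneg fun _ _ => abs_nonneg _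
  have s2 : 0 ≤ ∑ i, |B2 i| := Finset.sum_nonneg fun _ _ => abs_nonneg _
  have b0 : ∀ i, |B0 i| ≤ B := fun i => by
    have := Finset.single_le_sum (f := fun i => |B0 i|) (fun _ _ => abs_nonneg _) (Finset.mem_univ i)
    linarith
  have b2 : ∀ i, |B2 i| ≤ B := fun i => by
    have := Finset.single_le_sum (f := fun i => |B2 i|) (fun _ _ => abs_nonneg _) (Finset.mem_univ i)
    linarith
  have b1 : ∀ i j, |B1 i j| ≤ B := fun i j => by
    have h1 := Finset.single_le_sum (f := fun j => |B1 i j|) (fun _ _ => abs_nonneg _)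
      (Finset.mem_univ j)
    have h2 := Finset.single_le_sum (f := fun i => ∑ j, |B1 i j|)
      (fun _ _ => Finset.sum_nonneg fun _ _ => abs_nonneg _) (Finset.mem_univ i)
    linarith
  set M' := B * (1 + |R'|) ^ 2 + 4 * |M|
  have hB : 0 ≤ B := by positivity
  have key : ∀ (n : ℕ) (t : ℝ) (x : Plane), n ≤ 2 → (‖x‖ ≤ R' → |t| ≤ B) →
      (R' < ‖x‖ → 1 ≤ ‖x‖ ∧ |t| * ‖x‖ ^ n ≤ M) → |t| ≤ M' / (1 + ‖x‖) ^ n := by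
    intro n t x hn h1 h2
    have hx0 := norm_nonneg x
    rw [le_div_iff₀ (by positivity)]
    rcases le_or_gt ‖x‖ R' with h | h
    · calc |t| * (1 + ‖x‖) ^ n ≤ B * (1 + |R'|) ^ n := by
            gcongr
            · exact h1 h
            · exact h.trans (le_abs_self _)
        _ ≤ B * (1 + |R'|) ^ 2 := by
            gcongr
            have := abs_nonneg R'; linarith
        _ ≤ M' := by have := abs_nonneg M; simp only [M']; linarith
    · obtain ⟨h3, h4⟩ := h2 h
      calc |t| * (1 + ‖x‖) ^ n ≤ |t| * (2 * ‖x‖) ^ n := by gcongr; linarith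
        _ = 2 ^ n * (|t| * ‖x‖ ^ n) := by rw [mul_pow]; ring
        _ ≤ 2 ^ n * |M| := by gcongr; exact h4.trans (le_abs_self _)
        _ ≤ 2 ^ 2 * |M| := by gcongr; norm_num
        _ ≤ M' := by simp only [M']; nlinarith [abs_nonneg R']
  refine ⟨⟨G, M', c, by positivity, hG, he, hdiv, fun x hx => by linarith [hcurl x hx],
    fun x hx i => ?_, fun x hx i j => ?_, fun x hx i => ?_, hc, ?_, ?_⟩⟩
  · have := key 1 (G x i) x (by norm_num)
      (fun h => (hB0 i x (by simpa using h)).trans ((le_abs_self _).trans (b0 i)))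
      (fun h => ⟨(hR' h.le).2, by simpa using (hR' h.le).1.1 i⟩)
    simpa using this
  · exact key 2 _ x le_rfl
      (fun h => (hB1 i j x (by simpa using h)).trans ((le_abs_self _).trans (b1 i j)))
      (fun h => ⟨(hR' h.le).2, (hR' h.le).1.2.1 i j⟩)
  · exact key 2 _ x le_rfl
      (fun h => (hB2 i x (by simpa using h)).trans ((le_abs_self _).trans (b2 i)))
      (fun h => ⟨(hR' h.le).2, by
        have := (hR' h.le).1.2.2 i
        rwa [Fin.sum_univ_two] at this⟩)
  · intro ψ hψ hc
    refine hS.integral_along_eq_zero hG hdiv (fun x hx => ?_) hψ hc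
    rw [← he (by rw [closure_compl]; exact hx.2)]
    exact hH.normal_eq_zero x hx
  · rw [EventuallyEq, ae_restrict_iff' hS.isClosed.measurableSet]
    refine measure_mono_null (fun x hx => ?_) hS.volume_frontier
    by_contra hf
    refine hx fun hxS => hH.eq_zero_inside x ?_
    by_contra hi
    exact hf ⟨subset_closure hxS, hi⟩

namespace CircData

variable {S : Set Plane} {H : Plane → Plane} (D : CircData S H)

theorem norm_le {x : Plane} (hx : x ∈ Sᶜ) : ‖D.G x‖ ≤ 2 * D.M / (1 + ‖x‖) := by
  have h0 := D.bound x hx 0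
  have h1 := D.bound x hx 1
  have : ‖D.G x‖ ≤ |D.G x 0| + |D.G x 1| := by
    refine abs_le_of_sq_le_sq' ?_ (by positivity) |>.2
    rw [plane_norm_sq, ← sq_abs (D.G x 0), ← sq_abs (D.G x 1)]
    nlinarith [abs_nonneg (D.G x 0), abs_nonneg (D.G x 1)]
  rw [mul_div_assoc]
  linarith

end CircData

theorem memLp_two_of_decay {f : Plane → ℝ} {A : Set Plane} (hA : MeasurableSet A)
    (hf : AEStronglyMeasurable f (volume.restrict A)) {M : ℝ}
    (h : ∀ x ∈ A, |f x| ≤ M / (1 + ‖x‖) ^ 2) : MemLp f 2 (volume.restrict A) := by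
  have hi : Integrable fun x : Plane => (1 + ‖x‖) ^ (-(4 : ℝ)) :=
    integrable_one_add_norm (by simp; norm_num)
  rw [memLp_two_iff_integrable_sq hf]
  refine ((hi.const_mul (M ^ 2)).integrableOn (s := A)).mono' (hf.pow 2) ?_
  filter_upwards [ae_restrict_mem hA] with x hx
  have h1 : (1 + ‖x‖) ^ (-(4 : ℝ)) = ((1 + ‖x‖) ^ 4)⁻¹ := by
    rw [Real.rpow_neg (by positivity)]; norm_cast
  rw [h1, Real.norm_eq_abs, abs_pow]
  calc |f x| ^ 2 ≤ (M / (1 + ‖x‖) ^ 2) ^ 2 := by gcongr; exact h x hx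
    _ = _ := by rw [div_pow, ← pow_mul]; ring

/-! ### Real valued `L^p` norms -/

section LpNorm

variable {α E : Type*} [MeasurableSpace α] {μ : Measure α} [NormedAddCommGroup E]

instance holderTriple_four_four_two : ENNReal.HolderTriple 4 4 2 where
  inv_add_inv_eq_inv := by
    rw [show (4 : ℝ≥0∞) = 2 * 2 by norm_num, ENNReal.mul_inv (by simp) (by simp), ← mul_add,
      ENNReal.inv_two_add_inv_two, mul_one]

theorem lpNorm_two_eq {f : α → E} (hf : MemLp f 2 μ) : lpNorm f 2 μ = √(∫ x, ‖f x‖ ^ 2 ∂μ) := by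
  rw [lpNorm_eq_integral_norm_rpow_toReal (by norm_num) (by norm_num) hf.1, Real.sqrt_eq_rpow]
  norm_num

theorem lpNorm_mul_le {p q r : ℝ≥0∞} [ENNReal.HolderTriple p q r] {f g : α → ℝ} (hf : MemLp f p μ)
    (hg : MemLp g q μ) : lpNorm (fun x => f x * g x) r μ ≤ lpNorm f p μ * lpNorm g q μ := by
  change lpNorm (f * g) r μ ≤ _
  rw [← toReal_eLpNorm hf.1, ← toReal_eLpNorm hg.1, ← toReal_eLpNorm (hf.1.mul hg.1),
    ← ENNReal.toReal_mul]
  refine ENNReal.toReal_mono (ENNReal.mul_ne_top hf.2.ne hg.2.ne) ?_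
  exact eLpNorm_smul_le_mul_eLpNorm (E := ℝ) (𝕜 := ℝ) hg.1 hf.1

theorem lpNorm_mono_ae {F : Type*} [NormedAddCommGroup F] {p : ℝ≥0∞} {f : α → E} {g : α → F}
    (hf : AEStronglyMeasurable f μ) (hg : MemLp g p μ) (h : ∀ᵐ x ∂μ, ‖f x‖ ≤ ‖g x‖) :
    lpNorm f p μ ≤ lpNorm g p μ := by
  rw [← toReal_eLpNorm hf, ← toReal_eLpNorm hg.1]
  exact ENNReal.toReal_mono hg.2.ne (eLpNorm_mono_ae h)

/-- `f` is integrable with `L¹` norm at most `B`. -/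
def L1Le (μ : Measure α) (f : α → ℝ) (B : ℝ) : Prop := Integrable f μ ∧ ∫ x, |f x| ∂μ ≤ B

theorem L1Le.add {f g : α → ℝ} {A B : ℝ} (hf : L1Le μ f A) (hg : L1Le μ g B) :
    L1Le μ (fun x => f x + g x) (A + B) := by
  refine ⟨hf.1.add hg.1, ?_⟩
  calc ∫ x, |f x + g x| ∂μ ≤ ∫ x, (|f x| + |g x|) ∂μ :=
        integral_mono (hf.1.add hg.1).abs (hf.1.abs.add hg.1.abs) fun x => abs_add_le _ _
    _ = _ := integral_add hf.1.abs hg.1.abs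
    _ ≤ _ := add_le_add hf.2 hg.2

theorem L1Le.const_mul {f : α → ℝ} {A : ℝ} (hf : L1Le μ f A) {c C : ℝ} (hc : 0 ≤ c) (h : c ≤ C) :
    L1Le μ (fun x => c * f x) (C * A) := by
  refine ⟨hf.1.const_mul c, ?_⟩
  have h0 : 0 ≤ ∫ x, |f x| ∂μ := integral_nonneg fun _ => abs_nonneg _
  simp only [abs_mul, abs_of_nonneg hc]
  rw [integral_const_mul]
  exact mul_le_mul h hf.2 h0 (hc.trans h)

theorem L1Le.mono {f g : α → ℝ} {A B : ℝ} (hg : L1Le μ g A) (hf : AEStronglyMeasurable f μ)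
    (h : ∀ᵐ x ∂μ, |f x| ≤ g x) (hAB : A ≤ B) : L1Le μ f B := by
  refine ⟨hg.1.mono' hf h, (integral_mono_ae (hg.1.mono' hf h).abs hg.1.abs ?_).trans
    (hg.2.trans hAB)⟩
  filter_upwards [h] with x hx using hx.trans (le_abs_self _)

theorem L1Le.abs_integral_le {f : α → ℝ} {B : ℝ} (h : L1Le μ f B) : |∫ x, f x ∂μ| ≤ B :=
  (abs_integral_le_integral_abs).trans h.2

theorem L1Le.mul {f g : α → ℝ} (hf : MemLp f 2 μ) (hg : MemLp g 2 μ) {A B : ℝ}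
    (hA : lpNorm f 2 μ ≤ A) (hB : lpNorm g 2 μ ≤ B) : L1Le μ (fun x => f x * g x) (A * B) := by
  have hm : MemLp (fun x => f x * g x) 1 μ := MemLp.mul' hg hf
  refine ⟨memLp_one_iff_integrable.1 hm, ?_⟩
  have := lpNorm_mul_le (r := 1) hf hg
  rw [lpNorm_one_eq_integral_norm hm.1] at this
  exact this.trans (mul_le_mul hA hB lpNorm_nonneg (lpNorm_nonneg.trans hA))

end LpNorm

/-! ### Weak gradients of fields -/

theorem IsWeakGrad.unique {O : Set Plane} (hO : IsOpen O) {w : Plane → Plane} {G G' : Plane → Mat2}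
    (h : IsWeakGrad O w G) (h' : IsWeakGrad O w G') : G =ᵐ[volume.restrict O] G' := by
  have key : ∀ p : Fin 2 × Fin 2, (fun x => G x p) =ᵐ[volume.restrict O] fun x => G' x p :=
    fun p => ((isWeakGrad_iff hO).1 h p.1 p.2).unique hO ((isWeakGrad_iff hO).1 h' p.1 p.2)
  filter_upwards [ae_all_iff.2 key] with x hx
  ext p
  exact hx p

theorem IsWeakGrad.weakGrad_spec {O : Set Plane} {w : Plane → Plane} {G : Plane → Mat2}
    (h : IsWeakGrad O w G) : IsWeakGrad O w (weakGrad O w) := by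
  have hex : ∃ G, IsWeakGrad O w G := ⟨G, h⟩
  rw [weakGrad, dif_pos hex]
  exact hex.choose_spec

theorem IsWeakGrad.weakGrad_ae {O : Set Plane} (hO : IsOpen O) {w : Plane → Plane}
    {G : Plane → Mat2} (h : IsWeakGrad O w G) : weakGrad O w =ᵐ[volume.restrict O] G :=
  h.weakGrad_spec.unique hO h

theorem IsWeakGrad.congr {O : Set Plane} (hO : IsOpen O) {w w' : Plane → Plane} {G : Plane → Mat2}
    (h : IsWeakGrad O w G) (hw : w =ᵐ[volume.restrict O] w') : IsWeakGrad O w' G := by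
  rw [isWeakGrad_iff hO] at h ⊢
  exact fun i j => (h i j).congr hO (by filter_upwards [hw] with x hx; rw [hx]) (ae_eq_refl _)

/-- The gradient of a `C¹` field as a matrix field. -/
noncomputable def gradMat (G : Plane → Plane) (x : Plane) : Mat2 :=
  WithLp.toLp 2 fun p => pd p.2 (fun y => G y p.1) x

theorem continuous_gradMat {G : Plane → Plane} (hG : ContDiff ℝ 1 G) : Continuous (gradMat G) :=
  (PiLp.continuous_toLp 2 _).comp
    (continuous_pi fun p : Fin 2 × Fin 2 => continuous_pd (hG.coord p.1) p.2)

theorem isWeakGrad_gradMat {O : Set Plane} (hO : IsOpen O) {G : Plane → Plane}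
    (hG : ContDiff ℝ 1 G) : IsWeakGrad O G (gradMat G) :=
  (isWeakGrad_iff hO).2 fun i j => HasWeakPd.of_contDiff O (hG.coord i) j

/-! ### The contraction of two vectors with a matrix -/

/-- `[(u · ∇) w] · v` for `G = ∇w`. -/
noncomputable def contract (u : Plane) (G : Mat2) (v : Plane) : ℝ :=
  ∑ i : Fin 2, ∑ j : Fin 2, u j * G (i, j) * v i

theorem abs_contract_le (u : Plane) (G : Mat2) (v : Plane) :
    |contract u G v| ≤ ‖u‖ * ‖G‖ * ‖v‖ := by
  set T : Mat2 := WithLp.toLp 2 fun p => u p.2 * v p.1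
  have hT : ‖T‖ = ‖u‖ * ‖v‖ := by
    rw [← sq_eq_sq₀ (norm_nonneg _) (by positivity), mul_pow, plane_norm_sq, plane_norm_sq,
      EuclideanSpace.norm_sq_eq, Fintype.sum_prod_type]
    simp [T, Fin.sum_univ_two, mul_pow]
    ring
  have h : contract u G v = ⟪T, G⟫ := by
    rw [PiLp.inner_apply, Fintype.sum_prod_type]
    simp [T, contract, Fin.sum_univ_two]
    ring
  rw [h]
  refine (abs_real_inner_le_norm _ _).trans (le_of_eq ?_)
  rw [hT]; ring

theorem contract_add_left (u u' : Plane) (G : Mat2) (v : Plane) :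
    contract (u + u') G v = contract u G v + contract u' G v := by
  simp [contract, Fin.sum_univ_two]; ring

theorem contract_smul_left (c : ℝ) (u : Plane) (G : Mat2) (v : Plane) :
    contract (c • u) G v = c * contract u G v := by
  simp [contract, Fin.sum_univ_two]; ring

theorem contract_add_mid (u : Plane) (G G' : Mat2) (v : Plane) :
    contract u (G + G') v = contract u G v + contract u G' v := by
  simp [contract, Fin.sum_univ_two]; ring

theorem contract_smul_mid (c : ℝ) (u : Plane) (G : Mat2) (v : Plane) :
    contract u (c • G) v = c * contract u G v := by
  simp [contract, Fin.sum_univ_two]; ring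

theorem contract_add_right (u : Plane) (G : Mat2) (v v' : Plane) :
    contract u G (v + v') = contract u G v + contract u G v' := by
  simp [contract, Fin.sum_univ_two]; ring

theorem contract_smul_right (c : ℝ) (u : Plane) (G : Mat2) (v : Plane) :
    contract u G (c • v) = c * contract u G v := by
  simp [contract, Fin.sum_univ_two]; ring

theorem perp_add (x y : Plane) : perp (x + y) = perp x + perp y :=
  plane_ext fun i => by fin_cases i <;> simp [add_comm]

theorem perp_smul (c : ℝ) (x : Plane) : perp (c • x) = c • perp x :=
  plane_ext fun i => by fin_cases i <;> simp

theorem rigid_comb (c : ℝ) (q q' : Plane × ℝ) (x : Plane) :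
    rigid (c • q + q') x = c • rigid q x + rigid q' x :=
  plane_ext fun i => by fin_cases i <;> simp [rigid] <;> ring

theorem bIntegrand_eq (S : Set Plane) (u v w : Plane → Plane) (x : Plane) :
    bIntegrand S u v w x = contract (u x - rigid (rigidData S u) x) (weakGrad Sᶜ w x) (v x) -
      (rigidData S u).2 * ⟪perp (v x), w x⟫ := rfl

theorem aestronglyMeasurable_contract {α : Type*} [MeasurableSpace α] {μ : Measure α}
    {u v : α → Plane} {G : α → Mat2} (hu : AEStronglyMeasurable u μ)
    (hG : AEStronglyMeasurable G μ) (hv : AEStronglyMeasurable v μ) :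
    AEStronglyMeasurable (fun x => contract (u x) (G x) (v x)) μ := by
  have cu : ∀ j, AEStronglyMeasurable (fun x => u x j) μ := fun j =>
    (EuclideanSpace.proj (𝕜 := ℝ) j).continuous.comp_aestronglyMeasurable hu
  have cv : ∀ j, AEStronglyMeasurable (fun x => v x j) μ := fun j =>
    (EuclideanSpace.proj (𝕜 := ℝ) j).continuous.comp_aestronglyMeasurable hv
  have cG : ∀ p, AEStronglyMeasurable (fun x => G x p) μ := fun p =>
    (EuclideanSpace.proj (𝕜 := ℝ) p).continuous.comp_aestronglyMeasurable hG
  simp only [contract, Fin.sum_univ_two]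
  exact ((((cu 0).mul (cG _)).mul (cv 0)).add (((cu 1).mul (cG _)).mul (cv 0))).add
    ((((cu 0).mul (cG _)).mul (cv 1)).add (((cu 1).mul (cG _)).mul (cv 1)))

/-! ### Linearity of the form `b` -/

namespace IsSmoothBody

variable {S : Set Plane} (hS : IsSmoothBody S) {m c : ℝ} {u u' u'' v v' v'' w w' w'' : Plane → Plane}
include hS

theorem rigidData_comb {q q' : Plane × ℝ} (hu : u =ᵐ[volume.restrict S] rigid q)
    (hu' : u' =ᵐ[volume.restrict S] rigid q')
    (h : u'' =ᵐ[volume] fun x => c • u x + u' x) :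
    rigidData S u'' = c • rigidData S u + rigidData S u' := by
  rw [hS.rigidData_eq hu, hS.rigidData_eq hu']
  refine hS.rigidData_eq ?_
  filter_upwards [hu, hu', ae_restrict_of_ae h] with x h1 h2 h3
  rw [h3, h1, h2, rigid_comb]

theorem bForm_comb_left {q q' : Plane × ℝ} (hu : u =ᵐ[volume.restrict S] rigid q)
    (hu' : u' =ᵐ[volume.restrict S] rigid q') (h : u'' =ᵐ[volume] fun x => c • u x + u' x)
    (i1 : IntegrableOn (bIntegrand S u v w) Sᶜ) (i2 : IntegrableOn (bIntegrand S u' v w) Sᶜ) :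
    bForm S m u'' v w = c * bForm S m u v w + bForm S m u' v w := by
  have hq := hS.rigidData_comb hu hu' h
  have e : ∫ x in Sᶜ, bIntegrand S u'' v w x =
      ∫ x in Sᶜ, (c * bIntegrand S u v w x + bIntegrand S u' v w x) := by
    refine integral_congr_ae ?_
    filter_upwards [ae_restrict_of_ae h] with x hx
    simp only [bIntegrand_eq, hq, hx, rigid_comb]
    have : c • u x + u' x - (c • rigid (rigidData S u) x + rigid (rigidData S u') x) =
        c • (u x - rigid (rigidData S u) x) + (u' x - rigid (rigidData S u') x) := by
      rw [smul_sub]; abel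
    rw [this, contract_add_left, contract_smul_left]
    simp only [Prod.snd_add, Prod.smul_snd, smul_eq_mul]
    ring
  have e2 : bBody S m u'' v w = c * bBody S m u v w + bBody S m u' v w := by
    simp only [bBody, angVel, hq, Prod.snd_add, Prod.smul_snd, smul_eq_mul]
    ring
  rw [bForm, bForm, bForm, e, e2, integral_add (i1.const_mul c) i2, integral_const_mul]
  ring

theorem bForm_comb_mid {q q' : Plane × ℝ} (hv : v =ᵐ[volume.restrict S] rigid q)
    (hv' : v' =ᵐ[volume.restrict S] rigid q') (h : v'' =ᵐ[volume] fun x => c • v x + v' x)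
    (i1 : IntegrableOn (bIntegrand S u v w) Sᶜ) (i2 : IntegrableOn (bIntegrand S u v' w) Sᶜ) :
    bForm S m u v'' w = c * bForm S m u v w + bForm S m u v' w := by
  have hq := hS.rigidData_comb hv hv' h
  have e : ∫ x in Sᶜ, bIntegrand S u v'' w x =
      ∫ x in Sᶜ, (c * bIntegrand S u v w x + bIntegrand S u v' w x) := by
    refine integral_congr_ae ?_
    filter_upwards [ae_restrict_of_ae h] with x hx
    simp only [bIntegrand_eq, hx, contract_add_right, contract_smul_right, perp_add, perp_smul,
      inner_add_left, real_inner_smul_left]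
    ring
  have e2 : bBody S m u v'' w = c * bBody S m u v w + bBody S m u v' w := by
    simp only [bBody, linVel, hq, Prod.fst_add, Prod.smul_fst, perp_add, perp_smul,
      inner_add_left, real_inner_smul_left]
    ring
  rw [bForm, bForm, bForm, e, e2, integral_add (i1.const_mul c) i2, integral_const_mul]
  ring

theorem bForm_comb_right {q q' : Plane × ℝ} {G G' : Plane → Mat2}
    (hw : w =ᵐ[volume.restrict S] rigid q) (hw' : w' =ᵐ[volume.restrict S] rigid q')
    (hG : IsWeakGrad Sᶜ w G) (hG' : IsWeakGrad Sᶜ w' G')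
    (h : w'' =ᵐ[volume] fun x => c • w x + w' x)
    (i1 : IntegrableOn (bIntegrand S u v w) Sᶜ) (i2 : IntegrableOn (bIntegrand S u v w') Sᶜ) :
    bForm S m u v w'' = c * bForm S m u v w + bForm S m u v w' := by
  have hq := hS.rigidData_comb hw hw' h
  have hgrad := (hG.weakGrad_spec.comb hG'.weakGrad_spec c h).weakGrad_ae hS.isOpen_compl
  have e : ∫ x in Sᶜ, bIntegrand S u v w'' x =
      ∫ x in Sᶜ, (c * bIntegrand S u v w x + bIntegrand S u v w' x) := by
    refine integral_congr_ae ?_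
    filter_upwards [ae_restrict_of_ae h, hgrad] with x hx hg
    simp only [bIntegrand_eq, hx, hg, contract_add_mid, contract_smul_mid,
      inner_add_right, real_inner_smul_right]
    ring
  have e2 : bBody S m u v w'' = c * bBody S m u v w + bBody S m u v w' := by
    simp only [bBody, linVel, hq, Prod.fst_add, Prod.smul_fst,
      inner_add_right, real_inner_smul_right]
    ring
  rw [bForm, bForm, bForm, e, e2, integral_add (i1.const_mul c) i2, integral_const_mul]
  ring

end IsSmoothBody

/-! ### Fields with a multiple of the circulation field -/

theorem withH_comb {X : Submodule ℝ L2Plane} (H : Plane → Plane) (φ φ' : X) (β β' c : ℝ) :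
    withH H (c • φ + φ') (c * β + β') =ᵐ[volume] fun x => c • withH H φ β x + withH H φ' β' x := by
  filter_upwards [L2Plane.coeFn_comb c (φ : L2Plane) φ'] with x hx
  have : ((c • φ + φ' : X) : L2Plane) = c • (φ : L2Plane) + φ' := rfl
  simp only [withH, this, hx, add_smul, smul_add, mul_smul]
  abel

theorem field_comb {X : Submodule ℝ L2Plane} (φ φ' : X) (c : ℝ) :
    field (c • φ + φ') =ᵐ[volume] fun x => c • field φ x + field φ' x :=
  L2Plane.coeFn_comb c (φ : L2Plane) φ'

theorem memLp_field {X : Submodule ℝ L2Plane} (φ : X) (A : Set Plane) :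
    MemLp (field φ) 2 (volume.restrict A) := (Lp.memLp (φ : L2Plane)).restrict A

namespace CircData

variable {S : Set Plane} {H : Plane → Plane} (D : CircData S H)
include D

theorem withH_ae_rigid (hS : IsSmoothBody S) {X : Submodule ℝ L2Plane} (hX : X ≤ spaceH S)
    (φ : X) (β : ℝ) : withH H φ β =ᵐ[volume.restrict S] rigid (rigidData S (field φ)) := by
  filter_upwards [hS.field_ae_rigid hX φ, D.ae_zero] with x h1 h2
  simp only [withH, h2, Pi.zero_apply, smul_zero, add_zero]
  exact h1

theorem rigidData_withH (hS : IsSmoothBody S) {X : Submodule ℝ L2Plane} (hX : X ≤ spaceH S)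
    (φ : X) (β : ℝ) : rigidData S (withH H φ β) = rigidData S (field φ) :=
  hS.rigidData_eq (D.withH_ae_rigid hS hX φ β)

theorem ae_eq (hS : IsSmoothBody S) : H =ᵐ[volume.restrict Sᶜ] D.G := by
  filter_upwards [ae_restrict_mem hS.isOpen_compl.measurableSet] with x hx
  exact D.eqOn (subset_closure hx)

theorem isWeakGrad (hS : IsSmoothBody S) : IsWeakGrad Sᶜ H (gradMat D.G) :=
  (isWeakGrad_gradMat hS.isOpen_compl D.contDiff).congr hS.isOpen_compl (D.ae_eq hS).symm

theorem isWeakGrad_withH (hS : IsSmoothBody S) {X : Submodule ℝ L2Plane} {φ : X}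
    {G : Plane → Mat2} (h : IsWeakGrad Sᶜ (field φ) G) (β : ℝ) :
    IsWeakGrad Sᶜ (withH H φ β) (fun x => β • gradMat D.G x + G x) :=
  (D.isWeakGrad hS).comb h β (Eventually.of_forall fun _ => add_comm _ _)

end CircData

/-! ### The basic bound for the integrand of `b` -/

theorem norm_mat_le {A : Mat2} {B : ℝ} (h : ∀ i j, |A (i, j)| ≤ B) : ‖A‖ ≤ 2 * B := by
  have hB : 0 ≤ B := (abs_nonneg _).trans (h 0 0)
  refine abs_le_of_sq_le_sq' ?_ (by positivity) |>.2
  rw [EuclideanSpace.norm_sq_eq, Fintype.sum_prod_type]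
  have : ∀ i j, ‖A (i, j)‖ ^ 2 ≤ B ^ 2 := fun i j => by
    rw [Real.norm_eq_abs]
    exact pow_le_pow_left₀ (abs_nonneg _) (h i j) 2
  simp only [Fin.sum_univ_two]
  linarith [this 0 0, this 0 1, this 1 0, this 1 1]

theorem contract_perp_add (G : Plane → Plane) (x v : Plane) :
    contract (perp x) (gradMat G x) v + ⟪perp v, G x⟫ = ∑ i, angular G x i * v i := by
  simp [contract, gradMat, angular, along, plane_inner, Fin.sum_univ_two]
  ring

/-- Splitting of the integrand of `b`. -/
theorem integrand_split (G : Plane → Plane) (x u v w : Plane) (Γ : Mat2) (q : Plane × ℝ) (a b : ℝ) :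
    contract (u + a • G x - rigid q x) (b • gradMat G x + Γ) v - q.2 * ⟪perp v, w + b • G x⟫ =
      contract u Γ v + contract (a • G x - q.1) Γ v - q.2 * contract (perp x) Γ v +
      b * (contract u (gradMat G x) v + contract (a • G x - q.1) (gradMat G x) v) -
      b * q.2 * (∑ i, angular G x i * v i) - q.2 * ⟪perp v, w⟫ := by
  rw [← contract_perp_add]
  simp [contract, rigid, plane_inner, Fin.sum_univ_two]
  ring

theorem CircData.exists_l1Le {S : Set Plane} {H : Plane → Plane} (D : CircData S H)
    (hS : IsSmoothBody S) : ∃ K : ℝ, 0 ≤ K ∧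
      ∀ {u v w : Plane → Plane} {Γ : Plane → Mat2} {q : Plane × ℝ} {a b X Y Z k : ℝ},
      MemLp u 2 (volume.restrict Sᶜ) → MemLp v 2 (volume.restrict Sᶜ) →
      MemLp w 2 (volume.restrict Sᶜ) → MemLp Γ 2 (volume.restrict Sᶜ) →
      lpNorm u 2 (volume.restrict Sᶜ) ≤ X → ‖q.1‖ ≤ X → |q.2| ≤ X → |a| ≤ X →
      lpNorm v 2 (volume.restrict Sᶜ) ≤ Y → lpNorm w 2 (volume.restrict Sᶜ) ≤ Z →
      lpNorm Γ 2 (volume.restrict Sᶜ) ≤ Z → |b| ≤ Z →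
      L1Le (volume.restrict Sᶜ) (fun x => ‖u x‖ * ‖v x‖ * ‖Γ x‖) (k * (X * Y * Z)) →
      MemLp (fun x => |q.2| * (‖x‖ * ‖Γ x‖)) 2 (volume.restrict Sᶜ) →
      lpNorm (fun x => |q.2| * (‖x‖ * ‖Γ x‖)) 2 (volume.restrict Sᶜ) ≤ X * Z →
      L1Le (volume.restrict Sᶜ) (fun x => contract (u x + a • H x - rigid q x)
        (b • gradMat D.G x + Γ x) (v x) - q.2 * ⟪perp (v x), w x + b • H x⟫)
        ((k + K) * (X * Y * Z)) := by
  set μ := volume.restrict Sᶜ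
  set M := 4 * D.M
  have hM : 0 ≤ M := by have := D.M_nonneg; positivity
  set h : Plane → ℝ := fun x => M / (1 + ‖x‖) ^ 2
  have hm : MeasurableSet Sᶜ := hS.isOpen_compl.measurableSet
  have hcont : Continuous h := by
    refine continuous_const.div (by fun_prop) fun x => ?_
    have := norm_nonneg x
    positivity
  have hh : MemLp h 2 μ :=
    memLp_two_of_decay hm hcont.aestronglyMeasurable fun x _ => (abs_of_nonneg (by positivity)).le
  have hN : 0 ≤ lpNorm h 2 μ := lpNorm_nonneg
  refine ⟨(M + 1) + 1 + M + (M + 1) * lpNorm h 2 μ + lpNorm h 2 μ + 1, by positivity, ?_⟩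
  intro u v w Γ q a b X Y Z k mu mv mw mΓ nu nq1 nq2 na nv nw nΓ nb hT mW nW
  have hX : 0 ≤ X := (norm_nonneg _).trans nq1
  have hY : 0 ≤ Y := lpNorm_nonneg.trans nv
  have hZ : 0 ≤ Z := (abs_nonneg _).trans nb
  have nn : ∀ {E : Type} [NormedAddCommGroup E] {f : Plane → E} {B : ℝ}, MemLp f 2 μ →
      lpNorm f 2 μ ≤ B → lpNorm (fun x => ‖f x‖) 2 μ ≤ B :=
    fun hf hB => by rwa [lpNorm_norm hf.1]
  have t2 := (L1Le.mul mΓ.norm mv.norm (nn mΓ nΓ) (nn mv nv)).const_mul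
    (c := |a| * M + ‖q.1‖) (C := X * M + X) (by positivity) (by gcongr)
  have t3 := L1Le.mul mW mv.norm nW (nn mv nv)
  have t4 := (L1Le.mul mu.norm mv.norm (nn mu nu) (nn mv nv)).const_mul (c := |b| * M) (C := Z * M)
    (by positivity) (by gcongr)
  have t5 := (L1Le.mul hh mv.norm le_rfl (nn mv nv)).const_mul
    (c := |b| * (|a| * M + ‖q.1‖)) (C := Z * (X * M + X)) (by positivity) (by gcongr)
  have t6 := (L1Le.mul hh mv.norm le_rfl (nn mv nv)).const_mul (c := |b| * |q.2|) (C := Z * X)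
    (by positivity) (by gcongr)
  have t7 := (L1Le.mul mv.norm mw.norm (nn mv nv) (nn mw nw)).const_mul (c := |q.2|) (C := X)
    (by positivity) nq2
  have mH : AEStronglyMeasurable H μ :=
    D.contDiff.continuous.aestronglyMeasurable.congr (D.ae_eq hS).symm
  have mp : AEStronglyMeasurable (fun x => perp (v x)) μ :=
    continuous_perp.comp_aestronglyMeasurable mv.1
  refine (((((((hT.add t2).add t3).add t4).add t5).add t6).add t7)).mono ?_ ?_ (le_of_eq (by ring))
  · refine (aestronglyMeasurable_contract ((mu.1.add (mH.const_smul a)).sub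
      (continuous_rigid q).aestronglyMeasurable)
      (((continuous_gradMat D.contDiff).aestronglyMeasurable.const_smul b).add mΓ.1) mv.1).sub ?_
    exact (mp.inner (mw.1.add (mH.const_smul b))).const_mul _
  · filter_upwards [D.ae_eq hS, ae_restrict_mem hm] with x hx hxS
    have hx0 := norm_nonneg x
    rw [hx, integrand_split]
    have hG : ‖D.G x‖ ≤ M := (D.norm_le hxS).trans (by
      rw [div_le_iff₀ (by positivity)]
      simp only [M]
      nlinarith [D.M_nonneg, mul_nonneg D.M_nonneg hx0])
    have hgr : ‖gradMat D.G x‖ ≤ h x := by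
      refine (norm_mat_le (A := gradMat D.G x) (D.bound_pd x hxS)).trans ?_
      simp only [h, M, mul_div_assoc]
      have : 0 ≤ D.M / (1 + ‖x‖) ^ 2 := div_nonneg D.M_nonneg (by positivity)
      linarith
    have hhM : h x ≤ M := div_le_self hM (by nlinarith)
    have hh0 : 0 ≤ h x := by positivity
    have hang : |∑ i, angular D.G x i * v x i| ≤ h x * ‖v x‖ := by
      have hb := fun i => D.bound_angular x hxS i
      have h0 : 0 ≤ D.M / (1 + ‖x‖) ^ 2 := div_nonneg D.M_nonneg (by positivity)
      rw [Fin.sum_univ_two]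
      refine (abs_add_le _ _).trans ?_
      rw [abs_mul, abs_mul]
      calc _ ≤ D.M / (1 + ‖x‖) ^ 2 * ‖v x‖ + D.M / (1 + ‖x‖) ^ 2 * ‖v x‖ := by
            gcongr
            · exact hb 0
            · exact abs_coord_le _ _
            · exact hb 1
            · exact abs_coord_le _ _
        _ ≤ _ := by
            simp only [h, M, mul_div_assoc]
            nlinarith [mul_nonneg h0 (norm_nonneg (v x))]
    have hvel : ‖a • D.G x - q.1‖ ≤ |a| * M + ‖q.1‖ := by
      refine (norm_sub_le _ _).trans ?_
      rw [norm_smul, Real.norm_eq_abs]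
      gcongr
    have c1 := abs_contract_le (u x) (Γ x) (v x)
    have c2 : |contract (a • D.G x - q.1) (Γ x) (v x)| ≤ (|a| * M + ‖q.1‖) * (‖Γ x‖ * ‖v x‖) := by
      refine (abs_contract_le _ _ _).trans ?_
      rw [mul_assoc]; gcongr
    have c3 : |q.2 * contract (perp x) (Γ x) (v x)| ≤ |q.2| * (‖x‖ * ‖Γ x‖) * ‖v x‖ := by
      rw [abs_mul, mul_assoc]
      gcongr
      simpa [perp_norm] using abs_contract_le (perp x) (Γ x) (v x)
    have c4 : |b * contract (u x) (gradMat D.G x) (v x)| ≤ |b| * M * (‖u x‖ * ‖v x‖) := by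
      rw [abs_mul, mul_assoc]
      gcongr
      calc _ ≤ _ := abs_contract_le _ _ _
        _ ≤ ‖u x‖ * M * ‖v x‖ := by gcongr; exact hgr.trans hhM
        _ = _ := by ring
    have c5 : |b * contract (a • D.G x - q.1) (gradMat D.G x) (v x)| ≤
        |b| * (|a| * M + ‖q.1‖) * (h x * ‖v x‖) := by
      rw [abs_mul, mul_assoc]
      gcongr
      calc _ ≤ _ := abs_contract_le _ _ _
        _ ≤ (|a| * M + ‖q.1‖) * h x * ‖v x‖ := by gcongr
        _ = _ := by ring
    have c6 : |b * q.2 * ∑ i, angular D.G x i * v x i| ≤ |b| * |q.2| * (h x * ‖v x‖) := by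
      rw [abs_mul, abs_mul]; gcongr
    have c7 : |q.2 * ⟪perp (v x), w x⟫| ≤ |q.2| * (‖v x‖ * ‖w x‖) := by
      rw [abs_mul]
      gcongr
      simpa [perp_norm] using abs_real_inner_le_norm (perp (v x)) (w x)
    have e1 : ‖u x‖ * ‖Γ x‖ * ‖v x‖ = ‖u x‖ * ‖v x‖ * ‖Γ x‖ := by ring
    rw [e1] at c1
    rw [mul_add b]
    rw [abs_le] at *
    constructor <;> linarith [c1.1, c1.2, c2.1, c2.2, c3.1, c3.2, c4.1, c4.2, c5.1, c5.2, c6.1, c6.2,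
      c7.1, c7.2]

/-! ### The norms -/

theorem eLpNorm_le_sum_coord {α ι : Type*} [MeasurableSpace α] [Fintype ι] {μ : Measure α}
    {w : α → EuclideanSpace ℝ ι} (h : AEStronglyMeasurable w μ) {p : ℝ≥0∞} (hp : 1 ≤ p) :
    eLpNorm w p μ ≤ ∑ i, eLpNorm (fun x => w x i) p μ := by
  have m : ∀ i, AEStronglyMeasurable (fun x => ‖w x i‖) μ := fun i =>
    ((EuclideanSpace.proj (𝕜 := ℝ) i).continuous.comp_aestronglyMeasurable h).norm
  refine (eLpNorm_mono (g := ∑ i, fun x => ‖w x i‖) fun x => ?_).trans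
    ((eLpNorm_sum_le (fun i _ => m i) hp).trans (Finset.sum_le_sum fun i _ => (eLpNorm_norm _).le))
  rw [Finset.sum_apply, EuclideanSpace.norm_eq]
  exact ((Real.sqrt_le_left (Finset.sum_nonneg fun i _ => norm_nonneg _)).2
    (Finset.sum_sq_le_sq_sum_of_nonneg fun i _ => norm_nonneg _)).trans (Real.le_norm_self _)

section Norms

variable {S : Set Plane} {m J : ℝ}

theorem normH_nonneg (φ : Plane → Plane) : 0 ≤ normH S m J φ := Real.sqrt_nonneg _

theorem normH_le_normVu (φ : Plane → Plane) : normH S m J φ ≤ normVu S m J φ :=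
  le_add_of_nonneg_right (Real.sqrt_nonneg _)

theorem normH_le_normV (φ : Plane → Plane) : normH S m J φ ≤ normV S m J φ :=
  le_add_of_nonneg_right (Real.sqrt_nonneg _)

theorem lpNorm_le_normH (hm : 0 < m) (hJ : 0 < J) {φ : Plane → Plane}
    (h : MemLp φ 2 (volume.restrict Sᶜ)) : lpNorm φ 2 (volume.restrict Sᶜ) ≤ normH S m J φ := by
  rw [lpNorm_two_eq h, normH]
  refine Real.sqrt_le_sqrt ?_
  have h1 : 0 ≤ m * ‖linVel S φ‖ ^ 2 := by positivity
  have h2 : 0 ≤ J * angVel S φ ^ 2 := by positivity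
  linarith

theorem norm_linVel_le (hm : 0 < m) (hJ : 0 < J) (φ : Plane → Plane) :
    ‖linVel S φ‖ ≤ (√m)⁻¹ * normH S m J φ := by
  have hs := Real.sqrt_pos.2 hm
  rw [le_inv_mul_iff₀ hs]
  refine Real.le_sqrt_of_sq_le ?_
  have h0 : 0 ≤ ∫ x in Sᶜ, ‖φ x‖ ^ 2 := integral_nonneg fun _ => by positivity
  have h2 : 0 ≤ J * angVel S φ ^ 2 := by positivity
  rw [mul_pow, Real.sq_sqrt hm.le]
  linarith

theorem abs_angVel_le (hm : 0 < m) (hJ : 0 < J) (φ : Plane → Plane) :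
    |angVel S φ| ≤ (√J)⁻¹ * normH S m J φ := by
  have hs := Real.sqrt_pos.2 hJ
  rw [le_inv_mul_iff₀ hs]
  refine Real.le_sqrt_of_sq_le ?_
  have h0 : 0 ≤ ∫ x in Sᶜ, ‖φ x‖ ^ 2 := integral_nonneg fun _ => by positivity
  have h2 : 0 ≤ m * ‖linVel S φ‖ ^ 2 := by positivity
  rw [mul_pow, Real.sq_sqrt hJ.le, sq_abs]
  linarith

theorem spaceVu_le : spaceVu S ≤ spaceH S := inf_le_left

theorem spaceV_le : spaceV S ≤ spaceH S := inf_le_left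

theorem one_le_weight (y : Plane) : 1 ≤ √(1 + ‖y‖ ^ 2) :=
  Real.one_le_sqrt.2 (by have := sq_nonneg ‖y‖; linarith)

theorem norm_le_weight (y : Plane) : ‖y‖ ≤ √(1 + ‖y‖ ^ 2) := Real.le_sqrt_of_sq_le (by linarith)

theorem aestronglyMeasurable_of_weight {μ : Measure Plane} {G : Plane → Mat2}
    (h : AEStronglyMeasurable (fun y => √(1 + ‖y‖ ^ 2) • G y) μ) :
    AEStronglyMeasurable G μ := by
  have hc : Continuous fun y : Plane => (√(1 + ‖y‖ ^ 2))⁻¹ :=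
    Continuous.inv₀ (by fun_prop) fun y => (zero_lt_one.trans_le (one_le_weight y)).ne'
  refine (hc.aestronglyMeasurable.smul h).congr (ae_of_all _ fun y => ?_)
  show (√(1 + ‖y‖ ^ 2))⁻¹ • √(1 + ‖y‖ ^ 2) • G y = G y
  rw [smul_smul, inv_mul_cancel₀ (zero_lt_one.trans_le (one_le_weight y)).ne', one_smul]

theorem memLp_of_weight {μ : Measure Plane} {G : Plane → Mat2}
    (h : MemLp (fun y => √(1 + ‖y‖ ^ 2) • G y) 2 μ) :
    MemLp G 2 μ ∧ lpNorm G 2 μ ≤ lpNorm (fun y => √(1 + ‖y‖ ^ 2) • G y) 2 μ := by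
  have hm := aestronglyMeasurable_of_weight h.1
  have hle : ∀ᵐ y ∂μ, ‖G y‖ ≤ ‖√(1 + ‖y‖ ^ 2) • G y‖ := ae_of_all _ fun y => by
    rw [norm_smul, Real.norm_of_nonneg (Real.sqrt_nonneg _)]
    exact le_mul_of_one_le_left (norm_nonneg _) (one_le_weight y)
  exact ⟨h.mono hm hle, lpNorm_mono_ae hm h hle⟩

variable (hS : IsSmoothBody S)
include hS

theorem spaceVu_spec (φ : L2Plane) (h : φ ∈ spaceVu S) : IsWeakGrad Sᶜ φ (weakGrad Sᶜ φ) ∧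
    MemLp (weakGrad Sᶜ φ) 2 (volume.restrict Sᶜ) ∧
    lpNorm (weakGrad Sᶜ φ) 2 (volume.restrict Sᶜ) ≤ normVu S m J φ := by
  obtain ⟨-, G, h1, h2⟩ := h
  have h3 : MemLp (weakGrad Sᶜ φ) 2 (volume.restrict Sᶜ) :=
    (memLp_congr_ae (h1.weakGrad_ae hS.isOpen_compl)).2 h2
  refine ⟨h1.weakGrad_spec, h3, ?_⟩
  rw [lpNorm_two_eq h3]
  exact le_add_of_nonneg_left (normH_nonneg _)

theorem spaceV_spec (φ : L2Plane) (h : φ ∈ spaceV S) : IsWeakGrad Sᶜ φ (weakGrad Sᶜ φ) ∧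
    MemLp (fun y => √(1 + ‖y‖ ^ 2) • weakGrad Sᶜ φ y) 2 (volume.restrict Sᶜ) ∧
    lpNorm (fun y => √(1 + ‖y‖ ^ 2) • weakGrad Sᶜ φ y) 2 (volume.restrict Sᶜ) ≤ normV S m J φ := by
  obtain ⟨-, G, h1, h2⟩ := h
  have h3 : MemLp (fun y => √(1 + ‖y‖ ^ 2) • weakGrad Sᶜ φ y) 2 (volume.restrict Sᶜ) := by
    refine (memLp_congr_ae ?_).2 h2
    filter_upwards [h1.weakGrad_ae hS.isOpen_compl] with x hx
    rw [hx]
  refine ⟨h1.weakGrad_spec, h3, ?_⟩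
  rw [lpNorm_two_eq h3]
  refine le_trans (le_of_eq ?_) (le_add_of_nonneg_left (normH_nonneg _))
  congr 2
  ext y
  rw [norm_smul, mul_pow, Real.norm_of_nonneg (Real.sqrt_nonneg _), Real.sq_sqrt (by positivity)]
  ring

theorem spaceV_le_spaceVu : spaceV S ≤ spaceVu S := fun φ h =>
  ⟨h.1, _, (spaceV_spec (m := 0) (J := 0) hS φ h).1,
    (memLp_of_weight (spaceV_spec (m := 0) (J := 0) hS φ h).2.1).1⟩

theorem exists_lpNorm_four : ∃ A : ℝ, 0 ≤ A ∧ ∀ φ ∈ spaceVu S, ∀ {m J : ℝ}, 0 < m → 0 < J →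
    MemLp φ 4 (volume.restrict Sᶜ) ∧ lpNorm φ 4 (volume.restrict Sᶜ) ≤ A * normVu S m J φ := by
  obtain ⟨A, hA⟩ := hS.exists_L4
  refine ⟨2 * (A * 3), by positivity, fun φ hφ m J hm hJ => ?_⟩
  obtain ⟨h1, h2, h3⟩ := spaceVu_spec (m := m) (J := J) hS φ hφ
  have hφ2 : MemLp φ 2 (volume.restrict Sᶜ) := (Lp.memLp φ).restrict _
  have hH1 : ∀ i, IsH1 Sᶜ (fun x => φ x i) fun j x => weakGrad Sᶜ φ x (i, j) := fun i =>
    ⟨fun j => (isWeakGrad_iff hS.isOpen_compl).1 h1 i j,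
      (EuclideanSpace.proj (𝕜 := ℝ) i).comp_memLp' hφ2,
      fun j => (EuclideanSpace.proj (𝕜 := ℝ) (i, j)).comp_memLp' h2⟩
  set B := ENNReal.ofReal (normVu S m J φ)
  have b1 : eLpNorm φ 2 (volume.restrict Sᶜ) ≤ B := by
    rw [← ofReal_lpNorm hφ2]
    exact ENNReal.ofReal_le_ofReal ((lpNorm_le_normH hm hJ hφ2).trans (normH_le_normVu _))
  have b2 : eLpNorm (weakGrad Sᶜ φ) 2 (volume.restrict Sᶜ) ≤ B := by
    rw [← ofReal_lpNorm h2]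
    exact ENNReal.ofReal_le_ofReal h3
  have b3 : ∀ i, eLpNorm (fun x => φ x i) 4 (volume.restrict Sᶜ) ≤ A * (3 * B) := fun i => by
    refine (hA _ _ (hH1 i)).trans ?_
    gcongr
    unfold h1n
    rw [Fin.sum_univ_two]
    have c1 : eLpNorm (fun x => φ x i) 2 (volume.restrict Sᶜ) ≤ B :=
      (eLpNorm_mono fun x => abs_coord_le _ _ |>.trans (le_refl ‖φ x‖)).trans b1
    have c2 : ∀ j, eLpNorm (fun x => weakGrad Sᶜ φ x (i, j)) 2 (volume.restrict Sᶜ) ≤ B := fun j =>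
      (eLpNorm_mono fun x => PiLp.norm_apply_le (weakGrad Sᶜ φ x) (i, j)).trans b2
    calc _ ≤ B + (B + B) := by gcongr <;> apply_assumption
      _ = 3 * B := by ring
  have b4 : eLpNorm φ 4 (volume.restrict Sᶜ) ≤ 2 * (A * 3) * B := by
    refine (eLpNorm_le_sum_coord hφ2.1 (by norm_num)).trans ?_
    rw [Fin.sum_univ_two]
    calc _ ≤ A * (3 * B) + A * (3 * B) := add_le_add (b3 0) (b3 1)
      _ = _ := by ring
  have hfin : MemLp φ 4 (volume.restrict Sᶜ) := ⟨hφ2.1, b4.trans_lt (by finiteness)⟩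
  refine ⟨hfin, ?_⟩
  rw [← toReal_eLpNorm hfin.1]
  refine (ENNReal.toReal_mono (by finiteness) b4).trans (le_of_eq ?_)
  have hN : 0 ≤ normVu S m J φ := (normH_nonneg _).trans (normH_le_normVu _)
  simp [B, ENNReal.toReal_mul, ENNReal.toReal_ofReal hN]

end Norms

/-! ### Multilinear maps from additivity and homogeneity -/

section Builders

variable {A B C : Type*} [AddCommGroup A] [Module ℝ A] [AddCommGroup B] [Module ℝ B]
  [AddCommGroup C] [Module ℝ C]

/-- A linear functional from a function that respects `c • x + y`. -/
def linOfComb {V : Type*} [AddCommGroup V] [Module ℝ V] (f : A → V)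
    (h : ∀ (c : ℝ) a a', f (c • a + a') = c • f a + f a') : A →ₗ[ℝ] V where
  toFun := f
  map_add' a a' := by simpa using h 1 a a'
  map_smul' c a := by
    have h0 : f 0 = 0 := by simpa using h 1 0 0
    simpa [h0] using h c a 0

/-- A bilinear form from a function that respects `c • x + y` in each variable. -/
def bilinOfComb (f : A → B → ℝ) (h1 : ∀ (c : ℝ) a a' b, f (c • a + a') b = c * f a b + f a' b)
    (h2 : ∀ (c : ℝ) a b b', f a (c • b + b') = c * f a b + f a b') : A →ₗ[ℝ] B →ₗ[ℝ] ℝ :=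
  linOfComb (fun a => linOfComb (f a) fun c b b' => h2 c a b b') fun c a a' =>
    LinearMap.ext fun b => h1 c a a' b

/-- A trilinear form from a function that respects `c • x + y` in each variable. -/
def trilinOfComb (f : A → B → C → ℝ)
    (h1 : ∀ (c : ℝ) a a' b d, f (c • a + a') b d = c * f a b d + f a' b d)
    (h2 : ∀ (c : ℝ) a b b' d, f a (c • b + b') d = c * f a b d + f a b' d)
    (h3 : ∀ (c : ℝ) a b d d', f a b (c • d + d') = c * f a b d + f a b d') :
    A →ₗ[ℝ] B →ₗ[ℝ] C →ₗ[ℝ] ℝ :=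
  linOfComb (fun a => bilinOfComb (f a) (fun c b b' d => h2 c a b b' d)
    fun c b d d' => h3 c a b d d') fun c a a' =>
    LinearMap.ext fun b => LinearMap.ext fun d => h1 c a a' b d

end Builders

/-! ### Bounds for the form `b` -/

namespace CircData

variable {S : Set Plane} {H : Plane → Plane} (D : CircData S H) (hS : IsSmoothBody S)
include D hS

theorem bIntegrand_withH_ae {X X' : Submodule ℝ L2Plane} (hX : X ≤ spaceH S) {u : X} {w : X'}
    {v : Plane → Plane} {Γ : Plane → Mat2} (hΓ : IsWeakGrad Sᶜ (field w) Γ) (a b : ℝ) :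
    bIntegrand S (withH H u a) v (withH H w b) =ᵐ[volume.restrict Sᶜ] fun x =>
      contract (field u x + a • H x - rigid (rigidData S (field u)) x)
        (b • gradMat D.G x + Γ x) (v x) -
        (rigidData S (field u)).2 * ⟪perp (v x), field w x + b • H x⟫ := by
  filter_upwards [(D.isWeakGrad_withH hS hΓ b).weakGrad_ae hS.isOpen_compl] with x hx
  rw [bIntegrand_eq, hx, D.rigidData_withH hS hX]
  rfl

end CircData

theorem IsSmoothBody.rigidData_congr {S : Set Plane} (hS : IsSmoothBody S) {u u' : Plane → Plane}
    {q : Plane × ℝ} (hq : u =ᵐ[volume.restrict S] rigid q) (hu : u =ᵐ[volume] u') :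
    rigidData S u = rigidData S u' := by
  rw [hS.rigidData_eq hq, hS.rigidData_eq (EventuallyEq.trans (EventuallyEq.symm (ae_restrict_of_ae hu)) hq)]

theorem bIntegrand_congr {S : Set Plane} (hS : IsSmoothBody S) {u u' v w w' : Plane → Plane}
    {q : Plane × ℝ} {Γ : Plane → Mat2} (hq : u =ᵐ[volume.restrict S] rigid q)
    (hu : u =ᵐ[volume] u') (hΓ : IsWeakGrad Sᶜ w Γ) (hw : w =ᵐ[volume] w') :
    bIntegrand S u v w =ᵐ[volume.restrict Sᶜ] bIntegrand S u' v w' := by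
  have h1 := hS.rigidData_congr hq hu
  have hΓ' := hΓ.congr hS.isOpen_compl (ae_restrict_of_ae hw)
  filter_upwards [ae_restrict_of_ae hu, ae_restrict_of_ae hw, hΓ.weakGrad_ae hS.isOpen_compl,
    hΓ'.weakGrad_ae hS.isOpen_compl] with x a1 a2 a3 a4
  rw [bIntegrand_eq, bIntegrand_eq, a1, a2, a3, a4, h1]

theorem bForm_congr {S : Set Plane} (hS : IsSmoothBody S) {m : ℝ} {u u' v w w' : Plane → Plane}
    {q q' : Plane × ℝ} {Γ : Plane → Mat2} (hq : u =ᵐ[volume.restrict S] rigid q)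
    (hu : u =ᵐ[volume] u') (hq' : w =ᵐ[volume.restrict S] rigid q') (hΓ : IsWeakGrad Sᶜ w Γ)
    (hw : w =ᵐ[volume] w') : bForm S m u v w = bForm S m u' v w' := by
  have h1 := hS.rigidData_congr hq hu
  have h2 := hS.rigidData_congr hq' hw
  rw [bForm, bForm, integral_congr_ae (bIntegrand_congr hS hq hu hΓ hw)]
  simp only [bBody, angVel, linVel, h1, h2]

theorem withH_zero {X : Submodule ℝ L2Plane} (H : Plane → Plane) (β : ℝ) :
    withH H (0 : X) β =ᵐ[volume] fun x => β • H x := by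
  filter_upwards [coe_zero_ae] with x hx
  simp only [withH, Submodule.coe_zero, hx, zero_add]

theorem withH_coeff_zero {X : Submodule ℝ L2Plane} (H : Plane → Plane) (φ : X) :
    withH H φ 0 = field φ := by
  ext1 x
  simp [withH]

/-! ### The form `b` on the energy spaces -/

section Energy

variable {S : Set Plane} {H : Plane → Plane} (hS : IsSmoothBody S) (D : CircData S H) {m J : ℝ}
  (hm : 0 < m) (hJ : 0 < J)
include hS D hm hJ

/-- A bound for `b` that leaves the terms `[u · ∇ w] · v` and `r_u |x| |∇ w|` to be estimated. -/
theorem exists_bound_of_l1Le : ∃ K : ℝ, 0 < K ∧ ∀ {X₁ X₂ X₃ : Submodule ℝ L2Plane}, X₁ ≤ spaceH S →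
    X₃ ≤ spaceVu S → ∀ (u : X₁) (a : ℝ) (v : X₂) (w : X₃) (b : ℝ) {X Y Z k : ℝ},
    normH S m J (field u) + |a| ≤ X →
    normH S m J (field v) ≤ Y → normH S m J (field w) + |b| ≤ Z →
    lpNorm (weakGrad Sᶜ (field w)) 2 (volume.restrict Sᶜ) ≤ Z →
    L1Le (volume.restrict Sᶜ) (fun x => ‖field u x‖ * ‖field v x‖ * ‖weakGrad Sᶜ (field w) x‖)
      (k * (X * Y * Z)) →
    MemLp (fun x => |angVel S (field u)| * (‖x‖ * ‖weakGrad Sᶜ (field w) x‖)) 2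
      (volume.restrict Sᶜ) ∧
    lpNorm (fun x => |angVel S (field u)| * (‖x‖ * ‖weakGrad Sᶜ (field w) x‖)) 2
      (volume.restrict Sᶜ) ≤ |angVel S (field u)| * Z →
    IntegrableOn (bIntegrand S (withH H u a) (field v) (withH H w b)) Sᶜ ∧
    |bForm S m (withH H u a) (field v) (withH H w b)| ≤ (k + K) * (X * Y * Z) := by
  obtain ⟨K, hK, h⟩ := D.exists_l1Le hS
  set c := 1 + (√m)⁻¹ + (√J)⁻¹
  have i1 : 0 ≤ (√m)⁻¹ := by positivity
  have i2 : 0 ≤ (√J)⁻¹ := by positivity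
  have hc : 1 ≤ c := by simp only [c]; linarith
  have hc0 : 0 < c := by linarith
  refine ⟨(K + m) * c ^ 3, by positivity, ?_⟩
  intro X₁ X₂ X₃ h₁ h₃ u a v w b X Y Z k hX hv hZ hg hT hW
  have up : ∀ {s T : ℝ}, 0 ≤ s → s ≤ T → s ≤ c * T := fun hs h1 => by nlinarith
  have upm : ∀ {r s t T : ℝ}, s ≤ r * t → r ≤ c → 0 ≤ t → t ≤ T → s ≤ c * T :=
    fun h1 hr h0 h2 => h1.trans (mul_le_mul hr h2 h0 hc0.le)
  have hmc : (√m)⁻¹ ≤ c := by simp only [c]; linarith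
  have nu := normH_nonneg (S := S) (m := m) (J := J) (field u)
  have nv := normH_nonneg (S := S) (m := m) (J := J) (field v)
  have nw := normH_nonneg (S := S) (m := m) (J := J) (field w)
  have hu : normH S m J (field u) ≤ X := (le_add_of_nonneg_right (abs_nonneg a)).trans hX
  have hw : normH S m J (field w) ≤ Z := (le_add_of_nonneg_right (abs_nonneg b)).trans hZ
  obtain ⟨g1, m1, -⟩ := spaceVu_spec (m := m) (J := J) hS _ (h₃ w.2)
  have rX := upm (abs_angVel_le hm hJ _) (by simp only [c]; linarith) nu hu
  have lu := upm (norm_linVel_le hm hJ _) hmc nu hu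
  have lv := upm (norm_linVel_le hm hJ _) hmc nv hv
  have lw := upm (norm_linVel_le hm hJ _) hmc nw hw
  have hX0 : 0 ≤ c * X := mul_nonneg hc0.le (nu.trans hu)
  have hT' : k * (X * Y * Z) = k / c ^ 3 * (c * X * (c * Y) * (c * Z)) := by field_simp
  rw [hT'] at hT
  have hl := h (memLp_field u _) (memLp_field v _) (memLp_field w _) m1
    (up lpNorm_nonneg ((lpNorm_le_normH hm hJ (memLp_field u _)).trans hu)) lu rX
    (up (abs_nonneg a) ((le_add_of_nonneg_left nu).trans hX))
    (up lpNorm_nonneg ((lpNorm_le_normH hm hJ (memLp_field v _)).trans hv))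
    (up lpNorm_nonneg ((lpNorm_le_normH hm hJ (memLp_field w _)).trans hw))
    (up lpNorm_nonneg hg) (up (abs_nonneg b) ((le_add_of_nonneg_left nw).trans hZ)) hT hW.1
    (hW.2.trans (mul_le_mul rX (up (nw.trans hw) le_rfl) (nw.trans hw) hX0))
  have e := D.bIntegrand_withH_ae hS h₁ (u := u) (v := field v) g1 a b
  refine ⟨(integrable_congr e).2 hl.1, ?_⟩
  have hbody : |bBody S m (withH H u a) (field v) (withH H w b)| ≤
      m * (c * X * (c * Y * (c * Z))) := by
    simp only [bBody, angVel, linVel, D.rigidData_withH hS h₁,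
      D.rigidData_withH hS (h₃.trans spaceVu_le)]
    rw [abs_mul, abs_mul, abs_of_nonneg hm.le, mul_assoc]
    refine mul_le_mul_of_nonneg_left (mul_le_mul rX ?_ (abs_nonneg _) hX0) hm.le
    refine (abs_real_inner_le_norm _ _).trans ?_
    rw [perp_norm]
    exact mul_le_mul lv lw (norm_nonneg _) (mul_nonneg hc0.le (nv.trans hv))
  rw [bForm, integral_congr_ae e]
  refine (abs_sub _ _).trans ((add_le_add hl.abs_integral_le hbody).trans (le_of_eq ?_))
  field_simp
  ring

omit D hm hJ in
theorem memLp_angular_weight (w : spaceV S) (r : ℝ) {Z : ℝ} (hZ : normV S m J (field w) ≤ Z) :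
    MemLp (fun x => |r| * (‖x‖ * ‖weakGrad Sᶜ (field w) x‖)) 2 (volume.restrict Sᶜ) ∧
    lpNorm (fun x => |r| * (‖x‖ * ‖weakGrad Sᶜ (field w) x‖)) 2 (volume.restrict Sᶜ) ≤
      |r| * Z := by
  obtain ⟨-, g2, g3⟩ := spaceV_spec (m := m) (J := J) hS _ w.2
  have m0 : AEStronglyMeasurable (fun x => ‖x‖ * ‖weakGrad Sᶜ (field w) x‖) (volume.restrict Sᶜ) :=
    continuous_norm.aestronglyMeasurable.mul (memLp_of_weight g2).1.1.norm
  have hle : ∀ᵐ x ∂(volume.restrict Sᶜ), ‖‖x‖ * ‖weakGrad Sᶜ (field w) x‖‖ ≤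
      ‖√(1 + ‖x‖ ^ 2) • weakGrad Sᶜ (field w) x‖ := ae_of_all _ fun x => by
    rw [Real.norm_of_nonneg (by positivity), norm_smul, Real.norm_of_nonneg (Real.sqrt_nonneg _)]
    gcongr
    exact norm_le_weight x
  refine ⟨(g2.mono m0 hle).const_mul _, ?_⟩
  refine (lpNorm_const_smul |r| (fun x => ‖x‖ * ‖weakGrad Sᶜ (field w) x‖) _).le.trans ?_
  rw [coe_nnnorm, Real.norm_eq_abs, abs_abs]
  gcongr
  exact (lpNorm_mono_ae m0 g2 hle).trans (g3.trans hZ)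

theorem exists_bound_Vu_Vu_V : ∃ C : ℝ, 0 < C ∧ ∀ (u : spaceVu S) (a : ℝ) (v : spaceVu S)
    (w : spaceV S) (b : ℝ),
    IntegrableOn (bIntegrand S (withH H u a) (field v) (withH H w b)) Sᶜ ∧
    |bForm S m (withH H u a) (field v) (withH H w b)| ≤ C * (normVu S m J (field u) + |a|) *
      normVu S m J (field v) * (normV S m J (field w) + |b|) := by
  obtain ⟨K, hK, h⟩ := exists_bound_of_l1Le hS D hm hJ
  obtain ⟨A, hA, h4⟩ := exists_lpNorm_four hS
  refine ⟨A * A + K, by positivity, fun u a v w b => ?_⟩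
  obtain ⟨-, g2, g3⟩ := spaceV_spec (m := m) (J := J) hS _ w.2
  obtain ⟨m1, n1⟩ := memLp_of_weight g2
  have hZ : normV S m J (field w) ≤ normV S m J (field w) + |b| :=
    le_add_of_nonneg_right (abs_nonneg b)
  have n1Z := (n1.trans g3).trans hZ
  obtain ⟨fu, fu'⟩ := h4 _ u.2 hm hJ
  obtain ⟨fv, fv'⟩ := h4 _ v.2 hm hJ
  have m2 : MemLp (fun x => ‖field u x‖ * ‖field v x‖) 2 (volume.restrict Sᶜ) :=
    MemLp.mul' (p := 4) (q := 4) fv.norm fu.norm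
  have n2 : lpNorm (fun x => ‖field u x‖ * ‖field v x‖) 2 (volume.restrict Sᶜ) ≤
      (A * (normVu S m J (field u) + |a|)) * (A * normVu S m J (field v)) := by
    refine (lpNorm_mul_le (p := 4) (q := 4) fu.norm fv.norm).trans ?_
    rw [lpNorm_norm fu.1, lpNorm_norm fv.1]
    have h1 := fu'.trans (mul_le_mul_of_nonneg_left (le_add_of_nonneg_right (abs_nonneg a)) hA)
    exact mul_le_mul h1 fv' lpNorm_nonneg (lpNorm_nonneg.trans h1)
  have hT := L1Le.mul m2 m1.norm n2 ((lpNorm_norm m1.1 _).trans_le n1Z)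
  have key := h spaceVu_le (spaceV_le_spaceVu hS) u a v w b
    (add_le_add (normH_le_normVu _) le_rfl) (normH_le_normVu _)
    (add_le_add (normH_le_normV _) le_rfl) n1Z (k := A * A) (by convert hT using 1; ring)
    (memLp_angular_weight hS w _ hZ)
  exact ⟨key.1, key.2.trans (le_of_eq (by ring))⟩

/-- Boundedness of `b(H, ·, ·)`. -/
theorem exists_bound_H_Vu_Vu : ∃ C : ℝ, 0 < C ∧ ∀ v w : spaceVu S,
    IntegrableOn (bIntegrand S (withH H (0 : spaceVu S) 1) (field v) (field w)) Sᶜ ∧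
    |bForm S m (withH H (0 : spaceVu S) 1) (field v) (field w)| ≤
      C * normVu S m J (field v) * normVu S m J (field w) := by
  obtain ⟨K, hK, h⟩ := exists_bound_of_l1Le hS D hm hJ
  have z0 : field (0 : spaceVu S) =ᵐ[volume] fun _ => 0 := coe_zero_ae
  have hr : angVel S (field (0 : spaceVu S)) = 0 := by
    rw [angVel, hS.rigidData_eq (q := 0)]
    · rfl
    filter_upwards [ae_restrict_of_ae (s := S) z0] with x hx
    rw [hx]; simp [rigid]
  have hN := normH_nonneg (S := S) (m := m) (J := J) (field (0 : spaceVu S))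
  refine ⟨K * (normH S m J (field (0 : spaceVu S)) + |1|), by positivity, fun v w => ?_⟩
  obtain ⟨-, -, n1⟩ := spaceVu_spec (m := m) (J := J) hS _ w.2
  have hT : L1Le (volume.restrict Sᶜ)
      (fun x => ‖field (0 : spaceVu S) x‖ * ‖field v x‖ * ‖weakGrad Sᶜ (field w) x‖) 0 := by
    have e : (fun x => ‖field (0 : spaceVu S) x‖ * ‖field v x‖ * ‖weakGrad Sᶜ (field w) x‖)
        =ᵐ[volume.restrict Sᶜ] fun _ => 0 := by
      filter_upwards [ae_restrict_of_ae (s := Sᶜ) z0] with x hx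
      rw [hx]; simp
    refine ⟨(integrable_congr e).2 (integrable_zero _ _ _), ?_⟩
    rw [integral_congr_ae (g := fun _ => (0 : ℝ))
      (by filter_upwards [e] with x hx; rw [hx, abs_zero]), integral_zero]
  have key := h spaceVu_le le_rfl 0 1 v w 0 (Z := normVu S m J (field w)) (k := 0) le_rfl
    (normH_le_normVu _) (by simpa using normH_le_normVu _) n1 (by simpa using hT)
    (by rw [hr]; simp)
  rw [withH_coeff_zero] at key
  exact ⟨key.1, key.2.trans (le_of_eq (by ring))⟩

end Energy

theorem withH_zero_one (X : Submodule ℝ L2Plane) (H : Plane → Plane) :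
    withH H (0 : X) 1 =ᵐ[volume] H := by
  filter_upwards [withH_zero (X := X) H 1] with x hx
  rw [hx, one_smul]

section Energy

variable {S : Set Plane} {H : Plane → Plane} (hS : IsSmoothBody S) (D : CircData S H) {m J : ℝ}
  (hm : 0 < m) (hJ : 0 < J)
include hS D hm hJ

/-- The trilinear form on `(𝓥_ ⊕ ℝH) × 𝓥_ × (𝓥 ⊕ ℝH)`. -/
theorem trilinear_on_energy_spaces :
    (∀ (u : spaceVu S) (β₁ : ℝ) (v : spaceVu S) (w : spaceV S) (β₃ : ℝ),
        IntegrableOn (bIntegrand S (withH H u β₁) (field v) (withH H w β₃)) Sᶜ) ∧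
      ∃ B : (spaceVu S × ℝ) →ₗ[ℝ] spaceVu S →ₗ[ℝ] (spaceV S × ℝ) →ₗ[ℝ] ℝ,
        (∀ (u : spaceVu S) (β₁ : ℝ) (v : spaceVu S) (w : spaceV S) (β₃ : ℝ),
          B (u, β₁) v (w, β₃) = bForm S m (withH H u β₁) (field v) (withH H w β₃)) ∧
        ∃ C : ℝ, 0 < C ∧ ∀ (u : spaceVu S) (β₁ : ℝ) (v : spaceVu S) (w : spaceV S) (β₃ : ℝ),
          |B (u, β₁) v (w, β₃)| ≤ C * (normVu S m J (field u) + |β₁|) * normVu S m J (field v)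
            * (normV S m J (field w) + |β₃|) := by
  obtain ⟨C, hC, h⟩ := exists_bound_Vu_Vu_V hS D hm hJ
  refine ⟨fun u a v w b => (h u a v w b).1, trilinOfComb
    (fun p v r => bForm S m (withH H p.1 p.2) (field v) (withH H r.1 r.2)) ?_ ?_ ?_,
    fun _ _ _ _ _ => rfl, C, hC, fun u a v w b => (h u a v w b).2⟩
  · intro c p p' v r
    exact hS.bForm_comb_left (D.withH_ae_rigid hS spaceVu_le p.1 p.2)
      (D.withH_ae_rigid hS spaceVu_le p'.1 p'.2) (withH_comb H p.1 p'.1 p.2 p'.2 c)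
      (h _ _ _ _ _).1 (h _ _ _ _ _).1
  · intro c p v v' r
    exact hS.bForm_comb_mid (hS.field_ae_rigid spaceVu_le v) (hS.field_ae_rigid spaceVu_le v')
      (field_comb v v' c) (h _ _ _ _ _).1 (h _ _ _ _ _).1
  · intro c p v r r'
    exact hS.bForm_comb_right (D.withH_ae_rigid hS spaceV_le r.1 r.2)
      (D.withH_ae_rigid hS spaceV_le r'.1 r'.2)
      (D.isWeakGrad_withH hS (spaceV_spec (m := m) (J := J) hS _ r.1.2).1 r.2)
      (D.isWeakGrad_withH hS (spaceV_spec (m := m) (J := J) hS _ r'.1.2).1 r'.2)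
      (withH_comb H r.1 r'.1 r.2 r'.2 c) (h _ _ _ _ _).1 (h _ _ _ _ _).1

/-- The bilinear form `b(H, ·, ·)` on `𝓥_ × 𝓥_`. -/
theorem bilinear_H_left :
    (∀ v w : spaceVu S, IntegrableOn (bIntegrand S H (field v) (field w)) Sᶜ) ∧
      ∃ B : spaceVu S →ₗ[ℝ] spaceVu S →ₗ[ℝ] ℝ,
        (∀ v w : spaceVu S, B v w = bForm S m H (field v) (field w)) ∧
        ∃ C : ℝ, 0 < C ∧ ∀ v w : spaceVu S,
          |B v w| ≤ C * normVu S m J (field v) * normVu S m J (field w) := by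
  obtain ⟨C, hC, h⟩ := exists_bound_H_Vu_Vu hS D hm hJ
  have eH := withH_zero_one (spaceVu S) H
  have hrig := D.withH_ae_rigid hS spaceVu_le (0 : spaceVu S) 1
  have wg := fun w : spaceVu S => (spaceVu_spec (m := m) (J := J) hS _ w.2).1
  have hi : ∀ v w : spaceVu S, IntegrableOn (bIntegrand S H (field v) (field w)) Sᶜ := fun v w =>
    (integrable_congr (bIntegrand_congr hS hrig eH (wg w) (ae_eq_refl _))).1 (h v w).1
  refine ⟨hi, bilinOfComb (fun v w => bForm S m H (field v) (field w)) ?_ ?_, fun _ _ => rfl, C, hC,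
    fun v w => by
      have h1 := (h v w).2
      rwa [bForm_congr hS hrig eH (hS.field_ae_rigid spaceVu_le w) (wg w) (ae_eq_refl _)] at h1⟩
  · intro c v v' w
    exact hS.bForm_comb_mid (hS.field_ae_rigid spaceVu_le v) (hS.field_ae_rigid spaceVu_le v')
      (field_comb v v' c) (hi _ _) (hi _ _)
  · intro c v w w'
    exact hS.bForm_comb_right (hS.field_ae_rigid spaceVu_le w) (hS.field_ae_rigid spaceVu_le w')
      (wg w) (wg w') (field_comb w w' c) (hi _ _) (hi _ _)

/-- The bilinear form `b(·, ·, H)` on `𝓥_ × 𝓥_`. -/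
theorem bilinear_H_right :
    (∀ u v : spaceVu S, IntegrableOn (bIntegrand S (field u) (field v) H) Sᶜ) ∧
      ∃ B : spaceVu S →ₗ[ℝ] spaceVu S →ₗ[ℝ] ℝ,
        (∀ u v : spaceVu S, B u v = bForm S m (field u) (field v) H) ∧
        ∃ C : ℝ, 0 < C ∧ ∀ u v : spaceVu S,
          |B u v| ≤ C * normVu S m J (field u) * normVu S m J (field v) := by
  obtain ⟨C, hC, h⟩ := exists_bound_Vu_Vu_V hS D hm hJ
  have eH := withH_zero_one (spaceV S) H
  have hrig := D.withH_ae_rigid hS spaceV_le (0 : spaceV S) 1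
  have wg := D.isWeakGrad_withH hS (spaceV_spec (m := m) (J := J) hS _ (0 : spaceV S).2).1 1
  have hi : ∀ u v : spaceVu S, IntegrableOn (bIntegrand S (field u) (field v) H) Sᶜ := fun u v => by
    have h1 := (h u 0 v 0 1).1
    rw [withH_coeff_zero] at h1
    exact (integrable_congr (bIntegrand_congr hS (hS.field_ae_rigid spaceVu_le u) (ae_eq_refl _)
      wg eH)).1 h1
  refine ⟨hi, bilinOfComb (fun u v => bForm S m (field u) (field v) H) ?_ ?_, fun _ _ => rfl,
    C * (normV S m J (field (0 : spaceV S)) + |1|), ?_, fun u v => ?_⟩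
  rotate_left 2
  · have := (normH_nonneg _).trans (normH_le_normV (S := S) (m := m) (J := J) (field (0 : spaceV S)))
    positivity
  · have h1 := (h u 0 v 0 1).2
    rw [withH_coeff_zero, bForm_congr hS (hS.field_ae_rigid spaceVu_le u) (ae_eq_refl _) hrig wg eH,
      abs_zero, add_zero] at h1
    exact h1.trans (le_of_eq (by ring))
  · intro c u u' v
    exact hS.bForm_comb_left (hS.field_ae_rigid spaceVu_le u) (hS.field_ae_rigid spaceVu_le u')
      (field_comb u u' c) (hi _ _) (hi _ _)
  · intro c u v v'
    exact hS.bForm_comb_mid (hS.field_ae_rigid spaceVu_le v) (hS.field_ae_rigid spaceVu_le v')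
      (field_comb v v' c) (hi _ _) (hi _ _)

end Energy

/-! ### Convergence of products -/

section Products

variable {α : Type*} [MeasurableSpace α] {μ : Measure α}

theorem tendsto_eLpNorm_mul {p q r : ℝ≥0∞} [ENNReal.HolderTriple p q r] (hr : 1 ≤ r)
    {a b : ℕ → α → ℝ} {a0 b0 : α → ℝ} (ma : ∀ n, MemLp (a n) p μ) (ma0 : MemLp a0 p μ)
    (mb : ∀ n, MemLp (b n) q μ) (mb0 : MemLp b0 q μ)
    (ha : Tendsto (fun n => eLpNorm (fun x => a n x - a0 x) p μ) atTop (𝓝 0))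
    (hb : Tendsto (fun n => eLpNorm (fun x => b n x - b0 x) q μ) atTop (𝓝 0)) :
    Tendsto (fun n => eLpNorm (fun x => a n x * b n x - a0 x * b0 x) r μ) atTop (𝓝 0) := by
  have hmul : ∀ {f g : α → ℝ}, AEStronglyMeasurable f μ → AEStronglyMeasurable g μ →
      eLpNorm (fun x => f x * g x) r μ ≤ eLpNorm f p μ * eLpNorm g q μ := fun hf hg =>
    eLpNorm_smul_le_mul_eLpNorm (E := ℝ) (𝕜 := ℝ) hg hf
  have hlim : Tendsto (fun n => eLpNorm (fun x => a n x - a0 x) p μ *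
      eLpNorm (fun x => b n x - b0 x) q μ + eLpNorm (fun x => a n x - a0 x) p μ * eLpNorm b0 q μ +
      eLpNorm a0 p μ * eLpNorm (fun x => b n x - b0 x) q μ) atTop (𝓝 0) := by
    have t1 := ENNReal.Tendsto.mul ha (Or.inr (by simp)) hb (Or.inr (by simp))
    have t2 := ENNReal.Tendsto.mul_const ha (Or.inr mb0.2.ne)
    have t3 := ENNReal.Tendsto.const_mul hb (Or.inr ma0.2.ne)
    simpa using (t1.add t2).add t3
  refine tendsto_of_tendsto_of_tendsto_of_le_of_le tendsto_const_nhds hlim (fun _ => zero_le)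
    fun n => ?_
  have da := (ma n).1.sub ma0.1
  have db := (mb n).1.sub mb0.1
  have e : (fun x => a n x * b n x - a0 x * b0 x) = (fun x => (a n x - a0 x) * (b n x - b0 x)) +
      (fun x => (a n x - a0 x) * b0 x) + fun x => a0 x * (b n x - b0 x) := by
    ext x; simp only [Pi.add_apply]; ring
  rw [e]
  refine (eLpNorm_add_le ((da.mul db).add (da.mul mb0.1)) (ma0.1.mul db) hr).trans ?_
  gcongr
  · refine (eLpNorm_add_le (da.mul db) (da.mul mb0.1) hr).trans ?_
    gcongr
    · exact hmul da db
    · exact hmul da mb0.1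
  · exact hmul ma0.1 db

theorem tendsto_integral_mul {p q : ℝ≥0∞} [ENNReal.HolderTriple p q 1]
    {a b : ℕ → α → ℝ} {a0 b0 : α → ℝ} (ma : ∀ n, MemLp (a n) p μ) (ma0 : MemLp a0 p μ)
    (mb : ∀ n, MemLp (b n) q μ) (mb0 : MemLp b0 q μ)
    (ha : Tendsto (fun n => eLpNorm (fun x => a n x - a0 x) p μ) atTop (𝓝 0))
    (hb : Tendsto (fun n => eLpNorm (fun x => b n x - b0 x) q μ) atTop (𝓝 0)) :
    Tendsto (fun n => ∫ x, a n x * b n x ∂μ) atTop (𝓝 (∫ x, a0 x * b0 x ∂μ)) := by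
  refine tendsto_integral_of_L1' (fun x => a0 x * b0 x)
    (MemLp.mul' (p := p) (q := q) (r := 1) mb0 ma0).1
    (Eventually.of_forall fun n =>
      memLp_one_iff_integrable.1 (MemLp.mul' (p := p) (q := q) (mb n) (ma n))) ?_
  exact tendsto_eLpNorm_mul le_rfl ma ma0 mb mb0 ha hb

end Products

theorem tendsto_eLpNorm_const {α : Type*} [MeasurableSpace α] {μ : Measure α} (p : ℝ≥0∞)
    (f : α → ℝ) : Tendsto (fun _ : ℕ => eLpNorm (fun x => f x - f x) p μ) atTop (𝓝 0) := by
  simp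

/-! ### Tangential fields -/

/-- `U` is divergence free in the fluid domain and tangential at its boundary. -/
def Tangential (S : Set Plane) (U : Plane → Plane) : Prop :=
  ∀ ψ, ContDiff ℝ 1 ψ → HasCompactSupport ψ → ∫ x in Sᶜ, along U ψ x = 0

theorem memLp_of_compactSupport {f : Plane → ℝ} (hf : Continuous f) (hc : HasCompactSupport f)
    (p : ℝ≥0∞) : MemLp f p volume := hf.memLp_of_hasCompactSupport hc

theorem hasCompactSupport_pd' {ψ : Plane → ℝ} (hc : HasCompactSupport ψ) (j : Fin 2) :
    HasCompactSupport (pd j ψ) := hc.fderiv_apply ℝ _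

theorem memLp_coord {E : Type*} [MeasurableSpace E] {μ : Measure E} {ι : Type*} [Fintype ι]
    {u : E → EuclideanSpace ℝ ι} {p : ℝ≥0∞} (hu : MemLp u p μ) (i : ι) :
    MemLp (fun x => u x i) p μ := (EuclideanSpace.proj (𝕜 := ℝ) i).comp_memLp' hu

theorem integrable_along {u : Plane → Plane} {μ : Measure Plane} (hu : MemLp u 2 μ)
    (hμ : μ ≤ volume) {ψ : Plane → ℝ} (hψ : ContDiff ℝ 1 ψ) (hc : HasCompactSupport ψ) :
    Integrable (along u ψ) μ := by
  have key : ∀ j, Integrable (fun x => u x j * pd j ψ x) μ := fun j =>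
    memLp_one_iff_integrable.1 (MemLp.mul' (p := 2) (q := 2)
      ((memLp_of_compactSupport (continuous_pd hψ j) (hasCompactSupport_pd' hc j) 2).mono_measure hμ)
      (memLp_coord hu j))
  exact (key 0).add (key 1)

/-- Weakly divergence free fields may be tested with `C¹` functions. -/
theorem WeakDivFree.integral_along {u : Plane → Plane} (hu : MemLp u 2 volume)
    (h : WeakDivFree u) {ψ : Plane → ℝ} (hψ : ContDiff ℝ 1 ψ) (hc : HasCompactSupport ψ) :
    ∫ x, along u ψ x = 0 := by
  obtain ⟨K, hK, -⟩ := exists_isMollifier_small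
  have lψ : LocallyIntegrable ψ := hψ.continuous.locallyIntegrable
  have mψ := fun j => memLp_of_compactSupport (continuous_pd hψ j) (hasCompactSupport_pd' hc j) 2
  have e : ∀ n j, pd j (mol (K n) ψ) = mol (K n) (pd j ψ) := fun n j => by
    ext x
    have := (HasWeakPd.of_contDiff univ hψ j).pd_mol isOpen_univ (by simpa using lψ) (hK.smooth n)
      (hK.compact n) (x := x) fun _ _ => mem_univ _
    simpa using this
  have ht : ∀ n, IsTest univ (mol (K n) ψ) := fun n =>
    ⟨mol_contDiff lψ (hK.smooth n) (hK.compact n), by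
      rw [mol_eq_convolution]; exact HasCompactSupport.convolution _ hc (hK.compact n),
      subset_univ _⟩
  have t : ∀ j, Tendsto (fun n => ∫ x, u x j * pd j (mol (K n) ψ) x) atTop
      (𝓝 (∫ x, u x j * pd j ψ x)) := fun j =>
    tendsto_integral_mul (p := 2) (q := 2) (fun _ => memLp_coord hu j) (memLp_coord hu j)
      (fun n => memLp_of_compactSupport (continuous_pd (ht n).contDiff_one j)
        (hasCompactSupport_pd' (ht n).2.1 j) 2) (mψ j) (tendsto_eLpNorm_const 2 _) (by
        simp only [e]
        exact hK.tendsto_eLpNorm (mψ j))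
  have ii : ∀ {ψ : Plane → ℝ}, ContDiff ℝ 1 ψ → HasCompactSupport ψ → ∀ j,
      Integrable fun x => u x j * pd j ψ x := fun hψ hc j =>
    memLp_one_iff_integrable.1 (MemLp.mul' (p := 2) (q := 2)
      (memLp_of_compactSupport (continuous_pd hψ j) (hasCompactSupport_pd' hc j) 2)
      (memLp_coord hu j))
  have hsum := (t 0).add (t 1)
  have z : ∀ n, (∫ x, u x 0 * pd 0 (mol (K n) ψ) x) + ∫ x, u x 1 * pd 1 (mol (K n) ψ) x = 0 :=
    fun n => by
    rw [← integral_add (ii (ht n).contDiff_one (ht n).2.1 0) (ii (ht n).contDiff_one (ht n).2.1 1)]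
    exact h _ (ht n)
  simp only [z] at hsum
  have := tendsto_nhds_unique hsum tendsto_const_nhds
  unfold along
  rw [integral_add (ii hψ hc 0) (ii hψ hc 1), this]

theorem contDiff_perp {n : WithTop ℕ∞} : ContDiff ℝ n perp := by
  rw [contDiff_euclidean]
  intro i
  fin_cases i
  · simp only [Fin.zero_eta, perp_apply_zero]; fun_prop
  · simp only [Fin.mk_one, perp_apply_one]; fun_prop

theorem contDiff_rigid (q : Plane × ℝ) {n : WithTop ℕ∞} : ContDiff ℝ n (rigid q) :=
  contDiff_const.add (contDiff_perp.const_smul q.2)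

theorem integral_along_of_div {u : Plane → Plane} (hu : ContDiff ℝ 1 u)
    (hdiv : ∀ x, pd 0 (fun y => u y 0) x + pd 1 (fun y => u y 1) x = 0) {ψ : Plane → ℝ}
    (hψ : ContDiff ℝ 1 ψ) (hc : HasCompactSupport ψ) : ∫ x, along u ψ x = 0 := by
  have ii : ∀ j : Fin 2, Integrable fun x => u x j * pd j ψ x := fun j =>
    ((hu.coord j).continuous.mul (continuous_pd hψ j)).integrable_of_hasCompactSupport
      (hasCompactSupport_pd' hc j).mul_left
  have ii' : ∀ j : Fin 2, Integrable fun x => pd j (fun y => u y j) x * ψ x := fun j =>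
    ((continuous_pd (hu.coord j) j).mul hψ.continuous).integrable_of_hasCompactSupport hc.mul_left
  unfold along
  rw [integral_add (ii 0) (ii 1), integral_mul_pd (hu.coord 0) hψ hc,
    integral_mul_pd (hu.coord 1) hψ hc, ← neg_add, ← integral_add (ii' 0) (ii' 1), neg_eq_zero]
  simp only [← add_mul, hdiv, zero_mul, integral_zero]

theorem pd_rigid (q : Plane × ℝ) (j : Fin 2) (x : Plane) :
    pd j (fun y => rigid q y 0) x = (if j = 1 then -q.2 else 0) ∧
    pd j (fun y => rigid q y 1) x = (if j = 0 then q.2 else 0) := by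
  have e0 : (fun y => rigid q y 0) = fun y : Plane => q.1 0 + (-q.2) * y 1 := by
    ext y; rw [rigid_apply_zero]; ring
  have e1 : (fun y => rigid q y 1) = fun y : Plane => q.1 1 + q.2 * y 0 := by
    ext y; rw [rigid_apply_one]
  rw [e0, e1]
  constructor
  · rw [pd_add (by fun_prop) (by fun_prop), pd_mul (by fun_prop) (by fun_prop), pd_const, pd_const,
      pd_coord]
    fin_cases j <;> simp
  · rw [pd_add (by fun_prop) (by fun_prop), pd_mul (by fun_prop) (by fun_prop), pd_const, pd_const,
      pd_coord]
    fin_cases j <;> simp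

theorem integral_along_rigid (q : Plane × ℝ) {ψ : Plane → ℝ} (hψ : ContDiff ℝ 1 ψ)
    (hc : HasCompactSupport ψ) : ∫ x, along (rigid q) ψ x = 0 :=
  integral_along_of_div (contDiff_rigid q)
    (fun x => by rw [(pd_rigid q 0 x).1, (pd_rigid q 1 x).2]; simp) hψ hc

theorem along_sub (u v : Plane → Plane) (ψ : Plane → ℝ) (x : Plane) :
    along (fun y => u y - v y) ψ x = along u ψ x - along v ψ x := by
  simp [along]; ring

theorem along_add_smul (u v : Plane → Plane) (c : ℝ) (ψ : Plane → ℝ) (x : Plane) :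
    along (fun y => u y + c • v y) ψ x = along u ψ x + c * along v ψ x := by
  simp [along]; ring

theorem field_tangential {S : Set Plane} (hS : IsSmoothBody S) (φ : spaceH S) :
    Tangential S fun x => field φ x - rigid (rigidData S (field φ)) x := by
  intro ψ hψ hc
  set q := rigidData S (field φ)
  have h1 := WeakDivFree.integral_along (Lp.memLp (φ : L2Plane)) φ.2.1 hψ hc
  have h2 := integral_along_rigid q hψ hc
  have i1 := integrable_along (Lp.memLp (φ : L2Plane)) le_rfl hψ hc
  have i2 : Integrable (along (rigid q) ψ) :=
    (continuous_along (continuous_rigid q) hψ).integrable_of_hasCompactSupport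
      (hasCompactSupport_along _ hc)
  have e : ∫ x, along (fun x => field φ x - rigid q x) ψ x = 0 := by
    simp only [along_sub]
    rw [integral_sub i1 i2, h2, sub_zero]
    exact h1
  have i3 : Integrable (along (fun x => field φ x - rigid q x) ψ) := by
    simp only [funext (along_sub _ _ _)]; exact i1.sub i2
  rw [← integral_add_compl hS.isClosed.measurableSet i3] at e
  have z : ∫ x in S, along (fun x => field φ x - rigid q x) ψ x = 0 := by
    refine integral_eq_zero_of_ae ?_
    filter_upwards [hS.field_ae_rigid le_rfl φ] with x hx
    have hx' : field φ x = rigid q x := hx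
    rw [along_sub]
    simp only [along, hx', sub_self, Pi.zero_apply]
  rwa [z, zero_add] at e

theorem CircData.tangential {S : Set Plane} {H : Plane → Plane} (D : CircData S H)
    (hS : IsSmoothBody S) (φ : spaceH S) (β : ℝ) :
    Tangential S fun x => withH H φ β x - rigid (rigidData S (field φ)) x := by
  intro ψ hψ hc
  have h1 := field_tangential hS φ ψ hψ hc
  have h2 := D.flux ψ hψ hc
  set q := rigidData S (field φ)
  have i1 : IntegrableOn (along (fun x => field φ x - rigid q x) ψ) Sᶜ := by
    simp only [funext (along_sub _ _ _)]
    exact (integrable_along (memLp_field φ _) Measure.restrict_le_self hψ hc).sub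
      ((continuous_along (continuous_rigid q) hψ).integrable_of_hasCompactSupport
        (hasCompactSupport_along _ hc)).integrableOn
  have i2 : IntegrableOn (along D.G ψ) Sᶜ :=
    ((continuous_along D.contDiff.continuous hψ).integrable_of_hasCompactSupport
        (hasCompactSupport_along _ hc)).integrableOn
  have e : ∫ x in Sᶜ, along (fun x => withH H φ β x - rigid q x) ψ x =
      ∫ x in Sᶜ, (along (fun x => field φ x - rigid q x) ψ x + β * along D.G ψ x) := by
    refine integral_congr_ae ?_
    filter_upwards [D.ae_eq hS] with x hx
    rw [← along_add_smul]
    simp only [along, withH, hx, PiLp.add_apply, PiLp.sub_apply]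
    ring
  rw [e, integral_add i1 (i2.const_mul β), integral_const_mul, h1, h2]
  simp

/-! ### Integration by parts for functions in `H¹` -/

theorem IsTest.isH1 {φ : Plane → ℝ} (hφ : IsTest univ φ) (O : Set Plane) :
    IsH1 O φ fun j => pd j φ :=
  ⟨fun j => HasWeakPd.of_contDiff O hφ.contDiff_one j,
    (memLp_of_compactSupport hφ.1.continuous hφ.2.1 2).restrict O,
    fun j => (memLp_of_compactSupport (continuous_pd hφ.contDiff_one j)
      (hasCompactSupport_pd' hφ.2.1 j) 2).restrict O⟩

/-- Smooth approximation in `H¹` and in `L⁴`. -/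
theorem IsSmoothBody.exists_seq_approx_four {S : Set Plane} (hS : IsSmoothBody S) {f : Plane → ℝ}
    {G : Fin 2 → Plane → ℝ} (h : IsH1 Sᶜ f G) : MemLp f 4 (volume.restrict Sᶜ) ∧
    ∃ φ : ℕ → Plane → ℝ, (∀ n, IsTest univ (φ n)) ∧
      Tendsto (fun n => eLpNorm (fun x => φ n x - f x) 2 (volume.restrict Sᶜ)) atTop (𝓝 0) ∧
      Tendsto (fun n => eLpNorm (fun x => φ n x - f x) 4 (volume.restrict Sᶜ)) atTop (𝓝 0) ∧
      ∀ j, Tendsto (fun n => eLpNorm (fun x => pd j (φ n) x - G j x) 2 (volume.restrict Sᶜ)) atTop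
        (𝓝 0) := by
  obtain ⟨A, hA⟩ := hS.exists_L4
  obtain ⟨φ, hφ, ht⟩ := hS.exists_seq_approx h
  have sq : ∀ {a : ℕ → ℝ≥0∞}, (∀ n, a n ≤ h1n Sᶜ (φ n - f) fun j => pd j (φ n) - G j) →
      Tendsto a atTop (𝓝 0) := fun ha =>
    tendsto_of_tendsto_of_tendsto_of_le_of_le tendsto_const_nhds ht (fun _ => zero_le) ha
  have hd : ∀ n, IsH1 Sᶜ (φ n - f) fun j => pd j (φ n) - G j := fun n => by
    have h1 := (hφ n).isH1 Sᶜ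
    refine ⟨fun j => ?_, h1.memLp.sub h.memLp, fun j => (h1.memLp_grad j).sub (h.memLp_grad j)⟩
    refine ((h.weak j).comb (h1.weak j) (-1)).congr hS.isOpen_compl (ae_of_all _ fun x => ?_)
      (ae_of_all _ fun x => ?_)
    · simp only [Pi.sub_apply]; ring
    · simp only [Pi.sub_apply]; ring
  refine ⟨⟨h.memLp.1, (hA f G h).trans_lt (ENNReal.mul_lt_top (by simp) h.h1n_lt_top)⟩, φ, hφ,
    sq fun n => eLpNorm_le_h1n _ _ _, ?_, fun j => sq fun n => ?_⟩
  · have t := ENNReal.Tendsto.const_mul (a := (A : ℝ≥0∞)) ht (Or.inr (by simp))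
    rw [mul_zero] at t
    exact tendsto_of_tendsto_of_tendsto_of_le_of_le tendsto_const_nhds t (fun _ => zero_le)
      fun n => hA _ _ (hd n)
  · exact eLpNorm_le_h1n' Sᶜ (φ n - f) (fun j => pd j (φ n) - G j) j

theorem Tangential.integral_mul_along {S : Set Plane} (hS : IsSmoothBody S) {U : Plane → Plane}
    (hU : Tangential S U) (hU4 : ∀ R : ℝ, MemLp U 4 (volume.restrict (Sᶜ ∩ ball 0 R)))
    {f : Plane → ℝ} {G : Fin 2 → Plane → ℝ} (hf : IsH1 Sᶜ f G) {χ : Plane → ℝ}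
    (hχ : IsTest univ χ) :
    IntegrableOn (fun x => f x * f x * along U χ x) Sᶜ ∧
    IntegrableOn (fun x => χ x * (f x * (U x 0 * G 0 x + U x 1 * G 1 x))) Sᶜ ∧
    2 * ∫ x in Sᶜ, χ x * (f x * (U x 0 * G 0 x + U x 1 * G 1 x)) =
      - ∫ x in Sᶜ, f x * f x * along U χ x := by
  set μ := volume.restrict Sᶜ
  have hm : MeasurableSet Sᶜ := hS.isOpen_compl.measurableSet
  obtain ⟨f4, φ, hφ, t2, t4, tg⟩ := hS.exists_seq_approx_four hf
  have mφ : ∀ n p, MemLp (φ n) p μ := fun n p =>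
    (memLp_of_compactSupport (hφ n).1.continuous (hφ n).2.1 p).restrict _
  have mpφ : ∀ n j p, MemLp (pd j (φ n)) p μ := fun n j p =>
    (memLp_of_compactSupport (continuous_pd (hφ n).contDiff_one j)
      (hasCompactSupport_pd' (hφ n).2.1 j) p).restrict _
  obtain ⟨R, hR⟩ := hχ.2.1.isCompact.isBounded.subset_ball 0
  have cut4 : ∀ (a : Plane → ℝ), Continuous a → HasCompactSupport a → tsupport a ⊆ tsupport χ →
      ∀ j, MemLp (fun x => a x * U x j) 4 μ := by
    intro a ha hac has j
    have hB : MeasurableSet (ball (0 : Plane) R) := isOpen_ball.measurableSet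
    have e : (fun x => a x * U x j) = (ball (0 : Plane) R).indicator fun x => a x * U x j := by
      ext x
      by_cases hx : x ∈ ball (0 : Plane) R
      · rw [indicator_of_mem hx]
      · rw [indicator_of_notMem hx,
          image_eq_zero_of_notMem_tsupport fun h => hx (hR (has h)), zero_mul]
    rw [e, memLp_indicator_iff_restrict hB, Measure.restrict_restrict hB, inter_comm]
    exact MemLp.mul' (p := ∞) (q := 4) (memLp_coord (hU4 R) j)
      ((memLp_of_compactSupport ha hac ∞).restrict _)
  have cut2 : ∀ (a : Plane → ℝ), Continuous a → HasCompactSupport a → tsupport a ⊆ tsupport χ →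
      ∀ j, MemLp (fun x => a x * U x j) 2 μ := by
    intro a ha hac has j
    have hB : MeasurableSet (ball (0 : Plane) R) := isOpen_ball.measurableSet
    have e : (fun x => a x * U x j) = (ball (0 : Plane) R).indicator fun x => a x * U x j := by
      ext x
      by_cases hx : x ∈ ball (0 : Plane) R
      · rw [indicator_of_mem hx]
      · rw [indicator_of_notMem hx,
          image_eq_zero_of_notMem_tsupport fun h => hx (hR (has h)), zero_mul]
    have h4 := cut4 a ha hac has j
    rw [e, memLp_indicator_iff_restrict hB] at h4 ⊢
    have : IsFiniteMeasure (μ.restrict (ball (0 : Plane) R)) := by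
      refine ⟨?_⟩
      rw [Measure.restrict_apply_univ]
      exact (Measure.restrict_apply_le _ _).trans_lt measure_ball_lt_top
    exact h4.mono_exponent (by norm_num)
  have wχ : MemLp (along U χ) 2 μ := by
    have : ∀ j, MemLp (fun x => U x j * pd j χ x) 2 μ := fun j => by
      simpa only [mul_comm] using cut2 (pd j χ) (continuous_pd hχ.contDiff_one j)
        (hasCompactSupport_pd' hχ.2.1 j) (tsupport_pd_subset χ j) j
    exact (this 0).add (this 1)
  have ff : MemLp (fun x => f x * f x) 2 μ := MemLp.mul' (p := 4) (q := 4) f4 f4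
  have φφ : ∀ n, MemLp (fun x => φ n x * φ n x) 2 μ := fun n =>
    MemLp.mul' (p := 4) (q := 4) (mφ n 4) (mφ n 4)
  have T1 : Tendsto (fun n => ∫ x, (φ n x * φ n x) * along U χ x ∂μ) atTop
      (𝓝 (∫ x, (f x * f x) * along U χ x ∂μ)) :=
    tendsto_integral_mul (p := 2) (q := 2) φφ ff (fun _ => wχ) wχ
      (tendsto_eLpNorm_mul (by norm_num) (fun n => mφ n 4) f4 (fun n => mφ n 4) f4 t4 t4)
      (tendsto_eLpNorm_const 2 _)
  have uf : ∀ j, MemLp (fun x => χ x * U x j) 4 μ := fun j => cut4 χ hχ.1.continuous hχ.2.1 le_rfl j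
  have ufφ : ∀ j n, MemLp (fun x => χ x * U x j * φ n x) 2 μ := fun j n =>
    MemLp.mul' (p := 4) (q := 4) (mφ n 4) (uf j)
  have uff : ∀ j, MemLp (fun x => χ x * U x j * f x) 2 μ := fun j =>
    MemLp.mul' (p := 4) (q := 4) f4 (uf j)
  have T2 : ∀ j, Tendsto (fun n => ∫ x, (χ x * U x j * φ n x) * pd j (φ n) x ∂μ) atTop
      (𝓝 (∫ x, (χ x * U x j * f x) * G j x ∂μ)) := fun j =>
    tendsto_integral_mul (p := 2) (q := 2) (ufφ j) (uff j) (fun n => mpφ n j 2) (hf.memLp_grad j)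
      (tendsto_eLpNorm_mul (by norm_num) (fun _ => uf j) (uf j) (fun n => mφ n 4) f4
        (tendsto_eLpNorm_const 4 _) t4) (tg j)
  have iG : ∀ j, Integrable (fun x => (χ x * U x j * f x) * G j x) μ := fun j =>
    memLp_one_iff_integrable.1 (MemLp.mul' (p := 2) (q := 2) (hf.memLp_grad j) (uff j))
  have iφ : ∀ j n, Integrable (fun x => (χ x * U x j * φ n x) * pd j (φ n) x) μ := fun j n =>
    memLp_one_iff_integrable.1 (MemLp.mul' (p := 2) (q := 2) (mpφ n j 2) (ufφ j n))
  have i1 : ∀ n, Integrable (fun x => (φ n x * φ n x) * along U χ x) μ := fun n =>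
    memLp_one_iff_integrable.1 (MemLp.mul' (p := 2) (q := 2) wχ (φφ n))
  have iff' : Integrable (fun x => (f x * f x) * along U χ x) μ :=
    memLp_one_iff_integrable.1 (MemLp.mul' (p := 2) (q := 2) wχ ff)
  have hsum : (fun x => χ x * (f x * (U x 0 * G 0 x + U x 1 * G 1 x))) = fun x =>
      (χ x * U x 0 * f x) * G 0 x + (χ x * U x 1 * f x) * G 1 x := by
    ext x; ring
  have key : ∀ n, ∫ x, (φ n x * φ n x) * along U χ x ∂μ +
      2 * (∫ x, (χ x * U x 0 * φ n x) * pd 0 (φ n) x ∂μ +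
        ∫ x, (χ x * U x 1 * φ n x) * pd 1 (φ n) x ∂μ) = 0 := by
    intro n
    have h1 := (hφ n).contDiff_one
    have := hU (fun x => (φ n x * φ n x) * χ x) ((h1.mul h1).mul hχ.contDiff_one) hχ.2.1.mul_left
    have i2 : Integrable (fun x => 2 * ((χ x * U x 0 * φ n x) * pd 0 (φ n) x +
        (χ x * U x 1 * φ n x) * pd 1 (φ n) x)) μ := ((iφ 0 n).add (iφ 1 n)).const_mul 2
    rw [← this, ← integral_add (iφ 0 n) (iφ 1 n), ← integral_const_mul, ← integral_add (i1 n) i2]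
    refine integral_congr_ae (ae_of_all _ fun x => ?_)
    simp only [along_mul U (h1.mul h1) hχ.contDiff_one, along_mul U h1 h1]
    simp only [along]
    ring
  refine ⟨iff', ?_, ?_⟩
  · show Integrable _ μ
    rw [hsum]; exact (iG 0).add (iG 1)
  · have lim := T1.add (((T2 0).add (T2 1)).const_mul 2)
    simp only [key] at lim
    have := tendsto_nhds_unique lim tendsto_const_nhds
    rw [hsum, integral_add (iG 0) (iG 1)]
    linarith

/-! ### The gradient of the radial cut-off -/

/-- The factor with `∇ (cut N) x = cutSlope N x • x`. -/
noncomputable def cutSlope (N : ℝ) (x : Plane) : ℝ := deriv cutProfile (‖x‖ ^ 2 / N ^ 2) * (2 / N ^ 2)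

theorem along_cut (U : Plane → Plane) (N : ℝ) (x : Plane) :
    along U (cut N) x = cutSlope N x * ⟪U x, x⟫ := by
  simp only [along, pd_cut, cutSlope, plane_inner]; ring

theorem continuous_cutSlope (N : ℝ) : Continuous (cutSlope N) :=
  ((contDiff_deriv_cutProfile (n := 0)).continuous.comp
    (contDiff_normSq_div N).continuous).mul continuous_const

theorem cutSlope_eq_zero {N : ℝ} (hN : 0 < N) {x : Plane} (h : ‖x‖ < N) : cutSlope N x = 0 := by
  rw [cutSlope, deriv_cutProfile_low, zero_mul]
  rw [div_lt_one (by positivity)]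
  gcongr

theorem cutSlope_eq_zero' {N : ℝ} (hN : 0 < N) {x : Plane} (h : 2 * N < ‖x‖) :
    cutSlope N x = 0 := by
  rw [cutSlope, deriv_cutProfile_high, zero_mul]
  rw [lt_div_iff₀ (by positivity)]
  nlinarith

theorem tendsto_cutSlope (x : Plane) : Tendsto (fun N => cutSlope N x) atTop (𝓝 0) := by
  refine tendsto_const_nhds.congr' ?_
  filter_upwards [eventually_gt_atTop 0, eventually_gt_atTop ‖x‖] with N h1 h2
  rw [cutSlope_eq_zero h1 h2]

theorem exists_cutSlope_bound : ∃ K : ℝ, 0 < K ∧ ∀ N, 1 ≤ N → ∀ x,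
    |cutSlope N x| ≤ K / N ^ 2 ∧ |cutSlope N x| ≤ K / (1 + ‖x‖) ^ 2 := by
  obtain ⟨M, hM, h⟩ := exists_deriv_cutProfile_bound
  refine ⟨18 * M, by positivity, fun N hN x => ?_⟩
  have hN0 : 0 < N := by linarith
  have b : |cutSlope N x| ≤ 2 * M / N ^ 2 := by
    rw [cutSlope, abs_mul, abs_of_pos (by positivity : 0 < 2 / N ^ 2)]
    calc _ ≤ M * (2 / N ^ 2) := by gcongr; exact h _
      _ = _ := by ring
  refine ⟨b.trans (by gcongr; linarith), ?_⟩
  by_cases hx : 2 * N < ‖x‖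
  · rw [cutSlope_eq_zero' hN0 hx, abs_zero]; positivity
  · refine b.trans ?_
    rw [div_le_div_iff₀ (by positivity) (by positivity)]
    have : (1 + ‖x‖) ^ 2 ≤ (3 * N) ^ 2 := by gcongr; linarith
    nlinarith

theorem tendsto_integral_cut {μ : Measure Plane} {f : Plane → ℝ} (hf : Integrable f μ) :
    Tendsto (fun N => ∫ x, cut N x * f x ∂μ) atTop (𝓝 (∫ x, f x ∂μ)) := by
  refine tendsto_integral_filter_of_dominated_convergence _ (Eventually.of_forall fun N =>
    (contDiff_cut N).continuous.aestronglyMeasurable.mul hf.1) (Eventually.of_forall fun N =>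
    ae_of_all _ fun x => ?_) hf.norm (ae_of_all _ fun x => ?_)
  · rw [norm_mul]
    exact mul_le_of_le_one_left (norm_nonneg _) (abs_cut_le N x)
  · simpa using (tendsto_cut x).mul_const (f x)

theorem tendsto_integral_cutSlope {μ : Measure Plane} {f g : Plane → ℝ}
    (hf : AEStronglyMeasurable f μ) (hg : Integrable g μ)
    (h : ∀ᵐ x ∂μ, |f x| ≤ (1 + ‖x‖) ^ 2 * g x) :
    (∀ N, 1 ≤ N → Integrable (fun x => cutSlope N x * f x) μ) ∧
      Tendsto (fun N => ∫ x, cutSlope N x * f x ∂μ) atTop (𝓝 0) := by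
  obtain ⟨K, hK, hb⟩ := exists_cutSlope_bound
  have m := fun N => (continuous_cutSlope N).aestronglyMeasurable.mul hf
  have bd : ∀ N, 1 ≤ N → ∀ᵐ x ∂μ, ‖cutSlope N x * f x‖ ≤ K * g x := fun N hN => by
    filter_upwards [h] with x hx
    rw [norm_mul]
    calc _ ≤ K / (1 + ‖x‖) ^ 2 * ((1 + ‖x‖) ^ 2 * g x) := by
          gcongr
          · exact (hb N hN x).2
          · exact hx
      _ = _ := by field_simp
  refine ⟨fun N hN => (hg.const_mul K).mono' (m N) (bd N hN), ?_⟩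
  rw [← integral_zero Plane ℝ (μ := μ)]
  refine tendsto_integral_filter_of_dominated_convergence _ (Eventually.of_forall m)
    ((eventually_ge_atTop 1).mono bd) (hg.const_mul K) (ae_of_all _ fun x => ?_)
  simpa using (tendsto_cutSlope x).mul_const (f x)

/-! ### Vanishing of `b(H, ·, H)` -/

namespace CircData

variable {S : Set Plane} {H : Plane → Plane} (hS : IsSmoothBody S) (D : CircData S H)
include hS D

theorem integral_cut_convective (φ : spaceH S) {χ : Plane → ℝ} (hχ : ContDiff ℝ 1 χ)
    (hc : HasCompactSupport χ)
    (hi : IntegrableOn (fun x => χ x * contract (D.G x) (gradMat D.G x) (field φ x)) Sᶜ) :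
    ∫ x in Sᶜ, χ x * contract (D.G x) (gradMat D.G x) (field φ x) =
      - ∫ x in Sᶜ, (⟪D.G x, rigid (rigidData S (field φ)) x⟫ * along D.G χ x +
        ‖D.G x‖ ^ 2 / 2 * along (fun y => field φ y - rigid (rigidData S (field φ)) y) χ x) := by
  set q := rigidData S (field φ)
  set V := fun y => field φ y - rigid q y
  have c0 := D.contDiff.coord 0
  have c1 := D.contDiff.coord 1
  have r0 := (contDiff_rigid q (n := 1)).coord 0
  have r1 := (contDiff_rigid q (n := 1)).coord 1
  have hh : ContDiff ℝ 1 fun x => (D.G x 0 * D.G x 0 + D.G x 1 * D.G x 1) * (1 / 2 : ℝ) :=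
    ((c0.mul c0).add (c1.mul c1)).mul contDiff_const
  have hs : ContDiff ℝ 1 fun x => D.G x 0 * rigid q x 0 + D.G x 1 * rigid q x 1 :=
    (c0.mul r0).add (c1.mul r1)
  set h := fun x => (D.G x 0 * D.G x 0 + D.G x 1 * D.G x 1) * (1 / 2 : ℝ) with hh_def
  set s := fun x => D.G x 0 * rigid q x 0 + D.G x 1 * rigid q x 1 with hs_def
  have eh : ∀ j x, pd j h x = D.G x 0 * pd j (fun y => D.G y 0) x +
      D.G x 1 * pd j (fun y => D.G y 1) x := fun j x => by
    rw [hh_def, pd_mul_test ((c0.mul c0).add (c1.mul c1)) contDiff_const]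
    beta_reduce
    rw [pd_const, pd_add (((c0.mul c0).differentiable one_ne_zero) x)
      (((c1.mul c1).differentiable one_ne_zero) x), pd_mul_test c0 c0, pd_mul_test c1 c1]
    ring
  have es : ∀ j x, pd j s x = (pd j (fun y => D.G y 0) x * rigid q x 0 +
      D.G x 0 * (if j = 1 then -q.2 else 0)) + (pd j (fun y => D.G y 1) x * rigid q x 1 +
      D.G x 1 * (if j = 0 then q.2 else 0)) := fun j x => by
    rw [hs_def, pd_add (((c0.mul r0).differentiable one_ne_zero) x)
      (((c1.mul r1).differentiable one_ne_zero) x), pd_mul_test c0 r0, pd_mul_test c1 r1]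
    beta_reduce
    rw [(pd_rigid q j x).1, (pd_rigid q j x).2]
    ring
  have pw : ∀ x ∈ Sᶜ, ⟪D.G x, rigid q x⟫ * along D.G χ x + ‖D.G x‖ ^ 2 / 2 * along V χ x =
      along V (fun y => χ y * h y) x + along D.G (fun y => χ y * s y) x -
        χ x * contract (D.G x) (gradMat D.G x) (field φ x) := by
    intro x hx
    have hcurl := D.curl x hx
    rw [along_mul _ hχ hh, along_mul _ hχ hs, plane_inner, plane_norm_sq]
    simp only [along, eh, es, contract, gradMat, Fin.sum_univ_two, V, PiLp.sub_apply, hcurl, h, s]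
    simp
    ring
  have i1 : IntegrableOn (along V fun y => χ y * h y) Sᶜ := by
    simp only [V, funext (along_sub _ _ _)]
    exact (integrable_along (memLp_field φ _) Measure.restrict_le_self (hχ.mul hh) hc.mul_right).sub
      ((continuous_along (continuous_rigid q) (hχ.mul hh)).integrable_of_hasCompactSupport
        (hasCompactSupport_along _ hc.mul_right)).integrableOn
  have i2 : IntegrableOn (along D.G fun y => χ y * s y) Sᶜ :=
    ((continuous_along D.contDiff.continuous (hχ.mul hs)).integrable_of_hasCompactSupport
      (hasCompactSupport_along _ hc.mul_right)).integrableOn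
  have i12 : IntegrableOn (fun x => along V (fun y => χ y * h y) x +
      along D.G (fun y => χ y * s y) x) Sᶜ := i1.add i2
  rw [setIntegral_congr_fun hS.isOpen_compl.measurableSet pw, integral_sub i12 hi,
    integral_add i1 i2, D.flux _ (hχ.mul hs) hc.mul_right,
    field_tangential hS φ _ (hχ.mul hh) hc.mul_right]
  ring

omit hS in
theorem tendsto_angular_flux :
    Tendsto (fun N => ∫ x in Sᶜ, ⟪perp x, D.G x⟫ * along D.G (cut N) x) atTop (𝓝 0) := by
  obtain ⟨K, hK, hb⟩ := exists_cutSlope_bound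
  have cG := D.contDiff.continuous
  have cp : Continuous fun x => ⟪perp x, D.G x⟫ := continuous_perp.inner cG
  have e : ∀ N, 0 < N → ∫ x in Sᶜ, ⟪perp x, D.G x⟫ * along D.G (cut N) x =
      ∫ x in Sᶜ, (⟪perp x, D.G x⟫ - D.c) * along D.G (cut N) x := fun N hN => by
    have ca := continuous_along cG ((contDiff_cut N).of_le (by simp) : ContDiff ℝ 1 (cut N))
    have hca := hasCompactSupport_along D.G (hasCompactSupport_cut hN)
    have i1 : IntegrableOn (fun x => ⟪perp x, D.G x⟫ * along D.G (cut N) x) Sᶜ :=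
      ((cp.mul ca).integrable_of_hasCompactSupport hca.mul_left).integrableOn
    have i2 : IntegrableOn (fun x => D.c * along D.G (cut N) x) Sᶜ :=
      ((continuous_const.mul ca).integrable_of_hasCompactSupport hca.mul_left).integrableOn
    simp only [sub_mul]
    rw [integral_sub i1 i2, integral_const_mul,
      D.flux _ ((contDiff_cut N).of_le (by simp)) (hasCompactSupport_cut hN), mul_zero, sub_zero]
  rw [Metric.tendsto_nhds]
  intro ε hε
  have hM := D.M_nonneg
  set V := volume.real (ball (0 : Plane) 1)
  have hV : 0 ≤ V := measureReal_nonneg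
  set C := 2 * D.M * K * (4 * V) with hC
  have hC0 : 0 ≤ C := by positivity
  have h1 := D.tendsto.eventually (ball_mem_nhds D.c (show 0 < ε / (C + 1) by positivity))
  rw [← comap_norm_atTop, eventually_comap] at h1
  obtain ⟨R, hR⟩ := (eventually_atTop.1 h1)
  filter_upwards [eventually_ge_atTop 1, eventually_ge_atTop R] with N hN1 hNR
  have hN0 : 0 < N := by linarith
  rw [dist_zero_right, e N hN0]
  have hvol : volume.real (closedBall (0 : Plane) (2 * N)) = (2 * N) ^ 2 * V := by
    have := Measure.addHaar_real_closedBall (volume : Measure Plane) 0 (r := 2 * N) (by positivity)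
    simpa [V] using this
  have z : ∫ x in Sᶜ, (⟪perp x, D.G x⟫ - D.c) * along D.G (cut N) x =
      ∫ x in Sᶜ ∩ closedBall 0 (2 * N), (⟪perp x, D.G x⟫ - D.c) * along D.G (cut N) x := by
    rw [← setIntegral_indicator isClosed_closedBall.measurableSet]
    congr 1
    ext x
    by_cases hx : x ∈ closedBall (0 : Plane) (2 * N)
    · rw [indicator_of_mem hx]
    · rw [indicator_of_notMem hx, along_cut, cutSlope_eq_zero' hN0, zero_mul, mul_zero]
      simpa using hx
  have hfin : volume (Sᶜ ∩ closedBall (0 : Plane) (2 * N)) < ⊤ :=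
    (measure_mono inter_subset_right).trans_lt measure_closedBall_lt_top
  rw [z]
  have := norm_setIntegral_le_of_norm_le_const (μ := volume)
    (f := fun x => (⟪perp x, D.G x⟫ - D.c) * along D.G (cut N) x)
    (C := ε / (C + 1) * (K / N ^ 2 * (2 * D.M))) hfin fun x hx => by
      rw [along_cut, norm_mul, norm_mul, Real.norm_eq_abs, Real.norm_eq_abs, Real.norm_eq_abs]
      by_cases hxN : ‖x‖ < N
      · rw [cutSlope_eq_zero hN0 hxN]; simp; positivity
      · have hd := hR ‖x‖ (hNR.trans (not_lt.1 hxN)) x rfl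
        rw [Real.dist_eq] at hd
        have hi : |⟪D.G x, x⟫| ≤ 2 * D.M := by
          refine (abs_real_inner_le_norm _ _).trans ?_
          have h0 : 0 < 1 + ‖x‖ := by positivity
          calc ‖D.G x‖ * ‖x‖ ≤ 2 * D.M / (1 + ‖x‖) * (1 + ‖x‖) := by
                gcongr
                · exact D.norm_le hx.1
                · linarith
            _ = 2 * D.M := by field_simp
        gcongr
        exact (hb N hN1 x).1
  refine this.trans_lt ?_
  have hm : volume.real (Sᶜ ∩ closedBall (0 : Plane) (2 * N)) ≤ (2 * N) ^ 2 * V := by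
    rw [← hvol]; exact measureReal_mono inter_subset_right measure_closedBall_lt_top.ne
  calc _ ≤ ε / (C + 1) * (K / N ^ 2 * (2 * D.M)) * ((2 * N) ^ 2 * V) := by gcongr
    _ = ε / (C + 1) * C := by rw [hC]; field_simp; ring
    _ < ε := by rw [div_mul_eq_mul_div, div_lt_iff₀ (by positivity)]; nlinarith

theorem integral_convective_eq_zero (φ : spaceH S)
    (hi : IntegrableOn (fun x => contract (D.G x) (gradMat D.G x) (field φ x)) Sᶜ) :
    ∫ x in Sᶜ, contract (D.G x) (gradMat D.G x) (field φ x) = 0 := by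
  set q := rigidData S (field φ) with hq
  have cG := D.contDiff.continuous
  have hM := D.M_nonneg
  have hmeas := hS.isOpen_compl.measurableSet
  have hφm : AEStronglyMeasurable (field φ) (volume.restrict Sᶜ) := (memLp_field φ Sᶜ).1
  set P := fun x => ⟪D.G x, q.1⟫ * ⟪D.G x, x⟫ + ‖D.G x‖ ^ 2 / 2 * ⟪field φ x - q.1, x⟫ with hP
  have mP : AEStronglyMeasurable P (volume.restrict Sᶜ) :=
    (((cG.inner continuous_const).mul (cG.inner continuous_id)).aestronglyMeasurable).add
      ((((cG.norm.pow 2).div_const 2).aestronglyMeasurable).mul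
        ((hφm.sub aestronglyMeasurable_const).inner continuous_id.aestronglyMeasurable))
  have iw : Integrable fun x : Plane => (1 + ‖x‖) ^ (-(3 : ℝ)) :=
    integrable_one_add_norm (by simp; norm_num)
  have ew : ∀ x : Plane, (1 + ‖x‖) ^ (-(3 : ℝ)) = 1 / (1 + ‖x‖) ^ 3 := fun x => by
    rw [Real.rpow_neg (by positivity), one_div]; norm_cast
  have cw : Continuous fun x : Plane => 1 / (1 + ‖x‖) ^ 3 :=
    continuous_const.div (by fun_prop) fun x => by positivity
  have w2 : MemLp (fun x : Plane => 1 / (1 + ‖x‖) ^ 3) 2 (volume.restrict Sᶜ) := by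
    refine memLp_two_of_decay hmeas cw.aestronglyMeasurable (M := 1) fun x _ => ?_
    rw [abs_of_pos (by positivity)]
    exact one_div_le_one_div_of_le (by positivity)
      (pow_le_pow_right₀ (by linarith [norm_nonneg x]) (by norm_num))
  have iw2 : IntegrableOn (fun x => ‖field φ x‖ * (1 / (1 + ‖x‖) ^ 3)) Sᶜ :=
    memLp_one_iff_integrable.1 (MemLp.mul' (p := 2) (q := 2) w2 (memLp_field φ Sᶜ).norm)
  simp only [ew] at iw
  have bP : ∀ x ∈ Sᶜ, |P x| ≤ 4 * D.M ^ 2 * (‖field φ x‖ + 2 * ‖q.1‖) / (1 + ‖x‖) := by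
    intro x hx
    have hg := D.norm_le hx
    have hpos : 0 < 1 + ‖x‖ := by positivity
    have hxx : ‖x‖ ≤ 1 + ‖x‖ := by linarith
    have s1 : |⟪D.G x, q.1⟫ * ⟪D.G x, x⟫| ≤
        (2 * D.M / (1 + ‖x‖) * ‖q.1‖) * (2 * D.M / (1 + ‖x‖) * (1 + ‖x‖)) := by
      rw [abs_mul]
      gcongr
      · exact (abs_real_inner_le_norm _ _).trans (by gcongr)
      · exact (abs_real_inner_le_norm _ _).trans (by gcongr)
    have s2 : |‖D.G x‖ ^ 2 / 2 * ⟪field φ x - q.1, x⟫| ≤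
        (2 * D.M / (1 + ‖x‖)) ^ 2 * ((‖field φ x‖ + ‖q.1‖) * (1 + ‖x‖)) := by
      rw [abs_mul, abs_of_nonneg (by positivity)]
      gcongr
      · exact (half_le_self (by positivity)).trans (by gcongr)
      · exact (abs_real_inner_le_norm _ _).trans (by gcongr; exact norm_sub_le _ _)
    calc |P x| ≤ _ := (abs_add_le _ _).trans (add_le_add s1 s2)
      _ = _ := by field_simp; ring
  obtain ⟨iP, T⟩ := tendsto_integral_cutSlope mP
    ((iw2.add (iw.integrableOn.const_mul (2 * ‖q.1‖))).const_mul (4 * D.M ^ 2)) (by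
      filter_upwards [ae_restrict_mem hmeas] with x hx
      refine (bP x hx).trans (le_of_eq ?_)
      simp only [Pi.add_apply]
      field_simp)
  have A := (T.add (tendsto_angular_flux D |>.const_mul q.2)).neg
  simp only [mul_zero, add_zero, neg_zero] at A
  refine tendsto_nhds_unique (tendsto_integral_cut hi) (A.congr' ?_)
  filter_upwards [eventually_ge_atTop 1] with N hN
  have hN0 : 0 < N := by linarith
  have c1 : ContDiff ℝ 1 (cut N) := (contDiff_cut N).of_le (by simp)
  have i2 : IntegrableOn (fun x => q.2 * (⟪perp x, D.G x⟫ * along D.G (cut N) x)) Sᶜ :=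
    ((((continuous_perp.inner cG).mul (continuous_along cG c1)).integrable_of_hasCompactSupport
      (hasCompactSupport_along D.G (hasCompactSupport_cut hN0)).mul_left).const_mul _).integrableOn
  rw [D.integral_cut_convective hS φ c1 (hasCompactSupport_cut hN0), ← integral_const_mul,
    ← integral_add (iP N hN) i2]
  · congr 2
    ext x
    simp only [along_cut, P, ← hq, inner_sub_left]
    have : ⟪rigid q x, x⟫ = ⟪q.1, x⟫ := by
      simp only [plane_inner, rigid_apply_zero, rigid_apply_one]; ring
    rw [this, rigid, inner_add_right, inner_smul_right, real_inner_comm (D.G x) (perp x)]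
    ring
  · exact hi.bdd_mul (c := 1) (contDiff_cut N).continuous.aestronglyMeasurable
      (ae_of_all _ fun x => abs_cut_le N x)

/-- `b(H, v, H) = 0`. -/
theorem bForm_circulation {m J : ℝ} (hm : 0 < m) (hJ : 0 < J) (v : spaceVu S) :
    IntegrableOn (bIntegrand S H (field v) H) Sᶜ ∧ bForm S m H (field v) H = 0 := by
  obtain ⟨_, -, h⟩ := exists_bound_Vu_Vu_V hS D hm hJ
  have eH' := withH_zero_one (spaceV S) H
  have eH := withH_zero_one (spaceVu S) H
  have hrig := D.withH_ae_rigid hS spaceVu_le (0 : spaceVu S) 1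
  have hΓ := D.isWeakGrad_withH hS (spaceV_spec (m := m) (J := J) hS _ (0 : spaceV S).2).1 1
  have hi := (integrable_congr (bIntegrand_congr (v := field v) hS hrig eH hΓ eH')).1 (h 0 1 v 0 1).1
  have hr : rigidData S H = 0 := by
    refine hS.rigidData_eq (D.ae_zero.trans (ae_of_all _ fun x => ?_))
    simp [rigid]
  have e : bIntegrand S H (field v) H =ᵐ[volume.restrict Sᶜ]
      fun x => contract (D.G x) (gradMat D.G x) (field v x) := by
    filter_upwards [D.ae_eq hS, (D.isWeakGrad hS).weakGrad_ae hS.isOpen_compl] with x h1 h2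
    rw [bIntegrand_eq, hr, h1, h2]
    simp [rigid]
  refine ⟨hi, ?_⟩
  have := integral_convective_eq_zero hS D ⟨v, spaceVu_le v.2⟩ ((integrable_congr e).1 hi)
  rw [bForm, integral_congr_ae e]
  simp only [bBody, angVel, linVel, hr]
  simpa using this

end CircData

/-! ### Integrability of the convective term -/

section Integrability

variable {μ : Measure Plane} {U v : Plane → Plane} {Γ : Plane → Mat2}

theorem integrable_contract_four (hU : MemLp U 4 μ) (hΓ : MemLp Γ 2 μ) (hv : MemLp v 4 μ) :
    Integrable (fun x => contract (U x) (Γ x) (v x)) μ := by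
  have h1 : MemLp (fun x => ‖U x‖ * ‖v x‖) 2 μ := MemLp.mul' (p := 4) (q := 4) hv.norm hU.norm
  have h2 : Integrable (fun x => (‖U x‖ * ‖v x‖) * ‖Γ x‖) μ :=
    memLp_one_iff_integrable.1 (MemLp.mul' (p := 2) (q := 2) hΓ.norm h1)
  refine h2.mono' (aestronglyMeasurable_contract hU.1 hΓ.1 hv.1) (ae_of_all _ fun x => ?_)
  exact (abs_contract_le _ _ _).trans (le_of_eq (by ring))

theorem integrable_contract_of_bound {C : ℝ} (hUm : AEStronglyMeasurable U μ)
    (hU : ∀ᵐ x ∂μ, ‖U x‖ ≤ C) (hΓ : MemLp Γ 2 μ) (hv : MemLp v 2 μ) :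
    Integrable (fun x => contract (U x) (Γ x) (v x)) μ := by
  have h2 : Integrable (fun x => C * (‖Γ x‖ * ‖v x‖)) μ :=
    (memLp_one_iff_integrable.1 (MemLp.mul' (p := 2) (q := 2) hv.norm hΓ.norm)).const_mul C
  refine h2.mono' (aestronglyMeasurable_contract hUm hΓ.1 hv.1) ?_
  filter_upwards [hU] with x hx
  refine (abs_contract_le _ _ _).trans ?_
  rw [mul_assoc]
  gcongr

end Integrability

theorem Continuous.memLp_inter_ball {E : Type*} [NormedAddCommGroup E] [SecondCountableTopology E]
    {f : Plane → E} (hf : Continuous f) (A : Set Plane) (R : ℝ) (p : ℝ≥0∞) :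
    MemLp f p (volume.restrict (A ∩ ball 0 R)) := by
  obtain ⟨C, hC⟩ := (isCompact_closedBall (0 : Plane) R).exists_bound_of_continuousOn hf.continuousOn
  have : IsFiniteMeasure (volume.restrict (ball (0 : Plane) R)) :=
    ⟨by rw [Measure.restrict_apply_univ]; exact measure_ball_lt_top⟩
  refine (MemLp.of_bound (μ := volume.restrict (ball (0 : Plane) R))
    hf.aestronglyMeasurable C ?_).mono_measure (Measure.restrict_mono inter_subset_right le_rfl)
  filter_upwards [ae_restrict_mem isOpen_ball.measurableSet] with x hx
  exact hC x (ball_subset_closedBall hx)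

theorem iUnion_inter_ball (A : Set Plane) : (⋃ R : ℝ, A ∩ ball (0 : Plane) R) = A := by
  ext x
  simpa using fun _ => exists_gt ‖x‖

theorem spaceVu_isH1 {S : Set Plane} (hS : IsSmoothBody S) {φ : L2Plane} (hφ : φ ∈ spaceVu S)
    (i : Fin 2) : IsH1 Sᶜ (fun x => φ x i) fun j x => weakGrad Sᶜ φ x (i, j) := by
  obtain ⟨h1, h2, -⟩ := spaceVu_spec (m := 1) (J := 1) hS φ hφ
  exact ⟨fun j => (isWeakGrad_iff hS.isOpen_compl).1 h1 i j,
    memLp_coord ((Lp.memLp φ).restrict _) i, fun j => memLp_coord h2 (i, j)⟩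

/-! ### The cancellation property -/

/-- A rotating profile that vanishes on the body is tangential. -/
theorem tangential_rotation {S : Set Plane} {ζ : Plane → ℝ}
    (hζ : ContDiff ℝ 1 ζ) (hr : ∀ x, along perp ζ x = 0) (h0 : ∀ x ∈ S, ζ x = 0) :
    Tangential S fun x => ζ x • perp x := by
  intro ψ hψ hc
  have cu : ContDiff ℝ 1 fun x => ζ x • perp x := hζ.smul contDiff_perp
  have hd : ∀ x, pd 0 (fun y => (ζ y • perp y) 0) x + pd 1 (fun y => (ζ y • perp y) 1) x = 0 := by
    intro x
    have e0 : (fun y : Plane => (ζ y • perp y) 0) = fun y => ζ y * (-1 * y 1) := by ext y; simp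
    have e1 : (fun y : Plane => (ζ y • perp y) 1) = fun y => ζ y * y 0 := by ext y; simp
    have d := hζ.differentiable one_ne_zero x
    have := hr x
    simp only [along, perp_apply_zero, perp_apply_one] at this
    rw [e0, e1, pd_mul d (by fun_prop), pd_mul d (by fun_prop), pd_mul (by fun_prop) (by fun_prop),
      pd_const, pd_coord, pd_coord]
    simp
    linarith
  have e := integral_along_of_div cu hd hψ hc
  rwa [← setIntegral_eq_integral_of_forall_compl_eq_zero (s := Sᶜ)] at e
  intro x hx
  simp [along, h0 x (not_not.1 hx)]

section Cancellation

variable {S : Set Plane} (hS : IsSmoothBody S) {v : L2Plane} (hv : v ∈ spaceVu S)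
include hS hv

theorem Tangential.integral_contract {U : Plane → Plane} (hU : Tangential S U)
    (hU4 : ∀ R : ℝ, MemLp U 4 (volume.restrict (Sᶜ ∩ ball 0 R))) {χ : Plane → ℝ}
    (hχ : IsTest univ χ) :
    IntegrableOn (fun x => χ x * contract (U x) (weakGrad Sᶜ v x) (v x)) Sᶜ ∧
    2 * ∫ x in Sᶜ, χ x * contract (U x) (weakGrad Sᶜ v x) (v x) =
      - ∫ x in Sᶜ, ‖v x‖ ^ 2 * along U χ x := by
  obtain ⟨a0, b0, c0⟩ := hU.integral_mul_along hS hU4 (spaceVu_isH1 hS hv 0) hχ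
  obtain ⟨a1, b1, c1⟩ := hU.integral_mul_along hS hU4 (spaceVu_isH1 hS hv 1) hχ
  have e1 : (fun x => χ x * contract (U x) (weakGrad Sᶜ v x) (v x)) = fun x =>
      χ x * (v x 0 * (U x 0 * weakGrad Sᶜ v x (0, 0) + U x 1 * weakGrad Sᶜ v x (0, 1))) +
      χ x * (v x 1 * (U x 0 * weakGrad Sᶜ v x (1, 0) + U x 1 * weakGrad Sᶜ v x (1, 1))) := by
    ext x; simp only [contract, Fin.sum_univ_two]; ring
  have e2 : (fun x => ‖v x‖ ^ 2 * along U χ x) = fun x =>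
      v x 0 * v x 0 * along U χ x + v x 1 * v x 1 * along U χ x := by
    ext x; rw [plane_norm_sq]; ring
  rw [e1, e2]
  refine ⟨b0.add b1, ?_⟩
  rw [integral_add b0 b1, integral_add a0 a1, mul_add, c0, c1]
  ring

/-- A compactly supported radial multiple of `x^⊥ · ∇ v · v` that vanishes on the body has
vanishing integral. -/
theorem integral_radial_rotation {ζ : Plane → ℝ} (hζ : ContDiff ℝ 1 ζ) (hc : HasCompactSupport ζ)
    (hr : ∀ x, along perp ζ x = 0) (h0 : ∀ x ∈ S, ζ x = 0) :
    ∫ x in Sᶜ, ζ x * contract (perp x) (weakGrad Sᶜ v x) (v x) = 0 := by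
  obtain ⟨N, hN⟩ := hc.isBounded.subset_closedBall 0
  have hN0 : 0 < max N 1 := lt_max_of_lt_right one_pos
  have h := Tangential.integral_contract hS hv (tangential_rotation hζ hr h0)
    (fun R => (hζ.continuous.smul continuous_perp).memLp_inter_ball _ _ _) (IsTest.cut hN0)
  have e1 : (fun x => _root_.cut (max N 1) x * contract (ζ x • perp x) (weakGrad Sᶜ v x) (v x)) =
      fun x => ζ x * contract (perp x) (weakGrad Sᶜ v x) (v x) := by
    ext x
    rw [contract_smul_left]
    by_cases hx : x ∈ tsupport ζ
    · rw [cut_one hN0 ((mem_closedBall_zero_iff.1 (hN hx)).trans (le_max_left _ _)), one_mul]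
    · rw [image_eq_zero_of_notMem_tsupport hx]; ring
  have e2 : ∀ x, along (fun x => ζ x • perp x) (_root_.cut (max N 1)) x = 0 := fun x => by
    rw [along_cut]
    rw [inner_smul_left, inner_perp_self, mul_zero, mul_zero]
  have h2 := h.2
  rw [e1] at h2
  simp only [e2, mul_zero, integral_zero, neg_zero] at h2
  linarith

theorem integrableOn_rotation_ball (R : ℝ) :
    IntegrableOn (fun x => contract (perp x) (weakGrad Sᶜ v x) (v x)) (Sᶜ ∩ ball 0 R) := by
  have le : volume.restrict (Sᶜ ∩ ball 0 R) ≤ volume.restrict Sᶜ :=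
    Measure.restrict_mono inter_subset_left le_rfl
  refine integrable_contract_of_bound (C := R) continuous_perp.aestronglyMeasurable ?_
    ((spaceVu_spec (m := 1) (J := 1) hS v hv).2.1.mono_measure le)
    (((Lp.memLp v).restrict Sᶜ).mono_measure le)
  filter_upwards [ae_restrict_mem
    (hS.isOpen_compl.measurableSet.inter isOpen_ball.measurableSet)] with x hx
  rw [perp_norm]
  exact (mem_ball_zero_iff.1 hx.2).le

theorem exists_integral_rotation : ∃ R₀ : ℝ, ∃ j : ℝ,
    (∀ N, R₀ ≤ N → ∫ x in Sᶜ, cut N x * contract (perp x) (weakGrad Sᶜ v x) (v x) = j) ∧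
    ∀ R, R₀ ≤ R → ∫ x in Sᶜ ∩ ball 0 R, contract (perp x) (weakGrad Sᶜ v x) (v x) = j := by
  obtain ⟨N₀, hN₀⟩ := hS.isBounded.subset_closedBall (0 : Plane)
  obtain ⟨ρ, hρ1, hρN⟩ : ∃ ρ : ℝ, 1 ≤ ρ ∧ N₀ ≤ ρ := ⟨max N₀ 1, le_max_right _ _, le_max_left _ _⟩
  have hSρ : ∀ x ∈ S, ‖x‖ ≤ ρ := fun x hx => (mem_closedBall_zero_iff.1 (hN₀ hx)).trans hρN
  set B := fun x => contract (perp x) (weakGrad Sᶜ v x) (v x)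
  have iB := integrableOn_rotation_ball hS hv
  have iζ : ∀ {ζ : Plane → ℝ} {R : ℝ}, Continuous ζ → (∀ x, |ζ x| ≤ 1) →
      (∀ x, R ≤ ‖x‖ → ζ x = 0) → IntegrableOn (fun x => ζ x * B x) Sᶜ := by
    intro ζ R hζ h1 hR
    have h3 : IntegrableOn (fun x => ζ x * B x) (Sᶜ ∩ ball 0 R) :=
      (iB R).bdd_mul (c := 1) hζ.aestronglyMeasurable (ae_of_all _ h1)
    refine h3.of_forall_sdiff_eq_zero hS.isOpen_compl.measurableSet fun x hx => ?_
    rw [hR x, zero_mul]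
    by_contra h
    exact hx.2 ⟨hx.1, mem_ball_zero_iff.2 (not_le.1 h)⟩
  set p : ℝ → ℕ → Plane → ℝ := fun R k x => Real.smoothTransition ((k + 1) * (R ^ 2 - ‖x‖ ^ 2))
  have cp : ∀ R k, ContDiff ℝ 1 (p R k) := fun R k => Real.smoothTransition.contDiff.comp
      (contDiff_const.mul (contDiff_const.sub (contDiff_norm_sq ℝ)))
  have p0 : ∀ {R : ℝ} k x, 0 ≤ R → R ≤ ‖x‖ → p R k x = 0 := fun {R} k x h0 hx =>
    Real.smoothTransition.zero_of_nonpos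
      (mul_nonpos_of_nonneg_of_nonpos (by positivity) (by nlinarith))
  have pb : ∀ R k x, |p R k x| ≤ 1 := fun R k x => abs_le.2
    ⟨by have := Real.smoothTransition.nonneg ((k + 1) * (R ^ 2 - ‖x‖ ^ 2)); simp only [p]; linarith,
      Real.smoothTransition.le_one _⟩
  have eqR : ∀ N R k, ρ ≤ N → ρ + 1 ≤ R → ∫ x in Sᶜ, cut N x * B x = ∫ x in Sᶜ, p R k x * B x := by
    intro N R k hN hR
    have hN0 : 0 < N := by linarith
    have c1 : ContDiff ℝ 1 (cut N) := (contDiff_cut N).of_le (by simp)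
    have := integral_radial_rotation hS hv (ζ := fun x => cut N x - p R k x) (c1.sub (cp R k))
      ?_ (fun x => ?_) fun x hx => ?_
    · simp only [sub_mul] at this
      rw [integral_sub (iζ c1.continuous (abs_cut_le N) fun x => cut_zero hN0)
        (iζ (cp R k).continuous (pb R k) fun x => p0 k x (by linarith))] at this
      linarith
    · refine (hasCompactSupport_cut hN0).sub ?_
      refine HasCompactSupport.of_support_subset_isCompact (isCompact_closedBall 0 R) fun x hx => ?_
      by_contra h
      rw [mem_closedBall_zero_iff, not_le] at h
      exact hx (p0 k x (by linarith) h.le)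
    · have e : (fun x => cut N x - p R k x) = fun y => (fun s => cutProfile (s / N ^ 2) -
          Real.smoothTransition ((k + 1) * (R ^ 2 - s))) (‖y‖ ^ 2 / 1 ^ 2) := by
        ext y; simp [p, cut]
      have hd : Differentiable ℝ fun s =>
          cutProfile (s / N ^ 2) - Real.smoothTransition ((k + 1) * (R ^ 2 - s)) :=
        ((contDiff_cutProfile.comp (contDiff_id.div_const _)).sub
          ((Real.smoothTransition.contDiff (n := 1)).comp (contDiff_const.mul
            (contDiff_const.sub contDiff_id)))).differentiable one_ne_zero
      simp only [along, e, pd_radial hd, perp_apply_zero, perp_apply_one]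
      ring
    · have hx' := hSρ x hx
      show cut N x - p R k x = 0
      rw [cut_one hN0 (hx'.trans hN)]
      simp only [p]
      rw [Real.smoothTransition.one_of_one_le, sub_self]
      have h1 : 1 ≤ R ^ 2 - ‖x‖ ^ 2 := by nlinarith [norm_nonneg x]
      have h2 : (0 : ℝ) ≤ k := Nat.cast_nonneg k
      nlinarith
  refine ⟨ρ + 1, ∫ x in Sᶜ, cut ρ x * B x, fun N hN => ?_, fun R hR => ?_⟩
  · rw [eqR N (ρ + 1) 0 (by linarith) le_rfl, eqR ρ (ρ + 1) 0 le_rfl le_rfl]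
  · have hR0 : 0 ≤ R := by linarith
    have hm : MeasurableSet (ball (0 : Plane) R) := isOpen_ball.measurableSet
    have L : Tendsto (fun k => ∫ x in Sᶜ, p R k x * B x) atTop
        (𝓝 (∫ x in Sᶜ, (ball 0 R).indicator B x)) := by
      refine tendsto_integral_of_dominated_convergence ((ball 0 R).indicator fun x => |B x|)
        (fun k => (iζ (cp R k).continuous (pb R k) fun x => p0 k x hR0).1) ?_
        (fun k => ae_of_all _ fun x => ?_) (ae_of_all _ fun x => ?_)
      · have h3 : IntegrableOn (fun x => |B x|) (Sᶜ ∩ ball 0 R) := (iB R).abs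
        rw [← IntegrableOn, ← integrable_indicator_iff hS.isOpen_compl.measurableSet]
        rw [← integrable_indicator_iff (hS.isOpen_compl.measurableSet.inter hm),
          ← indicator_indicator] at h3
        exact h3
      · by_cases hx : x ∈ ball (0 : Plane) R
        · rw [indicator_of_mem hx, norm_mul]
          exact mul_le_of_le_one_left (norm_nonneg _) (pb R k x)
        · rw [indicator_of_notMem hx, p0 k x hR0 (by simpa using hx)]; simp
      · by_cases hx : x ∈ ball (0 : Plane) R
        · rw [indicator_of_mem hx]
          have hd : 0 < R ^ 2 - ‖x‖ ^ 2 := by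
            have := mem_ball_zero_iff.1 hx
            nlinarith [norm_nonneg x]
          refine tendsto_const_nhds.congr' ?_
          obtain ⟨n, hn⟩ := exists_nat_gt (R ^ 2 - ‖x‖ ^ 2)⁻¹
          filter_upwards [eventually_ge_atTop n] with k hk
          simp only [p]
          rw [Real.smoothTransition.one_of_one_le, one_mul]
          have h1 : (n : ℝ) ≤ k := by exact_mod_cast hk
          have h2 := mul_lt_mul_of_pos_right hn hd
          rw [inv_mul_cancel₀ hd.ne'] at h2
          nlinarith
        · rw [indicator_of_notMem hx]
          refine tendsto_const_nhds.congr fun k => ?_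
          rw [p0 k x hR0 (by simpa using hx), zero_mul]
    rw [← setIntegral_indicator hm]
    exact tendsto_nhds_unique L (tendsto_const_nhds.congr fun k => eqR ρ R k le_rfl hR)

end Cancellation

namespace CircData

variable {S : Set Plane} {H : Plane → Plane} (hS : IsSmoothBody S) (D : CircData S H)
  (u : spaceVu S) (β : ℝ) (v : spaceVu S)
include hS D

theorem bIntegrand_diag_ae : bIntegrand S (withH H u β) (field v) (field v) =ᵐ[volume.restrict Sᶜ]
    fun x => contract (withH D.G u β x - (rigidData S (field u)).1) (weakGrad Sᶜ (field v) x)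
        (field v x) - (rigidData S (field u)).2 *
      contract (perp x) (weakGrad Sᶜ (field v) x) (field v x) := by
  filter_upwards [D.ae_eq hS] with x hx
  rw [bIntegrand_eq, D.rigidData_withH hS spaceVu_le]
  rw [inner_perp_self, mul_zero, sub_zero]
  simp only [withH, hx, rigid, contract, Fin.sum_univ_two, PiLp.sub_apply, PiLp.add_apply,
    PiLp.smul_apply, smul_eq_mul]
  ring

theorem cancellation : (∀ R : ℝ, IntegrableOn (bIntegrand S (withH H u β) (field v) (field v))
      (Sᶜ ∩ ball 0 R)) ∧
    Tendsto (fun R : ℝ => ∫ x in Sᶜ ∩ ball 0 R,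
      bIntegrand S (withH H u β) (field v) (field v) x) atTop (𝓝 0) := by
  obtain ⟨R₀, j, hj1, hj2⟩ := exists_integral_rotation hS v.2
  obtain ⟨A, -, hA4⟩ := exists_lpNorm_four hS
  have hmeas := hS.isOpen_compl.measurableSet
  have mball : ∀ R : ℝ, MeasurableSet (Sᶜ ∩ ball (0 : Plane) R) := fun R =>
    hmeas.inter isOpen_ball.measurableSet
  have cG := D.contDiff.continuous
  have hM := D.M_nonneg
  set q := rigidData S (field u) with hq
  set Γ := weakGrad Sᶜ (field v)
  obtain ⟨-, hΓ, -⟩ := spaceVu_spec (m := 1) (J := 1) hS _ v.2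
  have hu2 := memLp_field u Sᶜ
  have hv2 := memLp_field v Sᶜ
  have hu4 : MemLp (field u) 4 (volume.restrict Sᶜ) := (hA4 _ u.2 one_pos one_pos).1
  have hv4 : MemLp (field v) 4 (volume.restrict Sᶜ) := (hA4 _ v.2 one_pos one_pos).1
  set C := |β| * (2 * D.M) + ‖q.1‖
  have hbd : ∀ x ∈ Sᶜ, ‖β • D.G x - q.1‖ ≤ C := fun x hx => by
    refine (norm_sub_le _ _).trans (add_le_add ?_ le_rfl)
    rw [norm_smul, Real.norm_eq_abs]
    gcongr
    refine (D.norm_le hx).trans (div_le_self (by positivity) ?_)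
    linarith [norm_nonneg x]
  set B1 := fun x => contract (withH D.G u β x - q.1) (Γ x) (field v x)
  set B2 := fun x => contract (perp x) (Γ x) (field v x)
  have i1 : IntegrableOn B1 Sᶜ := by
    have e : B1 = fun x => contract (field u x) (Γ x) (field v x) +
        contract (β • D.G x - q.1) (Γ x) (field v x) := by
      ext x
      rw [← contract_add_left]
      simp only [B1, withH, add_sub_assoc]
    rw [e]
    exact (integrable_contract_four hu4 hΓ hv4).add (integrable_contract_of_bound (C := C)
      ((cG.const_smul β).sub continuous_const).aestronglyMeasurable
      ((ae_restrict_mem hmeas).mono hbd) hΓ hv2)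
  have i2 := integrableOn_rotation_ball hS v.2
  have eB := D.bIntegrand_diag_ae hS u β v
  have eBR : ∀ R : ℝ, bIntegrand S (withH H u β) (field v) (field v)
      =ᵐ[volume.restrict (Sᶜ ∩ ball 0 R)] fun x => B1 x - q.2 * B2 x := fun R =>
    ae_restrict_of_ae_restrict_of_subset inter_subset_left eB
  have i1R : ∀ R : ℝ, IntegrableOn B1 (Sᶜ ∩ ball 0 R) := fun R => i1.mono_set inter_subset_left
  refine ⟨fun R => (integrable_congr (eBR R)).2 ((i1R R).sub ((i2 R).const_mul _)), ?_⟩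
  have L1 : Tendsto (fun R : ℝ => ∫ x in Sᶜ ∩ ball 0 R, B1 x) atTop (𝓝 (∫ x in Sᶜ, B1 x)) := by
    have e : (⋃ R : ℝ, Sᶜ ∩ ball (0 : Plane) R) = Sᶜ := iUnion_inter_ball _
    have := tendsto_setIntegral_of_monotone (μ := volume) (f := B1) mball
      (fun a b h => inter_subset_inter_right _ (ball_subset_ball h)) (by rwa [e])
    rwa [e] at this
  have L2 := tendsto_integral_cut i1
  have hT : Tangential S fun x => withH H u β x - rigid q x := D.tangential hS ⟨u, spaceVu_le u.2⟩ β
  have hT4 : ∀ R : ℝ, MemLp (fun x => withH H u β x - rigid q x) 4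
      (volume.restrict (Sᶜ ∩ ball 0 R)) := fun R => by
    have h1 : MemLp (fun x => field u x + β • D.G x - rigid q x) 4
        (volume.restrict (Sᶜ ∩ ball 0 R)) :=
      ((hu4.mono_measure (Measure.restrict_mono inter_subset_left le_rfl)).add
        ((cG.const_smul β).memLp_inter_ball _ _ _)).sub
          ((continuous_rigid q).memLp_inter_ball _ _ _)
    refine (memLp_congr_ae ?_).1 h1
    filter_upwards [ae_restrict_of_ae_restrict_of_subset inter_subset_left (D.ae_eq hS)] with x hx
    simp only [withH, hx]
  have sq2 : MemLp (fun x => ‖field v x‖ ^ 2) 2 (volume.restrict Sᶜ) := by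
    simpa only [pow_two] using MemLp.mul' (p := 4) (q := 4) (r := 2) hv4.norm hv4.norm
  have dom : IntegrableOn (fun x => ‖field v x‖ ^ 2 * ‖field u x‖ + C * ‖field v x‖ ^ 2) Sᶜ :=
    (memLp_one_iff_integrable.1 (MemLp.mul' (p := 2) (q := 2) hu2.norm sq2)).add
      (hv2.norm.integrable_sq.const_mul C)
  have L3 : Tendsto (fun N => ∫ x in Sᶜ, ‖field v x‖ ^ 2 *
      along (fun x => withH H u β x - rigid q x) (cut N) x) atTop (𝓝 0) := by
    have e : ∀ N x, ‖field v x‖ ^ 2 * along (fun x => withH H u β x - rigid q x) (cut N) x =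
        cutSlope N x * (‖field v x‖ ^ 2 * ⟪withH H u β x - q.1, x⟫) := fun N x => by
      rw [along_cut, rigid, ← sub_sub, inner_sub_left _ (q.2 • perp x), inner_smul_left,
        inner_perp_self, mul_zero, sub_zero, mul_left_comm]
    simp only [e]
    have hH : AEStronglyMeasurable (withH H u β) (volume.restrict Sᶜ) :=
      hu2.1.add ((cG.aestronglyMeasurable.congr (D.ae_eq hS).symm).const_smul β)
    refine (tendsto_integral_cutSlope (sq2.1.mul ((hH.sub aestronglyMeasurable_const).inner
      continuous_id.aestronglyMeasurable)) dom ?_).2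
    filter_upwards [ae_restrict_mem hmeas, D.ae_eq hS] with x hx hxG
    have hw : ‖withH H u β x - q.1‖ ≤ ‖field u x‖ + C := by
      simp only [withH, hxG, add_sub_assoc]
      exact (norm_add_le _ _).trans (add_le_add le_rfl (hbd x hx))
    show |‖field v x‖ ^ 2 * ⟪withH H u β x - q.1, x⟫| ≤ _
    rw [abs_mul, abs_of_nonneg (by positivity)]
    calc _ ≤ ‖field v x‖ ^ 2 * ((‖field u x‖ + C) * (1 + ‖x‖) ^ 2) := by
          gcongr
          refine (abs_real_inner_le_norm _ _).trans ?_
          gcongr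
          nlinarith [norm_nonneg x]
      _ = _ := by ring
  have hJ : ∫ x in Sᶜ, B1 x = q.2 * j := by
    have h1 : Tendsto (fun N => 2 * ((∫ x in Sᶜ, cut N x * B1 x) - q.2 * j)) atTop
        (𝓝 (2 * ((∫ x in Sᶜ, B1 x) - q.2 * j))) := (L2.sub_const _).const_mul 2
    have h2 : Tendsto (fun N => 2 * ((∫ x in Sᶜ, cut N x * B1 x) - q.2 * j)) atTop (𝓝 (-0)) := by
      refine L3.neg.congr' ?_
      filter_upwards [eventually_gt_atTop 0, eventually_ge_atTop R₀] with N hN0 hN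
      obtain ⟨a, b⟩ := Tangential.integral_contract hS v.2 hT hT4 (IsTest.cut hN0)
      have ia : IntegrableOn (fun x => cut N x * B1 x) Sᶜ :=
        i1.bdd_mul (c := 1) (contDiff_cut N).continuous.aestronglyMeasurable
          (ae_of_all _ fun x => abs_cut_le N x)
      have ec : (fun x => cut N x * contract (withH H u β x - rigid q x) (Γ x) (field v x))
          =ᵐ[volume.restrict Sᶜ] fun x => cut N x * B1 x - q.2 * (cut N x * B2 x) := by
        filter_upwards [D.ae_eq hS] with x hx
        simp only [B1, B2, withH, hx, rigid, contract, Fin.sum_univ_two, PiLp.sub_apply,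
          PiLp.add_apply, PiLp.smul_apply, smul_eq_mul]
        ring
      have ib : IntegrableOn (fun x => q.2 * (cut N x * B2 x)) Sᶜ := by
        have := ia.sub ((integrable_congr ec).1 a)
        refine this.congr (ae_of_all _ fun x => ?_)
        simp only [Pi.sub_apply]; ring
      rw [← b, integral_congr_ae ec, integral_sub ia ib, integral_const_mul, hj1 N hN]
    have := tendsto_nhds_unique h1 h2
    linarith
  rw [hJ] at L1
  have L4 := L1.sub_const (q.2 * j)
  rw [sub_self] at L4
  refine L4.congr' ?_
  filter_upwards [eventually_ge_atTop R₀] with R hR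
  rw [integral_congr_ae (eBR R), integral_sub (i1R R) ((i2 R).const_mul _), integral_const_mul,
    hj2 R hR]

omit hS D in
theorem _root_.bBody_diag (S : Set Plane) (m : ℝ) (u v : Plane → Plane) : bBody S m u v v = 0 := by
  rw [bBody, inner_perp_self, mul_zero]

/-- `b(u, v, v) = 0`. -/
theorem bForm_diag (m : ℝ) : bForm S m (withH H u β) (field v) (field v) = 0 := by
  rw [bForm, bBody_diag, sub_zero]
  by_cases hi : IntegrableOn (bIntegrand S (withH H u β) (field v) (field v)) Sᶜ
  · have e : (⋃ R : ℝ, Sᶜ ∩ ball (0 : Plane) R) = Sᶜ := iUnion_inter_ball _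
    have := tendsto_setIntegral_of_monotone (μ := volume)
      (f := bIntegrand S (withH H u β) (field v) (field v))
      (fun R : ℝ => hS.isOpen_compl.measurableSet.inter isOpen_ball.measurableSet)
      (fun a b h => inter_subset_inter_right _ (ball_subset_ball h)) (by rwa [e])
    rw [e] at this
    exact tendsto_nhds_unique this (D.cancellation hS u β v).2
  · exact integral_undef hi

/-- `b(u, v, w) = - b(u, w, v)`. -/
theorem bForm_antisymm {m J : ℝ} (hm : 0 < m) (hJ : 0 < J) (v w : spaceV S) :
    bForm S m (withH H u β) (field v) (field w) =
      - bForm S m (withH H u β) (field w) (field v) := by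
  obtain ⟨-, B, hB, -⟩ := trilinear_on_energy_spaces hS D hm hJ
  have k : ∀ a b : spaceV S, B (u, β) ⟨a, spaceV_le_spaceVu hS a.2⟩ (b, 0) =
      bForm S m (withH H u β) (field a) (field b) := fun a b => by
    rw [hB, withH_coeff_zero]
  have h0 : ∀ a : spaceV S, B (u, β) ⟨a, spaceV_le_spaceVu hS a.2⟩ (a, 0) = 0 := fun a => by
    rw [k]
    exact D.bForm_diag hS u β ⟨a, spaceV_le_spaceVu hS a.2⟩ m
  have h := h0 (v + w)
  have e1 : (⟨((v + w : spaceV S) : L2Plane), spaceV_le_spaceVu hS (v + w).2⟩ : spaceVu S) =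
      ⟨v, spaceV_le_spaceVu hS v.2⟩ + ⟨w, spaceV_le_spaceVu hS w.2⟩ := rfl
  have e2 : ((v + w, 0) : spaceV S × ℝ) = (v, 0) + (w, 0) := by simp
  rw [e1, e2, map_add, map_add, LinearMap.add_apply, LinearMap.add_apply, h0, h0, k, k] at h
  linarith

end CircData

/-! ### A Poincaré inequality -/

theorem lintegral_comp_smul_plane {Θ : Plane → ℝ≥0∞} (hΘ : Measurable Θ) {t : ℝ} (ht : t ≠ 0) :
    ∫⁻ h, Θ (t • h) = ENNReal.ofReal ((t ^ 2)⁻¹) * ∫⁻ y, Θ y := by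
  have h1 := lintegral_map (μ := (volume : Measure Plane)) hΘ (measurable_const_smul t)
  rw [← h1, Measure.map_addHaar_smul _ ht, lintegral_smul_measure]
  simp [abs_of_nonneg, sq_nonneg]

theorem enorm_sub_sq_le {g : Plane → ℝ} (hg : ContDiff ℝ 1 g) (p h : Plane) :
    ‖g (p + h) - g p‖ₑ ^ (2 : ℝ) ≤ ENNReal.ofReal (‖h‖ ^ 2) *
      ∫⁻ t in Ioc (0 : ℝ) 1, ENNReal.ofReal (pdSum g (p + t • h) ^ 2) := by
  set μ : Measure ℝ := volume.restrict (Ioc 0 1)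
  have hμ : IsProbabilityMeasure μ := ⟨by simp [μ]⟩
  have cl : Continuous fun t : ℝ => p + t • h := by fun_prop
  have hd : ∀ t : ℝ, HasDerivAt (fun t => g (p + t • h)) (fderiv ℝ g (p + t • h) h) t := fun t => by
    have h1 : HasDerivAt (fun t : ℝ => p + t • h) h t := by
      simpa using ((hasDerivAt_id t).smul_const h).const_add p
    exact (hg.differentiable (by simp) (p + t • h)).hasFDerivAt.comp_hasDerivAt t h1
  have cd : Continuous fun t : ℝ => fderiv ℝ g (p + t • h) h :=
    ((hg.continuous_fderiv (by simp)).comp cl).clm_apply continuous_const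
  have e := intervalIntegral.integral_eq_sub_of_hasDerivAt (a := 0) (b := 1) (fun t _ => hd t)
    (cd.intervalIntegrable _ _)
  rw [intervalIntegral.integral_of_le zero_le_one] at e
  simp only [one_smul, zero_smul, add_zero] at e
  have cP : Continuous fun t : ℝ => pdSum g (p + t • h) := (continuous_pdSum hg).comp cl
  have e1 : ‖g (p + h) - g p‖ₑ ≤ ENNReal.ofReal ‖h‖ * eLpNorm (fun t => pdSum g (p + t • h)) 2 μ := by
    calc ‖g (p + h) - g p‖ₑ ≤ ∫⁻ t, ‖fderiv ℝ g (p + t • h) h‖ₑ ∂μ := by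
          rw [← e]; exact enorm_integral_le_lintegral_enorm _
      _ ≤ ∫⁻ t, ENNReal.ofReal ‖h‖ * ‖pdSum g (p + t • h)‖ₑ ∂μ := by
          refine lintegral_mono fun t => ?_
          rw [← ofReal_norm, ← ofReal_norm, ← ENNReal.ofReal_mul (norm_nonneg _)]
          refine ENNReal.ofReal_le_ofReal ((abs_fderiv_le g _ h).trans ?_)
          gcongr
          exact Real.le_norm_self _
      _ = ENNReal.ofReal ‖h‖ * eLpNorm (fun t => pdSum g (p + t • h)) 1 μ := by
          rw [lintegral_const_mul _ cP.measurable.enorm, eLpNorm_one_eq_lintegral_enorm]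
      _ ≤ _ := by
          gcongr
          exact eLpNorm_le_eLpNorm_of_exponent_le (by norm_num) cP.aestronglyMeasurable
  refine (ENNReal.rpow_le_rpow e1 (by norm_num)).trans (le_of_eq ?_)
  rw [ENNReal.mul_rpow_of_nonneg _ _ (by norm_num), ENNReal.ofReal_pow (norm_nonneg _),
    ENNReal.rpow_two, eLpNorm_eq_lintegral_rpow_enorm_toReal (by norm_num) (by norm_num),
    ← ENNReal.rpow_mul]
  norm_num
  congr 2
  ext t
  rw [Real.enorm_eq_ofReal_abs, ← ENNReal.ofReal_pow (abs_nonneg _), sq_abs]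

/-- A Poincaré inequality for functions that vanish near the centre of a ball. -/
theorem exists_poincare (p : Plane) {δ R : ℝ} (hδ : 0 < δ) (hR : 0 < R) : ∃ C : ℝ≥0,
    ∀ g, ContDiff ℝ 1 g → g p = 0 → (∀ x ∈ ball p δ, ∀ j, pd j g x = 0) →
      eLpNorm g 2 (volume.restrict (ball p R)) ≤ C * eLpNorm (pdSum g) 2 := by
  refine ⟨Real.toNNReal (R ^ 2 / δ), fun g hg hp h0 => ?_⟩
  set F : Plane → ℝ≥0∞ := fun y => ENNReal.ofReal (pdSum g y ^ 2)
  have mF : Measurable F := ((continuous_pdSum hg).measurable.pow_const 2).ennreal_ofReal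
  have hF0 : ∀ x ∈ ball p δ, F x = 0 := fun x hx => by simp [F, pdSum, h0 x hx]
  set k := ENNReal.ofReal (R ^ 2 / δ ^ 2)
  have bt : ∀ t ∈ Ioc (0 : ℝ) 1, ∫⁻ h in ball (0 : Plane) R, F (p + t • h) ≤ k * ∫⁻ y, F y := by
    intro t ht
    by_cases hta : t * R ≤ δ
    · rw [setLIntegral_congr_fun isOpen_ball.measurableSet (g := fun _ => 0), lintegral_zero]
      · exact zero_le
      · intro h hh
        refine hF0 _ ?_
        rw [mem_ball_iff_norm, add_sub_cancel_left, norm_smul, Real.norm_of_nonneg ht.1.le]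
        exact (mul_lt_mul_of_pos_left (mem_ball_zero_iff.1 hh) ht.1).trans_le hta
    · rw [not_le] at hta
      calc _ ≤ ∫⁻ h, F (p + t • h) := setLIntegral_le_lintegral _ _
        _ = ENNReal.ofReal ((t ^ 2)⁻¹) * ∫⁻ y, F (p + y) :=
            lintegral_comp_smul_plane (Θ := fun y => F (p + y)) (mF.comp (measurable_const_add p)) ht.1.ne'
        _ = ENNReal.ofReal ((t ^ 2)⁻¹) * ∫⁻ y, F y := by rw [lintegral_add_left_eq_self F p]
        _ ≤ _ := by
            gcongr
            refine ENNReal.ofReal_le_ofReal ?_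
            rw [← inv_div, ← div_pow]
            gcongr
            rw [div_le_iff₀ hR]
            exact hta.le
  have e1 : ∫⁻ x in ball p R, ‖g x‖ₑ ^ (2 : ℝ) =
      ∫⁻ h in ball (0 : Plane) R, ‖g (p + h)‖ₑ ^ (2 : ℝ) := by
    rw [← lintegral_indicator isOpen_ball.measurableSet,
      ← lintegral_indicator isOpen_ball.measurableSet, ← lintegral_add_left_eq_self _ p]
    congr 1
    ext h
    by_cases hh : h ∈ ball (0 : Plane) R
    · rw [indicator_of_mem hh, indicator_of_mem]
      simpa [mem_ball_iff_norm] using hh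
    · rw [indicator_of_notMem hh, indicator_of_notMem]
      simpa [mem_ball_iff_norm] using hh
  have e2 : ∫⁻ x in ball p R, ‖g x‖ₑ ^ (2 : ℝ) ≤ ENNReal.ofReal (R ^ 2) * (k * ∫⁻ y, F y) := by
    rw [e1]
    calc _ ≤ ∫⁻ h in ball (0 : Plane) R, ENNReal.ofReal (R ^ 2) *
          ∫⁻ t in Ioc (0 : ℝ) 1, F (p + t • h) := by
          refine setLIntegral_mono' isOpen_ball.measurableSet fun h hh => ?_
          have := enorm_sub_sq_le hg p h
          rw [hp, sub_zero] at this
          refine this.trans ?_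
          gcongr
          exact (mem_ball_zero_iff.1 hh).le
      _ = ENNReal.ofReal (R ^ 2) * ∫⁻ h in ball (0 : Plane) R,
          ∫⁻ t in Ioc (0 : ℝ) 1, F (p + t • h) := lintegral_const_mul' _ _ ENNReal.ofReal_ne_top
      _ = ENNReal.ofReal (R ^ 2) * ∫⁻ t in Ioc (0 : ℝ) 1,
          ∫⁻ h in ball (0 : Plane) R, F (p + t • h) := by
          congr 1
          refine lintegral_lintegral_swap (Measurable.aemeasurable ?_)
          have : Continuous fun q : Plane × ℝ => p + q.2 • q.1 := by fun_prop
          exact mF.comp this.measurable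
      _ ≤ ENNReal.ofReal (R ^ 2) * ∫⁻ t in Ioc (0 : ℝ) 1, k * ∫⁻ y, F y := by
          refine mul_le_mul_right ?_ _
          exact setLIntegral_mono' measurableSet_Ioc bt
      _ = _ := by simp
  rw [eLpNorm_eq_lintegral_rpow_enorm_toReal (by norm_num) (by norm_num),
    eLpNorm_eq_lintegral_rpow_enorm_toReal (by norm_num) (by norm_num)]
  simp only [ENNReal.toReal_ofNat]
  have e3 : ∫⁻ y, F y = ∫⁻ y, ‖pdSum g y‖ₑ ^ (2 : ℝ) := by
    refine lintegral_congr fun y => ?_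
    rw [ENNReal.rpow_two, Real.enorm_eq_ofReal_abs, ← ENNReal.ofReal_pow (abs_nonneg _), sq_abs]
  rw [e3] at e2
  refine (ENNReal.rpow_le_rpow e2 (by norm_num)).trans (le_of_eq ?_)
  rw [← mul_assoc, ENNReal.mul_rpow_of_nonneg _ _ (by norm_num), ← ENNReal.ofReal_mul (by positivity)]
  congr 1
  rw [ENNReal.ofReal_rpow_of_nonneg (by positivity) (by norm_num), ← Real.sqrt_eq_rpow]
  have : R ^ 2 * (R ^ 2 / δ ^ 2) = (R ^ 2 / δ) ^ 2 := by ring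
  rw [this, Real.sqrt_sq (by positivity)]
  rfl

/-! ### Stream functions -/

theorem exists_stream_smooth {V : Plane → Plane} (hV : ContDiff ℝ 1 V)
    (hdiv : ∀ x, pd 0 (fun y => V y 0) x + pd 1 (fun y => V y 1) x = 0) (p : Plane) :
    ∃ g, ContDiff ℝ 1 g ∧ g p = 0 ∧ ∀ x, pd 0 g x = V x 1 ∧ pd 1 g x = - V x 0 := by
  set P : Fin 2 → Plane →L[ℝ] ℝ := fun i => EuclideanSpace.proj i
  set κ : Plane → Plane →L[ℝ] ℝ := fun x => V x 1 • P 0 - V x 0 • P 1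
  have hκ : ContDiff ℝ 1 κ := ((hV.coord 1).smul contDiff_const).sub ((hV.coord 0).smul contDiff_const)
  have hd : ∀ a x y, fderiv ℝ κ a x y =
      fderiv ℝ (fun z => V z 1) a x * y 0 - fderiv ℝ (fun z => V z 0) a x * y 1 := by
    intro a x y
    have h1 := ((hV.coord 1).differentiable one_ne_zero a).hasFDerivAt.smul_const (P 0)
    have h0 := ((hV.coord 0).differentiable one_ne_zero a).hasFDerivAt.smul_const (P 1)
    have h := (h1.sub h0).fderiv
    change fderiv ℝ κ a = _ at h
    rw [h]
    simp [P]
  obtain ⟨f, hf⟩ := convex_univ.exists_forall_hasFDerivAt_of_fderiv_symmetric isOpen_univ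
    (hκ.differentiable one_ne_zero).differentiableOn fun a _ x y => by
      rw [hd, hd]
      simp only [ContDiff.pd_sum_smul (f := fun z => V z 1) a,
        ContDiff.pd_sum_smul (f := fun z => V z 0) a]
      linear_combination (x 1 * y 0 - x 0 * y 1) * hdiv a
  have hf' : fderiv ℝ f = κ := funext fun x => (hf x trivial).fderiv
  refine ⟨fun x => f x - f p, ?_, sub_self _, fun x => ?_⟩
  · refine ContDiff.sub ?_ contDiff_const
    rw [contDiff_one_iff_fderiv, hf']
    exact ⟨fun x => (hf x trivial).differentiableAt, hκ.continuous⟩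
  · simp [pd, fderiv_sub_const, hf', κ, P]

theorem exists_memLp_limit {α E : Type*} [MeasurableSpace α] {μ : Measure α} [NormedAddCommGroup E]
    [CompleteSpace E] {p : ℝ≥0∞} [Fact (1 ≤ p)] {f : ℕ → α → E} (hf : ∀ n, MemLp (f n) p μ)
    (h : Tendsto (fun q : ℕ × ℕ => eLpNorm (fun x => f q.1 x - f q.2 x) p μ) atTop (𝓝 0)) :
    ∃ g, MemLp g p μ ∧ Tendsto (fun n => eLpNorm (fun x => f n x - g x) p μ) atTop (𝓝 0) := by
  have hc : CauchySeq fun n => (hf n).toLp (f n) := by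
    rw [Lp.cauchySeq_Lp_iff_cauchySeq_eLpNorm]
    refine h.congr fun q => eLpNorm_congr_ae ?_
    filter_upwards [(hf q.1).coeFn_toLp, (hf q.2).coeFn_toLp] with x h1 h2
    rw [Pi.sub_apply, h1, h2]
  obtain ⟨G, hG⟩ := cauchySeq_tendsto_of_complete hc
  refine ⟨G, Lp.memLp G, ?_⟩
  have hG' : (Lp.memLp G).toLp (G : α → E) = G := Lp.toLp_coeFn G (Lp.memLp G)
  rw [← hG'] at hG
  exact (Lp.tendsto_Lp_iff_tendsto_eLpNorm'' f hf G (Lp.memLp G)).1 hG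

theorem tendsto_eLpNorm_cauchy {α E : Type*} [MeasurableSpace α] {μ : Measure α}
    [NormedAddCommGroup E] {p : ℝ≥0∞} (hp : 1 ≤ p) {f : ℕ → α → E} {g : α → E}
    (hf : ∀ n, AEStronglyMeasurable (f n) μ) (hg : AEStronglyMeasurable g μ)
    (h : Tendsto (fun n => eLpNorm (fun x => f n x - g x) p μ) atTop (𝓝 0)) :
    Tendsto (fun q : ℕ × ℕ => eLpNorm (fun x => f q.1 x - f q.2 x) p μ) atTop (𝓝 0) := by
  have t := (h.comp tendsto_fst).add (h.comp tendsto_snd)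
  rw [add_zero, prod_atTop_atTop_eq] at t
  refine tendsto_of_tendsto_of_tendsto_of_le_of_le tendsto_const_nhds t (fun _ => zero_le) fun q => ?_
  have e : (fun x => f q.1 x - f q.2 x) = (fun x => f q.1 x - g x) - fun x => f q.2 x - g x := by
    ext x; simp
  rw [e]
  exact eLpNorm_sub_le ((hf _).sub hg) ((hf _).sub hg) hp

theorem memLp_of_coord {α ι : Type*} [MeasurableSpace α] [Fintype ι] {μ : Measure α} {p : ℝ≥0∞}
    {w : α → EuclideanSpace ℝ ι} (h : ∀ i, MemLp (fun x => w x i) p μ) : MemLp w p μ :=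
  MemLp.of_eval_piLp h

/-- Mollification of a vector field. -/
noncomputable def vmol (K : Plane → ℝ) (w : Plane → Plane) (x : Plane) : Plane :=
  WithLp.toLp 2 fun i => mol K (fun y => w y i) x

theorem vmol_contDiff {K : Plane → ℝ} {w : Plane → Plane} (hw : MemLp w 2) (hK : ContDiff ℝ ∞ K)
    (hc : HasCompactSupport K) : ContDiff ℝ ∞ (vmol K w) := by
  rw [contDiff_euclidean]
  exact fun i => mol_contDiff ((memLp_coord hw i).locallyIntegrable (by norm_num)) hK hc

theorem vmol_div {K : Plane → ℝ} {w : Plane → Plane} (hw : MemLp w 2) (hd : WeakDivFree w)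
    (hK : ContDiff ℝ ∞ K) (hc : HasCompactSupport K) (x : Plane) :
    pd 0 (fun y => vmol K w y 0) x + pd 1 (fun y => vmol K w y 1) x = 0 := by
  have l := fun i => (memLp_coord hw i).locallyIntegrable (by norm_num)
  have i := fun j => integrable_mul_kernel (l j) (continuous_pd (hK.of_le (by simp)) j)
    (hasCompactSupport_pd hc j) x
  have e := hd _ (IsTest.of_kernel (O := univ) hK hc (x := x) fun _ _ => mem_univ _)
  simp only [pd_kernel hK, mul_neg, ← neg_add, integral_neg, neg_eq_zero] at e
  change pd 0 (mol K fun y => w y 0) x + pd 1 (mol K fun y => w y 1) x = 0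
  rw [pd_mol (l 0) hK hc, pd_mol (l 1) hK hc, mol, mol, ← integral_add (i 0) (i 1), e]

theorem tendsto_vmol {K : ℕ → Plane → ℝ} (hK : IsMollifier K) {w : Plane → Plane}
    (hw : MemLp w 2) : Tendsto (fun n => eLpNorm (fun x => vmol (K n) w x - w x) 2) atTop (𝓝 0) := by
  have t := tendsto_finsetSum Finset.univ fun i _ => hK.tendsto_eLpNorm (memLp_coord hw i)
  rw [Finset.sum_const_zero] at t
  refine tendsto_of_tendsto_of_tendsto_of_le_of_le tendsto_const_nhds t (fun _ => zero_le) fun n => ?_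
  exact eLpNorm_le_sum_coord ((vmol_contDiff hw (hK.smooth n)
    (hK.compact n)).continuous.aestronglyMeasurable.sub hw.1) (by norm_num)

/-- `f` is a stream function of `U` in the open set `O`. -/
def IsStream (O : Set Plane) (f : Plane → ℝ) (U : Plane → Plane) : Prop :=
  ∀ χ, IsTest O χ → ∫ x, f x * pd 0 χ x = - ∫ x, U x 1 * χ x ∧ ∫ x, f x * pd 1 χ x = ∫ x, U x 0 * χ x

theorem eLpNorm_pdSum_le {g : Plane → ℝ} {W : Plane → Plane} (hW : AEStronglyMeasurable W volume)
    (h0 : ∀ x, pd 0 g x = W x 1) (h1 : ∀ x, pd 1 g x = - W x 0) :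
    eLpNorm (pdSum g) 2 ≤ eLpNorm W 2 + eLpNorm W 2 := by
  have e : eLpNorm (fun x => ‖W x‖) 2 = eLpNorm W 2 :=
    eLpNorm_congr_norm_ae (ae_of_all _ fun x => norm_norm _)
  have h : eLpNorm (pdSum g) 2 ≤ eLpNorm ((fun x => ‖W x‖) + fun x => ‖W x‖) 2 := by
    refine eLpNorm_mono fun x => ?_
    rw [pdSum, h0, h1, abs_neg, Real.norm_of_nonneg (by positivity), Pi.add_apply]
    exact (add_le_add (abs_coord_le _ _) (abs_coord_le _ _)).trans (Real.le_norm_self _)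
  refine h.trans ((eLpNorm_add_le hW.norm hW.norm (by norm_num)).trans (le_of_eq ?_))
  rw [e]

/-- Square integrable solenoidal fields that vanish near `p` have a local stream function that
vanishes near `p`. -/
theorem exists_stream {U : Plane → Plane} (hU : MemLp U 2) (hd : WeakDivFree U) {p : Plane}
    {δ R : ℝ} (hδ : 0 < δ) (hR : δ ≤ R) (h0 : ∀ x ∈ ball p (2 * δ), U x = 0) :
    ∃ f, MemLp f 2 ∧ f =ᵐ[volume.restrict (ball p δ)] 0 ∧ IsStream (ball p R) f U := by
  obtain ⟨K, hK, hs⟩ := exists_isMollifier_small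
  obtain ⟨n₀, hn₀⟩ := exists_nat_one_div_lt hδ
  set V : ℕ → Plane → Plane := fun n => vmol (K (n + n₀)) U
  have hV : ∀ n, ContDiff ℝ ∞ (V n) := fun n => vmol_contDiff hU (hK.smooth _) (hK.compact _)
  have hV1 : ∀ n, ContDiff ℝ 1 (V n) := fun n => (hV n).of_le (by simp)
  have tV : Tendsto (fun n => eLpNorm (fun x => V n x - U x) 2) atTop (𝓝 0) :=
    (tendsto_vmol hK hU).comp (tendsto_add_atTop_nat n₀)
  have V0 : ∀ n, ∀ x ∈ ball p δ, V n x = 0 := fun n x hx => plane_ext fun i => by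
    refine mol_eq_zero_of_disjoint fun z hz => ?_
    rw [h0]; · rfl
    have h1 : ‖z‖ < δ := by
      refine (hs _ z hz).trans (lt_of_le_of_lt ?_ hn₀)
      exact one_div_le_one_div_of_le (by positivity) (by push_cast; linarith [Nat.cast_nonneg (α := ℝ) n])
    rw [mem_ball_iff_norm] at hx ⊢
    calc ‖x - z - p‖ = ‖(x - p) - z‖ := by congr 1; abel
      _ ≤ ‖x - p‖ + ‖z‖ := norm_sub_le _ _
      _ < 2 * δ := by linarith
  choose g hg hgp hgd using fun n => exists_stream_smooth (hV1 n)
    (vmol_div hU hd (hK.smooth _) (hK.compact _)) p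
  have g0 : ∀ n, ∀ x ∈ ball p δ, g n x = 0 := fun n x hx => by
    rw [← hgp n]
    refine eqOn_const_of_pd_eq_zero isOpen_ball (convex_ball p δ).isPreconnected
      ((hg n).differentiable one_ne_zero) (fun j y hy => ?_) hx (mem_ball_self hδ)
    fin_cases j
    · exact ((hgd n y).1).trans (by rw [V0 n y hy]; rfl)
    · exact ((hgd n y).2).trans (by rw [V0 n y hy]; exact neg_zero)
  have mV : ∀ n, AEStronglyMeasurable (V n) := fun n => (hV n).continuous.aestronglyMeasurable
  obtain ⟨C, hC⟩ := exists_poincare p hδ (hδ.trans_le hR)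
  set μ := (volume : Measure Plane).restrict (ball p R)
  have cg : Tendsto (fun q : ℕ × ℕ => eLpNorm (fun x => g q.1 x - g q.2 x) 2 μ) atTop (𝓝 0) := by
    have t := tendsto_eLpNorm_cauchy (p := 2) (by norm_num) mV hU.1 tV
    have t2 := ENNReal.Tendsto.const_mul (a := (C : ℝ≥0∞)) (t.add t) (Or.inr (by simp))
    rw [add_zero, mul_zero] at t2
    refine tendsto_of_tendsto_of_tendsto_of_le_of_le tendsto_const_nhds t2 (fun _ => zero_le)
      fun q => ?_
    have dg := (hg q.1).sub (hg q.2)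
    have ep : ∀ j x, pd j (fun x => g q.1 x - g q.2 x) x = pd j (g q.1) x - pd j (g q.2) x :=
      fun j x => by
        simp only [pd]
        rw [fderiv_fun_sub ((hg q.1).differentiable one_ne_zero x)
          ((hg q.2).differentiable one_ne_zero x)]
        rfl
    have e0 : ∀ x, pd 0 (fun x => g q.1 x - g q.2 x) x = (V q.1 x - V q.2 x) 1 := fun x => by
      rw [ep, (hgd _ x).1, (hgd _ x).1]; rfl
    have e1 : ∀ x, pd 1 (fun x => g q.1 x - g q.2 x) x = - (V q.1 x - V q.2 x) 0 := fun x => by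
      rw [ep, (hgd _ x).2, (hgd _ x).2, PiLp.sub_apply]; ring
    refine (hC _ dg (by simp [hgp]) fun x hx j => ?_).trans ?_
    · fin_cases j
      · exact (e0 x).trans (by rw [V0 _ x hx, V0 _ x hx, sub_zero]; rfl)
      · exact (e1 x).trans (by rw [V0 _ x hx, V0 _ x hx, sub_zero]; exact neg_zero)
    · gcongr
      exact eLpNorm_pdSum_le ((mV _).sub (mV _)) e0 e1
  have mg : ∀ n, MemLp (g n) 2 μ := fun n => by
    obtain ⟨B, hB⟩ := (isCompact_closedBall p R).exists_bound_of_continuousOn (hg n).continuous.continuousOn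
    have : IsFiniteMeasure μ := ⟨by rw [Measure.restrict_apply_univ]; exact measure_ball_lt_top⟩
    refine MemLp.of_bound (hg n).continuous.aestronglyMeasurable B ?_
    filter_upwards [ae_restrict_mem isOpen_ball.measurableSet] with x hx
    exact hB x (ball_subset_closedBall hx)
  obtain ⟨f, hf, tf⟩ := exists_memLp_limit mg cg
  have hm : MeasurableSet (ball p R) := isOpen_ball.measurableSet
  refine ⟨(ball p R).indicator f, (memLp_indicator_iff_restrict hm).2 hf, ?_, fun χ hχ => ?_⟩
  · have hsub : ball p δ ⊆ ball p R := ball_subset_ball hR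
    have hle : (volume : Measure Plane).restrict (ball p δ) ≤ μ := Measure.restrict_mono hsub le_rfl
    have z : eLpNorm f 2 (volume.restrict (ball p δ)) = 0 := by
      refine le_antisymm (ge_of_tendsto' tf fun n => ?_) zero_le
      refine le_trans (le_of_eq ?_) (eLpNorm_mono_measure _ hle)
      rw [← eLpNorm_neg]
      refine eLpNorm_congr_ae ?_
      filter_upwards [ae_restrict_mem isOpen_ball.measurableSet] with x hx
      rw [g0 n x hx, zero_sub]; rfl
    rw [eLpNorm_eq_zero_iff (hf.1.mono_measure hle) (by norm_num)] at z
    filter_upwards [z, ae_restrict_mem isOpen_ball.measurableSet] with x hx hxb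
    rw [indicator_of_mem (hsub hxb), hx]
  · have key : ∀ j (k : Fin 2) (c : ℝ), (∀ n x, pd j (g n) x = c * V n x k) →
        ∫ x, (ball p R).indicator f x * pd j χ x = - (c * ∫ x, U x k * χ x) := by
      intro j k c hc
      have hχj := memLp_of_compactSupport (continuous_pd hχ.contDiff_one j)
        (hasCompactSupport_pd' hχ.2.1 j) 2
      have hχ2 := memLp_of_compactSupport hχ.1.continuous hχ.2.1 2
      have T1 : Tendsto (fun n => ∫ x, g n x * pd j χ x ∂μ) atTop (𝓝 (∫ x, f x * pd j χ x ∂μ)) :=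
        tendsto_integral_mul (p := 2) (q := 2) mg hf (fun _ => hχj.restrict _) (hχj.restrict _) tf
          (tendsto_eLpNorm_const 2 _)
      have mVn : ∀ n, MemLp (V n) 2 := fun n => memLp_of_coord fun i =>
        memLp_mol (memLp_coord hU i) (hK.smooth _) (hK.compact _)
      have T2 : Tendsto (fun n => ∫ x, V n x k * χ x) atTop (𝓝 (∫ x, U x k * χ x)) := by
        refine tendsto_integral_mul (p := 2) (q := 2) (fun n => memLp_coord (mVn n) k)
          (memLp_coord hU k) (fun _ => hχ2) hχ2 ?_ (tendsto_eLpNorm_const 2 _)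
        refine tendsto_of_tendsto_of_tendsto_of_le_of_le tendsto_const_nhds tV (fun _ => zero_le)
          fun n => eLpNorm_mono fun x => ?_
        exact abs_coord_le (V n x - U x) k
      have e : ∀ n, ∫ x, g n x * pd j χ x ∂μ = - (c * ∫ x, V n x k * χ x) := fun n => by
        rw [setIntegral_mul_of_tsupport_subset ((tsupport_pd_subset χ j).trans hχ.2.2),
          integral_mul_pd (hg n) hχ.contDiff_one hχ.2.1, ← integral_const_mul]
        simp only [hc, mul_assoc]
      simp only [e] at T1
      rw [← tendsto_nhds_unique T1 (T2.const_mul c).neg,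
        ← setIntegral_mul_of_tsupport_subset ((tsupport_pd_subset χ j).trans hχ.2.2)]
      refine setIntegral_congr_fun hm fun x hx => ?_
      simp only [indicator_of_mem hx]
    refine ⟨?_, ?_⟩
    · have := key 0 1 1 fun n x => by rw [(hgd n x).1, one_mul]
      rwa [one_mul] at this
    · have := key 1 0 (-1) fun n x => by rw [(hgd n x).2]; ring
      rwa [neg_one_mul, neg_neg] at this

/-! ### Localization of solenoidal fields -/

/-- The field `∇^⊥(ζ f)`, where `U = ∇^⊥ f`. -/
noncomputable def streamMul (ζ f : Plane → ℝ) (U : Plane → Plane) (x : Plane) : Plane :=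
  !₂[ζ x * U x 0 - f x * pd 1 ζ x, ζ x * U x 1 + f x * pd 0 ζ x]

theorem streamMul_eq_zero {ζ f : Plane → ℝ} {U : Plane → Plane} {x : Plane}
    (h : U x = 0 ∧ f x = 0 ∨ x ∉ tsupport ζ) : streamMul ζ f U x = 0 := by
  rcases h with ⟨h1, h2⟩ | h
  · refine plane_ext fun i => ?_
    fin_cases i <;> simp [streamMul, h1, h2]
  · have hp : ∀ j, pd j ζ x = 0 := fun j =>
      image_eq_zero_of_notMem_tsupport fun h' => h (tsupport_pd_subset ζ j h')
    refine plane_ext fun i => ?_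
    fin_cases i <;> simp [streamMul, image_eq_zero_of_notMem_tsupport h, hp]

theorem memLp_streamMul {ζ f : Plane → ℝ} {U : Plane → Plane} (hζ : IsTest univ ζ)
    (hf : MemLp f 2) (hU : MemLp U 2) : MemLp (streamMul ζ f U) 2 := by
  obtain ⟨M, hM0, hM1⟩ := exists_bound_test hζ.contDiff_one hζ.2.1
  have k : ∀ {a g : Plane → ℝ}, Continuous a → (∀ x, |a x| ≤ M) → MemLp g 2 →
      MemLp (fun x => a x * g x) 2 := fun ha hM hg =>
    MemLp.of_le_mul (c := M) hg (ha.aestronglyMeasurable.mul hg.1) (ae_of_all _ fun x => by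
      rw [norm_mul]; gcongr; exact hM x)
  have kf := fun j => k (continuous_pd hζ.contDiff_one j) (hM1 j) hf
  have kU := fun i => k hζ.1.continuous hM0 (memLp_coord hU i)
  refine memLp_of_coord fun i => ?_
  fin_cases i
  · refine ((kU 0).sub (kf 1)).ae_eq (ae_of_all _ fun x => ?_)
    simp [streamMul, mul_comm]
  · refine ((kU 1).add (kf 0)).ae_eq (ae_of_all _ fun x => ?_)
    simp [streamMul, mul_comm]

theorem weakDivFree_streamMul {O : Set Plane} {ζ f : Plane → ℝ} {U : Plane → Plane}
    (hζ : IsTest O ζ) (hf : LocallyIntegrable f) (hU : LocallyIntegrable U)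
    (hs : IsStream O f U) (hd : WeakDivFree U) : WeakDivFree (streamMul ζ f U) := by
  intro ψ hψ
  have lU := fun i => locallyIntegrableOn_coord (locallyIntegrableOn_univ.2 hU) i
  have lf := locallyIntegrableOn_univ.2 hf
  have I : ∀ {a g : Plane → ℝ}, LocallyIntegrableOn a univ → IsTest univ g →
      Integrable fun x => a x * g x := fun ha hg => by
    simpa [IntegrableOn] using integrableOn_mul_test ha hg.1.continuous hg.2.1 hg.2.2
  have tp : ∀ j, IsTest O fun x => ψ x * pd j ζ x := fun j =>
    IsTest.mul ⟨contDiff_pd hζ.1 j, hasCompactSupport_pd hζ.2.1 j,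
      (tsupport_pd_subset ζ j).trans hζ.2.2⟩ hψ.1
  have tζ : IsTest univ fun x => ψ x * ζ x := IsTest.mul ⟨hζ.1, hζ.2.1, subset_univ _⟩ hψ.1
  have t : ∀ {g : Plane → ℝ}, IsTest O g → IsTest univ g := fun h => ⟨h.1, h.2.1, subset_univ _⟩
  have p : ∀ {g : Plane → ℝ}, IsTest univ g → ∀ j, IsTest univ (pd j g) := fun h j =>
    ⟨contDiff_pd h.1 j, hasCompactSupport_pd h.2.1 j, subset_univ _⟩
  have e1 := hd _ tζ
  have e2 := (hs _ (tp 0)).2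
  have e3 := (hs _ (tp 1)).1
  have c2 : ∀ j x, pd j (fun x => ψ x * ζ x) x = ψ x * pd j ζ x + pd j ψ x * ζ x := fun j x => by
    rw [pd_mul_test hψ.contDiff_one hζ.contDiff_one]
  have c3 : ∀ j k x, pd j (fun x => ψ x * pd k ζ x) x = ψ x * pd j (pd k ζ) x + pd j ψ x * pd k ζ x :=
    fun j k x => by rw [pd_mul_test hψ.contDiff_one ((contDiff_pd hζ.1 k).of_le (by simp))]
  have pw : ∀ x, streamMul ζ f U x 0 * pd 0 ψ x + streamMul ζ f U x 1 * pd 1 ψ x =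
      ((U x 0 * pd 0 (fun x => ψ x * ζ x) x + U x 1 * pd 1 (fun x => ψ x * ζ x) x) +
      (f x * pd 1 (fun x => ψ x * pd 0 ζ x) x - f x * pd 0 (fun x => ψ x * pd 1 ζ x) x)) -
      (U x 0 * (ψ x * pd 0 ζ x) + U x 1 * (ψ x * pd 1 ζ x)) := fun x => by
    simp only [c2, c3, streamMul, pd_comm hζ.1 1 0]
    simp
    ring
  simp only [pw]
  have i0 := fun i j => I (lU i) (p tζ j)
  have i1 := fun j k => I lf (p (t (tp k)) j)
  have i2 := fun i j => I (lU i) (t (tp j))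
  have j0 := (i0 0 0).add (i0 1 1)
  have j1 := (i1 1 0).sub (i1 0 1)
  have j2 := (i2 0 0).add (i2 1 1)
  rw [integral_sub, integral_add, integral_sub (i1 1 0) (i1 0 1), integral_add (i2 0 0) (i2 1 1),
    e1, e2, e3]
  · ring
  · exact j0
  · exact j1
  · exact j0.add j1
  · exact j2

/-! ### Density of smooth fields -/

/-- `w` is a limit in `L²` of solenoidal fields in `H¹` that coincide with `rigid q` on `S`. -/
def SolenoidalApprox (S : Set Plane) (q : Plane × ℝ) (w : Plane → Plane) : Prop :=
  MemLp w 2 ∧ ∀ ε : ℝ≥0∞, ε ≠ 0 → ∃ w', ContDiff ℝ 1 w' ∧ MemLp w' 2 ∧ MemLp (gradMat w') 2 ∧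
    WeakDivFree w' ∧ (∀ x ∈ S, w' x = rigid q x) ∧ eLpNorm (fun x => w' x - w x) 2 ≤ ε

theorem WeakDivFree.add {u v : Plane → Plane} (hu : MemLp u 2) (hv : MemLp v 2)
    (hu' : WeakDivFree u) (hv' : WeakDivFree v) (c : ℝ) : WeakDivFree fun x => u x + c • v x := by
  intro ψ hψ
  have e := fun x => along_add_smul u v c ψ x
  simp only [along] at e
  have iu := integrable_along hu le_rfl hψ.contDiff_one hψ.2.1
  have iv := integrable_along hv le_rfl hψ.contDiff_one hψ.2.1
  simp only [e]
  have h : ∫ x, (along u ψ x + c * along v ψ x) = 0 := by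
    rw [integral_add iu (iv.const_mul c), integral_const_mul, show ∫ x, along u ψ x = 0 from hu' ψ hψ,
      show ∫ x, along v ψ x = 0 from hv' ψ hψ, mul_zero, add_zero]
  exact h

theorem SolenoidalApprox.add {S : Set Plane} {q q' : Plane × ℝ} {w w' : Plane → Plane}
    (h : SolenoidalApprox S q w) (h' : SolenoidalApprox S q' w') :
    SolenoidalApprox S (q + q') (w + w') := by
  refine ⟨h.1.add h'.1, fun ε hε => ?_⟩
  have h2 : ε / 2 ≠ 0 := (ENNReal.half_pos hε).ne'
  obtain ⟨u, a1, a2, a3, a4, a5, a6⟩ := h.2 _ h2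
  obtain ⟨v, b1, b2, b3, b4, b5, b6⟩ := h'.2 _ h2
  refine ⟨fun x => u x + v x, a1.add b1, a2.add b2, ?_, ?_, fun x hx => ?_, ?_⟩
  · have e : gradMat (fun x => u x + v x) = gradMat u + gradMat v := by
      ext x p
      exact pd_add ((a1.coord p.1).differentiable one_ne_zero x)
        ((b1.coord p.1).differentiable one_ne_zero x) p.2
    rw [e]; exact a3.add b3
  · simpa using WeakDivFree.add a2 b2 a4 b4 1
  · beta_reduce
    rw [a5 x hx, b5 x hx]
    simp only [rigid, Prod.fst_add, Prod.snd_add]; module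
  · have e : (fun x => u x + v x - (w + w') x) = (fun x => u x - w x) + fun x => v x - w' x := by
      ext1 x; simp only [Pi.add_apply]; abel
    rw [e]
    refine (eLpNorm_add_le (a2.1.sub h.1.1) (b2.1.sub h'.1.1) (by norm_num)).trans ?_
    exact (add_le_add a6 b6).trans (le_of_eq (ENNReal.add_halves ε))

theorem solenoidalApprox_of_contDiff {S : Set Plane} {q : Plane × ℝ} {w : Plane → Plane}
    (hw : ContDiff ℝ 1 w) (h1 : MemLp w 2) (h2 : MemLp (gradMat w) 2) (hd : WeakDivFree w)
    (h0 : ∀ x ∈ S, w x = rigid q x) : SolenoidalApprox S q w :=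
  ⟨h1, fun ε _ => ⟨w, hw, h1, h2, hd, h0, by simp⟩⟩

theorem solenoidalApprox_of_mol {S : Set Plane} {w : Plane → Plane} (hw : MemLp w 2)
    (hd : WeakDivFree w) {K : ℕ → Plane → ℝ} (hK : IsMollifier K)
    (h0 : ∀ᶠ n in atTop, ∀ x ∈ S, (∀ z ∈ tsupport (K n), w (x - z) = 0)) :
    SolenoidalApprox S 0 w := by
  refine ⟨hw, fun ε hε => ?_⟩
  obtain ⟨n, h1, h2⟩ := (h0.and (ENNReal.tendsto_nhds_zero.1 (tendsto_vmol hK hw) ε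
    (pos_iff_ne_zero.2 hε))).exists
  have hs := vmol_contDiff hw (hK.smooth n) (hK.compact n)
  refine ⟨vmol (K n) w, hs.of_le (by simp), memLp_of_coord fun i =>
    memLp_mol (memLp_coord hw i) (hK.smooth n) (hK.compact n), memLp_of_coord fun p => ?_,
    fun ψ hψ => integral_along_of_div (hs.of_le (by simp)) (vmol_div hw hd (hK.smooth n) (hK.compact n))
      hψ.contDiff_one hψ.2.1, fun x hx => ?_, h2⟩
  · change MemLp (pd p.2 (mol (K n) fun y => w y p.1)) 2
    rw [pd_mol ((memLp_coord hw _).locallyIntegrable (by norm_num)) (hK.smooth n) (hK.compact n)]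
    exact memLp_mol (memLp_coord hw _) (contDiff_pd (hK.smooth n) _)
      (hasCompactSupport_pd (hK.compact n) _)
  · rw [show rigid 0 x = 0 by simp [rigid]]
    refine plane_ext fun i => mol_eq_zero_of_disjoint fun z hz => ?_
    rw [h1 x hx z hz]; rfl

theorem isStream_of_contDiff {f : Plane → ℝ} {U : Plane → Plane} (hf : ContDiff ℝ 1 f)
    (h : ∀ x, pd 0 f x = U x 1 ∧ pd 1 f x = - U x 0) (O : Set Plane) : IsStream O f U := by
  intro χ hχ
  rw [integral_mul_pd hf hχ.contDiff_one hχ.2.1, integral_mul_pd hf hχ.contDiff_one hχ.2.1]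
  simp only [(h _).1, (h _).2, neg_mul, integral_neg, neg_neg, and_self]

namespace IsSmoothBody

variable {S : Set Plane} (hS : IsSmoothBody S)
include hS

/-- Every rigid motion of the body extends to a solenoidal field of compact support. -/
theorem exists_extension (q : Plane × ℝ) : ∃ E, ContDiff ℝ 1 E ∧ MemLp E 2 ∧
    SolenoidalApprox S q E ∧ WeakDivFree E ∧ ∀ x ∈ S, E x = rigid q x := by
  obtain ⟨N, hN⟩ := hS.isBounded.subset_closedBall (0 : Plane)
  have hρ : 0 < max N 0 + 1 := by positivity
  set ρ := max N 0 + 1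
  have hSρ : ∀ x ∈ S, ‖x‖ < ρ := fun x hx =>
    ((mem_closedBall_zero_iff.1 (hN hx)).trans (le_max_left N 0)).trans_lt (lt_add_one _)
  obtain ⟨f, hf, -, hfd⟩ := exists_stream_smooth (contDiff_rigid q)
    (fun x => by rw [(pd_rigid q 0 x).1, (pd_rigid q 1 x).2]; simp) 0
  have ht := IsTest.cut hρ
  set E := streamMul (cut ρ) f (rigid q)
  have r := fun i => (contDiff_rigid q (n := 1)).coord i
  have cp : ∀ j, ContDiff ℝ 1 (pd j (cut ρ)) := fun j => (contDiff_pd ht.1 j).of_le (by simp)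
  have cE : ContDiff ℝ 1 E := by
    rw [contDiff_euclidean]
    intro i
    fin_cases i
    · exact (ht.contDiff_one.mul (r 0)).sub (hf.mul (cp 1))
    · exact (ht.contDiff_one.mul (r 1)).add (hf.mul (cp 0))
  have hE0 : ∀ x, x ∉ tsupport (cut ρ) → E x = 0 := fun x hx => streamMul_eq_zero (Or.inr hx)
  have hE : HasCompactSupport E := HasCompactSupport.intro ht.2.1 hE0
  have mE : MemLp E 2 := cE.continuous.memLp_of_hasCompactSupport hE
  have dE : WeakDivFree E := weakDivFree_streamMul (O := univ) ht hf.continuous.locallyIntegrable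
    (continuous_rigid q).locallyIntegrable (isStream_of_contDiff hf hfd univ)
    fun ψ hψ => integral_along_rigid q hψ.contDiff_one hψ.2.1
  have eE : ∀ x ∈ S, E x = rigid q x := fun x hx => plane_ext fun i => by
    have hp : ∀ j, pd j (cut ρ) x = 0 := fun j => pd_cut_eq_zero hρ j (hSρ x hx)
    fin_cases i <;> simp [E, streamMul, hp, cut_one hρ (hSρ x hx).le]
  refine ⟨E, cE, mE, solenoidalApprox_of_contDiff cE mE ?_ dE eE, dE, eE⟩
  refine memLp_of_coord fun p => (continuous_pd (cE.coord p.1) p.2).memLp_of_hasCompactSupport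
    (hasCompactSupport_pd' (hE.comp_left (g := fun v : Plane => v p.1) rfl) p.2)

/-- A local stream function of a field that vanishes on the body vanishes on the body. -/
theorem exists_stream_body {U : Plane → Plane} (hU : MemLp U 2) (hd : WeakDivFree U)
    (h0 : ∀ x ∈ S, U x = 0) (r : ℝ) : ∃ f, MemLp f 2 ∧ (∀ x ∈ S, f x = 0) ∧
      IsStream (ball 0 r) f U := by
  obtain ⟨p, hp⟩ := hS.interior_nonempty
  obtain ⟨δ', hδ', hball⟩ := Metric.isOpen_iff.1 isOpen_interior p hp
  obtain ⟨N, hN⟩ := hS.isBounded.subset_closedBall p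
  set δ := δ' / 2
  have hδ : 0 < δ := half_pos hδ'
  have h2 : 2 * δ = δ' := by simp only [δ]; ring
  set R := max δ (max (‖p‖ + r) (N + 1))
  obtain ⟨f, hf, hf0, hfs⟩ := exists_stream hU hd (p := p) hδ (le_max_left δ _ : δ ≤ R) fun x hx =>
    h0 x (interior_subset (hball (by rwa [h2] at hx)))
  have hSR : S ⊆ ball p R := fun x hx => by
    have h1 := mem_closedBall.1 (hN hx)
    have h3 : N + 1 ≤ R := (le_max_right _ _).trans (le_max_right _ _)
    exact mem_ball.2 (by linarith)
  have hz : ∀ ψ, IsTest (interior S) ψ → ∀ j, ∫ x, f x * pd j ψ x = 0 := fun ψ hψ j => by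
    have h3 := hfs ψ ⟨hψ.1, hψ.2.1, hψ.2.2.trans (interior_subset.trans hSR)⟩
    have h4 : ∀ i, ∫ x, U x i * ψ x = 0 := fun i => by
      refine integral_eq_zero_of_ae (ae_of_all _ fun x => ?_)
      by_cases hx : x ∈ S
      · simp [h0 x hx]
      · simp [image_eq_zero_of_notMem_tsupport fun h => hx (interior_subset (hψ.2.2 h))]
    rw [h4, h4, neg_zero] at h3
    fin_cases j
    exacts [h3.1, h3.2]
  have hφ : ∀ i : Fin 2, MemLp (fun x => (!₂[f x, 0] : Plane) i) 2 := fun i => by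
    fin_cases i
    · exact hf
    · exact MemLp.zero
  obtain ⟨q, hq⟩ := hS.exists_rigid (φ := fun x => !₂[f x, 0]) hφ fun ψ hψ i j => by
    have k : ∀ i j : Fin 2, Integrable (fun x => (!₂[f x, 0] : Plane) i * pd j ψ x) ∧
        ∫ x, (!₂[f x, 0] : Plane) i * pd j ψ x = 0 := fun i j => by
      refine ⟨memLp_one_iff_integrable.1 (MemLp.mul' (p := 2) (q := 2)
        (memLp_of_compactSupport (continuous_pd hψ.contDiff_one j)
          (hasCompactSupport_pd' hψ.2.1 j) 2) (hφ i)), ?_⟩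
      fin_cases i
      · exact hz ψ hψ j
      · simp
    rw [integral_add (k i j).1 (k j i).1, (k i j).2, (k j i).2, add_zero]
  have hq0 : q = 0 := by
    refine rigid_unique isOpen_ball ⟨p, mem_ball_self hδ⟩ ?_
    have hsub : ball p δ ⊆ S := (ball_subset_ball (by linarith)).trans (hball.trans interior_subset)
    filter_upwards [hf0, ae_restrict_of_ae_restrict_of_subset hsub hq] with x h3 h4
    rw [← h4, h3]
    refine plane_ext fun i => ?_
    fin_cases i <;> simp [rigid]
  have hfS : f =ᵐ[volume] Sᶜ.indicator f := by
    rw [hq0] at hq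
    filter_upwards [(ae_restrict_iff' hS.isClosed.measurableSet).1 hq] with x hx
    by_cases hxS : x ∈ S
    · have := congrArg (fun v : Plane => v 0) (hx hxS)
      rw [indicator_of_notMem (not_not.2 hxS)]
      simpa [rigid] using this
    · rw [indicator_of_mem (show x ∈ Sᶜ from hxS)]
  refine ⟨Sᶜ.indicator f, (memLp_congr_ae hfS).1 hf, fun x hx => indicator_of_notMem (not_not.2 hx) f,
    fun χ hχ => ?_⟩
  have hb : ball (0 : Plane) r ⊆ ball p R := by
    refine ball_subset_ball' ?_
    rw [dist_zero_left, add_comm]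
    exact (le_max_left _ _).trans (le_max_right _ _)
  have e : ∀ g : Plane → ℝ, ∫ x, Sᶜ.indicator f x * g x = ∫ x, f x * g x := fun g =>
    integral_congr_ae (by filter_upwards [hfS] with x hx; rw [← hx])
  rw [e, e]
  exact hfs χ ⟨hχ.1, hχ.2.1, hχ.2.2.trans hb⟩

theorem solenoidalApprox_of_zero {U : Plane → Plane} (hU : MemLp U 2) (hd : WeakDivFree U)
    (h0 : ∀ x ∈ S, U x = 0) : SolenoidalApprox S 0 U := by
  obtain ⟨N, hN⟩ := hS.isBounded.subset_closedBall (0 : Plane)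
  have hρ : 0 < max N 0 + 1 := by positivity
  set ρ := max N 0 + 1 with hρ_def
  have hSρ : ∀ x ∈ S, ‖x‖ ≤ ρ - 1 := fun x hx => by
    rw [hρ_def, add_sub_cancel_right]
    exact (mem_closedBall_zero_iff.1 (hN hx)).trans (le_max_left N 0)
  obtain ⟨f, hf, hf0, hfs⟩ := hS.exists_stream_body hU hd h0 (2 * ρ + 1)
  have lf := hf.locallyIntegrable (by norm_num)
  have lU := hU.locallyIntegrable (by norm_num)
  have ct : tsupport (cut ρ) ⊆ ball 0 (2 * ρ + 1) :=
    (tsupport_cut_subset hρ).trans (closedBall_subset_ball (by linarith))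
  obtain ⟨ι, _, C, η, hη, hsum⟩ := hS.exists_partition
  set η0 : Plane → ℝ := fun x => 1 - ∑ k, η k x
  let ζ : Option ι → Plane → ℝ := fun o => o.elim (fun x => η0 x * cut ρ x) fun k x => cut ρ x * η k x
  have tζ : ∀ o, IsTest (ball 0 (2 * ρ + 1)) (ζ o) := by
    rintro (_ | k)
    · exact IsTest.mul ⟨contDiff_cut ρ, hasCompactSupport_cut hρ, ct⟩
        (contDiff_const.sub (ContDiff.sum fun k _ => (hη k).1))
    · exact ⟨((hη k).mul (contDiff_cut ρ)).1, ((hη k).mul (contDiff_cut ρ)).2.1,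
        tsupport_mul_subset_left.trans ct⟩
  have tu : ∀ o, IsTest univ (ζ o) := fun o => ⟨(tζ o).1, (tζ o).2.1, subset_univ _⟩
  have piece : ∀ o, SolenoidalApprox S 0 (streamMul (ζ o) f U) := by
    intro o
    obtain ⟨K, hK, hs⟩ : ∃ K, IsMollifier K ∧ Sees S (tsupport (ζ o)) K := by
      rcases o with _ | k
      · refine exists_kernel_away (tζ none).2.1 (eq_empty_iff_forall_notMem.2 ?_)
        rintro x ⟨hx1, hx2⟩
        rw [tsupport, mem_closure_iff_nhds] at hx1
        obtain ⟨y, hy1, hy2⟩ := hx1 _ (hsum x hx2)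
        refine hy2 ?_
        have : ∑ k, η k y = 1 := hy1
        simp [ζ, η0, this]
      · exact (C k).exists_kernel_in (tζ (some k)).2.1 ((hη k).mul (contDiff_cut ρ)).2.2
    refine solenoidalApprox_of_mol (memLp_streamMul (tu o) hf hU)
      (weakDivFree_streamMul (tζ o) lf lU hfs hd) hK ?_
    filter_upwards [hs] with n hn x hx z hz
    rcases hn x hx with h | h
    · exact streamMul_eq_zero (Or.inl ⟨h0 _ (h z hz), hf0 _ (h z hz)⟩)
    · exact streamMul_eq_zero (Or.inr (h z hz))
  have hcut : IsTest (ball 0 (2 * ρ + 1)) (cut ρ) := ⟨contDiff_cut ρ, hasCompactSupport_cut hρ, ct⟩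
  have far : SolenoidalApprox S 0 fun x => U x + (-1 : ℝ) • streamMul (cut ρ) f U x := by
    have mc := memLp_streamMul (IsTest.cut hρ) hf hU
    obtain ⟨K, hK, hs⟩ := exists_isMollifier_small
    refine solenoidalApprox_of_mol (hU.add (mc.const_smul (-1 : ℝ))) (WeakDivFree.add hU mc hd
      (weakDivFree_streamMul hcut lf lU hfs hd) (-1)) hK (Eventually.of_forall fun n x hx z hz => ?_)
    have h1 : ‖z‖ < 1 := (hs n z hz).trans_le (by
      rw [div_le_one (by positivity)]; linarith [Nat.cast_nonneg (α := ℝ) n])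
    have h2 : ‖x - z‖ < ρ := (norm_sub_le _ _).trans_lt (by linarith [hSρ x hx])
    refine plane_ext fun i => ?_
    fin_cases i <;> simp [streamMul, pd_cut_eq_zero hρ _ h2, cut_one hρ h2.le]
  have hsumA : SolenoidalApprox S 0 (∑ o, streamMul (ζ o) f U) := by
    refine Finset.sum_induction _ (SolenoidalApprox S 0) (fun a b ha hb => ?_) ?_ fun o _ => piece o
    · simpa using ha.add hb
    · exact ⟨MemLp.zero, fun ε _ => ⟨0, contDiff_const, MemLp.zero, by
        rw [show gradMat 0 = 0 from funext fun x => by ext p; exact pd_const 0 p.2 x]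
        exact MemLp.zero, fun ψ _ => by simp, fun x _ => by simp [rigid], by simp⟩⟩
  have e : U = (∑ o, streamMul (ζ o) f U) + fun x => U x + (-1 : ℝ) • streamMul (cut ρ) f U x := by
    have hζs : ∀ x, ∑ o, ζ o x = cut ρ x := fun x => by
      rw [Fintype.sum_option]
      simp only [ζ, Option.elim, η0, ← Finset.mul_sum]
      ring
    have hζp : ∀ j x, ∑ o, pd j (ζ o) x = pd j (cut ρ) x := fun j x => by
      rw [← pd_sum fun o _ => (tu o).differentiableAt x]
      simp only [hζs]
    have es : ∀ x, ∑ o, streamMul (ζ o) f U x = streamMul (cut ρ) f U x := fun x => by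
      refine plane_ext fun i => ?_
      rw [WithLp.ofLp_sum, Finset.sum_apply]
      fin_cases i
      · simp only [streamMul]
        simp only [Fin.zero_eta, Matrix.cons_val_zero]
        rw [Finset.sum_sub_distrib, ← Finset.sum_mul, ← Finset.mul_sum, hζs, hζp]
      · simp only [streamMul]
        simp only [Fin.mk_one, Matrix.cons_val_one, Matrix.cons_val_fin_one]
        rw [Finset.sum_add_distrib, ← Finset.sum_mul, ← Finset.mul_sum, hζs, hζp]
    ext1 x
    rw [Pi.add_apply, Finset.sum_apply, es]
    module
  rw [e]
  simpa using hsumA.add far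

/-- The space `𝓥_` is dense in `𝓗`. -/
theorem exists_approx_spaceVu (φ : spaceH S) {ε : ℝ≥0∞} (hε : ε ≠ 0) :
    ∃ ψ : spaceVu S, field ψ =ᵐ[volume.restrict S] rigid (rigidData S (field φ)) ∧
      eLpNorm (fun x => field ψ x - field φ x) 2 ≤ ε := by
  set q := rigidData S (field φ)
  obtain ⟨E, cE, mE, aE, dE, eE⟩ := hS.exists_extension q
  have mφ : MemLp (field φ) 2 := Lp.memLp (φ : L2Plane)
  set U := Sᶜ.indicator fun x => field φ x + (-1 : ℝ) • E x
  have hUe : (fun x => field φ x + (-1 : ℝ) • E x) =ᵐ[volume] U := by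
    filter_upwards [(ae_restrict_iff' hS.isClosed.measurableSet).1 (hS.field_ae_rigid le_rfl φ)]
      with x hx
    by_cases hxS : x ∈ S
    · simp only [U]
      rw [indicator_of_notMem (not_not.2 hxS), eE x hxS, hx hxS]
      simp [q]
    · simp only [U]
      rw [indicator_of_mem (show x ∈ Sᶜ from hxS)]
  have mU : MemLp U 2 := (memLp_congr_ae hUe).1 (mφ.add (mE.const_smul (-1 : ℝ)))
  have dU : WeakDivFree U := fun ψ hψ => by
    rw [← WeakDivFree.add mφ mE φ.2.1 dE (-1) ψ hψ]
    refine integral_congr_ae ?_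
    filter_upwards [hUe] with x hx
    rw [← hx]
  have h := aE.add (hS.solenoidalApprox_of_zero mU dU fun x hx => indicator_of_notMem (not_not.2 hx) _)
  rw [add_zero] at h
  obtain ⟨w, a1, a2, a3, a4, a5, a6⟩ := h.2 ε hε
  have ew : (a2.toLp w : Plane → Plane) =ᵐ[volume] w := a2.coeFn_toLp
  have r := fun i => (contDiff_rigid q (n := 1)).coord i
  have hmem : a2.toLp w ∈ spaceVu S := by
    refine ⟨⟨fun ψ hψ => ?_, fun ψ hψ i j => ?_⟩, gradMat w, (isWeakGrad_gradMat hS.isOpen_compl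
      a1).congr hS.isOpen_compl (ae_restrict_of_ae ew.symm), a3.restrict _⟩
    · rw [← a4 ψ hψ]
      refine integral_congr_ae ?_
      filter_upwards [ew] with x hx
      rw [hx]
    · have i1 : ∀ i j : Fin 2, Integrable fun x => rigid q x i * pd j ψ x := fun i j =>
        ((r i).continuous.mul (continuous_pd hψ.contDiff_one j)).integrable_of_hasCompactSupport
          (hasCompactSupport_pd' hψ.2.1 j).mul_left
      have i2 : ∀ i j : Fin 2, Integrable fun x => pd j (fun y => rigid q y i) x * ψ x := fun i j =>
        ((continuous_pd (r i) j).mul hψ.1.continuous).integrable_of_hasCompactSupport hψ.2.1.mul_left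
      have e : ∫ x, ((a2.toLp w : Plane → Plane) x i * pd j ψ x +
          (a2.toLp w : Plane → Plane) x j * pd i ψ x) =
          ∫ x, (rigid q x i * pd j ψ x + rigid q x j * pd i ψ x) := by
        refine integral_congr_ae ?_
        filter_upwards [ew] with x hx
        by_cases hxS : x ∈ tsupport ψ
        · rw [hx, a5 x (interior_subset (hψ.2.2 hxS))]
        · have hp : ∀ j, pd j ψ x = 0 := fun j =>
            image_eq_zero_of_notMem_tsupport fun h' => hxS (tsupport_pd_subset ψ j h')
          simp [hp]
      rw [e, integral_add (i1 i j) (i1 j i), integral_mul_pd (r i) hψ.contDiff_one hψ.2.1,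
        integral_mul_pd (r j) hψ.contDiff_one hψ.2.1, ← neg_add, ← integral_add (i2 i j) (i2 j i),
        neg_eq_zero]
      refine integral_eq_zero_of_ae (ae_of_all _ fun x => ?_)
      simp only [Pi.zero_apply]
      rw [← add_mul]
      refine mul_eq_zero_of_left ?_ _
      fin_cases i <;> fin_cases j <;> simp [(pd_rigid q _ x).1, (pd_rigid q _ x).2]
  refine ⟨⟨a2.toLp w, hmem⟩, ?_, ?_⟩
  · filter_upwards [ae_restrict_of_ae ew, ae_restrict_mem hS.isClosed.measurableSet] with x h1 h2
    exact h1.trans (a5 x h2)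
  · refine le_trans (le_of_eq (eLpNorm_congr_ae ?_)) a6
    filter_upwards [ew, hUe] with x h1 h2
    simp only [Pi.add_apply, ← h2]
    change (a2.toLp w : Plane → Plane) x - field φ x = _
    rw [h1]
    module

end IsSmoothBody

/-! ### The extension of `b` by density -/

theorem LipschitzWith.hasWeakPd {K : ℝ≥0} {g : Plane → ℝ} (hg : LipschitzWith K g) (O : Set Plane)
    (j : Fin 2) : HasWeakPd O j g fun x => lineDeriv ℝ g x (EuclideanSpace.single j 1) := by
  refine ⟨hg.continuous.locallyIntegrable.locallyIntegrableOn O,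
    (hg.locallyIntegrable_lineDeriv _).locallyIntegrableOn O, fun ψ hψ => ?_⟩
  obtain ⟨L, hL⟩ := hψ.contDiff_one.lipschitzWith_of_hasCompactSupport hψ.2.1 one_ne_zero
  rw [setIntegral_eq_integral_of_forall_compl_eq_zero, setIntegral_eq_integral_of_forall_compl_eq_zero,
    hg.integral_lineDeriv_mul_eq hL hψ.2.1, ← integral_neg]
  · congr 1
    ext x
    rw [((hψ.contDiff_one.differentiable one_ne_zero) x).lineDeriv_eq_fderiv, map_neg, pd]
    ring
  · intro x hx
    rw [image_eq_zero_of_notMem_tsupport fun h => hx (hψ.2.2 h), mul_zero]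
  · intro x hx
    rw [image_eq_zero_of_notMem_tsupport fun h => hx ((hψ.integrable_pd j).2.2 h), mul_zero]

theorem LipBound.norm_weakGrad_le {S : Set Plane} (hS : IsClosed S) {w : Plane → Plane}
    {Γ : Plane → Mat2} (hΓ : IsWeakGrad Sᶜ w Γ) {A K : ℝ} (h : LipBound S w A K) :
    ∀ᵐ x ∂(volume.restrict Sᶜ), ‖Γ x‖ ≤ 2 * K := by
  obtain ⟨-, hK, f, h1, -, h3⟩ := h
  have hO := hS.isOpen_compl
  have key : ∀ p : Fin 2 × Fin 2, ∀ᵐ x ∂(volume.restrict Sᶜ), |Γ x p| ≤ K := fun p => by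
    have hl : LipschitzOnWith ⟨K, hK⟩ (fun x => f x p.1) Sᶜ :=
      LipschitzOnWith.of_dist_le_mul fun x hx y hy => by
        rw [dist_eq_norm, dist_eq_norm]
        exact (PiLp.norm_apply_le (f x - f y) p.1).trans
          (h3 x (subset_closure hx) y (subset_closure hy))
    obtain ⟨g, hg, hfg⟩ := hl.extend_real
    have e : g =ᵐ[volume.restrict Sᶜ] fun x => w x p.1 := by
      filter_upwards [h1, ae_restrict_mem hO.measurableSet] with x a1 a2
      rw [← a1]; exact (hfg a2).symm
    filter_upwards [((isWeakGrad_iff hO).1 hΓ p.1 p.2).unique hO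
      ((hg.hasWeakPd Sᶜ p.2).congr hO e (ae_eq_refl _))] with x hx
    rw [hx]
    have := norm_lineDeriv_le_of_lipschitz ℝ hg (x₀ := x) (v := EuclideanSpace.single p.2 1)
    rw [PiLp.norm_single, norm_one, mul_one] at this
    exact this
  filter_upwards [ae_all_iff.2 key] with x hx using norm_mat_le fun i j => hx (i, j)

theorem spaceVhat_le {S : Set Plane} : spaceVhat S ≤ spaceV S := inf_le_left

section Extension

variable {S : Set Plane} {H : Plane → Plane} (hS : IsSmoothBody S) (D : CircData S H) {m J : ℝ}
  (hm : 0 < m) (hJ : 0 < J)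
include hS hm hJ

include D in
theorem exists_bound_H_H_Vhat : ∃ C : ℝ, 0 < C ∧ ∀ (u : spaceH S) (a : ℝ) (v : spaceH S)
    (w : spaceVhat S) (b : ℝ),
    IntegrableOn (bIntegrand S (withH H u a) (field v) (withH H w b)) Sᶜ ∧
    |bForm S m (withH H u a) (field v) (withH H w b)| ≤ C * (normH S m J (field u) + |a|) *
      normH S m J (field v) * (normVhat S m J (field w) + |b|) := by
  obtain ⟨K, hK, h⟩ := exists_bound_of_l1Le hS D hm hJ
  refine ⟨2 + K, by positivity, fun u a v w b => ?_⟩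
  set X := normH S m J (field u) + |a|
  set Y := normH S m J (field v)
  set N := normV S m J (field w)
  have hN : 0 ≤ N := (normH_nonneg _).trans (normH_le_normV _)
  have hY : 0 ≤ Y := normH_nonneg _
  have hu : normH S m J (field u) ≤ X := le_add_of_nonneg_right (abs_nonneg a)
  have hX : 0 ≤ X := (normH_nonneg _).trans hu
  obtain ⟨g1, g2, g3⟩ := spaceV_spec (m := m) (J := J) hS _ (spaceVhat_le w.2)
  obtain ⟨m1, n1⟩ := memLp_of_weight g2
  have key : ∀ A L, LipBound S (field w) A L →
      IntegrableOn (bIntegrand S (withH H u a) (field v) (withH H w b)) Sᶜ ∧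
      |bForm S m (withH H u a) (field v) (withH H w b)| ≤
        (2 + K) * (X * Y * (N + (A + L) + |b|)) := fun A L hL => by
    have hA := hL.1
    have hL0 := hL.2.1
    have t := L1Le.mul (memLp_field u Sᶜ).norm (memLp_field v Sᶜ).norm (A := X) (B := Y)
      (by rw [lpNorm_norm (memLp_field u Sᶜ).1]
          exact (lpNorm_le_normH hm hJ (memLp_field u _)).trans hu)
      (by rw [lpNorm_norm (memLp_field v Sᶜ).1]; exact lpNorm_le_normH hm hJ (memLp_field v _))
    have t2 := t.const_mul (c := 2 * L) (by positivity) le_rfl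
    have hZ : N ≤ N + (A + L) + |b| := by linarith [abs_nonneg b]
    refine h le_rfl (spaceVhat_le.trans (spaceV_le_spaceVu hS)) u a v w b le_rfl le_rfl
      (add_le_add ((normH_le_normV _).trans (le_add_of_nonneg_right (by positivity))) le_rfl)
      ((n1.trans g3).trans hZ) (t2.mono ?_ ?_ ?_)
      (memLp_angular_weight hS ⟨w, spaceVhat_le w.2⟩ _ hZ)
    · exact (((memLp_field u Sᶜ).1.norm.mul (memLp_field v Sᶜ).1.norm)).mul m1.1.norm
    · filter_upwards [hL.norm_weakGrad_le hS.isClosed g1] with x hx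
      rw [abs_of_nonneg (by positivity), mul_comm (2 * L)]
      exact mul_le_mul_of_nonneg_left hx (by positivity)
    · have h1 : 0 ≤ X * Y := by positivity
      have := abs_nonneg b
      nlinarith
  obtain ⟨A, L, hL⟩ := w.2.2
  refine ⟨(key A L hL).1, ?_⟩
  have hp : 0 ≤ (2 + K) * (X * Y) := by positivity
  refine le_of_forall_pos_le_add fun ε hε => ?_
  obtain ⟨M, ⟨A', L', hL', rfl⟩, hM⟩ := exists_lt_of_csInf_lt (s := {M | ∃ A K, LipBound S (field w) A K ∧ M = A + K})
    ⟨_, A, L, hL, rfl⟩ (lt_add_of_pos_right (normLip S (field w)) (div_pos hε (by positivity :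
      0 < (2 + K) * (X * Y) + 1)))
  refine (key A' L' hL').2.trans ?_
  set δ := ε / ((2 + K) * (X * Y) + 1)
  have hδ : (2 + K) * (X * Y) * δ ≤ ε := by
    have e : ((2 + K) * (X * Y) + 1) * δ = ε := mul_div_cancel₀ _ (by positivity)
    have : 0 ≤ δ := by positivity
    linarith
  have := mul_le_mul_of_nonneg_left hM.le hp
  rw [normVhat]
  linarith

omit hm hJ in
/-- A continuous linear functional on `𝓗` is determined by its values on `𝓥_`. -/
theorem linear_eq_of_spaceVu (L₁ L₂ : spaceH S →ₗ[ℝ] ℝ) {C₁ C₂ : ℝ}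
    (hC₁ : ∀ v, |L₁ v| ≤ C₁ * normH S m J (field v))
    (hC₂ : ∀ v, |L₂ v| ≤ C₂ * normH S m J (field v))
    (h : ∀ v : spaceH S, (v : L2Plane) ∈ spaceVu S → L₁ v = L₂ v) (v : spaceH S) :
    L₁ v = L₂ v := by
  set L := L₁ - L₂
  set C := C₁ + C₂
  have h0 : ∀ v : spaceH S, (v : L2Plane) ∈ spaceVu S → L v = 0 := fun v hv => sub_eq_zero.2 (h v hv)
  have hC : ∀ v, |L v| ≤ C * normH S m J (field v) := fun v =>
    (abs_sub _ _).trans ((add_le_add (hC₁ v) (hC₂ v)).trans (le_of_eq (add_mul _ _ _).symm))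
  refine sub_eq_zero.1 (show L v = 0 from ?_)
  have key : ∀ ε : ℝ, 0 < ε → |L v| ≤ |C| * ε := fun ε hε => by
    obtain ⟨ψ, h1, h2⟩ := hS.exists_approx_spaceVu v (ENNReal.ofReal_pos.2 hε).ne'
    set ψ' : spaceH S := ⟨ψ, spaceVu_le ψ.2⟩
    have e : L v = - L (ψ' - v) := by rw [map_sub, h0 ψ' ψ.2]; ring
    have ed : field (ψ' - v) =ᵐ[volume] fun x => field ψ x - field v x :=
      Lp.coeFn_sub (ψ : L2Plane) v
    have hq : rigidData S (field (ψ' - v)) = 0 := by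
      refine hS.rigidData_eq ?_
      filter_upwards [ae_restrict_of_ae (s := S) ed, h1, hS.field_ae_rigid le_rfl v] with x a1 a2 a3
      rw [a1, a2, a3]; simp [rigid]
    have hn : normH S m J (field (ψ' - v)) ≤ ε := by
      have e1 : normH S m J (field (ψ' - v)) = lpNorm (field (ψ' - v)) 2 (volume.restrict Sᶜ) := by
        rw [lpNorm_two_eq (memLp_field _ _), normH, linVel, angVel, hq]
        simp
      rw [e1, ← toReal_eLpNorm (memLp_field _ _).1]
      refine ENNReal.toReal_le_of_le_ofReal hε.le (le_trans ?_ h2)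
      rw [eLpNorm_congr_ae (ae_restrict_of_ae ed)]
      exact eLpNorm_mono_measure _ Measure.restrict_le_self
    rw [e, abs_neg]
    refine (hC _).trans ((mul_le_mul_of_nonneg_right (le_abs_self C) (normH_nonneg _)).trans ?_)
    exact mul_le_mul_of_nonneg_left hn (abs_nonneg C)
  refine abs_eq_zero.1 (le_antisymm (le_of_forall_pos_le_add fun ε hε => ?_) (abs_nonneg _))
  refine (key (ε / (|C| + 1)) (by positivity)).trans ?_
  rw [zero_add, mul_div_assoc', div_le_iff₀ (by positivity)]
  nlinarith [abs_nonneg C]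

include D in
/-- The extension of `b` to `(𝓗 ⊕ ℝH) × 𝓗 × (𝓥^ ⊕ ℝH)`. -/
theorem existsUnique_extension :
    ∃! B : (spaceH S × ℝ) →ₗ[ℝ] spaceH S →ₗ[ℝ] (spaceVhat S × ℝ) →ₗ[ℝ] ℝ,
      (∀ (u : spaceH S) (β₁ : ℝ) (v : spaceH S) (w : spaceVhat S) (β₃ : ℝ),
        (u : L2Plane) ∈ spaceVu S → (v : L2Plane) ∈ spaceVu S →
          B (u, β₁) v (w, β₃) = bForm S m (withH H u β₁) (field v) (withH H w β₃)) ∧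
      ∃ C : ℝ, 0 < C ∧ ∀ (u : spaceH S) (β₁ : ℝ) (v : spaceH S) (w : spaceVhat S) (β₃ : ℝ),
        |B (u, β₁) v (w, β₃)| ≤ C * (normH S m J (field u) + |β₁|) * normH S m J (field v)
          * (normVhat S m J (field w) + |β₃|) := by
  obtain ⟨C, hC, h⟩ := exists_bound_H_H_Vhat hS D hm hJ
  have hle : spaceVhat S ≤ spaceH S := spaceVhat_le.trans spaceV_le
  have wg := fun r : spaceVhat S × ℝ =>
    D.isWeakGrad_withH hS (spaceV_spec (m := m) (J := J) hS _ (spaceVhat_le r.1.2)).1 r.2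
  refine ⟨trilinOfComb
    (fun p v r => bForm S m (withH H p.1 p.2) (field v) (withH H r.1 r.2)) ?_ ?_ ?_,
    ⟨fun _ _ _ _ _ _ _ => rfl, C, hC, fun u a v w b => (h u a v w b).2⟩, ?_⟩
  · intro c p p' v r
    exact hS.bForm_comb_left (D.withH_ae_rigid hS le_rfl p.1 p.2)
      (D.withH_ae_rigid hS le_rfl p'.1 p'.2) (withH_comb H p.1 p'.1 p.2 p'.2 c)
      (h _ _ _ _ _).1 (h _ _ _ _ _).1
  · intro c p v v' r
    exact hS.bForm_comb_mid (hS.field_ae_rigid le_rfl v) (hS.field_ae_rigid le_rfl v')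
      (field_comb v v' c) (h _ _ _ _ _).1 (h _ _ _ _ _).1
  · intro c p v r r'
    exact hS.bForm_comb_right (D.withH_ae_rigid hS hle r.1 r.2) (D.withH_ae_rigid hS hle r'.1 r'.2)
      (wg r) (wg r') (withH_comb H r.1 r'.1 r.2 r'.2 c) (h _ _ _ _ _).1 (h _ _ _ _ _).1
  · rintro B ⟨hB, C', -, hB'⟩
    set B₀ := trilinOfComb (fun (p : spaceH S × ℝ) (v : spaceH S) (r : spaceVhat S × ℝ) =>
      bForm S m (withH H p.1 p.2) (field v) (withH H r.1 r.2)) _ _ _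
    have hB₀ : ∀ u a v w b, |B₀ (u, a) v (w, b)| ≤ C * (normH S m J (field u) + |a|) *
      normH S m J (field v) * (normVhat S m J (field w) + |b|) := fun u a v w b => (h u a v w b).2
    have h1 : ∀ u : spaceH S, (u : L2Plane) ∈ spaceVu S → ∀ a v r, B (u, a) v r = B₀ (u, a) v r :=
      fun u hu a v r => by
      refine linear_eq_of_spaceVu (m := m) (J := J) hS ((LinearMap.applyₗ r).comp (B (u, a)))
        ((LinearMap.applyₗ r).comp (B₀ (u, a))) (C₁ := C' * (normH S m J (field u) + |a|) *
          (normVhat S m J (field r.1) + |r.2|)) (C₂ := C * (normH S m J (field u) + |a|) *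
          (normVhat S m J (field r.1) + |r.2|)) (fun v => ?_) (fun v => ?_)
        (fun v hv => hB u a v r.1 r.2 hu hv) v
      · exact (hB' u a v r.1 r.2).trans (le_of_eq (by ring))
      · exact (hB₀ u a v r.1 r.2).trans (le_of_eq (by ring))
    refine LinearMap.ext fun p => LinearMap.ext fun v => LinearMap.ext fun r => ?_
    have e : p = LinearMap.inl ℝ _ _ p.1 + (0, p.2) := by ext <;> simp
    have h2 : B (LinearMap.inl ℝ _ _ p.1) v r = B₀ (LinearMap.inl ℝ _ _ p.1) v r := by
      refine linear_eq_of_spaceVu (m := m) (J := J) hS ((LinearMap.applyₗ r).comp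
        ((LinearMap.applyₗ v).comp (B.comp (LinearMap.inl ℝ _ _)))) ((LinearMap.applyₗ r).comp
        ((LinearMap.applyₗ v).comp (B₀.comp (LinearMap.inl ℝ _ _)))) (C₁ := C' *
        normH S m J (field v) * (normVhat S m J (field r.1) + |r.2|)) (C₂ := C *
        normH S m J (field v) * (normVhat S m J (field r.1) + |r.2|)) (fun u => ?_) (fun u => ?_)
        (fun u hu => h1 u hu 0 v r) p.1
      · refine (hB' u 0 v r.1 r.2).trans (le_of_eq ?_)
        rw [abs_zero]; ring
      · refine (hB₀ u 0 v r.1 r.2).trans (le_of_eq ?_)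
        rw [abs_zero]; ring
    rw [e, map_add, map_add, LinearMap.add_apply, LinearMap.add_apply, LinearMap.add_apply,
      LinearMap.add_apply, h2, h1 0 (Submodule.zero_mem _) p.2 v r]

end Extension

/-! ### Traces -/

theorem classicalGrad_eq {φ : Plane → Plane} (hφ : ContDiff ℝ 1 φ) :
    classicalGrad φ = gradMat φ := by
  ext x p
  have := ((EuclideanSpace.proj (𝕜 := ℝ) p.1).hasFDerivAt.comp x
    (hφ.differentiable one_ne_zero x).hasFDerivAt).fderiv
  simp only [classicalGrad, gradMat, pd]
  exact (DFunLike.congr_fun this _).symm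

theorem gradMat_comb {φ ψ : Plane → Plane} (hφ : ContDiff ℝ 1 φ) (hψ : ContDiff ℝ 1 ψ) (c : ℝ)
    (x : Plane) : gradMat (fun y => c • φ y + ψ y) x = c • gradMat φ x + gradMat ψ x := by
  rw [← classicalGrad_eq ((hφ.const_smul c).add hψ), ← classicalGrad_eq hφ, ← classicalGrad_eq hψ]
  ext p
  have d1 := hφ.differentiable one_ne_zero x
  have d2 := hψ.differentiable one_ne_zero x
  have e : fderiv ℝ (fun y => c • φ y + ψ y) x = c • fderiv ℝ φ x + fderiv ℝ ψ x :=
    ((d1.hasFDerivAt.const_smul c).add d2.hasFDerivAt).fderiv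
  simp [classicalGrad, e]

theorem tendsto_eLpNorm_comb {α E : Type*} [MeasurableSpace α] {μ : Measure α}
    [NormedAddCommGroup E] [NormedSpace ℝ E] {f g F : ℕ → α → E}
    (hf : ∀ n, AEStronglyMeasurable (f n) μ) (hg : ∀ n, AEStronglyMeasurable (g n) μ)
    (tf : Tendsto (fun n => eLpNorm (f n) 2 μ) atTop (𝓝 0))
    (tg : Tendsto (fun n => eLpNorm (g n) 2 μ) atTop (𝓝 0)) (c : ℝ)
    (e : ∀ n, F n =ᵐ[μ] c • f n + g n) : Tendsto (fun n => eLpNorm (F n) 2 μ) atTop (𝓝 0) := by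
  have t := (ENNReal.Tendsto.const_mul tf (Or.inr (enorm_ne_top (x := c)))).add tg
  rw [mul_zero, add_zero] at t
  refine tendsto_of_tendsto_of_tendsto_of_le_of_le tendsto_const_nhds t (fun _ => zero_le) fun n => ?_
  rw [eLpNorm_congr_ae (e n)]
  refine (eLpNorm_add_le ((hf n).const_smul c) (hg n) (by norm_num)).trans ?_
  rw [eLpNorm_const_smul]

theorem IsTrace.comb {S : Set Plane} (hS : IsClosed S) {u v w g h : Plane → Plane}
    (hu : IsTrace S u g) (hv : IsTrace S v h) (c : ℝ)
    (hw : w =ᵐ[volume] fun x => c • u x + v x) : IsTrace S w (c • g + h) := by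
  obtain ⟨mg, ⟨U, hU⟩, φ, cφ, a1, a2, a3⟩ := hu
  obtain ⟨mh, ⟨V, hV⟩, ψ, cψ, b1, b2, b3⟩ := hv
  have hW := hU.comb hV c hw
  have sub := fun R : ℝ => Measure.restrict_mono_set (volume : Measure Plane)
    (inter_subset_left : Sᶜ ∩ ball 0 R ⊆ Sᶜ)
  have mc : ∀ {φ : ℕ → Plane → Plane}, (∀ n, ContDiff ℝ 1 (φ n)) → ∀ n,
      Continuous (classicalGrad (φ n)) := fun hφ n => by
    rw [classicalGrad_eq (hφ n)]; exact continuous_gradMat (hφ n)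
  refine ⟨(mg.const_smul c).add mh, ⟨_, hW⟩, fun n x => c • φ n x + ψ n x,
    fun n => ((cφ n).const_smul c).add (cψ n), fun R => ?_, fun R => ?_, ?_⟩
  · refine tendsto_eLpNorm_comb (fun n => (cφ n).continuous.aestronglyMeasurable.sub
      (hU.1.aestronglyMeasurable.mono_measure (sub R))) (fun n =>
      (cψ n).continuous.aestronglyMeasurable.sub (hV.1.aestronglyMeasurable.mono_measure (sub R)))
      (a1 R) (b1 R) c fun n => ?_
    filter_upwards [ae_restrict_of_ae hw] with x hx
    simp only [hx, Pi.add_apply, Pi.smul_apply, Pi.sub_apply]; module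
  · refine tendsto_eLpNorm_comb (fun n => (mc cφ n).aestronglyMeasurable.sub
      (hU.weakGrad_spec.2.1.aestronglyMeasurable.mono_measure (sub R))) (fun n =>
      (mc cψ n).aestronglyMeasurable.sub
      (hV.weakGrad_spec.2.1.aestronglyMeasurable.mono_measure (sub R))) (a2 R) (b2 R) c fun n => ?_
    filter_upwards [(ae_mono (sub R)) ((hU.weakGrad_spec.comb hV.weakGrad_spec c hw).weakGrad_ae
      hS.isOpen_compl)] with x hx
    simp only [hx, Pi.add_apply, Pi.smul_apply, Pi.sub_apply]
    rw [classicalGrad_eq ((cφ n).const_smul c |>.add (cψ n)), gradMat_comb (cφ n) (cψ n),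
      classicalGrad_eq (cφ n), classicalGrad_eq (cψ n)]
    module
  · refine tendsto_eLpNorm_comb (fun n => (cφ n).continuous.aestronglyMeasurable.sub mg.1)
      (fun n => (cψ n).continuous.aestronglyMeasurable.sub mh.1) a3 b3 c fun n => ?_
    refine ae_of_all _ fun x => ?_
    simp only [Pi.add_apply, Pi.smul_apply, Pi.sub_apply]; module

theorem IsTrace.bdryTrace_spec {S : Set Plane} {u g : Plane → Plane} (h : IsTrace S u g) :
    IsTrace S u (bdryTrace S u) := by
  have hex : ∃ g, IsTrace S u g := ⟨g, h⟩
  rw [bdryTrace, dif_pos hex]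
  exact hex.choose_spec

namespace IsSmoothBody

variable {S : Set Plane} (hS : IsSmoothBody S)
include hS

theorem exists_trace_inequality_field : ∃ (A : ℝ≥0) (R : ℝ), ∀ φ, ContDiff ℝ 1 φ →
    eLpNorm φ 2 (arcLength S) ≤ A * (eLpNorm φ 2 (volume.restrict (Sᶜ ∩ ball 0 R)) +
      eLpNorm (gradMat φ) 2 (volume.restrict (Sᶜ ∩ ball 0 R))) := by
  obtain ⟨A, R, h⟩ := hS.exists_trace_inequality
  refine ⟨4 * A, R, fun φ hφ => ?_⟩
  set a := eLpNorm φ 2 (volume.restrict (Sᶜ ∩ ball 0 R))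
  set b := eLpNorm (gradMat φ) 2 (volume.restrict (Sᶜ ∩ ball 0 R))
  refine (eLpNorm_le_sum_coord hφ.continuous.aestronglyMeasurable (by norm_num)).trans ?_
  have k : ∀ i, eLpNorm (fun x => φ x i) 2 (arcLength S) ≤ A * (a + (b + b)) := fun i => by
    refine (h _ (hφ.coord i)).trans ?_
    rw [h1n, Fin.sum_univ_two]
    gcongr
    · exact eLpNorm_mono fun x => PiLp.norm_apply_le (φ x) i
    · exact eLpNorm_mono fun x => PiLp.norm_apply_le (gradMat φ x) (i, 0)
    · exact eLpNorm_mono fun x => PiLp.norm_apply_le (gradMat φ x) (i, 1)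
  rw [Fin.sum_univ_two]
  refine (add_le_add (k 0) (k 1)).trans ?_
  calc _ = A * (2 * a + 4 * b) := by ring
    _ ≤ A * (4 * a + 4 * b) := by gcongr; norm_num
    _ = _ := by push_cast; ring

theorem memLp_arcLength {φ : Plane → Plane} (hφ : ContDiff ℝ 1 φ) : MemLp φ 2 (arcLength S) := by
  obtain ⟨A, R, h⟩ := hS.exists_trace_inequality_field
  exact ⟨hφ.continuous.aestronglyMeasurable, (h φ hφ).trans_lt (ENNReal.mul_lt_top (by simp)
    (ENNReal.add_lt_top.2 ⟨(hφ.continuous.memLp_inter_ball _ _ _).2,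
      ((continuous_gradMat hφ).memLp_inter_ball _ _ _).2⟩))⟩

theorem exists_trace_bound : ∃ A : ℝ≥0, ∀ u g, IsTrace S u g → eLpNorm g 2 (arcLength S) ≤
    A * (eLpNorm u 2 (volume.restrict Sᶜ) + eLpNorm (weakGrad Sᶜ u) 2 (volume.restrict Sᶜ)) := by
  obtain ⟨A, R, h⟩ := hS.exists_trace_inequality_field
  refine ⟨A, ?_⟩
  rintro u g ⟨mg, ⟨U, hU⟩, φ, cφ, a1, a2, a3⟩
  have sub := Measure.restrict_mono_set (volume : Measure Plane)
    (inter_subset_left : Sᶜ ∩ ball 0 R ⊆ Sᶜ)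
  have mu := hU.1.aestronglyMeasurable.mono_measure sub
  have mU := hU.weakGrad_spec.2.1.aestronglyMeasurable.mono_measure sub
  have t := a3.add (ENNReal.Tendsto.const_mul (a := A) (((a1 R).add_const
    (eLpNorm u 2 (volume.restrict Sᶜ))).add ((a2 R).add_const
      (eLpNorm (weakGrad Sᶜ u) 2 (volume.restrict Sᶜ)))) (Or.inr ENNReal.coe_ne_top))
  simp only [zero_add] at t
  have tri : ∀ {E : Type} [NormedAddCommGroup E] {f f' : Plane → E} {μ ν : Measure Plane}, μ ≤ ν →
      AEStronglyMeasurable f μ → AEStronglyMeasurable f' μ →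
      eLpNorm f 2 μ ≤ eLpNorm (fun x => f x - f' x) 2 μ + eLpNorm f' 2 ν :=
    fun {E} _ {f f' μ ν} hμ hf hf' => by
    have e : f = (fun x => f x - f' x) + f' := by ext1 x; simp
    conv_lhs => rw [e]
    exact (eLpNorm_add_le (hf.sub hf') hf' (by norm_num)).trans
      (add_le_add le_rfl (eLpNorm_mono_measure _ hμ))
  refine ge_of_tendsto' t fun n => ?_
  have cg := continuous_gradMat (cφ n)
  have h1 := tri (le_refl (arcLength S)) mg.1 (cφ n).continuous.aestronglyMeasurable
  rw [show eLpNorm (fun x => g x - φ n x) 2 (arcLength S) = eLpNorm (fun x => φ n x - g x) 2 _ from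
    eLpNorm_sub_comm g (φ n) 2 _] at h1
  refine h1.trans (add_le_add le_rfl ((h _ (cφ n)).trans ?_))
  rw [classicalGrad_eq (cφ n)]
  gcongr
  · exact tri sub (cφ n).continuous.aestronglyMeasurable mu
  · exact tri sub cg.aestronglyMeasurable mU

theorem bdryTrace_ae {u g : Plane → Plane} (h : IsTrace S u g) :
    bdryTrace S u =ᵐ[arcLength S] g := by
  obtain ⟨A, hA⟩ := hS.exists_trace_bound
  have z : (fun _ => (0 : Plane)) =ᵐ[volume] fun x => (-1 : ℝ) • u x + u x :=
    ae_of_all _ fun x => by simp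
  have h1 := hA _ _ (h.comb hS.isClosed h.bdryTrace_spec (-1) z)
  have e : weakGrad Sᶜ (fun _ => (0 : Plane)) =ᵐ[volume.restrict Sᶜ] 0 :=
    ((isWeakGrad_zero Sᶜ).congr hS.isOpen_compl (ae_restrict_of_ae coe_zero_ae)).weakGrad_ae
      hS.isOpen_compl
  rw [eLpNorm_congr_ae e, eLpNorm_zero, eLpNorm_zero', add_zero, mul_zero, nonpos_iff_eq_zero,
    eLpNorm_eq_zero_iff ((h.1.const_smul (-1 : ℝ)).add h.bdryTrace_spec.1).1 (by norm_num)] at h1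
  filter_upwards [h1] with x hx
  simpa [neg_add_eq_zero, eq_comm] using hx

theorem exists_trace (φ : spaceVu S) : ∃ g, IsTrace S (field φ) g := by
  choose f hf t using fun i => hS.exists_seq_approx (spaceVu_isH1 hS φ.2 i)
  obtain ⟨w1, w2, -⟩ := spaceVu_spec (m := 1) (J := 1) hS _ φ.2
  set Φ : ℕ → Plane → Plane := fun n x => WithLp.toLp 2 fun i => f i n x
  have cΦ : ∀ n, ContDiff ℝ 1 (Φ n) := fun n => contDiff_euclidean.2 fun i => (hf i n).contDiff_one
  have t1 : Tendsto (fun n => eLpNorm (fun x => Φ n x - field φ x) 2 (volume.restrict Sᶜ)) atTop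
      (𝓝 0) := by
    have := tendsto_finsetSum Finset.univ fun i _ => t i
    rw [Finset.sum_const_zero] at this
    refine tendsto_of_tendsto_of_tendsto_of_le_of_le tendsto_const_nhds this (fun _ => zero_le)
      fun n => (eLpNorm_le_sum_coord ((cΦ n).continuous.aestronglyMeasurable.sub
        (memLp_field φ Sᶜ).1) (by norm_num)).trans (Finset.sum_le_sum fun i _ => ?_)
    exact eLpNorm_le_h1n _ _ _
  have t2 : Tendsto (fun n => eLpNorm (fun x => gradMat (Φ n) x - weakGrad Sᶜ (field φ) x) 2
      (volume.restrict Sᶜ)) atTop (𝓝 0) := by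
    have := tendsto_finsetSum Finset.univ fun (p : Fin 2 × Fin 2) _ => t p.1
    rw [Finset.sum_const_zero] at this
    refine tendsto_of_tendsto_of_tendsto_of_le_of_le tendsto_const_nhds this (fun _ => zero_le)
      fun n => (eLpNorm_le_sum_coord ((continuous_gradMat (cΦ n)).aestronglyMeasurable.sub w2.1)
        (by norm_num)).trans (Finset.sum_le_sum fun p _ => ?_)
    exact eLpNorm_le_h1n' _ _ (fun j => pd j (f p.1 n) - fun x => weakGrad Sᶜ (field φ) x (p.1, j)) p.2
  obtain ⟨A, R, h⟩ := hS.exists_trace_inequality_field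
  have sub := fun R : ℝ => Measure.restrict_mono_set (volume : Measure Plane)
    (inter_subset_left : Sᶜ ∩ ball 0 R ⊆ Sᶜ)
  have mono : ∀ {E : Type} [NormedAddCommGroup E] {F : ℕ → Plane → E},
      Tendsto (fun n => eLpNorm (F n) 2 (volume.restrict Sᶜ)) atTop (𝓝 0) → ∀ R,
      Tendsto (fun n => eLpNorm (F n) 2 (volume.restrict (Sᶜ ∩ ball 0 R))) atTop (𝓝 0) :=
    fun ht R => tendsto_of_tendsto_of_tendsto_of_le_of_le tendsto_const_nhds ht
      (fun _ => zero_le) fun n => eLpNorm_mono_measure _ (sub R)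
  obtain ⟨g, mg, tg⟩ := exists_memLp_limit (fun n => hS.memLp_arcLength (cΦ n)) (by
    have c1 := tendsto_eLpNorm_cauchy (by norm_num) (fun n =>
      (cΦ n).continuous.aestronglyMeasurable) ((memLp_field φ Sᶜ).1.mono_measure (sub R)) (mono t1 R)
    have c2 := tendsto_eLpNorm_cauchy (by norm_num) (fun n =>
      (continuous_gradMat (cΦ n)).aestronglyMeasurable) (w2.1.mono_measure (sub R)) (mono t2 R)
    have c3 := ENNReal.Tendsto.const_mul (a := A) (c1.add c2) (Or.inr ENNReal.coe_ne_top)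
    rw [add_zero, mul_zero] at c3
    refine tendsto_of_tendsto_of_tendsto_of_le_of_le tendsto_const_nhds c3 (fun _ => zero_le)
      fun q => ?_
    refine (h _ ((cΦ q.1).sub (cΦ q.2))).trans (le_of_eq ?_)
    congr 3
    ext1 x
    have := gradMat_comb (cΦ q.2) (cΦ q.1) (-1) x
    simp only [neg_smul, one_smul, neg_add_eq_sub] at this
    exact this)
  refine ⟨g, mg, ⟨_, w1⟩, Φ, cΦ, mono t1, mono ?_, tg⟩
  simpa only [classicalGrad_eq (cΦ _)] using t2

end IsSmoothBody

theorem CircData.isTrace {S : Set Plane} {H : Plane → Plane} (D : CircData S H)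
    (hS : IsSmoothBody S) : IsTrace S H D.G := by
  refine ⟨hS.memLp_arcLength D.contDiff, ⟨_, D.isWeakGrad hS⟩, fun _ => D.G, fun _ => D.contDiff,
    fun R => ?_, fun R => ?_, by simp⟩
  · refine tendsto_const_nhds.congr fun _ => (eLpNorm_eq_zero_of_ae_zero ?_).symm
    filter_upwards [ae_mono (Measure.restrict_mono_set _ inter_subset_left) (D.ae_eq hS)] with x hx
    rw [hx, sub_self]; rfl
  · refine tendsto_const_nhds.congr fun _ => (eLpNorm_eq_zero_of_ae_zero ?_).symm
    filter_upwards [ae_mono (Measure.restrict_mono_set _ inter_subset_left)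
      ((D.isWeakGrad hS).weakGrad_ae hS.isOpen_compl)] with x hx
    rw [hx, classicalGrad_eq D.contDiff, sub_self]; rfl

theorem CircData.exists_trace_withH {S : Set Plane} {H : Plane → Plane} (D : CircData S H)
    (hS : IsSmoothBody S) (u : spaceVu S) (β : ℝ) : ∃ g, IsTrace S (withH H u β) g := by
  obtain ⟨g, hg⟩ := hS.exists_trace u
  exact ⟨_, (D.isTrace hS).comb hS.isClosed hg β (ae_of_all _ fun x => add_comm _ _)⟩

/-! ### The form `a` -/

/-- The symmetric part of a matrix. -/
noncomputable def symmetricPart : Mat2 →L[ℝ] Mat2 := LinearMap.toContinuousLinearMap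
    (linOfComb (fun A => WithLp.toLp 2 fun p => (A p + A p.swap) / 2) fun c A A' => by
      ext p
      simp only [PiLp.add_apply, PiLp.smul_apply, smul_eq_mul]; ring)

theorem deformationProduct_eq (S : Set Plane) (u v : Plane → Plane) (x : Plane) :
    deformationProduct S u v x =
      ⟪symmetricPart (weakGrad Sᶜ u x), symmetricPart (weakGrad Sᶜ v x)⟫ := by
  rw [PiLp.inner_apply, Fintype.sum_prod_type]
  exact Finset.sum_congr rfl fun i _ => Finset.sum_congr rfl fun j _ => mul_comm _ _

theorem exists_linear_lp {A E : Type*} [AddCommGroup A] [Module ℝ A] [NormedAddCommGroup E]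
    [NormedSpace ℝ E] {μ : Measure Plane} {F : A → Plane → E} (hF : ∀ a, MemLp (F a) 2 μ)
    (h : ∀ (c : ℝ) a a', F (c • a + a') =ᵐ[μ] c • F a + F a') :
    ∃ T : A →ₗ[ℝ] Lp E 2 μ, ∀ a, T a = (hF a).toLp (F a) :=
  ⟨linOfComb (fun a => (hF a).toLp (F a)) fun c a a' => by
    rw [← MemLp.toLp_const_smul, ← MemLp.toLp_add]
    exact (MemLp.toLp_eq_toLp_iff _ _).2 (h c a a'), fun _ => rfl⟩

theorem norm_le_of_left {X V : Type*} [AddCommGroup X] [Module ℝ X] [NormedAddCommGroup V]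
    [NormedSpace ℝ V] (T : X × ℝ →ₗ[ℝ] V) {N : X → ℝ} (hN : ∀ u, 0 ≤ N u) {c : ℝ}
    (h : ∀ u, ‖T (u, 0)‖ ≤ c * N u) (p : X × ℝ) :
    ‖T p‖ ≤ (|c| + ‖T (0, 1)‖) * (N p.1 + |p.2|) := by
  have e : p = (p.1, 0) + p.2 • (0, 1) := by ext <;> simp
  have h1 := (h p.1).trans (mul_le_mul_of_nonneg_right (le_abs_self c) (hN _))
  have h2 := mul_nonneg (abs_nonneg c) (abs_nonneg p.2)
  have h3 := mul_nonneg (norm_nonneg (T (0, 1))) (hN p.1)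
  conv_lhs => rw [e, map_add, map_smul]
  refine (norm_add_le _ _).trans ?_
  rw [norm_smul, Real.norm_eq_abs]
  linarith

theorem exists_bilinear_of_inner {X V W : Type*} [AddCommGroup X] [Module ℝ X]
    [NormedAddCommGroup V] [InnerProductSpace ℝ V] [NormedAddCommGroup W] [InnerProductSpace ℝ W]
    (α : ℝ) (T : X × ℝ →ₗ[ℝ] V) (E : X × ℝ →ₗ[ℝ] W) {N : X → ℝ} (hN : ∀ u, 0 ≤ N u) {K L : ℝ}
    (hT : ∀ p, ‖T p‖ ≤ K * (N p.1 + |p.2|)) (hE : ∀ p, ‖E p‖ ≤ L * (N p.1 + |p.2|)) :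
    ∃ B : X × ℝ →ₗ[ℝ] X →ₗ[ℝ] ℝ, (∀ p v, B p v = -α * ⟪T p, T (v, 0)⟫ - ⟪E p, E (v, 0)⟫) ∧
      ∃ C : ℝ, 0 < C ∧ ∀ u β v, |B (u, β) v| ≤ C * (N u + |β|) * N v := by
  refine ⟨bilinOfComb (fun p v => -α * ⟪T p, T (v, 0)⟫ - ⟪E p, E (v, 0)⟫) ?_ ?_, fun _ _ => rfl,
    |α| * (K * K) + L * L + 1, ?_, fun u β v => ?_⟩
  · intro c p p' v
    simp only [map_add, map_smul, inner_add_left, real_inner_smul_left]; ring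
  · intro c p v v'
    have e : (c • v + v', (0 : ℝ)) = c • (v, 0) + (v', 0) := by ext <;> simp
    simp only [e, map_add, map_smul, inner_add_right, real_inner_smul_right]; ring
  · have := mul_self_nonneg K
    have := mul_self_nonneg L
    positivity
  · show |-α * ⟪T (u, β), T (v, 0)⟫ - ⟪E (u, β), E (v, 0)⟫| ≤ _
    have kT : ‖T (v, 0)‖ ≤ K * N v := by simpa using hT (v, 0)
    have kE : ‖E (v, 0)‖ ≤ L * N v := by simpa using hE (v, 0)
    have i1 := (abs_real_inner_le_norm (T (u, β)) (T (v, 0))).trans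
      (mul_le_mul (hT (u, β)) kT (norm_nonneg _) ((norm_nonneg _).trans (hT (u, β))))
    have i2 := (abs_real_inner_le_norm (E (u, β)) (E (v, 0))).trans
      (mul_le_mul (hE (u, β)) kE (norm_nonneg _) ((norm_nonneg _).trans (hE (u, β))))
    refine (abs_sub _ _).trans ?_
    rw [abs_mul, abs_neg]
    have := mul_nonneg (add_nonneg (hN u) (abs_nonneg β)) (hN v)
    calc _ ≤ _ := add_le_add (mul_le_mul_of_nonneg_left i1 (abs_nonneg α)) i2
      _ = (|α| * (K * K) + L * L) * ((N u + |β|) * N v) := by ring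
      _ ≤ (|α| * (K * K) + L * L + 1) * ((N u + |β|) * N v) := by linarith
      _ = _ := by ring

namespace CircData

variable {S : Set Plane} {H : Plane → Plane} (D : CircData S H) (hS : IsSmoothBody S) {m J : ℝ}
  (hm : 0 < m) (hJ : 0 < J)
include D hS

theorem exists_deformation_map : ∃ T : spaceVu S × ℝ →ₗ[ℝ] Lp Mat2 2 (volume.restrict Sᶜ),
    (∀ p, T p =ᵐ[volume.restrict Sᶜ] fun x => symmetricPart (weakGrad Sᶜ (withH H p.1 p.2) x)) ∧
    ∃ C, ∀ p, ‖T p‖ ≤ C * (normVu S m J (field p.1) + |p.2|) := by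
  have w := fun p : spaceVu S × ℝ => D.isWeakGrad_withH hS
    (spaceVu_spec (m := m) (J := J) hS _ p.1.2).1 p.2
  have mG : MemLp (gradMat D.G) 2 (volume.restrict Sᶜ) := memLp_of_coord fun p =>
    memLp_two_of_decay hS.isOpen_compl.measurableSet
      (continuous_pd (D.contDiff.coord p.1) p.2).aestronglyMeasurable
      fun x hx => D.bound_pd x hx p.1 p.2
  have mF : ∀ p : spaceVu S × ℝ, MemLp (weakGrad Sᶜ (withH H p.1 p.2)) 2 (volume.restrict Sᶜ) :=
    fun p => (memLp_congr_ae ((w p).weakGrad_ae hS.isOpen_compl)).2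
      ((mG.const_smul p.2).add (spaceVu_spec (m := m) (J := J) hS _ p.1.2).2.1)
  obtain ⟨T, hT⟩ := exists_linear_lp mF fun c p p' =>
    ((w p).weakGrad_spec.comb (w p').weakGrad_spec c
      (withH_comb H p.1 p'.1 p.2 p'.2 c)).weakGrad_ae hS.isOpen_compl
  set M := symmetricPart.compLpL 2 (volume.restrict Sᶜ)
  refine ⟨M.toLinearMap ∘ₗ T, fun p => ?_, _, norm_le_of_left _
    (fun u => (normH_nonneg _).trans (normH_le_normVu _)) (c := ‖M‖) fun u => ?_⟩
  · filter_upwards [symmetricPart.coeFn_compLp (T p), (hT p ▸ (mF p).coeFn_toLp :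
      T p =ᵐ[volume.restrict Sᶜ] weakGrad Sᶜ (withH H p.1 p.2))] with x h1 h2
    rw [← h2, ← h1]; rfl
  obtain ⟨-, h2, h3⟩ := spaceVu_spec (m := m) (J := J) hS _ u.2
  refine (M.le_opNorm (T (u, 0))).trans (mul_le_mul_of_nonneg_left ?_ (norm_nonneg _))
  rw [hT, Lp.norm_toLp, withH_coeff_zero, toReal_eLpNorm h2.1]
  exact h3

include hm hJ in
theorem exists_slip_map : ∃ T : spaceVu S × ℝ →ₗ[ℝ] Lp Plane 2 (arcLength S),
    (∀ p, T p =ᵐ[arcLength S] fun x =>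
      bdryTrace S (withH H p.1 p.2) x - rigidPart S (withH H p.1 p.2) x) ∧
    ∃ C, ∀ p, ‖T p‖ ≤ C * (normVu S m J (field p.1) + |p.2|) := by
  have tr := fun p : spaceVu S × ℝ => (D.exists_trace_withH hS p.1 p.2).choose_spec.bdryTrace_spec
  obtain ⟨T, hT⟩ := exists_linear_lp (fun p => (tr p).1) fun c p p' =>
    hS.bdryTrace_ae ((tr p).comb hS.isClosed (tr p') c (withH_comb H p.1 p'.1 p.2 p'.2 c))
  obtain ⟨R, hR⟩ := exists_linear_lp (fun q => hS.memLp_arcLength (contDiff_rigid q)) fun c q q' =>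
    ae_of_all _ fun x => rigid_comb c q q' x
  set ρ : spaceVu S × ℝ →ₗ[ℝ] Plane × ℝ := linOfComb (fun p => rigidData S (withH H p.1 p.2))
    fun c p p' => hS.rigidData_comb (D.withH_ae_rigid hS spaceVu_le p.1 p.2)
      (D.withH_ae_rigid hS spaceVu_le p'.1 p'.2) (withH_comb H p.1 p'.1 p.2 p'.2 c)
  obtain ⟨A, hA⟩ := hS.exists_trace_bound
  set L := LinearMap.toContinuousLinearMap R
  refine ⟨T - R ∘ₗ ρ, fun p => ?_, _, norm_le_of_left _
    (fun u => (normH_nonneg _).trans (normH_le_normVu _))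
    (c := A * 2 + ‖L‖ * ((√m)⁻¹ + (√J)⁻¹)) fun u => ?_⟩
  · rw [LinearMap.sub_apply, LinearMap.comp_apply, hT, hR]
    filter_upwards [Lp.coeFn_sub ((tr p).1.toLp _) ((hS.memLp_arcLength (contDiff_rigid (ρ p))).toLp _),
      (tr p).1.coeFn_toLp, (hS.memLp_arcLength (contDiff_rigid (ρ p))).coeFn_toLp] with x h1 h2 h3
    rw [h1, Pi.sub_apply, h2, h3]
    rfl
  · set N := normVu S m J (field u)
    have hN : normH S m J (field u) ≤ N := normH_le_normVu _
    obtain ⟨-, h2, h3⟩ := spaceVu_spec (m := m) (J := J) hS _ u.2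
    have b1 : ‖T (u, 0)‖ ≤ A * 2 * N := by
      rw [hT, Lp.norm_toLp]
      refine ENNReal.toReal_le_of_le_ofReal (by have := (normH_nonneg _).trans hN; positivity)
        ((hA _ _ (tr (u, 0))).trans ?_)
      simp only [withH_coeff_zero]
      rw [← ofReal_lpNorm (memLp_field u Sᶜ), ← ofReal_lpNorm h2, ← ENNReal.ofReal_coe_nnreal,
        ← ENNReal.ofReal_add lpNorm_nonneg lpNorm_nonneg, ← ENNReal.ofReal_mul A.coe_nonneg, mul_assoc]
      refine ENNReal.ofReal_le_ofReal (mul_le_mul_of_nonneg_left ?_ A.coe_nonneg)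
      linarith [(lpNorm_le_normH hm hJ (memLp_field u Sᶜ)).trans hN, h3]
    have b2 : ‖ρ (u, 0)‖ ≤ ((√m)⁻¹ + (√J)⁻¹) * N := by
      have e : ρ (u, 0) = rigidData S (field u) := D.rigidData_withH hS spaceVu_le u 0
      have l1 := (norm_linVel_le hm hJ (S := S) (field u)).trans
        (mul_le_mul_of_nonneg_left hN (by positivity))
      have l2 := (abs_angVel_le hm hJ (S := S) (field u)).trans
        (mul_le_mul_of_nonneg_left hN (by positivity))
      rw [e, Prod.norm_def, add_mul]
      exact max_le (l1.trans (le_add_of_nonneg_right ((abs_nonneg _).trans l2)))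
        (l2.trans (le_add_of_nonneg_left ((norm_nonneg _).trans l1)))
    have b3 : ‖R (ρ (u, 0))‖ ≤ ‖L‖ * ‖ρ (u, 0)‖ := L.le_opNorm _
    refine (norm_sub_le _ _).trans ((add_le_add b1 (b3.trans
      (mul_le_mul_of_nonneg_left b2 (norm_nonneg _)))).trans (le_of_eq ?_))
    ring

include hm hJ in
/-- The form `a` on `(𝓥_ ⊕ ℝH) × 𝓥_`. -/
theorem bilinear_dissipation (α : ℝ) : (∀ (u : spaceVu S) (β : ℝ) (v : spaceVu S),
        (∃ g, IsTrace S (withH H u β) g) ∧ (∃ g, IsTrace S (field v) g) ∧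
        Integrable (slipProduct S (withH H u β) (field v)) (arcLength S) ∧
        IntegrableOn (deformationProduct S (withH H u β) (field v)) Sᶜ) ∧
      ∃ B : (spaceVu S × ℝ) →ₗ[ℝ] spaceVu S →ₗ[ℝ] ℝ, (∀ (u : spaceVu S) (β : ℝ) (v : spaceVu S),
          B (u, β) v = aForm S α (withH H u β) (field v)) ∧
        ∃ C : ℝ, 0 < C ∧ ∀ (u : spaceVu S) (β : ℝ) (v : spaceVu S),
          |B (u, β) v| ≤ C * (normVu S m J (field u) + |β|) * normVu S m J (field v) := by
  obtain ⟨T, hT, K, hK⟩ := D.exists_slip_map hS hm hJ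
  obtain ⟨E, hE, L, hL⟩ := D.exists_deformation_map hS (m := m) (J := J)
  have eT : ∀ u β v, (fun x => ⟪T (u, β) x, T (v, 0) x⟫) =ᵐ[arcLength S]
      slipProduct S (withH H u β) (field v) := fun u β v => by
    filter_upwards [hT (u, β), hT (v, 0)] with x h1 h2
    rw [h1, h2, withH_coeff_zero]; rfl
  have eE : ∀ u β v, (fun x => ⟪E (u, β) x, E (v, 0) x⟫) =ᵐ[volume.restrict Sᶜ]
      deformationProduct S (withH H u β) (field v) := fun u β v => by
    filter_upwards [hE (u, β), hE (v, 0)] with x h1 h2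
    rw [deformationProduct_eq, h1, h2, withH_coeff_zero]
  obtain ⟨B, hB, hB'⟩ := exists_bilinear_of_inner α T E
    (fun u : spaceVu S => (normH_nonneg _).trans (normH_le_normVu _)) hK hL
  refine ⟨fun u β v => ⟨D.exists_trace_withH hS u β, hS.exists_trace v,
    (integrable_congr (eT u β v)).1 (L2.integrable_inner (𝕜 := ℝ) (T (u, β)) (T (v, 0))),
    (integrable_congr (eE u β v)).1 (L2.integrable_inner (𝕜 := ℝ) (E (u, β)) (E (v, 0)))⟩,
    B, fun u β v => ?_, hB'⟩
  rw [hB, aForm, ← integral_congr_ae (eT u β v), ← integral_congr_ae (eE u β v),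
    L2.inner_def (T (u, β)), L2.inner_def (E (u, β))]

end CircData

theorem mainTheorem4
    (S : Set Plane) (hS : IsSmoothBody S)
    (m J α : ℝ) (hm : 0 < m) (hJ : 0 < J) (hα : 0 ≤ α)
    (H : Plane → Plane) (hH : IsCirculationField S H) :
    -- i. `b` on `(𝓥_ ⊕ ℝH) × 𝓥_ × (𝓥 ⊕ ℝH)`
    ((∀ (u : spaceVu S) (β₁ : ℝ) (v : spaceVu S) (w : spaceV S) (β₃ : ℝ),
        IntegrableOn (bIntegrand S (withH H u β₁) (field v) (withH H w β₃)) Sᶜ) ∧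
      ∃ B : (spaceVu S × ℝ) →ₗ[ℝ] spaceVu S →ₗ[ℝ] (spaceV S × ℝ) →ₗ[ℝ] ℝ,
        (∀ (u : spaceVu S) (β₁ : ℝ) (v : spaceVu S) (w : spaceV S) (β₃ : ℝ),
          B (u, β₁) v (w, β₃) = bForm S m (withH H u β₁) (field v) (withH H w β₃)) ∧
        ∃ C : ℝ, 0 < C ∧ ∀ (u : spaceVu S) (β₁ : ℝ) (v : spaceVu S) (w : spaceV S) (β₃ : ℝ),
          |B (u, β₁) v (w, β₃)| ≤ C * (normVu S m J (field u) + |β₁|) * normVu S m J (field v)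
            * (normV S m J (field w) + |β₃|)) ∧
    -- ii. `b(H, ·, ·)` and `b(·, ·, H)` on `𝓥_ × 𝓥_`, and the vanishing of `b(H, v, H)`
    ((∀ v w : spaceVu S, IntegrableOn (bIntegrand S H (field v) (field w)) Sᶜ) ∧
      (∃ B : spaceVu S →ₗ[ℝ] spaceVu S →ₗ[ℝ] ℝ,
        (∀ v w : spaceVu S, B v w = bForm S m H (field v) (field w)) ∧
        ∃ C : ℝ, 0 < C ∧ ∀ v w : spaceVu S,
          |B v w| ≤ C * normVu S m J (field v) * normVu S m J (field w)) ∧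
      (∀ u v : spaceVu S, IntegrableOn (bIntegrand S (field u) (field v) H) Sᶜ) ∧
      (∃ B : spaceVu S →ₗ[ℝ] spaceVu S →ₗ[ℝ] ℝ,
        (∀ u v : spaceVu S, B u v = bForm S m (field u) (field v) H) ∧
        ∃ C : ℝ, 0 < C ∧ ∀ u v : spaceVu S,
          |B u v| ≤ C * normVu S m J (field u) * normVu S m J (field v)) ∧
      (∀ v : spaceVu S, IntegrableOn (bIntegrand S H (field v) H) Sᶜ ∧
        bForm S m H (field v) H = 0)) ∧
    -- iii. cancellation (also as an improper integral, for `v` in `𝓥_` only) and antisymmetry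
    ((∀ (u : spaceVu S) (β : ℝ) (v : spaceVu S),
        bForm S m (withH H u β) (field v) (field v) = 0 ∧
        (∀ R : ℝ, IntegrableOn (bIntegrand S (withH H u β) (field v) (field v))
          (Sᶜ ∩ Metric.ball 0 R)) ∧
        Tendsto (fun R : ℝ =>
          (∫ x in Sᶜ ∩ Metric.ball 0 R, bIntegrand S (withH H u β) (field v) (field v) x)
            - bBody S m (withH H u β) (field v) (field v)) atTop (𝓝 0)) ∧
      (∀ (u : spaceVu S) (β : ℝ) (v w : spaceV S),
        bForm S m (withH H u β) (field v) (field w) =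
          - bForm S m (withH H u β) (field w) (field v))) ∧
    -- iv. the unique continuous trilinear extension to `(𝓗 ⊕ ℝH) × 𝓗 × (𝓥^ ⊕ ℝH)`
    (∃! B : (spaceH S × ℝ) →ₗ[ℝ] spaceH S →ₗ[ℝ] (spaceVhat S × ℝ) →ₗ[ℝ] ℝ,
      (∀ (u : spaceH S) (β₁ : ℝ) (v : spaceH S) (w : spaceVhat S) (β₃ : ℝ),
        (u : L2Plane) ∈ spaceVu S → (v : L2Plane) ∈ spaceVu S →
          B (u, β₁) v (w, β₃) = bForm S m (withH H u β₁) (field v) (withH H w β₃)) ∧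
      ∃ C : ℝ, 0 < C ∧ ∀ (u : spaceH S) (β₁ : ℝ) (v : spaceH S) (w : spaceVhat S) (β₃ : ℝ),
        |B (u, β₁) v (w, β₃)| ≤ C * (normH S m J (field u) + |β₁|) * normH S m J (field v)
          * (normVhat S m J (field w) + |β₃|)) ∧
    -- v. `a` on `(𝓥_ ⊕ ℝH) × 𝓥_`
    ((∀ (u : spaceVu S) (β : ℝ) (v : spaceVu S),
        (∃ g, IsTrace S (withH H u β) g) ∧ (∃ g, IsTrace S (field v) g) ∧
        Integrable (slipProduct S (withH H u β) (field v)) (arcLength S) ∧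
        IntegrableOn (deformationProduct S (withH H u β) (field v)) Sᶜ) ∧
      ∃ B : (spaceVu S × ℝ) →ₗ[ℝ] spaceVu S →ₗ[ℝ] ℝ,
        (∀ (u : spaceVu S) (β : ℝ) (v : spaceVu S),
          B (u, β) v = aForm S α (withH H u β) (field v)) ∧
        ∃ C : ℝ, 0 < C ∧ ∀ (u : spaceVu S) (β : ℝ) (v : spaceVu S),
          |B (u, β) v| ≤ C * (normVu S m J (field u) + |β|) * normVu S m J (field v)) := by
  obtain ⟨D⟩ := hH.exists_data hS
  obtain ⟨i1, i2⟩ := bilinear_H_left hS D hm hJ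
  obtain ⟨j1, j2⟩ := bilinear_H_right hS D hm hJ
  refine ⟨trilinear_on_energy_spaces hS D hm hJ, ⟨i1, i2, j1, j2, fun v =>
    D.bForm_circulation hS hm hJ v⟩, ⟨fun u β v => ⟨D.bForm_diag hS u β v m, ?_⟩,
    fun u β v w => D.bForm_antisymm hS u β hm hJ v w⟩, existsUnique_extension hS D hm hJ,
    D.bilinear_dissipation hS hm hJ α⟩
  obtain ⟨h1, h2⟩ := D.cancellation hS u β v
  exact ⟨h1, by simpa only [bBody_diag, sub_zero] using h2⟩
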